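/- **Conventions.** A large $2$-category has a large set of objects and large hom-categories. Composites of morphisms are written $v\circ u$; vertical composites of cells are written $\beta\odot\gamma$ in diagrammatic order. Let $\mathcal S$ be the sesquicategory of large $2$-categories, $2$-functors and lax natural transformations $\phi\colon f\Rightarrow g$, with components $\phi_x\colon fx\to gx$ and naturality cells $\phi_s\colon gs\circ\phi_x\Rightarrow\phi_y\circ fs$ for $s\colon x\to y$. Pullbacks in $\mathcal S$ are conical (they are pullbacks in the underlying $1$-category that also have the corresponding universal property for cells). The $\mathbf 2$-cotensor $A^{\mathbf 2}$, that is the universal cell $\mathrm{src}\Rightarrow\mathrm{tgt}\colon A^{\mathbf 2}\to A$, is the lax arrow $2$-category: its objects are morphisms $u\colon a\to b$ of $A$; its morphisms $u_0\to u_1$ are triples $(s,\zeta,t)$ with $s\colon a_0\to a_1$, $t\colon b_0\to b_1$ and a cell $\zeta\colon t\circ u_0\Rightarrow u_1\circ s$; its cells $(s_0,\zeta_0,t_0)\Rightarrow(s_1,\zeta_1,t_1)$ are pairs of cells $\sigma\colon s_0\Rightarrow s_1$, $\tau\colon t_0\Rightarrow t_1$ with $\zeta_0\odot(u_1\circ\sigma)=(\tau\circ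 u_0)\odot\zeta_1$. Through its universal property $A^{\mathbf 2}$ is a category internal to the underlying $1$-category of $\mathcal S$, with composition given by vertical composition of the universal cell with itself. An **internal split two-sided fibration** in $\mathcal S$ on a span $A\xleftarrow{p}J\xrightarrow{q}B$ is the structure of an internal profunctor from $A^{\mathbf 2}$ to $B^{\mathbf 2}$: a left action $A^{\mathbf 2}\times_AJ\to J$ and a right action $J\times_BB^{\mathbf 2}\to J$ that are morphisms of spans, associative, unital and compatible with each other. A **cleavage making $q\colon J\to B$ a split op-$2$-fibration** consists of a lift $\rho(i,u)\colon i\to u_!i$ of each $u\colon qi\to b$ (so $q(\rho(i,u))=u$) and a lift $\rho(\beta,s)\colon\beta^*s\Rightarrow s$ of each cell $\beta\colon u\Rightarrow qs$, for $s\colon i\to j$ (so $q(\rho(\beta,s))=\beta$), such that * $\rho(i,v\circ u)=\rho(u_!i,v)\circ\rho(i,u)$, $\rho(i,\mathrm{id})=\mathrm{id}_i$, $\rho(\gamma\odot\beta,s)=\rho(\gamma,\beta^*s)\odot\rho(\beta,s)$, $\rho(\delta\circ\beta,t\circ s)=\rho(\delta,t)\circ\rho(\beta,s)$ and $\rho(\mathrm{id}_{qs},s)=\mathrm{id}_s$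 (equalities that include those of sources and targets); * each $\rho(i,u)$ is opcartesian: if $s\colon i\to j$ and $qs=v\circ u$ there is a unique $\tilde v$ with $q\tilde v=v$ and $\tilde v\circ\rho(i,u)=s$; and if moreover $t\colon i\to j$, $qt=w\circ u$ with lift $\tilde w$, and $\sigma\colon s\Rightarrow t$ has $q\sigma=\beta\circ u$ with $\beta\colon v\Rightarrow w$, there is a unique $\tilde\beta\colon\tilde v\Rightarrow\tilde w$ with $q\tilde\beta=\beta$ and $\tilde\beta\circ\rho(i,u)=\sigma$; * each $\rho(\beta,s)$ is cartesian: if $\sigma\colon r\Rightarrow s$ has $q\sigma=\alpha\odot\beta$ there is a unique $\tilde\alpha\colon r\Rightarrow\beta^*s$ with $q\tilde\alpha=\alpha$ and $\tilde\alpha\odot\rho(\beta,s)=\sigma$. A **cleavage making $p\colon J\to A$ a split co-$2$-fibration** is the dual notion, with the directions of both morphisms and cells reversed: cartesian lifts $\lambda(u,i)\colon u^*i\to i$ of $u\colon a\to pi$ and opcartesian lifts $\lambda(s,\alpha)\colon s\Rightarrow\alpha_!s$ of $\alpha\colon ps\Rightarrow v$, subject to the dual conditions. **Theorem.** A span $A\xleftarrow{p}J\xrightarrow{q}B$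 of $2$-functors between large $2$-categories admits the structure of an internal split two-sided fibration in $\mathcal S$ if and only if there are 1. a cleavage $\lambda$ making $p$ a split co-$2$-fibration, and 2. a cleavage $\rho$ making $q$ a split op-$2$-fibration, such that 3. $q(\lambda(u,i))=\mathrm{id}_{qi}$, $q(\lambda(s,\alpha))=\mathrm{id}_{qs}$, $p(\rho(j,v))=\mathrm{id}_{pj}$ and $p(\rho(\beta,t))=\mathrm{id}_{pt}$, for all lifts; 4. for all $u\colon a\to pi$ and $v\colon qi\to b$: $v_!(u^*i)=u^*(v_!i)$ and $\rho(i,v)\circ\lambda(u,i)=\lambda(u,v_!i)\circ\rho(u^*i,v)$; 5. for all $s\colon i\to j$ in $J$, $\alpha\colon ps\Rightarrow v$ in $A$ and $\beta\colon u\Rightarrow qs$ in $B$: $\alpha_!(\beta^*s)=\beta^*(\alpha_!s)$ and $\rho(\beta,s)\odot\lambda(s,\alpha)=\lambda(\beta^*s,\alpha)\odot\rho(\beta,\alpha_!s)$. Moreover there is a bijection between the structures of internal split two-sided fibration on the span and the pairs $(\lambda,\rho)$ that satisfy 1–5. It sends a structure with right action $\rho$ to the cleavage with $u_!i=\rho(i,u)$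 and $\rho(i,u)$ the image of $(\mathrm{id}_i,(\mathrm{id}_{qi},\mathrm{id}_u,u))$, and with $\beta^*s$ the image of $(s,(qs,\beta,u))\colon(i,\mathrm{id}_{qi})\to(j,\mathrm{id}_{qj})$ and $\rho(\beta,s)$ the image of $(\mathrm{id}_s,(\mathrm{id}_{qs},\beta))$; dually for the left action and $\lambda$: $u^*i=\lambda(u,i)$ with lift the image of $((u,\mathrm{id}_u,\mathrm{id}_{pi}),\mathrm{id}_i)$, $\alpha_!s$ is the image of $((v,\alpha,ps),s)$ and its lift is the image of $((\alpha,\mathrm{id}_{ps}),\mathrm{id}_s)$. -/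

import Mathlib

open CategoryTheory Bicategory

set_option linter.unusedVariables false
set_option linter.unusedSectionVars false

universe w v u w₁ v₁ u₁ w₂ v₂ u₂ w₃ v₃ u₃

namespace TwoDim

section heq
variable {C : Type u} [Bicategory.{w, v} C]

theorem comp₁_heq {a b c a' b' c' : C} {f : a ⟶ b} {g : b ⟶ c} {f' : a' ⟶ b'} {g' : b' ⟶ c'}
    (ha : a = a') (hb : b = b') (hc : c = c') (hf : f ≍ f') (hg : g ≍ g') :
    (f ≫ g) ≍ (f' ≫ g') := by
  subst ha hb hc hf hg; rfl

theorem comp₂_heq {a b a' b' : C} {f g h : a ⟶ b} {f' g' h' : a' ⟶ b'} {η : f ⟶ g} {θ : g ⟶ h}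
    {η' : f' ⟶ g'} {θ' : g' ⟶ h'} (ha : a = a') (hb : b = b') (hf : f ≍ f') (hg : g ≍ g')
    (hh : h ≍ h') (hη : η ≍ η') (hθ : θ ≍ θ') : (η ≫ θ) ≍ (η' ≫ θ') := by
  subst ha hb hf hg hh hη hθ; rfl

theorem id₂_heq {a b a' b' : C} {f : a ⟶ b} {f' : a' ⟶ b'} (ha : a = a') (hb : b = b')
    (hf : f ≍ f') : 𝟙 f ≍ 𝟙 f' := by
  subst ha hb hf; rfl

theorem whiskerLeft_heq {a b c a' b' c' : C} {f : a ⟶ b} {g h : b ⟶ c} {f' : a' ⟶ b'}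
    {g' h' : b' ⟶ c'} {η : g ⟶ h} {η' : g' ⟶ h'} (ha : a = a') (hb : b = b') (hc : c = c')
    (hf : f ≍ f') (hg : g ≍ g') (hh : h ≍ h') (hη : η ≍ η') : (f ◁ η) ≍ (f' ◁ η') := by
  subst ha hb hc hf hg hh hη; rfl

theorem whiskerRight_heq {a b c a' b' c' : C} {f g : a ⟶ b} {h : b ⟶ c} {f' g' : a' ⟶ b'}
    {h' : b' ⟶ c'} {η : f ⟶ g} {η' : f' ⟶ g'} (ha : a = a') (hb : b = b') (hc : c = c')
    (hf : f ≍ f') (hg : g ≍ g') (hh : h ≍ h') (hη : η ≍ η') : (η ▷ h) ≍ (η' ▷ h') := by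
  subst ha hb hc hf hg hh hη; rfl

end heq

section functor
variable {B : Type u₁} [Bicategory.{w₁, v₁} B] {C : Type u₂} [Bicategory.{w₂, v₂} C]
  {D : Type u₃} [Bicategory.{w₃, v₃} D]

theorem ext_of_heq {F G : StrictPseudofunctor B C} (h₀ : ∀ a, F.obj a = G.obj a)
    (h₁ : ∀ {a b : B} (f : a ⟶ b), F.map f ≍ G.map f)
    (h₂ : ∀ {a b : B} {f g : a ⟶ b} (η : f ⟶ g), F.map₂ η ≍ G.map₂ η) : F = G := by
  obtain ⟨⟨⟨⟨⟨⟨Fo, Fm⟩, Ft⟩, _, _⟩, Fi, Fc, _, _, _, _, _⟩, hFi, hFi'⟩, hFc, hFc'⟩ := F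
  obtain ⟨⟨⟨⟨⟨⟨Go, Gm⟩, Gt⟩, _, _⟩, Gi, Gc, _, _, _, _, _⟩, hGi, hGi'⟩, hGc, hGc'⟩ := G
  dsimp only at h₀ h₁ h₂ hFi hFi' hFc hFc' hGi hGi' hGc hGc'
  obtain rfl : Fo = Go := funext h₀
  obtain rfl : @Fm = @Gm := by
    funext a b f; exact eq_of_heq (h₁ f)
  obtain rfl : @Ft = @Gt := by
    funext a b f g η; exact eq_of_heq (h₂ η)
  obtain rfl : @Fi = @Gi := by
    funext a; rw [hFi', hGi']
  obtain rfl : @Fc = @Gc := by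
    funext a b c f g; rw [hFc', hGc']
  rfl

end functor

/-- A (possibly large) `2`-category: a strict bicategory with a `u`-large set of objects and
`u`-large hom-categories. -/
structure TwoCat : Type (u + 1) where
  carrier : Type u
  [bicategory : Bicategory.{u, u} carrier]
  [strict : Bicategory.Strict carrier]

instance : CoeSort TwoCat.{u} (Type u) := ⟨TwoCat.carrier⟩
instance (A : TwoCat.{u}) : Bicategory.{u, u} A := A.bicategory
instance (A : TwoCat.{u}) : Bicategory.Strict A := A.strict

instance : Category TwoCat.{u} where
  Hom A B := StrictPseudofunctor A B
  id A := StrictPseudofunctor.id A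
  comp F G := F.comp G
  id_comp F := ext_of_heq (fun _ => rfl) (fun _ => HEq.rfl) (fun _ => HEq.rfl)
  comp_id F := ext_of_heq (fun _ => rfl) (fun _ => HEq.rfl) (fun _ => HEq.rfl)
  assoc F G H := ext_of_heq (fun _ => rfl) (fun _ => HEq.rfl) (fun _ => HEq.rfl)

section
variable {B : Type u₁} [Bicategory.{w₁, v₁} B] {C : Type u₂} [Bicategory.{w₂, v₂} C]
  {D : Type u₃} [Bicategory.{w₃, v₃} D]

/-- A lax natural transformation between `2`-functors. This is Mathlib's notion for the underlying
lax functors, see `LaxNat.equivLaxTrans`. -/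
@[ext]
structure LaxNat (F G : StrictPseudofunctor B C) where
  app (a : B) : F.obj a ⟶ G.obj a
  nat {a b : B} (f : a ⟶ b) : app a ≫ G.map f ⟶ F.map f ≫ app b
  nat_nat {a b : B} {f g : a ⟶ b} (η : f ⟶ g) :
    nat f ≫ F.map₂ η ▷ app b = app a ◁ G.map₂ η ≫ nat g
  nat_id (a : B) : app a ◁ (G.mapId a).inv ≫ nat (𝟙 a) =
    (ρ_ (app a)).hom ≫ (λ_ (app a)).inv ≫ (F.mapId a).inv ▷ app a
  nat_comp {a b c : B} (f : a ⟶ b) (g : b ⟶ c) :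
    app a ◁ (G.mapComp f g).inv ≫ nat (f ≫ g) =
      (α_ (app a) (G.map f) (G.map g)).inv ≫ nat f ▷ G.map g ≫
        (α_ (F.map f) (app b) (G.map g)).hom ≫ F.map f ◁ nat g ≫
        (α_ (F.map f) (F.map g) (app c)).inv ≫ (F.mapComp f g).inv ▷ app c

namespace LaxNat

/-- Agreement with Mathlib's lax transformations of lax functors. -/
def equivLaxTrans (F G : StrictPseudofunctor B C) :
    LaxNat F G ≃ Lax.LaxTrans F.toPseudofunctor.toLax G.toPseudofunctor.toLax where
  toFun φ := ⟨φ.app, φ.nat, φ.nat_nat, φ.nat_id, φ.nat_comp⟩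
  invFun φ := ⟨φ.app, φ.naturality, φ.naturality_naturality, φ.naturality_id, φ.naturality_comp⟩
  left_inv _ := rfl
  right_inv _ := rfl

theorem heq_of_heq {F G F' G' : StrictPseudofunctor B C} {φ : LaxNat F G} {ψ : LaxNat F' G'}
    (hF : F = F') (hG : G = G') (h₀ : ∀ a, φ.app a ≍ ψ.app a)
    (h₁ : ∀ {a b : B} (f : a ⟶ b), φ.nat f ≍ ψ.nat f) : φ ≍ ψ := by
  subst hF hG
  obtain ⟨φa, φn, _, _, _⟩ := φ
  obtain ⟨ψa, ψn, _, _, _⟩ := ψ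
  obtain rfl : φa = ψa := funext fun a => eq_of_heq (h₀ a)
  obtain rfl : @φn = @ψn := by
    funext a b f; exact eq_of_heq (h₁ f)
  rfl

theorem nat_nat_assoc {F G : StrictPseudofunctor B C} (φ : LaxNat F G) {a b : B} {f g : a ⟶ b}
    (η : f ⟶ g) {k : F.obj a ⟶ G.obj b} (θ : F.map g ≫ φ.app b ⟶ k) :
    φ.nat f ≫ F.map₂ η ▷ φ.app b ≫ θ = φ.app a ◁ G.map₂ η ≫ φ.nat g ≫ θ := by
  simpa using congrArg (· ≫ θ) (φ.nat_nat η)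

theorem nat_id_assoc {F G : StrictPseudofunctor B C} (φ : LaxNat F G) (a : B)
    {k : F.obj a ⟶ G.obj a} (θ : F.map (𝟙 a) ≫ φ.app a ⟶ k) :
    φ.app a ◁ (G.mapId a).inv ≫ φ.nat (𝟙 a) ≫ θ =
      (ρ_ (φ.app a)).hom ≫ (λ_ (φ.app a)).inv ≫ (F.mapId a).inv ▷ φ.app a ≫ θ := by
  simpa using congrArg (· ≫ θ) (φ.nat_id a)

theorem nat_comp_assoc {F G : StrictPseudofunctor B C} (φ : LaxNat F G) {a b c : B} (f : a ⟶ b)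
    (g : b ⟶ c) {k : F.obj a ⟶ G.obj c} (θ : F.map (f ≫ g) ≫ φ.app c ⟶ k) :
    φ.app a ◁ (G.mapComp f g).inv ≫ φ.nat (f ≫ g) ≫ θ =
      (α_ (φ.app a) (G.map f) (G.map g)).inv ≫ φ.nat f ▷ G.map g ≫
        (α_ (F.map f) (φ.app b) (G.map g)).hom ≫ F.map f ◁ φ.nat g ≫
        (α_ (F.map f) (F.map g) (φ.app c)).inv ≫ (F.mapComp f g).inv ▷ φ.app c ≫ θ := by
  simpa using congrArg (· ≫ θ) (φ.nat_comp f g)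

section whiskering

theorem mapComp_cancel (H : StrictPseudofunctor C D) {a b c d : C} (f : a ⟶ b) (g : b ⟶ c)
    (h : c ⟶ d) : (H.mapComp f (g ≫ h)).inv ≫ H.map₂ (α_ f g h).inv ≫ (H.mapComp (f ≫ g) h).hom =
      H.map f ◁ (H.mapComp g h).hom ≫ (α_ (H.map f) (H.map g) (H.map h)).inv ≫
        (H.mapComp f g).inv ▷ H.map h := by
  rw [Iso.inv_comp_eq, H.mapComp_assoc_right_hom_assoc]
  simp

theorem mapComp_cancel_assoc (H : StrictPseudofunctor C D) {a b c d : C} (f : a ⟶ b) (g : b ⟶ c)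
    (h : c ⟶ d) {k : H.obj a ⟶ H.obj d} (θ : H.map (f ≫ g) ≫ H.map h ⟶ k) :
    (H.mapComp f (g ≫ h)).inv ≫ H.map₂ (α_ f g h).inv ≫ (H.mapComp (f ≫ g) h).hom ≫ θ =
      H.map f ◁ (H.mapComp g h).hom ≫ (α_ (H.map f) (H.map g) (H.map h)).inv ≫
        (H.mapComp f g).inv ▷ H.map h ≫ θ := by
  simpa using congrArg (· ≫ θ) (mapComp_cancel H f g h)

theorem preW_id (F : StrictPseudofunctor B C) {G H : StrictPseudofunctor C D} (φ : LaxNat G H)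
    (a : B) : φ.app (F.obj a) ◁ ((H.mapId (F.obj a)).inv ≫ H.map₂ (F.mapId a).inv) ≫
        φ.nat (F.map (𝟙 a)) =
      (ρ_ (φ.app (F.obj a))).hom ≫ (λ_ (φ.app (F.obj a))).inv ≫
        ((G.mapId (F.obj a)).inv ≫ G.map₂ (F.mapId a).inv) ▷ φ.app (F.obj a) := by
  simp [← φ.nat_nat, φ.nat_id_assoc]

theorem preW_comp (F : StrictPseudofunctor B C) {G H : StrictPseudofunctor C D} (φ : LaxNat G H)
    {a b c : B} (f : a ⟶ b) (g : b ⟶ c) :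
    φ.app (F.obj a) ◁ ((H.mapComp (F.map f) (F.map g)).inv ≫ H.map₂ (F.mapComp f g).inv) ≫
        φ.nat (F.map (f ≫ g)) =
      (α_ (φ.app (F.obj a)) (H.map (F.map f)) (H.map (F.map g))).inv ≫
      φ.nat (F.map f) ▷ H.map (F.map g) ≫
      (α_ (G.map (F.map f)) (φ.app (F.obj b)) (H.map (F.map g))).hom ≫
      G.map (F.map f) ◁ φ.nat (F.map g) ≫
      (α_ (G.map (F.map f)) (G.map (F.map g)) (φ.app (F.obj c))).inv ≫
      ((G.mapComp (F.map f) (F.map g)).inv ≫ G.map₂ (F.mapComp f g).inv) ▷ φ.app (F.obj c) := by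
  simp [← φ.nat_nat, φ.nat_comp_assoc]

variable {F G : StrictPseudofunctor B C} (φ : LaxNat F G) (H : StrictPseudofunctor C D)

theorem postW_nat {a b : B} {f g : a ⟶ b} (η : f ⟶ g) :
    ((H.mapComp (φ.app a) (G.map f)).inv ≫ H.map₂ (φ.nat f) ≫
      (H.mapComp (F.map f) (φ.app b)).hom) ≫ H.map₂ (F.map₂ η) ▷ H.map (φ.app b) =
    H.map (φ.app a) ◁ H.map₂ (G.map₂ η) ≫ (H.mapComp (φ.app a) (G.map g)).inv ≫
      H.map₂ (φ.nat g) ≫ (H.mapComp (F.map g) (φ.app b)).hom := by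
  have h := congrArg H.map₂ (φ.nat_nat η)
  rw [← cancel_epi (H.mapComp (φ.app a) (G.map f)).hom,
    ← cancel_mono (H.mapComp (F.map g) (φ.app b)).inv]
  simpa using h

theorem postW_id (a : B) :
    H.map (φ.app a) ◁ ((H.mapId (G.obj a)).inv ≫ H.map₂ (G.mapId a).inv) ≫
      (H.mapComp (φ.app a) (G.map (𝟙 a))).inv ≫ H.map₂ (φ.nat (𝟙 a)) ≫
        (H.mapComp (F.map (𝟙 a)) (φ.app a)).hom =
    (ρ_ (H.map (φ.app a))).hom ≫ (λ_ (H.map (φ.app a))).inv ≫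
      ((H.mapId (F.obj a)).inv ≫ H.map₂ (F.mapId a).inv) ▷ H.map (φ.app a) := by
  have h := congrArg H.map₂ (φ.nat_id a)
  rw [← cancel_mono (H.mapComp (F.map (𝟙 a)) (φ.app a)).inv]
  have e := H.whiskerRight_mapId_inv (φ.app a)
  rw [← Iso.inv_comp_eq] at e
  simp at h e ⊢
  rw [h, reassoc_of% e]
  simp [← whiskerLeft_comp_assoc]

theorem postW_comp {a b c : B} (f : a ⟶ b) (g : b ⟶ c) :
    H.map (φ.app a) ◁ ((H.mapComp (G.map f) (G.map g)).inv ≫ H.map₂ (G.mapComp f g).inv) ≫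
      (H.mapComp (φ.app a) (G.map (f ≫ g))).inv ≫ H.map₂ (φ.nat (f ≫ g)) ≫
        (H.mapComp (F.map (f ≫ g)) (φ.app c)).hom =
    (α_ (H.map (φ.app a)) (H.map (G.map f)) (H.map (G.map g))).inv ≫
      ((H.mapComp (φ.app a) (G.map f)).inv ≫ H.map₂ (φ.nat f) ≫
        (H.mapComp (F.map f) (φ.app b)).hom) ▷ H.map (G.map g) ≫
      (α_ (H.map (F.map f)) (H.map (φ.app b)) (H.map (G.map g))).hom ≫
      H.map (F.map f) ◁ ((H.mapComp (φ.app b) (G.map g)).inv ≫ H.map₂ (φ.nat g) ≫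
        (H.mapComp (F.map g) (φ.app c)).hom) ≫
      (α_ (H.map (F.map f)) (H.map (F.map g)) (H.map (φ.app c))).inv ≫
      ((H.mapComp (F.map f) (F.map g)).inv ≫ H.map₂ (F.mapComp f g).inv) ▷ H.map (φ.app c) := by
  have h := congrArg H.map₂ (φ.nat_comp f g)
  rw [← cancel_mono (H.mapComp (F.map (f ≫ g)) (φ.app c)).inv]
  simp at h
  rw [← Iso.eq_inv_comp, mapComp_cancel_assoc, mapComp_cancel_assoc] at h
  simp
  rw [h]
  simp only [← whiskerLeft_comp_assoc, Iso.inv_hom_id, whiskerLeft_id, Category.id_comp]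

end whiskering

/-- Whiskering of a lax natural transformation with a `2`-functor on its source. -/
def preW (F : StrictPseudofunctor B C) {G H : StrictPseudofunctor C D} (φ : LaxNat G H) :
    LaxNat (F.comp G) (F.comp H) where
  app a := φ.app (F.obj a)
  nat f := φ.nat (F.map f)
  nat_nat η := φ.nat_nat (F.map₂ η)
  nat_id a := preW_id F φ a
  nat_comp f g := preW_comp F φ f g

/-- Whiskering of a lax natural transformation with a `2`-functor on its target. -/
def postW {F G : StrictPseudofunctor B C} (φ : LaxNat F G) (H : StrictPseudofunctor C D) :
    LaxNat (F.comp H) (G.comp H) where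
  app a := H.map (φ.app a)
  nat {a b} f := (H.mapComp (φ.app a) (G.map f)).inv ≫ H.map₂ (φ.nat f) ≫
    (H.mapComp (F.map f) (φ.app b)).hom
  nat_nat η := postW_nat φ H η
  nat_id a := postW_id φ H a
  nat_comp f g := postW_comp φ H f g

/-- The identity lax natural transformation. -/
protected def id (F : StrictPseudofunctor B C) : LaxNat F F where
  app a := 𝟙 (F.obj a)
  nat f := (λ_ (F.map f)).hom ≫ (ρ_ (F.map f)).inv
  nat_nat := ((equivLaxTrans F F).symm (Lax.LaxTrans.id _)).nat_nat
  nat_id := ((equivLaxTrans F F).symm (Lax.LaxTrans.id _)).nat_id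
  nat_comp := ((equivLaxTrans F F).symm (Lax.LaxTrans.id _)).nat_comp

/-- Vertical composition of lax natural transformations. -/
protected def comp {F G H : StrictPseudofunctor B C} (φ : LaxNat F G) (ψ : LaxNat G H) :
    LaxNat F H where
  app a := φ.app a ≫ ψ.app a
  nat {a b} f := (α_ (φ.app a) (ψ.app a) (H.map f)).hom ≫ φ.app a ◁ ψ.nat f ≫
    (α_ (φ.app a) (G.map f) (ψ.app b)).inv ≫ φ.nat f ▷ ψ.app b ≫
    (α_ (F.map f) (φ.app b) (ψ.app b)).hom
  nat_nat := ((equivLaxTrans F H).symm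
    ((equivLaxTrans F G φ).vComp (equivLaxTrans G H ψ))).nat_nat
  nat_id := ((equivLaxTrans F H).symm
    ((equivLaxTrans F G φ).vComp (equivLaxTrans G H ψ))).nat_id
  nat_comp := ((equivLaxTrans F H).symm
    ((equivLaxTrans F G φ).vComp (equivLaxTrans G H ψ))).nat_comp

end LaxNat
end

/-- A sesquicategory: a category whose hom-sets are lifted to categories, with (strictly
associative and unital) whiskerings of cells by morphisms that are functorial with respect to
vertical composition. No interchange law is required. -/
class Sesquicategory (S : Type u) extends Category.{v} S where
  homCategory (A C : S) : Category.{w} (A ⟶ C)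
  preW {X A C : S} (l : X ⟶ A) {f g : A ⟶ C} (φ : f ⟶ g) : l ≫ f ⟶ l ≫ g
  postW {A C E : S} {f g : A ⟶ C} (φ : f ⟶ g) (h : C ⟶ E) : f ≫ h ⟶ g ≫ h
  preW_id {X A C : S} (l : X ⟶ A) (f : A ⟶ C) : preW l (𝟙 f) = 𝟙 (l ≫ f)
  preW_comp {X A C : S} (l : X ⟶ A) {f g h : A ⟶ C} (φ : f ⟶ g) (ψ : g ⟶ h) :
    preW l (φ ≫ ψ) = preW l φ ≫ preW l ψ
  postW_id {A C E : S} (f : A ⟶ C) (h : C ⟶ E) : postW (𝟙 f) h = 𝟙 (f ≫ h)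
  postW_comp {A C E : S} {f g k : A ⟶ C} (φ : f ⟶ g) (ψ : g ⟶ k) (h : C ⟶ E) :
    postW (φ ≫ ψ) h = postW φ h ≫ postW ψ h
  id_preW {A C : S} {f g : A ⟶ C} (φ : f ⟶ g) : preW (𝟙 A) φ ≍ φ
  comp_preW {W X A C : S} (k : W ⟶ X) (l : X ⟶ A) {f g : A ⟶ C} (φ : f ⟶ g) :
    preW (k ≫ l) φ ≍ preW k (preW l φ)
  id_postW {A C : S} {f g : A ⟶ C} (φ : f ⟶ g) : postW φ (𝟙 C) ≍ φ
  comp_postW {A C D E : S} {f g : A ⟶ C} (φ : f ⟶ g) (h : C ⟶ D) (k : D ⟶ E) :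
    postW φ (h ≫ k) ≍ postW (postW φ h) k
  preW_postW {X A C E : S} (l : X ⟶ A) {f g : A ⟶ C} (φ : f ⟶ g) (h : C ⟶ E) :
    postW (preW l φ) h ≍ preW l (postW φ h)

attribute [instance, reducible] Sesquicategory.homCategory

section
variable {B : Type u₁} [Bicategory.{w₁, v₁} B] {C : Type u₂} [Bicategory.{w₂, v₂} C]
  {D : Type u₃} [Bicategory.{w₃, v₃} D]

namespace LaxNat

theorem strict_heq [Strict C] {a b : C} {f g f' g' : a ⟶ b} (hf : f = f') (hg : g = g')
    {η : f ⟶ g} {θ : f' ⟶ g'} (h : η = eqToHom hf ≫ θ ≫ eqToHom hg.symm) : η ≍ θ := by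
  subst hf hg
  simp at h
  exact heq_of_eq h

theorem id_comp' [Strict C] {F G : StrictPseudofunctor B C} (φ : LaxNat F G) :
    (LaxNat.id F).comp φ = φ :=
  eq_of_heq (heq_of_heq rfl rfl (fun a => heq_of_eq (Strict.id_comp _)) fun f =>
    strict_heq (by simp [LaxNat.comp, LaxNat.id]) (by simp [LaxNat.comp, LaxNat.id])
      (by simp [LaxNat.comp, LaxNat.id, Strict.leftUnitor_eqToIso, Strict.rightUnitor_eqToIso,
        Strict.associator_eqToIso]))

theorem comp_id' [Strict C] {F G : StrictPseudofunctor B C} (φ : LaxNat F G) :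
    φ.comp (LaxNat.id G) = φ :=
  eq_of_heq (heq_of_heq rfl rfl (fun a => heq_of_eq (Strict.comp_id _)) fun f =>
    strict_heq (by simp [LaxNat.comp, LaxNat.id]) (by simp [LaxNat.comp, LaxNat.id])
      (by simp [LaxNat.comp, LaxNat.id, Strict.leftUnitor_eqToIso, Strict.rightUnitor_eqToIso,
        Strict.associator_eqToIso]))

theorem assoc' [Strict C] {F G H K : StrictPseudofunctor B C} (φ : LaxNat F G) (ψ : LaxNat G H)
    (χ : LaxNat H K) : (φ.comp ψ).comp χ = φ.comp (ψ.comp χ) :=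
  eq_of_heq (heq_of_heq rfl rfl (fun a => heq_of_eq (Strict.assoc _ _ _)) fun f => by
    dsimp only [LaxNat.comp]
    exact strict_heq (by simp [Strict.assoc]) (by simp [Strict.assoc])
      (by simp [Strict.associator_eqToIso]))

/-- The category of `2`-functors and lax natural transformations. -/
abbrev category [Strict C] : Category (StrictPseudofunctor B C) where
  Hom F G := LaxNat F G
  id F := LaxNat.id F
  comp φ ψ := φ.comp ψ
  id_comp φ := id_comp' φ
  comp_id φ := comp_id' φ
  assoc φ ψ χ := assoc' φ ψ χ

theorem postW_id₂ {F : StrictPseudofunctor B C} [Strict C] [Strict D]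
    (H : StrictPseudofunctor C D) :
    postW (LaxNat.id F) H = LaxNat.id (F.comp H) := by
  refine eq_of_heq (heq_of_heq rfl rfl (fun a => heq_of_eq (H.map_id _)) fun {a b} f => ?_)
  change ((H.mapComp (𝟙 (F.obj a)) (F.map f)).inv ≫ H.map₂ ((λ_ (F.map f)).hom ≫
    (ρ_ (F.map f)).inv) ≫ (H.mapComp (F.map f) (𝟙 (F.obj b))).hom) ≍
    ((λ_ (H.map (F.map f))).hom ≫ (ρ_ (H.map (F.map f))).inv)
  refine strict_heq (by simp [H.map_id]) (by simp [H.map_id]) ?_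
  simp [H.mapComp_eq_eqToIso, Strict.leftUnitor_eqToIso, Strict.rightUnitor_eqToIso,
    PrelaxFunctor.map₂_eqToHom]

theorem postW_comp₂ {F G K : StrictPseudofunctor B C} [Strict C] [Strict D] (φ : LaxNat F G)
    (ψ : LaxNat G K) (H : StrictPseudofunctor C D) :
    postW (φ.comp ψ) H = (postW φ H).comp (postW ψ H) := by
  refine eq_of_heq (heq_of_heq rfl rfl (fun a => heq_of_eq (H.map_comp _ _)) fun {a b} f => ?_)
  change (H.mapComp (φ.app a ≫ ψ.app a) (K.map f)).inv ≫ H.map₂ ((α_ (φ.app a) (ψ.app a)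
      (K.map f)).hom ≫ φ.app a ◁ ψ.nat f ≫
      (α_ (φ.app a) (G.map f) (ψ.app b)).inv ≫ φ.nat f ▷ ψ.app b ≫
      (α_ (F.map f) (φ.app b) (ψ.app b)).hom) ≫
      (H.mapComp (F.map f) (φ.app b ≫ ψ.app b)).hom ≍
    (α_ (H.map (φ.app a)) (H.map (ψ.app a)) (H.map (K.map f))).hom ≫
    H.map (φ.app a) ◁ ((H.mapComp (ψ.app a) (K.map f)).inv ≫ H.map₂ (ψ.nat f) ≫
      (H.mapComp (G.map f) (ψ.app b)).hom) ≫
    (α_ (H.map (φ.app a)) (H.map (G.map f)) (H.map (ψ.app b))).inv ≫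
    ((H.mapComp (φ.app a) (G.map f)).inv ≫ H.map₂ (φ.nat f) ≫
      (H.mapComp (F.map f) (φ.app b)).hom) ▷ H.map (ψ.app b) ≫
    (α_ (H.map (F.map f)) (H.map (φ.app b)) (H.map (ψ.app b))).hom
  refine strict_heq (by simp [H.map_comp]) (by simp [H.map_comp]) ?_
  simp [H.mapComp_eq_eqToIso, Strict.associator_eqToIso, PrelaxFunctor.map₂_eqToHom]

theorem id_postW' {F G : StrictPseudofunctor B C} (φ : LaxNat F G) :
    postW φ (StrictPseudofunctor.id C) ≍ φ :=
  heq_of_heq (ext_of_heq (fun _ => rfl) (fun _ => HEq.rfl) (fun _ => HEq.rfl))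
    (ext_of_heq (fun _ => rfl) (fun _ => HEq.rfl) (fun _ => HEq.rfl)) (fun _ => HEq.rfl)
    fun {a b} f => by
      change 𝟙 (φ.app a ≫ G.map f) ≫ φ.nat f ≫ 𝟙 (F.map f ≫ φ.app b) ≍ φ.nat f
      simp

theorem comp_postW' {E : Type*} [Bicategory E] {F G : StrictPseudofunctor B C}
    (φ : LaxNat F G) (H : StrictPseudofunctor C D) (K : StrictPseudofunctor D E) :
    postW φ (H.comp K) ≍ postW (postW φ H) K :=
  heq_of_heq (ext_of_heq (fun _ => rfl) (fun _ => HEq.rfl) (fun _ => HEq.rfl))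
    (ext_of_heq (fun _ => rfl) (fun _ => HEq.rfl) (fun _ => HEq.rfl)) (fun _ => HEq.rfl)
    fun {a b} f => by
      change ((K.mapComp (H.map (φ.app a)) (H.map (G.map f))).inv ≫
          K.map₂ (H.mapComp (φ.app a) (G.map f)).inv) ≫ K.map₂ (H.map₂ (φ.nat f)) ≫
          K.map₂ (H.mapComp (F.map f) (φ.app b)).hom ≫
          (K.mapComp (H.map (F.map f)) (H.map (φ.app b))).hom ≍
        (K.mapComp (H.map (φ.app a)) (H.map (G.map f))).inv ≫
          K.map₂ ((H.mapComp (φ.app a) (G.map f)).inv ≫ H.map₂ (φ.nat f) ≫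
          (H.mapComp (F.map f) (φ.app b)).hom) ≫
          (K.mapComp (H.map (F.map f)) (H.map (φ.app b))).hom
      simp

end LaxNat

/-- The sesquicategory of (large) `2`-categories, `2`-functors and lax natural transformations. -/
instance : Sesquicategory TwoCat.{u} where
  homCategory A C := LaxNat.category (B := A) (C := C)
  preW l _ _ φ := LaxNat.preW l φ
  postW φ h := LaxNat.postW φ h
  preW_id l f := rfl
  preW_comp l _ _ _ φ ψ := rfl
  postW_id f h := LaxNat.postW_id₂ h
  postW_comp φ ψ h := LaxNat.postW_comp₂ φ ψ h
  id_preW φ := LaxNat.heq_of_heq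
    (ext_of_heq (fun _ => rfl) (fun _ => HEq.rfl) (fun _ => HEq.rfl))
    (ext_of_heq (fun _ => rfl) (fun _ => HEq.rfl) (fun _ => HEq.rfl))
    (fun _ => HEq.rfl) fun f => HEq.rfl
  comp_preW k l _ _ φ := LaxNat.heq_of_heq
    (ext_of_heq (fun _ => rfl) (fun _ => HEq.rfl) (fun _ => HEq.rfl))
    (ext_of_heq (fun _ => rfl) (fun _ => HEq.rfl) (fun _ => HEq.rfl))
    (fun _ => HEq.rfl) fun f => HEq.rfl
  id_postW φ := LaxNat.id_postW' φ
  comp_postW φ h k := LaxNat.comp_postW' φ h k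
  preW_postW l _ _ φ h := LaxNat.heq_of_heq
    (ext_of_heq (fun _ => rfl) (fun _ => HEq.rfl) (fun _ => HEq.rfl))
    (ext_of_heq (fun _ => rfl) (fun _ => HEq.rfl) (fun _ => HEq.rfl))
    (fun _ => HEq.rfl) fun f => HEq.rfl

end

section internal

/-- A category with chosen pullbacks. -/
class ChosenPullbacks (E : Type u) [Category.{v} E] where
  chosen {X Y Z : E} (f : X ⟶ Z) (g : Y ⟶ Z) : Limits.ChosenPullback f g

variable {E : Type u} [Category.{v} E] [ChosenPullbacks E]

section
variable {X Y Z : E} (f : X ⟶ Z) (g : Y ⟶ Z)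

/-- The chosen pullback `X ×_Z Y`. -/
abbrev pb : E := (ChosenPullbacks.chosen f g).pullback
/-- The first projection. -/
abbrev π₁ : pb f g ⟶ X := (ChosenPullbacks.chosen f g).p₁
/-- The second projection. -/
abbrev π₂ : pb f g ⟶ Y := (ChosenPullbacks.chosen f g).p₂

theorem pb_condition : π₁ f g ≫ f = π₂ f g ≫ g := (ChosenPullbacks.chosen f g).condition

variable {f g}

/-- The morphism `(a, b)` into the chosen pullback. -/
def pair {W : E} (a : W ⟶ X) (b : W ⟶ Y) (h : a ≫ f = b ≫ g) : W ⟶ pb f g :=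
  Limits.PullbackCone.IsLimit.lift (ChosenPullbacks.chosen f g).isLimit a b h

@[simp]
theorem pair_π₁ {W : E} (a : W ⟶ X) (b : W ⟶ Y) (h : a ≫ f = b ≫ g) :
    pair a b h ≫ π₁ f g = a :=
  Limits.PullbackCone.IsLimit.lift_fst (ChosenPullbacks.chosen f g).isLimit a b h

@[simp]
theorem pair_π₂ {W : E} (a : W ⟶ X) (b : W ⟶ Y) (h : a ≫ f = b ≫ g) :
    pair a b h ≫ π₂ f g = b :=
  Limits.PullbackCone.IsLimit.lift_snd (ChosenPullbacks.chosen f g).isLimit a b h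

end

section
variable {X Y Z V W : E} {f : X ⟶ Z} {g : Y ⟶ Z}

theorem pb_condition_assoc (k : Z ⟶ V) : π₁ f g ≫ f ≫ k = π₂ f g ≫ g ≫ k := by
  rw [← Category.assoc, pb_condition, Category.assoc]

@[simp]
theorem pair_π₁_assoc (a : W ⟶ X) (b : W ⟶ Y) (h : a ≫ f = b ≫ g) (k : X ⟶ V) :
    pair a b h ≫ π₁ f g ≫ k = a ≫ k := by
  rw [← Category.assoc, pair_π₁]

@[simp]
theorem pair_π₂_assoc (a : W ⟶ X) (b : W ⟶ Y) (h : a ≫ f = b ≫ g) (k : Y ⟶ V) :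
    pair a b h ≫ π₂ f g ≫ k = b ≫ k := by
  rw [← Category.assoc, pair_π₂]

end

/-- An internal category with object of objects `A`. -/
structure InternalCategory (A : E) where
  arr : E
  src : arr ⟶ A
  tgt : arr ⟶ A
  comp : pb tgt src ⟶ arr
  comp_src : comp ≫ src = π₁ tgt src ≫ src
  comp_tgt : comp ≫ tgt = π₂ tgt src ≫ tgt
  unit : A ⟶ arr
  unit_src : unit ≫ src = 𝟙 A
  unit_tgt : unit ≫ tgt = 𝟙 A
  /-- Associativity, as an equality of morphisms `(arr ×_A arr) ×_A arr ⟶ arr`. -/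
  assoc :
    pair (π₁ (π₂ tgt src ≫ tgt) src ≫ comp) (π₂ (π₂ tgt src ≫ tgt) src)
        (by rw [Category.assoc, comp_tgt, pb_condition]) ≫ comp =
      pair (π₁ (π₂ tgt src ≫ tgt) src ≫ π₁ tgt src)
        (pair (π₁ (π₂ tgt src ≫ tgt) src ≫ π₂ tgt src) (π₂ (π₂ tgt src ≫ tgt) src)
          (by rw [Category.assoc, pb_condition]) ≫ comp)
        (by rw [Category.assoc, Category.assoc, comp_src, pair_π₁_assoc, Category.assoc,
          pb_condition]) ≫ comp
  id_comp : pair (src ≫ unit) (𝟙 arr) (by simp [unit_tgt]) ≫ comp = 𝟙 arr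
  comp_id : pair (𝟙 arr) (tgt ≫ unit) (by simp [unit_src]) ≫ comp = 𝟙 arr

/-- The structure of an internal profunctor from `α` to `β` on the span `A ⟵ J ⟶ B`. -/
@[ext]
structure Profunctor {A B J : E} (α : InternalCategory A) (β : InternalCategory B)
    (p : J ⟶ A) (q : J ⟶ B) where
  /-- the left action -/
  left : pb α.tgt p ⟶ J
  /-- the right action -/
  right : pb q β.src ⟶ J
  left_p : left ≫ p = π₁ α.tgt p ≫ α.src
  left_q : left ≫ q = π₂ α.tgt p ≫ q
  right_p : right ≫ p = π₁ q β.src ≫ p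
  right_q : right ≫ q = π₂ q β.src ≫ β.tgt
  /-- Associativity of the left action, on `(α.arr ×_A α.arr) ×_A J`. -/
  left_assoc :
    pair (π₁ (π₂ α.tgt α.src ≫ α.tgt) p ≫ α.comp) (π₂ (π₂ α.tgt α.src ≫ α.tgt) p)
        (by rw [Category.assoc, α.comp_tgt, pb_condition]) ≫ left =
      pair (π₁ (π₂ α.tgt α.src ≫ α.tgt) p ≫ π₁ α.tgt α.src)
        (pair (π₁ (π₂ α.tgt α.src ≫ α.tgt) p ≫ π₂ α.tgt α.src) (π₂ (π₂ α.tgt α.src ≫ α.tgt) p)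
          (by rw [Category.assoc, pb_condition]) ≫ left)
        (by rw [Category.assoc, Category.assoc, left_p, pair_π₁_assoc, Category.assoc,
          pb_condition]) ≫ left
  left_unit : pair (p ≫ α.unit) (𝟙 J) (by simp [α.unit_tgt]) ≫ left = 𝟙 J
  /-- Associativity of the right action, on `(J ×_B β.arr) ×_B β.arr`. -/
  right_assoc :
    pair (π₁ (π₂ q β.src ≫ β.tgt) β.src ≫ π₁ q β.src)
        (pair (π₁ (π₂ q β.src ≫ β.tgt) β.src ≫ π₂ q β.src) (π₂ (π₂ q β.src ≫ β.tgt) β.src)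
          (by rw [Category.assoc, pb_condition]) ≫ β.comp)
        (by rw [Category.assoc, Category.assoc, β.comp_src, pair_π₁_assoc, Category.assoc,
          pb_condition]) ≫ right =
      pair (π₁ (π₂ q β.src ≫ β.tgt) β.src ≫ right) (π₂ (π₂ q β.src ≫ β.tgt) β.src)
        (by rw [Category.assoc, right_q, pb_condition]) ≫ right
  right_unit : pair (𝟙 J) (q ≫ β.unit) (by simp [β.unit_src]) ≫ right = 𝟙 J
  /-- Compatibility of the two actions, on `(α.arr ×_A J) ×_B β.arr`. -/
  left_right :
    pair (π₁ (π₂ α.tgt p ≫ q) β.src ≫ left) (π₂ (π₂ α.tgt p ≫ q) β.src)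
        (by rw [Category.assoc, left_q, pb_condition]) ≫ right =
      pair (π₁ (π₂ α.tgt p ≫ q) β.src ≫ π₁ α.tgt p)
        (pair (π₁ (π₂ α.tgt p ≫ q) β.src ≫ π₂ α.tgt p) (π₂ (π₂ α.tgt p ≫ q) β.src)
          (by rw [Category.assoc, pb_condition]) ≫ right)
        (by rw [Category.assoc, Category.assoc, right_p, pair_π₁_assoc, Category.assoc,
          pb_condition]) ≫ left

end internal

section sesqui
variable {S : Type u} [Sesquicategory.{w, v} S]
open Sesquicategory

/-- A `2`-cotensor of `A`: the comma object of the identity of `A` with itself, that is, the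
universal cell `δ : src ⟶ tgt` between morphisms into `A`. -/
structure TwoCotensor (A : S) where
  obj : S
  src : obj ⟶ A
  tgt : obj ⟶ A
  δ : src ⟶ tgt
  lift {X : S} {f g : X ⟶ A} (φ : f ⟶ g) : X ⟶ obj
  lift_src {X : S} {f g : X ⟶ A} (φ : f ⟶ g) : lift φ ≫ src = f
  lift_tgt {X : S} {f g : X ⟶ A} (φ : f ⟶ g) : lift φ ≫ tgt = g
  lift_δ {X : S} {f g : X ⟶ A} (φ : f ⟶ g) : preW (lift φ) δ ≍ φ
  hom_ext {X : S} {k l : X ⟶ obj} : k ≫ src = l ≫ src → k ≫ tgt = l ≫ tgt →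
    preW k δ ≍ preW l δ → k = l

/-- A conical pullback in a sesquicategory: a pullback in the underlying category that also has
the universal property for cells. -/
structure ConicalPullback {X Y Z : S} (f : X ⟶ Z) (g : Y ⟶ Z) extends
    Limits.ChosenPullback f g where
  existsUnique_cell {W : S} (k l : W ⟶ pullback) (φ : k ≫ p₁ ⟶ l ≫ p₁) (ψ : k ≫ p₂ ⟶ l ≫ p₂) :
    postW φ f ≍ postW ψ g → ∃! χ : k ⟶ l, postW χ p₁ = φ ∧ postW χ p₂ = ψ

variable (S) in
/-- Specified conical pullbacks and `2`-cotensors in a sesquicategory. -/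
class SpecifiedLimits where
  pullback {X Y Z : S} (f : X ⟶ Z) (g : Y ⟶ Z) : ConicalPullback f g
  cotensor (A : S) : TwoCotensor A

instance [SpecifiedLimits S] : ChosenPullbacks S where
  chosen f g := (SpecifiedLimits.pullback f g).toChosenPullback

theorem vcomp_heq {A C : S} {f g h f' g' h' : A ⟶ C} {φ : f ⟶ g} {ψ : g ⟶ h} {φ' : f' ⟶ g'}
    {ψ' : g' ⟶ h'} (hf : f = f') (hg : g = g') (hh : h = h') (hφ : φ ≍ φ') (hψ : ψ ≍ ψ') :
    (φ ≫ ψ) ≍ (φ' ≫ ψ') := by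
  subst hf hg hh hφ hψ; rfl

theorem id_vcomp_heq {A C : S} {f g h k x : A ⟶ C} {φ : f ⟶ g} {e : g = h} {ψ : h ⟶ k}
    (hf : f = x) (hg : g = x) (hφ : φ ≍ 𝟙 x) : (φ ≫ eqToHom e ≫ ψ) ≍ ψ := by
  subst hf hg e
  rw [eq_of_heq hφ]; simp

theorem vcomp_id_heq {A C : S} {f g h k x : A ⟶ C} {φ : f ⟶ g} {e : g = h} {ψ : h ⟶ k}
    (hf : h = x) (hg : k = x) (hψ : ψ ≍ 𝟙 x) : (φ ≫ eqToHom e ≫ ψ) ≍ φ := by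
  subst hf hg e
  rw [eq_of_heq hψ]; simp

theorem vcomp_assoc_heq {A C : S} {f g g' h h' k m n m' n' : A ⟶ C} {φ : f ⟶ g} (e : g = g')
    {ψ : g' ⟶ h} (e' : h = h') {χ : h' ⟶ k} {Φ : m ⟶ n} {Ψ : m' ⟶ n'} (hm : m = f) (hn : n = h)
    (hΦ : Φ ≍ (φ ≫ eqToHom e ≫ ψ)) (hm' : m' = g') (hn' : n' = k)
    (hΨ : Ψ ≍ (ψ ≫ eqToHom e' ≫ χ)) {a : n = h'} {b : g = m'} :
    (Φ ≫ eqToHom a ≫ χ) ≍ (φ ≫ eqToHom b ≫ Ψ) := by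
  subst hm hn hm' hn' a b
  rw [eq_of_heq hΦ, eq_of_heq hΨ]; simp

theorem preW_heq {X A C : S} {k k' : X ⟶ A} {f g f' g' : A ⟶ C} {φ : f ⟶ g} {φ' : f' ⟶ g'}
    (hk : k = k') (hf : f = f') (hg : g = g') (hφ : φ ≍ φ') : preW k φ ≍ preW k' φ' := by
  subst hk hf hg hφ; rfl

theorem preW_eqToHom {X A C : S} (k : X ⟶ A) {f g : A ⟶ C} (h : f = g) :
    preW k (eqToHom h) = eqToHom (by rw [h]) := by
  subst h; simp [preW_id]

namespace TwoCotensor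
variable {A : S} (T : TwoCotensor A)

theorem lift_id_δ {X : S} (a : X ⟶ A) : preW (a ≫ T.lift (𝟙 (𝟙 A))) T.δ ≍ 𝟙 a := by
  refine (comp_preW _ _ _).trans ((preW_heq rfl (T.lift_src _) (T.lift_tgt _)
    (T.lift_δ (𝟙 (𝟙 A)))).trans ?_)
  rw [preW_id]
  rw [Category.comp_id]

section
variable [ChosenPullbacks S]

/-- The vertical composite of the two universal cells over `A^𝟚 ×_A A^𝟚`. -/
def compCell : π₁ T.tgt T.src ≫ T.src ⟶ π₂ T.tgt T.src ≫ T.tgt :=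
  preW (π₁ T.tgt T.src) T.δ ≫ eqToHom (pb_condition T.tgt T.src) ≫ preW (π₂ T.tgt T.src) T.δ

theorem comp_δ {X : S} (k : X ⟶ pb T.tgt T.src) (a b : X ⟶ T.obj) (ha : k ≫ π₁ T.tgt T.src = a)
    (hb : k ≫ π₂ T.tgt T.src = b) (h : a ≫ T.tgt = b ≫ T.src) :
    preW (k ≫ T.lift T.compCell) T.δ ≍ (preW a T.δ ≫ eqToHom h ≫ preW b T.δ) := by
  subst ha hb
  refine (comp_preW _ _ _).trans ((preW_heq rfl (T.lift_src _) (T.lift_tgt _)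
    (T.lift_δ T.compCell)).trans ?_)
  rw [compCell, preW_comp, preW_comp, preW_eqToHom]
  refine vcomp_heq (Category.assoc _ _ _).symm (Category.assoc _ _ _).symm
    (Category.assoc _ _ _).symm (comp_preW _ _ _).symm ?_
  exact (eqToHom_comp_heq _ _).trans ((comp_preW _ _ _).symm.trans (eqToHom_comp_heq _ _).symm)

/-- The internal category structure of the `2`-cotensor `A^𝟚`. -/
def internalCategory : InternalCategory A where
  arr := T.obj
  src := T.src
  tgt := T.tgt
  comp := T.lift T.compCell
  comp_src := T.lift_src _
  comp_tgt := T.lift_tgt _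
  unit := T.lift (𝟙 (𝟙 A))
  unit_src := T.lift_src _
  unit_tgt := T.lift_tgt _
  assoc := by
    apply T.hom_ext
    · simp [T.lift_src]
    · simp [T.lift_tgt]
    · let k := π₁ (π₂ T.tgt T.src ≫ T.tgt) T.src
      let z := π₂ (π₂ T.tgt T.src ≫ T.tgt) T.src
      have e₁ : (k ≫ π₁ T.tgt T.src) ≫ T.tgt = (k ≫ π₂ T.tgt T.src) ≫ T.src := by
        rw [Category.assoc, Category.assoc, pb_condition]
      have e₂ : (k ≫ π₂ T.tgt T.src) ≫ T.tgt = z ≫ T.src := by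
        rw [Category.assoc, pb_condition]
      have e₃ : (k ≫ T.lift T.compCell) ≫ T.tgt = z ≫ T.src := by
        rw [Category.assoc, T.lift_tgt, pb_condition]
      have e₄ : (k ≫ π₁ T.tgt T.src) ≫ T.tgt =
          (pair (k ≫ π₂ T.tgt T.src) z e₂ ≫ T.lift T.compCell) ≫ T.src := by
        rw [Category.assoc (pair _ _ _), T.lift_src, pair_π₁_assoc, e₁]
      refine (T.comp_δ _ _ _ (pair_π₁ _ _ _) (pair_π₂ _ _ _) e₃).trans (HEq.trans ?_
        (T.comp_δ _ _ _ (pair_π₁ _ _ _) (pair_π₂ _ _ _) e₄).symm)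
      refine vcomp_assoc_heq e₁ e₂ ?_ ?_ (T.comp_δ k _ _ rfl rfl e₁) ?_ ?_
        (T.comp_δ _ _ _ (pair_π₁ _ _ _) (pair_π₂ _ _ _) e₂)
      · rw [Category.assoc, T.lift_src, Category.assoc]
      · rw [Category.assoc, T.lift_tgt, Category.assoc]
      · rw [Category.assoc, T.lift_src, pair_π₁_assoc]
      · rw [Category.assoc, T.lift_tgt, pair_π₂_assoc]
  id_comp := by
    apply T.hom_ext
    · simp [T.lift_src]
    · simp [T.lift_tgt]
    · have e : (T.src ≫ T.lift (𝟙 (𝟙 A))) ≫ T.tgt = 𝟙 T.obj ≫ T.src := by simp [T.lift_tgt]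
      refine (T.comp_δ _ _ _ (pair_π₁ _ _ _) (pair_π₂ _ _ _) e).trans
        (id_vcomp_heq (by simp [T.lift_src]) (by simp [T.lift_tgt]) (T.lift_id_δ T.src))
  comp_id := by
    apply T.hom_ext
    · simp [T.lift_src]
    · simp [T.lift_tgt]
    · have e : 𝟙 T.obj ≫ T.tgt = (T.tgt ≫ T.lift (𝟙 (𝟙 A))) ≫ T.src := by simp [T.lift_src]
      refine (T.comp_δ _ _ _ (pair_π₁ _ _ _) (pair_π₂ _ _ _) e).trans
        (vcomp_id_heq (by simp [T.lift_src]) (by simp [T.lift_tgt]) (T.lift_id_δ T.tgt))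

end

end TwoCotensor

/-- The structure of an internal split two-sided fibration on the span `A ⟵ J ⟶ B` in a
sesquicategory: an internal profunctor from `A^𝟚` to `B^𝟚` in the underlying category. -/
abbrev SplitTwoSidedFibration [SpecifiedLimits S] {A B J : S} (p : J ⟶ A) (q : J ⟶ B) :=
  Profunctor (SpecifiedLimits.cotensor A).internalCategory
    (SpecifiedLimits.cotensor B).internalCategory p q

end sesqui

section laxArrow
variable (C : Type u) [Bicategory.{w, v} C]

/-- The objects of the lax arrow `2`-category: the morphisms `hom : left ⟶ right`. -/
structure LaxArrow where
  left : C
  right : C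
  hom : left ⟶ right

variable {C}

namespace LaxArrow

/-- The morphisms of the lax arrow `2`-category: the lax squares. -/
structure Hom (x y : LaxArrow C) where
  left : x.left ⟶ y.left
  right : x.right ⟶ y.right
  cell : x.hom ≫ right ⟶ left ≫ y.hom

instance : CategoryStruct (LaxArrow C) where
  Hom x y := Hom x y
  id x := ⟨𝟙 _, 𝟙 _, (ρ_ x.hom).hom ≫ (λ_ x.hom).inv⟩
  comp {x y z} f g := ⟨f.left ≫ g.left, f.right ≫ g.right,
    (α_ x.hom f.right g.right).inv ≫ f.cell ▷ g.right ≫ (α_ f.left y.hom g.right).hom ≫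
      f.left ◁ g.cell ≫ (α_ f.left g.left z.hom).inv⟩

/-- The cells of the lax arrow `2`-category: the pairs of cells that are compatible with the
squares. -/
@[ext]
structure Hom₂ {x y : LaxArrow C} (f g : x ⟶ y) where
  left : f.left ⟶ g.left
  right : f.right ⟶ g.right
  w : f.cell ≫ left ▷ y.hom = x.hom ◁ right ≫ g.cell

theorem Hom₂.w_assoc {x y : LaxArrow C} {f g : x ⟶ y} (η : Hom₂ f g) {k : x.left ⟶ y.right}
    (θ : g.left ≫ y.hom ⟶ k) : f.cell ≫ η.left ▷ y.hom ≫ θ = x.hom ◁ η.right ≫ g.cell ≫ θ := by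
  rw [← Category.assoc, η.w, Category.assoc]

instance (x y : LaxArrow C) : Category (x ⟶ y) where
  Hom f g := Hom₂ f g
  id f := ⟨𝟙 _, 𝟙 _, by simp⟩
  comp η θ := ⟨η.left ≫ θ.left, η.right ≫ θ.right, by simp [η.w_assoc, θ.w]⟩

@[ext]
theorem hom₂_ext {x y : LaxArrow C} {f g : x ⟶ y} {η θ : f ⟶ g} (h : η.left = θ.left)
    (h' : η.right = θ.right) : η = θ := Hom₂.ext h h'

section
variable {x y z : LaxArrow C} {f g h : x ⟶ y} {k : y ⟶ z}
@[simp] theorem id_left : (𝟙 x : x ⟶ x).left = 𝟙 x.left := rfl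
@[simp] theorem id_right : (𝟙 x : x ⟶ x).right = 𝟙 x.right := rfl
@[simp] theorem id_cell : (𝟙 x : x ⟶ x).cell = (ρ_ x.hom).hom ≫ (λ_ x.hom).inv := rfl
@[simp] theorem comp_left : (f ≫ k).left = f.left ≫ k.left := rfl
@[simp] theorem comp_right : (f ≫ k).right = f.right ≫ k.right := rfl
@[simp] theorem comp_cell : (f ≫ k).cell =
    (α_ x.hom f.right k.right).inv ≫ f.cell ▷ k.right ≫ (α_ f.left y.hom k.right).hom ≫
      f.left ◁ k.cell ≫ (α_ f.left k.left z.hom).inv := rfl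
@[simp] theorem id₂_left : (𝟙 f : f ⟶ f).left = 𝟙 f.left := rfl
@[simp] theorem id₂_right : (𝟙 f : f ⟶ f).right = 𝟙 f.right := rfl
@[simp] theorem comp₂_left (η : f ⟶ g) (θ : g ⟶ h) : (η ≫ θ).left = η.left ≫ θ.left := rfl
@[simp] theorem comp₂_right (η : f ⟶ g) (θ : g ⟶ h) : (η ≫ θ).right = η.right ≫ θ.right := rfl
end

/-- An invertible cell from invertible components. -/
def mkIso {x y : LaxArrow C} {f g : x ⟶ y} (l : f.left ≅ g.left) (r : f.right ≅ g.right)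
    (w : f.cell ≫ l.hom ▷ y.hom = x.hom ◁ r.hom ≫ g.cell) : f ≅ g where
  hom := ⟨l.hom, r.hom, w⟩
  inv := ⟨l.inv, r.inv, by
    rw [← cancel_epi (x.hom ◁ r.hom), ← Category.assoc, ← w, Category.assoc, ← comp_whiskerRight,
      ← Category.assoc, ← Bicategory.whiskerLeft_comp]
    simp⟩
  hom_inv_id := by ext <;> simp
  inv_hom_id := by ext <;> simp

section
variable {x y : LaxArrow C} {f g : x ⟶ y} (l : f.left ≅ g.left) (r : f.right ≅ g.right)
    (w : f.cell ≫ l.hom ▷ y.hom = x.hom ◁ r.hom ≫ g.cell)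
@[simp] theorem mkIso_hom_left : (mkIso l r w).hom.left = l.hom := rfl
@[simp] theorem mkIso_hom_right : (mkIso l r w).hom.right = r.hom := rfl
@[simp] theorem mkIso_inv_left : (mkIso l r w).inv.left = l.inv := rfl
@[simp] theorem mkIso_inv_right : (mkIso l r w).inv.right = r.inv := rfl
end

theorem whiskerLeft_w {x y z : LaxArrow C} (f : x ⟶ y) {g h : y ⟶ z} (η : g ⟶ h) :
    (f ≫ g).cell ≫ (f.left ◁ η.left) ▷ z.hom = x.hom ◁ f.right ◁ η.right ≫ (f ≫ h).cell := by
  have e : f.left ◁ g.cell ≫ f.left ◁ η.left ▷ z.hom =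
      f.left ◁ y.hom ◁ η.right ≫ f.left ◁ h.cell := by
    rw [← Bicategory.whiskerLeft_comp, η.w, Bicategory.whiskerLeft_comp]
  have e' {k} (θ : f.left ≫ h.left ≫ z.hom ⟶ k) := congrArg (· ≫ θ) e
  simp only [Category.assoc] at e'
  simp only [comp_cell, Category.assoc]
  simp only [whisker_assoc, Iso.inv_hom_id_assoc]
  rw [e', ← associator_naturality_right_assoc, ← whisker_exchange_assoc]
  simp

theorem whiskerRight_w {x y z : LaxArrow C} {f g : x ⟶ y} (η : f ⟶ g) (h : y ⟶ z) :
    (f ≫ h).cell ≫ (η.left ▷ h.left) ▷ z.hom = x.hom ◁ η.right ▷ h.right ≫ (g ≫ h).cell := by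
  have e : f.cell ▷ h.right ≫ η.left ▷ y.hom ▷ h.right =
      (x.hom ◁ η.right) ▷ h.right ≫ g.cell ▷ h.right := by
    rw [← comp_whiskerRight, η.w, comp_whiskerRight]
  have e' {k} (θ : (g.left ≫ y.hom) ≫ h.right ⟶ k) := congrArg (· ≫ θ) e
  simp only [Category.assoc] at e'
  simp only [comp_cell, Category.assoc]
  rw [← associator_inv_naturality_left, whisker_exchange_assoc,
    ← associator_naturality_left_assoc, e']
  simp

/-- Left whiskering of cells of the lax arrow `2`-category. -/
def wl {x y z : LaxArrow C} (f : x ⟶ y) {g h : y ⟶ z} (η : g ⟶ h) : f ≫ g ⟶ f ≫ h :=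
  Hom₂.mk (f.left ◁ η.left) (f.right ◁ η.right) (whiskerLeft_w f η)

/-- Right whiskering of cells of the lax arrow `2`-category. -/
def wr {x y z : LaxArrow C} {f g : x ⟶ y} (η : f ⟶ g) (h : y ⟶ z) : f ≫ h ⟶ g ≫ h :=
  Hom₂.mk (η.left ▷ h.left) (η.right ▷ h.right) (whiskerRight_w η h)

section
variable {x y z : LaxArrow C} 
@[simp] theorem wl_left (f : x ⟶ y) {g h : y ⟶ z} (η : g ⟶ h) :
    (wl f η).left = f.left ◁ η.left := rfl
@[simp] theorem wl_right (f : x ⟶ y) {g h : y ⟶ z} (η : g ⟶ h) :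
    (wl f η).right = f.right ◁ η.right := rfl
@[simp] theorem wr_left {f g : x ⟶ y} (η : f ⟶ g) (h : y ⟶ z) :
    (wr η h).left = η.left ▷ h.left := rfl
@[simp] theorem wr_right {f g : x ⟶ y} (η : f ⟶ g) (h : y ⟶ z) :
    (wr η h).right = η.right ▷ h.right := rfl
end

theorem assoc_w {x y z t : LaxArrow C} (f : x ⟶ y) (g : y ⟶ z) (h : z ⟶ t) :
    ((f ≫ g) ≫ h).cell ≫ (α_ f.left g.left h.left).hom ▷ t.hom =
      x.hom ◁ (α_ f.right g.right h.right).hom ≫ (f ≫ g ≫ h).cell := by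
  simp

theorem leftUnitor_w {x y : LaxArrow C} (f : x ⟶ y) :
    (𝟙 x ≫ f).cell ≫ (λ_ f.left).hom ▷ y.hom = x.hom ◁ (λ_ f.right).hom ≫ f.cell := by
  simp

theorem rightUnitor_w {x y : LaxArrow C} (f : x ⟶ y) :
    (f ≫ 𝟙 y).cell ≫ (ρ_ f.left).hom ▷ y.hom = x.hom ◁ (ρ_ f.right).hom ≫ f.cell := by
  simp

/-- The associator of the lax arrow `2`-category. -/
abbrev assocIso {x y z t : LaxArrow C} (f : x ⟶ y) (g : y ⟶ z) (h : z ⟶ t) :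
    (f ≫ g) ≫ h ≅ f ≫ g ≫ h :=
  mkIso (α_ f.left g.left h.left) (α_ f.right g.right h.right) (assoc_w f g h)

/-- The left unitor of the lax arrow `2`-category. -/
abbrev leftIso {x y : LaxArrow C} (f : x ⟶ y) : 𝟙 x ≫ f ≅ f :=
  mkIso (λ_ f.left) (λ_ f.right) (leftUnitor_w f)

/-- The right unitor of the lax arrow `2`-category. -/
abbrev rightIso {x y : LaxArrow C} (f : x ⟶ y) : f ≫ 𝟙 y ≅ f :=
  mkIso (ρ_ f.left) (ρ_ f.right) (rightUnitor_w f)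

/-- The lax arrow `2`-category, with compositions given componentwise and by the pasting of
squares. -/
instance bicategory : Bicategory (LaxArrow C) where
  whiskerLeft f _ _ η := wl f η
  whiskerRight η h := wr η h
  associator f g h := assocIso f g h
  leftUnitor f := leftIso f
  rightUnitor f := rightIso f
  whiskerLeft_id f g := by ext <;> simp
  whiskerLeft_comp f _ _ _ η θ := by ext <;> simp
  id_whiskerLeft η := by ext <;> simp
  comp_whiskerLeft f g _ _ η := by ext <;> simp
  id_whiskerRight f g := by ext <;> simp
  comp_whiskerRight η θ g := by ext <;> simp
  whiskerRight_id η := by ext <;> simp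
  whiskerRight_comp η g h := by ext <;> simp
  whisker_assoc f _ _ η h := by ext <;> simp
  whisker_exchange η θ := by ext <;> simp [whisker_exchange]
  pentagon f g h i := by ext <;> simp
  triangle f g := by ext <;> simp

section
variable {x y : LaxArrow C}

theorem hom_ext {f g : x ⟶ y} (hl : f.left = g.left) (hr : f.right = g.right)
    (hc : f.cell ≫ eqToHom hl ▷ y.hom = x.hom ◁ eqToHom hr ≫ g.cell) : f = g := by
  obtain ⟨fl, fr, fc⟩ := f
  obtain ⟨gl, gr, gc⟩ := g
  dsimp only at hl hr
  subst hl hr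
  congr 1
  simpa using hc

theorem eqToHom_left {f g : x ⟶ y} (h : f = g) :
    (eqToHom h).left = eqToHom (congrArg Hom.left h) := by
  subst h; rfl

theorem eqToHom_right {f g : x ⟶ y} (h : f = g) :
    (eqToHom h).right = eqToHom (congrArg Hom.right h) := by
  subst h; rfl

theorem mkIso_eq {f g : x ⟶ y} (h : f = g) {l : f.left ≅ g.left} {r : f.right ≅ g.right}
    {w : f.cell ≫ l.hom ▷ y.hom = x.hom ◁ r.hom ≫ g.cell}
    (hl : l = eqToIso (congrArg Hom.left h)) (hr : r = eqToIso (congrArg Hom.right h)) :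
    mkIso l r w = eqToIso h := by
  subst hl hr h
  ext <;> rfl

end

instance strict [Strict C] : Strict (LaxArrow C) where
  id_comp f := hom_ext (Strict.id_comp _) (Strict.id_comp _)
    (by simpa [Strict.leftUnitor_eqToIso] using leftUnitor_w f)
  comp_id f := hom_ext (Strict.comp_id _) (Strict.comp_id _)
    (by simpa [Strict.rightUnitor_eqToIso] using rightUnitor_w f)
  assoc f g h := hom_ext (Strict.assoc _ _ _) (Strict.assoc _ _ _)
    (by have := assoc_w f g h; rw [Strict.associator_eqToIso, Strict.associator_eqToIso] at this; exact this)
  leftUnitor_eqToIso f := mkIso_eq _ (Strict.leftUnitor_eqToIso _) (Strict.leftUnitor_eqToIso _)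
  rightUnitor_eqToIso f := mkIso_eq _ (Strict.rightUnitor_eqToIso _) (Strict.rightUnitor_eqToIso _)
  associator_eqToIso f g h :=
    mkIso_eq _ (Strict.associator_eqToIso _ _ _) (Strict.associator_eqToIso _ _ _)

variable (C) in
/-- The projection to the source. -/
def src [Strict C] : StrictPseudofunctor (LaxArrow C) C := StrictPseudofunctor.mk''
  { obj x := x.left
    map f := f.left
    map₂ η := η.left
    map₂_whisker_left f _ _ η := by simp; rfl
    map₂_whisker_right η f := by simp; rfl }

variable (C) in
/-- The projection to the target. -/
def tgt [Strict C] : StrictPseudofunctor (LaxArrow C) C := StrictPseudofunctor.mk''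
  { obj x := x.right
    map f := f.right
    map₂ η := η.right
    map₂_whisker_left f _ _ η := by simp; rfl
    map₂_whisker_right η f := by simp; rfl }

variable (C) in
/-- The universal lax natural transformation. -/
def δ [Strict C] : LaxNat (src C) (tgt C) where
  app x := x.hom
  nat f := f.cell
  nat_nat η := η.w
  nat_id x := by
    change x.hom ◁ 𝟙 (𝟙 x.right) ≫ ((ρ_ x.hom).hom ≫ (λ_ x.hom).inv) =
      (ρ_ x.hom).hom ≫ (λ_ x.hom).inv ≫ 𝟙 (𝟙 x.left) ▷ x.hom
    simp
  nat_comp {x y z} f g := by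
    change x.hom ◁ 𝟙 (f.right ≫ g.right) ≫ (f ≫ g).cell = (α_ x.hom f.right g.right).inv ≫
      f.cell ▷ g.right ≫ (α_ f.left y.hom g.right).hom ≫
      f.left ◁ g.cell ≫ (α_ f.left g.left z.hom).inv ≫ 𝟙 (f.left ≫ g.left) ▷ z.hom
    simp

variable {B : Type u₁} [Bicategory.{w₁, v₁} B] [Strict B] [Strict C]
  {F G : StrictPseudofunctor B C} (φ : LaxNat F G)

/-- The object of the lax arrow `2`-category that is given by a component. -/
abbrev liftObj (a : B) : LaxArrow C := ⟨F.obj a, G.obj a, φ.app a⟩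

/-- The square that is given by a lax naturality cell. -/
abbrev liftMap {a b : B} (f : a ⟶ b) : liftObj φ a ⟶ liftObj φ b :=
  Hom.mk (F.map f) (G.map f) (φ.nat f)

theorem lift_id (a : B) : φ.nat (𝟙 a) ≫ eqToHom (F.map_id a) ▷ φ.app a =
    φ.app a ◁ eqToHom (G.map_id a) ≫ (ρ_ (φ.app a)).hom ≫ (λ_ (φ.app a)).inv := by
  have h := φ.nat_id a
  rw [F.mapId_eq_eqToIso, G.mapId_eq_eqToIso] at h
  rw [← cancel_epi (φ.app a ◁ (eqToIso (G.map_id a)).inv), ← Category.assoc, h,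
    ← Bicategory.whiskerLeft_comp_assoc]
  simp

theorem lift_comp {a b c : B} (f : a ⟶ b) (g : b ⟶ c) :
    φ.nat (f ≫ g) ≫ eqToHom (F.map_comp f g) ▷ φ.app c =
      φ.app a ◁ eqToHom (G.map_comp f g) ≫ (liftMap φ f ≫ liftMap φ g).cell := by
  have h := φ.nat_comp f g
  rw [F.mapComp_eq_eqToIso, G.mapComp_eq_eqToIso] at h
  rw [← cancel_epi (φ.app a ◁ (eqToIso (G.map_comp f g)).inv)]
  refine (Category.assoc _ _ _).symm.trans ((congrArg (· ≫ _) h).trans ?_)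
  have e : φ.app a ◁ (eqToIso (G.map_comp f g)).inv ≫ φ.app a ◁ eqToHom (G.map_comp f g) = 𝟙 _ := by
    rw [← Bicategory.whiskerLeft_comp]; simp
  have e' : (eqToIso (F.map_comp f g)).inv ▷ φ.app c ≫ eqToHom (F.map_comp f g) ▷ φ.app c =
      𝟙 _ := by
    rw [← Bicategory.comp_whiskerRight]; simp
  refine Eq.trans ?_ ((Category.id_comp _).symm.trans
    ((congrArg (· ≫ _) e.symm).trans (Category.assoc _ _ _)))
  simp only [Category.assoc, e']
  rw [Category.comp_id]
  rfl

/-- The `2`-functor that corresponds to a lax natural transformation. -/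
def lift : StrictPseudofunctor B (LaxArrow C) :=
  StrictPseudofunctor.mk''
  { obj a := liftObj φ a
    map f := liftMap φ f
    map₂ η := Hom₂.mk (F.map₂ η) (G.map₂ η) (φ.nat_nat η)
    map₂_id f := hom₂_ext (F.map₂_id f) (G.map₂_id f)
    map₂_comp η θ := hom₂_ext (F.map₂_comp η θ) (G.map₂_comp η θ)
    map_id a := hom_ext (F.map_id a) (G.map_id a) (lift_id φ a)
    map_comp f g := hom_ext (F.map_comp f g) (G.map_comp f g) (lift_comp φ f g)
    map₂_whisker_left f _ _ η := by
      refine hom₂_ext ?_ ?_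
      · rw [comp₂_left, comp₂_left, eqToHom_left, eqToHom_left]
        exact (F.map₂_whisker_left f η).trans (by simp [F.mapComp_eq_eqToIso]; rfl)
      · rw [comp₂_right, comp₂_right, eqToHom_right, eqToHom_right]
        exact (G.map₂_whisker_left f η).trans (by simp [G.mapComp_eq_eqToIso]; rfl)
    map₂_whisker_right η f := by
      refine hom₂_ext ?_ ?_
      · rw [comp₂_left, comp₂_left, eqToHom_left, eqToHom_left]
        exact (F.map₂_whisker_right η f).trans (by simp [F.mapComp_eq_eqToIso]; rfl)
      · rw [comp₂_right, comp₂_right, eqToHom_right, eqToHom_right]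
        exact (G.map₂_whisker_right η f).trans (by simp [G.mapComp_eq_eqToIso]; rfl) }

theorem obj_ext {x y : LaxArrow C} (hl : x.left = y.left) (hr : x.right = y.right)
    (h : x.hom ≍ y.hom) : x = y := by
  obtain ⟨xl, xr, xh⟩ := x
  obtain ⟨yl, yr, yh⟩ := y
  dsimp only at hl hr h
  subst hl hr h
  rfl

theorem hom_heq {x y x' y' : LaxArrow C} {f : x ⟶ y} {f' : x' ⟶ y'} (hx : x = x') (hy : y = y')
    (hl : f.left ≍ f'.left) (hr : f.right ≍ f'.right) (h : f.cell ≍ f'.cell) : f ≍ f' := by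
  subst hx hy
  obtain ⟨fl, fr, fh⟩ := f
  obtain ⟨gl, gr, gh⟩ := f'
  dsimp only at hl hr h
  subst hl hr h
  rfl

theorem hom₂_heq {x y x' y' : LaxArrow C} {f g : x ⟶ y} {f' g' : x' ⟶ y'} {η : f ⟶ g}
    {η' : f' ⟶ g'} (hx : x = x') (hy : y = y') (hf : f ≍ f') (hg : g ≍ g')
    (hl : η.left ≍ η'.left) (hr : η.right ≍ η'.right) : η ≍ η' := by
  subst hx hy hf hg
  exact heq_of_eq (hom₂_ext (eq_of_heq hl) (eq_of_heq hr))

end LaxArrow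

theorem obj_congr {B : Type u₁} [Bicategory.{w₁, v₁} B] {C : Type u₂} [Bicategory.{w₂, v₂} C]
    {F G : StrictPseudofunctor B C} (h : F = G) (a : B) : F.obj a = G.obj a := by rw [h]

theorem map_congr {B : Type u₁} [Bicategory.{w₁, v₁} B] {C : Type u₂} [Bicategory.{w₂, v₂} C]
    {F G : StrictPseudofunctor B C} (h : F = G) {a b : B} (f : a ⟶ b) : F.map f ≍ G.map f := by
  rw [h]

theorem map₂_congr {B : Type u₁} [Bicategory.{w₁, v₁} B] {C : Type u₂} [Bicategory.{w₂, v₂} C]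
    {F G : StrictPseudofunctor B C} (h : F = G) {a b : B} {f g : a ⟶ b} (η : f ⟶ g) :
    F.map₂ η ≍ G.map₂ η := by
  rw [h]

theorem app_congr {B : Type u₁} [Bicategory.{w₁, v₁} B] {C : Type u₂} [Bicategory.{w₂, v₂} C]
    {F G F' G' : StrictPseudofunctor B C} {φ : LaxNat F G} {ψ : LaxNat F' G'} (h : F = F')
    (h' : G = G') (e : φ ≍ ψ) (a : B) : φ.app a ≍ ψ.app a := by
  subst h h' e; rfl

theorem nat_congr {B : Type u₁} [Bicategory.{w₁, v₁} B] {C : Type u₂} [Bicategory.{w₂, v₂} C]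
    {F G F' G' : StrictPseudofunctor B C} {φ : LaxNat F G} {ψ : LaxNat F' G'} (h : F = F')
    (h' : G = G') (e : φ ≍ ψ) {a b : B} (f : a ⟶ b) : φ.nat f ≍ ψ.nat f := by
  subst h h' e; rfl

theorem LaxArrow.functor_ext {B : Type u₁} [Bicategory.{w₁, v₁} B] {C : Type u₂}
    [Bicategory.{w₂, v₂} C] [Strict C] {K L : StrictPseudofunctor B (LaxArrow C)}
    (hs : K.comp (src C) = L.comp (src C)) (ht : K.comp (tgt C) = L.comp (tgt C))
    (h : LaxNat.preW K (δ C) ≍ LaxNat.preW L (δ C)) : K = L := by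
  have h₀ (a : B) : K.obj a = L.obj a :=
    LaxArrow.obj_ext (obj_congr hs a) (obj_congr ht a) (app_congr hs ht h a)
  have h₁ {a b : B} (f : a ⟶ b) : K.map f ≍ L.map f :=
    LaxArrow.hom_heq (h₀ a) (h₀ b) (map_congr hs f) (map_congr ht f) (nat_congr hs ht h f)
  exact ext_of_heq h₀ h₁ fun {a b f g} η =>
    LaxArrow.hom₂_heq (h₀ a) (h₀ b) (h₁ f) (h₁ g) (map₂_congr hs η) (map₂_congr ht η)

/-- The lax arrow `2`-category is a `2`-cotensor. -/
def TwoCat.cotensor (A : TwoCat.{u}) : TwoCotensor A where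
  obj := ⟨LaxArrow A⟩
  src := LaxArrow.src A
  tgt := LaxArrow.tgt A
  δ := LaxArrow.δ A
  lift φ := LaxArrow.lift φ
  lift_src φ := ext_of_heq (fun _ => rfl) (fun _ => HEq.rfl) (fun _ => HEq.rfl)
  lift_tgt φ := ext_of_heq (fun _ => rfl) (fun _ => HEq.rfl) (fun _ => HEq.rfl)
  lift_δ φ := LaxNat.heq_of_heq
    (ext_of_heq (fun _ => rfl) (fun _ => HEq.rfl) (fun _ => HEq.rfl))
    (ext_of_heq (fun _ => rfl) (fun _ => HEq.rfl) (fun _ => HEq.rfl))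
    (fun _ => HEq.rfl) (fun _ => HEq.rfl)
  hom_ext hs ht h := LaxArrow.functor_ext hs ht h

end laxArrow

section strictHEq
variable {B : Type u₁} [Bicategory.{w₁, v₁} B] {C : Type u₂} [Bicategory.{w₂, v₂} C]
  (F : StrictPseudofunctor B C)

theorem eqToHom_heq {a b a' b' : C} {f g : a ⟶ b} {f' g' : a' ⟶ b'} (h : f = g) (h' : f' = g')
    (ha : a = a') (hb : b = b') (hf : f ≍ f') : eqToHom h ≍ eqToHom h' := by
  subst ha hb h h' hf; rfl

theorem conj_heq {a b : C} {f g f' g' : a ⟶ b} (hf : f = f') (hg : g' = g) (η : f' ⟶ g') :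
    (eqToHom hf ≫ η ≫ eqToHom hg) ≍ η := by
  subst hf hg; simp

theorem map₂_whiskerLeft_heq {a b c : B} (f : a ⟶ b) {g h : b ⟶ c} (η : g ⟶ h) :
    F.map₂ (f ◁ η) ≍ F.map f ◁ F.map₂ η := by
  rw [F.map₂_whisker_left, F.mapComp_eq_eqToIso, F.mapComp_eq_eqToIso]
  exact conj_heq (F.map_comp f g) (F.map_comp f h).symm _

theorem map₂_whiskerRight_heq {a b c : B} {f g : a ⟶ b} (η : f ⟶ g) (h : b ⟶ c) :
    F.map₂ (η ▷ h) ≍ F.map₂ η ▷ F.map h := by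
  rw [F.map₂_whisker_right, F.mapComp_eq_eqToIso, F.mapComp_eq_eqToIso]
  exact conj_heq (F.map_comp f h) (F.map_comp g h).symm _

theorem mapComp_conj_heq {a b b' c : B} {f : a ⟶ b} {g : b ⟶ c} {f' : a ⟶ b'} {g' : b' ⟶ c}
    (η : F.map (f ≫ g) ⟶ F.map (f' ≫ g')) :
    ((F.mapComp f g).inv ≫ η ≫ (F.mapComp f' g').hom) ≍ η := by
  rw [F.mapComp_eq_eqToIso, F.mapComp_eq_eqToIso]
  exact conj_heq (F.map_comp _ _).symm (F.map_comp _ _) _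

theorem strip_id {a b c d : C} {φ : a ⟶ b} {ψ : c ⟶ d} {f g : b ⟶ d} {k l : a ⟶ c} (m : f ⟶ g)
    (n : φ ≫ g ⟶ k ≫ ψ) (m' : l ⟶ k) {y : a ⟶ d} {x₁ : φ ≫ f ⟶ y} {x₂ : y ⟶ l ≫ ψ}
    (h : φ ◁ (𝟙 f ≫ m) ≫ n = x₁ ≫ x₂ ≫ (𝟙 l ≫ m') ▷ ψ) :
    φ ◁ m ≫ n = x₁ ≫ x₂ ≫ m' ▷ ψ := by
  simpa using h

theorem strip_comp {a b c d : C} {φ : a ⟶ b} {ψ : c ⟶ d} {f g : b ⟶ d} {k l : a ⟶ c} (m : f ⟶ g)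
    (n : φ ≫ g ⟶ k ≫ ψ) (m' : l ⟶ k) {y₁ y₂ y₃ y₄ : a ⟶ d} {x₁ : φ ≫ f ⟶ y₁} {x₂ : y₁ ⟶ y₂}
    {x₃ : y₂ ⟶ y₃} {x₄ : y₃ ⟶ y₄} {x₅ : y₄ ⟶ l ≫ ψ}
    (h : φ ◁ (𝟙 f ≫ m) ≫ n = x₁ ≫ x₂ ≫ x₃ ≫ x₄ ≫ x₅ ≫ (𝟙 l ≫ m') ▷ ψ) :
    φ ◁ m ≫ n = x₁ ≫ x₂ ≫ x₃ ≫ x₄ ≫ x₅ ≫ m' ▷ ψ := by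
  simpa using h

end strictHEq

section pullback
variable {X : Type u₁} [Bicategory.{w₁, v₁} X] {Y : Type u₂} [Bicategory.{w₂, v₂} Y]
  {Z : Type u₃} [Bicategory.{w₃, v₃} Z]

/-- The objects of the pullback of two `2`-functors. -/
structure Pullback (F : StrictPseudofunctor X Z) (G : StrictPseudofunctor Y Z) where
  fst : X
  snd : Y
  w : F.obj fst = G.obj snd

namespace Pullback
variable {F : StrictPseudofunctor X Z} {G : StrictPseudofunctor Y Z}

/-- The morphisms of the pullback of two `2`-functors. -/
structure Hom (x y : Pullback F G) where
  fst : x.fst ⟶ y.fst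
  snd : x.snd ⟶ y.snd
  w : F.map fst ≍ G.map snd

instance : CategoryStruct (Pullback F G) where
  Hom x y := Hom x y
  id x := ⟨𝟙 _, 𝟙 _, by rw [F.map_id, G.map_id, x.w]⟩
  comp {x y z} f g := ⟨f.fst ≫ g.fst, f.snd ≫ g.snd, by
    rw [F.map_comp, G.map_comp]; exact comp₁_heq x.w y.w z.w f.w g.w⟩

/-- The cells of the pullback of two `2`-functors. -/
@[ext]
structure Hom₂ {x y : Pullback F G} (f g : x ⟶ y) where
  fst : f.fst ⟶ g.fst
  snd : f.snd ⟶ g.snd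
  w : F.map₂ fst ≍ G.map₂ snd

instance (x y : Pullback F G) : Category (x ⟶ y) where
  Hom f g := Hom₂ f g
  id f := ⟨𝟙 _, 𝟙 _, by rw [F.map₂_id, G.map₂_id]; exact id₂_heq x.w y.w f.w⟩
  comp {f g h} η θ := ⟨η.fst ≫ θ.fst, η.snd ≫ θ.snd, by
    rw [F.map₂_comp, G.map₂_comp]; exact comp₂_heq x.w y.w f.w g.w h.w η.w θ.w⟩

@[ext]
theorem hom₂_ext {x y : Pullback F G} {f g : x ⟶ y} {η θ : f ⟶ g} (h : η.fst = θ.fst)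
    (h' : η.snd = θ.snd) : η = θ := Hom₂.ext h h'

section
variable {x y z : Pullback F G} {f g h : x ⟶ y} {k : y ⟶ z}
@[simp] theorem id_fst : (𝟙 x : x ⟶ x).fst = 𝟙 x.fst := rfl
@[simp] theorem id_snd : (𝟙 x : x ⟶ x).snd = 𝟙 x.snd := rfl
@[simp] theorem comp_fst : (f ≫ k).fst = f.fst ≫ k.fst := rfl
@[simp] theorem comp_snd : (f ≫ k).snd = f.snd ≫ k.snd := rfl
@[simp] theorem id₂_fst : (𝟙 f : f ⟶ f).fst = 𝟙 f.fst := rfl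
@[simp] theorem id₂_snd : (𝟙 f : f ⟶ f).snd = 𝟙 f.snd := rfl
@[simp] theorem comp₂_fst (η : f ⟶ g) (θ : g ⟶ h) : (η ≫ θ).fst = η.fst ≫ θ.fst := rfl
@[simp] theorem comp₂_snd (η : f ⟶ g) (θ : g ⟶ h) : (η ≫ θ).snd = η.snd ≫ θ.snd := rfl
end

/-- An invertible cell from invertible components. -/
def mkIso {x y : Pullback F G} {f g : x ⟶ y} (l : f.fst ≅ g.fst) (r : f.snd ≅ g.snd)
    (w : F.map₂ l.hom ≍ G.map₂ r.hom) (w' : F.map₂ l.inv ≍ G.map₂ r.inv) : f ≅ g where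
  hom := ⟨l.hom, r.hom, w⟩
  inv := ⟨l.inv, r.inv, w'⟩
  hom_inv_id := by ext <;> simp
  inv_hom_id := by ext <;> simp

section
variable {x y : Pullback F G} {f g : x ⟶ y} (l : f.fst ≅ g.fst) (r : f.snd ≅ g.snd)
    (w : F.map₂ l.hom ≍ G.map₂ r.hom) (w' : F.map₂ l.inv ≍ G.map₂ r.inv)
@[simp] theorem mkIso_hom_fst : (mkIso l r w w').hom.fst = l.hom := rfl
@[simp] theorem mkIso_hom_snd : (mkIso l r w w').hom.snd = r.hom := rfl
@[simp] theorem mkIso_inv_fst : (mkIso l r w w').inv.fst = l.inv := rfl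
@[simp] theorem mkIso_inv_snd : (mkIso l r w w').inv.snd = r.inv := rfl
end

/-- Left whiskering of cells of the pullback. -/
def wl {x y z : Pullback F G} (f : x ⟶ y) {g h : y ⟶ z} (η : g ⟶ h) : f ≫ g ⟶ f ≫ h :=
  Hom₂.mk (f.fst ◁ η.fst) (f.snd ◁ η.snd)
    ((map₂_whiskerLeft_heq F _ _).trans ((whiskerLeft_heq x.w y.w z.w f.w g.w h.w η.w).trans
      (map₂_whiskerLeft_heq G _ _).symm))

/-- Right whiskering of cells of the pullback. -/
def wr {x y z : Pullback F G} {f g : x ⟶ y} (η : f ⟶ g) (h : y ⟶ z) : f ≫ h ⟶ g ≫ h :=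
  Hom₂.mk (η.fst ▷ h.fst) (η.snd ▷ h.snd)
    ((map₂_whiskerRight_heq F _ _).trans ((whiskerRight_heq x.w y.w z.w f.w g.w h.w η.w).trans
      (map₂_whiskerRight_heq G _ _).symm))

section
variable {x y z : Pullback F G}
@[simp] theorem wl_fst (f : x ⟶ y) {g h : y ⟶ z} (η : g ⟶ h) :
    (wl f η).fst = f.fst ◁ η.fst := rfl
@[simp] theorem wl_snd (f : x ⟶ y) {g h : y ⟶ z} (η : g ⟶ h) :
    (wl f η).snd = f.snd ◁ η.snd := rfl
@[simp] theorem wr_fst {f g : x ⟶ y} (η : f ⟶ g) (h : y ⟶ z) :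
    (wr η h).fst = η.fst ▷ h.fst := rfl
@[simp] theorem wr_snd {f g : x ⟶ y} (η : f ⟶ g) (h : y ⟶ z) :
    (wr η h).snd = η.snd ▷ h.snd := rfl
end

variable [Strict X] [Strict Y]

theorem map₂_eqToHom_heq {x y : Pullback F G} {f g : x ⟶ y} (h : f.fst = g.fst)
    (h' : f.snd = g.snd) : F.map₂ (eqToHom h) ≍ G.map₂ (eqToHom h') := by
  rw [PrelaxFunctor.map₂_eqToHom, PrelaxFunctor.map₂_eqToHom]
  exact eqToHom_heq _ _ x.w y.w f.w

/-- The associator of the pullback. -/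
abbrev assocIso {x y z t : Pullback F G} (f : x ⟶ y) (g : y ⟶ z) (h : z ⟶ t) :
    (f ≫ g) ≫ h ≅ f ≫ g ≫ h :=
  mkIso (α_ f.fst g.fst h.fst) (α_ f.snd g.snd h.snd)
    (by rw [Strict.associator_eqToIso, Strict.associator_eqToIso]
        exact map₂_eqToHom_heq (f := (f ≫ g) ≫ h) (g := f ≫ g ≫ h)
          (Strict.assoc _ _ _) (Strict.assoc _ _ _))
    (by rw [Strict.associator_eqToIso, Strict.associator_eqToIso]
        exact map₂_eqToHom_heq (g := (f ≫ g) ≫ h) (f := f ≫ g ≫ h)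
          (Strict.assoc _ _ _).symm (Strict.assoc _ _ _).symm)

/-- The left unitor of the pullback. -/
abbrev leftIso {x y : Pullback F G} (f : x ⟶ y) : 𝟙 x ≫ f ≅ f :=
  mkIso (λ_ f.fst) (λ_ f.snd)
    (by rw [Strict.leftUnitor_eqToIso, Strict.leftUnitor_eqToIso]
        exact map₂_eqToHom_heq (f := 𝟙 x ≫ f) (g := f)
          (Strict.id_comp _) (Strict.id_comp _))
    (by rw [Strict.leftUnitor_eqToIso, Strict.leftUnitor_eqToIso]
        exact map₂_eqToHom_heq (f := f) (g := 𝟙 x ≫ f)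
          (Strict.id_comp _).symm (Strict.id_comp _).symm)

/-- The right unitor of the pullback. -/
abbrev rightIso {x y : Pullback F G} (f : x ⟶ y) : f ≫ 𝟙 y ≅ f :=
  mkIso (ρ_ f.fst) (ρ_ f.snd)
    (by rw [Strict.rightUnitor_eqToIso, Strict.rightUnitor_eqToIso]
        exact map₂_eqToHom_heq (f := f ≫ 𝟙 y) (g := f)
          (Strict.comp_id _) (Strict.comp_id _))
    (by rw [Strict.rightUnitor_eqToIso, Strict.rightUnitor_eqToIso]
        exact map₂_eqToHom_heq (f := f) (g := f ≫ 𝟙 y)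
          (Strict.comp_id _).symm (Strict.comp_id _).symm)

/-- The pullback of two `2`-functors, with compositions given componentwise. -/
instance bicategory : Bicategory (Pullback F G) where
  whiskerLeft f _ _ η := wl f η
  whiskerRight η h := wr η h
  associator f g h := assocIso f g h
  leftUnitor f := leftIso f
  rightUnitor f := rightIso f
  whiskerLeft_id f g := by ext <;> simp
  whiskerLeft_comp f _ _ _ η θ := by ext <;> simp
  id_whiskerLeft η := by ext <;> simp
  comp_whiskerLeft f g _ _ η := by ext <;> simp
  id_whiskerRight f g := by ext <;> simp
  comp_whiskerRight η θ g := by ext <;> simp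
  whiskerRight_id η := by ext <;> simp
  whiskerRight_comp η g h := by ext <;> simp
  whisker_assoc f _ _ η h := by ext <;> simp
  whisker_exchange η θ := by ext <;> simp [whisker_exchange]
  pentagon f g h i := by ext <;> simp
  triangle f g := by ext <;> simp

section
variable {x y : Pullback F G}

theorem hom_ext {f g : x ⟶ y} (h : f.fst = g.fst) (h' : f.snd = g.snd) : f = g := by
  obtain ⟨fl, fr, fw⟩ := f
  obtain ⟨gl, gr, gw⟩ := g
  dsimp only at h h'
  subst h h'
  rfl

theorem eqToHom_fst {f g : x ⟶ y} (h : f = g) :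
    (eqToHom h).fst = eqToHom (congrArg Hom.fst h) := by
  subst h; rfl

theorem eqToHom_snd {f g : x ⟶ y} (h : f = g) :
    (eqToHom h).snd = eqToHom (congrArg Hom.snd h) := by
  subst h; rfl

theorem mkIso_eq {f g : x ⟶ y} (h : f = g) {l : f.fst ≅ g.fst} {r : f.snd ≅ g.snd}
    {w : F.map₂ l.hom ≍ G.map₂ r.hom} {w' : F.map₂ l.inv ≍ G.map₂ r.inv}
    (hl : l = eqToIso (congrArg Hom.fst h)) (hr : r = eqToIso (congrArg Hom.snd h)) :
    mkIso l r w w' = eqToIso h := by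
  subst hl hr h
  ext <;> rfl

end

instance strict : Strict (Pullback F G) where
  id_comp f := hom_ext (Strict.id_comp _) (Strict.id_comp _)
  comp_id f := hom_ext (Strict.comp_id _) (Strict.comp_id _)
  assoc f g h := hom_ext (Strict.assoc _ _ _) (Strict.assoc _ _ _)
  leftUnitor_eqToIso f := mkIso_eq _ (Strict.leftUnitor_eqToIso _) (Strict.leftUnitor_eqToIso _)
  rightUnitor_eqToIso f := mkIso_eq _ (Strict.rightUnitor_eqToIso _) (Strict.rightUnitor_eqToIso _)
  associator_eqToIso f g h :=
    mkIso_eq _ (Strict.associator_eqToIso _ _ _) (Strict.associator_eqToIso _ _ _)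

variable (F G) in
/-- The first projection. -/
def p₁ : StrictPseudofunctor (Pullback F G) X := StrictPseudofunctor.mk''
  { obj x := x.fst
    map f := f.fst
    map₂ η := η.fst
    map₂_whisker_left f _ _ η := by simp; rfl
    map₂_whisker_right η f := by simp; rfl }

variable (F G) in
/-- The second projection. -/
def p₂ : StrictPseudofunctor (Pullback F G) Y := StrictPseudofunctor.mk''
  { obj x := x.snd
    map f := f.snd
    map₂ η := η.snd
    map₂_whisker_left f _ _ η := by simp; rfl
    map₂_whisker_right η f := by simp; rfl }

theorem condition : (p₁ F G).comp F = (p₂ F G).comp G :=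
  ext_of_heq (fun x => x.w) (fun f => f.w) (fun η => η.w)

variable {W : Type u} [Bicategory.{w, v} W] [Strict W]

/-- The `2`-functor into the pullback that is given by a commutative square. -/
def lift (H : StrictPseudofunctor W X) (K : StrictPseudofunctor W Y) (h : H.comp F = K.comp G) :
    StrictPseudofunctor W (Pullback F G) := StrictPseudofunctor.mk''
  { obj a := ⟨H.obj a, K.obj a, obj_congr h a⟩
    map f := Hom.mk (H.map f) (K.map f) (map_congr h f)
    map₂ η := Hom₂.mk (H.map₂ η) (K.map₂ η) (map₂_congr h η)
    map₂_id f := hom₂_ext (H.map₂_id f) (K.map₂_id f)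
    map₂_comp η θ := hom₂_ext (H.map₂_comp η θ) (K.map₂_comp η θ)
    map_id a := hom_ext (H.map_id a) (K.map_id a)
    map_comp f g := hom_ext (H.map_comp f g) (K.map_comp f g)
    map₂_whisker_left f _ _ η := by
      refine hom₂_ext ?_ ?_
      · rw [comp₂_fst, comp₂_fst, eqToHom_fst, eqToHom_fst]
        exact (H.map₂_whisker_left f η).trans (by simp [H.mapComp_eq_eqToIso]; rfl)
      · rw [comp₂_snd, comp₂_snd, eqToHom_snd, eqToHom_snd]
        exact (K.map₂_whisker_left f η).trans (by simp [K.mapComp_eq_eqToIso]; rfl)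
    map₂_whisker_right η f := by
      refine hom₂_ext ?_ ?_
      · rw [comp₂_fst, comp₂_fst, eqToHom_fst, eqToHom_fst]
        exact (H.map₂_whisker_right η f).trans (by simp [H.mapComp_eq_eqToIso]; rfl)
      · rw [comp₂_snd, comp₂_snd, eqToHom_snd, eqToHom_snd]
        exact (K.map₂_whisker_right η f).trans (by simp [K.mapComp_eq_eqToIso]; rfl) }

theorem obj_ext {x y : Pullback F G} (h : x.fst = y.fst) (h' : x.snd = y.snd) : x = y := by
  obtain ⟨xl, xr, xh⟩ := x
  obtain ⟨yl, yr, yh⟩ := y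
  dsimp only at h h'
  subst h h'
  rfl

theorem hom_heq {x y x' y' : Pullback F G} {f : x ⟶ y} {f' : x' ⟶ y'} (hx : x = x') (hy : y = y')
    (h : f.fst ≍ f'.fst) (h' : f.snd ≍ f'.snd) : f ≍ f' := by
  subst hx hy
  exact heq_of_eq (hom_ext (eq_of_heq h) (eq_of_heq h'))

theorem hom₂_heq {x y x' y' : Pullback F G} {f g : x ⟶ y} {f' g' : x' ⟶ y'} {η : f ⟶ g}
    {η' : f' ⟶ g'} (hx : x = x') (hy : y = y') (hf : f ≍ f') (hg : g ≍ g')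
    (hl : η.fst ≍ η'.fst) (hr : η.snd ≍ η'.snd) : η ≍ η' := by
  subst hx hy hf hg
  exact heq_of_eq (hom₂_ext (eq_of_heq hl) (eq_of_heq hr))

theorem functor_ext {K L : StrictPseudofunctor W (Pullback F G)}
    (h : K.comp (p₁ F G) = L.comp (p₁ F G)) (h' : K.comp (p₂ F G) = L.comp (p₂ F G)) : K = L := by
  have h₀ (a : W) : K.obj a = L.obj a := obj_ext (obj_congr h a) (obj_congr h' a)
  have h₁ {a b : W} (f : a ⟶ b) : K.map f ≍ L.map f :=
    hom_heq (h₀ a) (h₀ b) (map_congr h f) (map_congr h' f)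
  exact ext_of_heq h₀ h₁ fun {a b f g} η =>
    hom₂_heq (h₀ a) (h₀ b) (h₁ f) (h₁ g) (map₂_congr h η) (map₂_congr h' η)

section cells
variable {K L : StrictPseudofunctor W (Pullback F G)}
  (φ : LaxNat (K.comp (p₁ F G)) (L.comp (p₁ F G)))
  (ψ : LaxNat (K.comp (p₂ F G)) (L.comp (p₂ F G)))

theorem comp_condition (K : StrictPseudofunctor W (Pullback F G)) :
    (K.comp (p₁ F G)).comp F = (K.comp (p₂ F G)).comp G :=
  ext_of_heq (fun x => (K.obj x).w) (fun f => (K.map f).w) (fun η => (K.map₂ η).w)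

theorem liftCell_app (h : LaxNat.postW φ F ≍ LaxNat.postW ψ G) (a : W) : F.map (φ.app a) ≍ G.map (ψ.app a) :=
  app_congr (comp_condition K) (comp_condition L) h a

theorem liftCell_nat (h : LaxNat.postW φ F ≍ LaxNat.postW ψ G) {a b : W} (f : a ⟶ b) : F.map₂ (φ.nat f) ≍ G.map₂ (ψ.nat f) := by
  have e := nat_congr (comp_condition K) (comp_condition L) h f
  change (F.mapComp (φ.app a) (L.map f).fst).inv ≫ F.map₂ (φ.nat f) ≫
      (F.mapComp (K.map f).fst (φ.app b)).hom ≍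
    (G.mapComp (ψ.app a) (L.map f).snd).inv ≫ G.map₂ (ψ.nat f) ≫
      (G.mapComp (K.map f).snd (ψ.app b)).hom at e
  exact (mapComp_conj_heq F _).symm.trans (e.trans (mapComp_conj_heq G _))

/-- The lax natural transformation into the pullback that is given by compatible components. -/
def liftCell (h : LaxNat.postW φ F ≍ LaxNat.postW ψ G) : LaxNat K L where
  app a := Hom.mk (φ.app a) (ψ.app a) (liftCell_app φ ψ h a)
  nat f := Hom₂.mk (φ.nat f) (ψ.nat f) (liftCell_nat φ ψ h f)
  nat_nat η := hom₂_ext (φ.nat_nat η) (ψ.nat_nat η)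
  nat_id a := hom₂_ext
    (strip_id (φ := φ.app a) (ψ := φ.app a) (L.mapId a).inv.fst (φ.nat (𝟙 a))
      (K.mapId a).inv.fst (φ.nat_id a))
    (strip_id (φ := ψ.app a) (ψ := ψ.app a) (L.mapId a).inv.snd (ψ.nat (𝟙 a))
      (K.mapId a).inv.snd (ψ.nat_id a))
  nat_comp {a b c} f g := hom₂_ext
    (strip_comp (φ := φ.app a) (ψ := φ.app c) (L.mapComp f g).inv.fst (φ.nat (f ≫ g))
      (K.mapComp f g).inv.fst (φ.nat_comp f g))
    (strip_comp (φ := ψ.app a) (ψ := ψ.app c) (L.mapComp f g).inv.snd (ψ.nat (f ≫ g))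
      (K.mapComp f g).inv.snd (ψ.nat_comp f g))

theorem postW_p₁_nat (χ : LaxNat K L) {a b : W} (f : a ⟶ b) :
    (LaxNat.postW χ (p₁ F G)).nat f = (χ.nat f).fst := by
  change 𝟙 _ ≫ (χ.nat f).fst ≫ 𝟙 _ = _
  rw [Category.id_comp, Category.comp_id]

theorem postW_p₂_nat (χ : LaxNat K L) {a b : W} (f : a ⟶ b) :
    (LaxNat.postW χ (p₂ F G)).nat f = (χ.nat f).snd := by
  change 𝟙 _ ≫ (χ.nat f).snd ≫ 𝟙 _ = _
  rw [Category.id_comp, Category.comp_id]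

theorem existsUnique_cell (h : LaxNat.postW φ F ≍ LaxNat.postW ψ G) :
    ∃! χ : LaxNat K L, LaxNat.postW χ (p₁ F G) = φ ∧ LaxNat.postW χ (p₂ F G) = ψ := by
  refine ⟨liftCell φ ψ h, ⟨?_, ?_⟩, ?_⟩
  · exact eq_of_heq (LaxNat.heq_of_heq rfl rfl (fun a => HEq.rfl)
      fun f => heq_of_eq (postW_p₁_nat _ f))
  · exact eq_of_heq (LaxNat.heq_of_heq rfl rfl (fun a => HEq.rfl)
      fun f => heq_of_eq (postW_p₂_nat _ f))
  · rintro χ ⟨rfl, rfl⟩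
    refine eq_of_heq (LaxNat.heq_of_heq rfl rfl (fun a => HEq.rfl) fun f => heq_of_eq ?_)
    exact hom₂_ext (postW_p₁_nat χ f).symm (postW_p₂_nat χ f).symm

end cells

end Pullback

/-- The pullback of two `2`-functors is a pullback in the underlying category. -/
def TwoCat.chosenPullback {X Y Z : TwoCat.{u}} (F : X ⟶ Z) (G : Y ⟶ Z) :
    Limits.ChosenPullback F G where
  pullback := ⟨Pullback F G⟩
  p₁ := Pullback.p₁ F G
  p₂ := Pullback.p₂ F G
  condition := Pullback.condition
  isLimit := Limits.PullbackCone.IsLimit.mk _ (fun s => Pullback.lift s.fst s.snd s.condition)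
    (fun s => ext_of_heq (fun _ => rfl) (fun _ => HEq.rfl) (fun _ => HEq.rfl))
    (fun s => ext_of_heq (fun _ => rfl) (fun _ => HEq.rfl) (fun _ => HEq.rfl))
    (fun s m h h' => Pullback.functor_ext
      (h.trans (ext_of_heq (fun _ => rfl) (fun _ => HEq.rfl) (fun _ => HEq.rfl)))
      (h'.trans (ext_of_heq (fun _ => rfl) (fun _ => HEq.rfl) (fun _ => HEq.rfl))))

/-- The pullback of two `2`-functors is a conical pullback. -/
def TwoCat.conicalPullback {X Y Z : TwoCat.{u}} (F : X ⟶ Z) (G : Y ⟶ Z) :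
    ConicalPullback F G where
  toChosenPullback := TwoCat.chosenPullback F G
  existsUnique_cell k l φ ψ h := Pullback.existsUnique_cell φ ψ h

instance : SpecifiedLimits TwoCat.{u} where
  pullback F G := TwoCat.conicalPullback F G
  cotensor A := TwoCat.cotensor A

end pullback

section cleavage
variable {J : Type u₁} [Bicategory.{w₁, v₁} J] {B : Type u₂} [Bicategory.{w₂, v₂} B]
  (q : StrictPseudofunctor J B)

/-- A morphism `f` is opcartesian with respect to the `2`-functor `q`: factorisations of morphisms
and of cells through `f` are created by `q`. -/
structure IsOpcartesian {i k : J} (f : i ⟶ k) : Prop where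
  existsUnique_hom {j : J} (s : i ⟶ j) (v : q.obj k ⟶ q.obj j) : q.map s = q.map f ≫ v →
    ∃! t : k ⟶ j, q.map t = v ∧ f ≫ t = s
  existsUnique_cell {j : J} {t t' : k ⟶ j} (σ : f ≫ t ⟶ f ≫ t') (β : q.map t ⟶ q.map t') :
    q.map₂ σ = eqToHom (q.map_comp f t) ≫ q.map f ◁ β ≫ eqToHom (q.map_comp f t').symm →
    ∃! τ : t ⟶ t', q.map₂ τ = β ∧ f ◁ τ = σ

/-- A morphism `f` is cartesian with respect to the `2`-functor `q`. -/
structure IsCartesian {k i : J} (f : k ⟶ i) : Prop where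
  existsUnique_hom {j : J} (s : j ⟶ i) (v : q.obj j ⟶ q.obj k) : q.map s = v ≫ q.map f →
    ∃! t : j ⟶ k, q.map t = v ∧ t ≫ f = s
  existsUnique_cell {j : J} {t t' : j ⟶ k} (σ : t ≫ f ⟶ t' ≫ f) (β : q.map t ⟶ q.map t') :
    q.map₂ σ = eqToHom (q.map_comp t f) ≫ β ▷ q.map f ≫ eqToHom (q.map_comp t' f).symm →
    ∃! τ : t ⟶ t', q.map₂ τ = β ∧ τ ▷ f = σ

/-- A cell `τ` is cartesian with respect to the `2`-functor `q`. -/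
def IsCartesianCell {i j : J} {t s : i ⟶ j} (τ : t ⟶ s) : Prop :=
  ∀ {r : i ⟶ j} (σ : r ⟶ s) (α : q.map r ⟶ q.map t), q.map₂ σ = α ≫ q.map₂ τ →
    ∃! ω : r ⟶ t, q.map₂ ω = α ∧ ω ≫ τ = σ

/-- A cell `τ` is opcartesian with respect to the `2`-functor `q`. -/
def IsOpcartesianCell {i j : J} {s t : i ⟶ j} (τ : s ⟶ t) : Prop :=
  ∀ {r : i ⟶ j} (σ : s ⟶ r) (α : q.map t ⟶ q.map r), q.map₂ σ = q.map₂ τ ≫ α →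
    ∃! ω : t ⟶ r, q.map₂ ω = α ∧ τ ≫ ω = σ

/-- A cleavage for the `2`-functor `q : J ⟶ B`, making it into a split op-`2`-fibration. It supplies
opcartesian lifts `lift u : i ⟶ push u` of morphisms `u : q i ⟶ b` and cartesian lifts
`cellLift s β : pull s β ⟶ s` of cells `β : u ⟶ q s`. -/
structure OpCleavage where
  push {i : J} {b : B} (u : q.obj i ⟶ b) : J
  lift {i : J} {b : B} (u : q.obj i ⟶ b) : i ⟶ push u
  obj_push {i : J} {b : B} (u : q.obj i ⟶ b) : q.obj (push u) = b
  map_lift {i : J} {b : B} (u : q.obj i ⟶ b) : q.map (lift u) ≍ u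
  pull {i j : J} (s : i ⟶ j) {u : q.obj i ⟶ q.obj j} (β : u ⟶ q.map s) : i ⟶ j
  cellLift {i j : J} (s : i ⟶ j) {u : q.obj i ⟶ q.obj j} (β : u ⟶ q.map s) : pull s β ⟶ s
  map_pull {i j : J} (s : i ⟶ j) {u : q.obj i ⟶ q.obj j} (β : u ⟶ q.map s) :
    q.map (pull s β) = u
  map₂_cellLift {i j : J} (s : i ⟶ j) {u : q.obj i ⟶ q.obj j} (β : u ⟶ q.map s) :
    q.map₂ (cellLift s β) = eqToHom (map_pull s β) ≫ β
  push_comp {i : J} {b b' : B} (u : q.obj i ⟶ b) (v : b ⟶ b') :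
    push (u ≫ v) = push (v.cast (obj_push u).symm rfl)
  lift_comp {i : J} {b b' : B} (u : q.obj i ⟶ b) (v : b ⟶ b') :
    lift (u ≫ v) ≍ lift u ≫ lift (v.cast (obj_push u).symm rfl)
  push_id (i : J) : push (𝟙 (q.obj i)) = i
  lift_id (i : J) : lift (𝟙 (q.obj i)) ≍ 𝟙 i
  pull_vcomp {i j : J} (s : i ⟶ j) {u u' : q.obj i ⟶ q.obj j} (γ : u' ⟶ u) (β : u ⟶ q.map s) :
    pull s (γ ≫ β) = pull (pull s β) (γ ≫ eqToHom (map_pull s β).symm)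
  cellLift_vcomp {i j : J} (s : i ⟶ j) {u u' : q.obj i ⟶ q.obj j} (γ : u' ⟶ u)
    (β : u ⟶ q.map s) : cellLift s (γ ≫ β) = eqToHom (pull_vcomp s γ β) ≫
      cellLift (pull s β) (γ ≫ eqToHom (map_pull s β).symm) ≫ cellLift s β
  pull_hcomp {i j k : J} (s : i ⟶ j) (t : j ⟶ k) {u : q.obj i ⟶ q.obj j}
    {v : q.obj j ⟶ q.obj k} (β : u ⟶ q.map s) (γ : v ⟶ q.map t) :
    pull (s ≫ t) ((β ▷ v ≫ q.map s ◁ γ) ≫ eqToHom (q.map_comp s t).symm) = pull s β ≫ pull t γ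
  cellLift_hcomp {i j k : J} (s : i ⟶ j) (t : j ⟶ k) {u : q.obj i ⟶ q.obj j}
    {v : q.obj j ⟶ q.obj k} (β : u ⟶ q.map s) (γ : v ⟶ q.map t) :
    cellLift (s ≫ t) ((β ▷ v ≫ q.map s ◁ γ) ≫ eqToHom (q.map_comp s t).symm) =
      eqToHom (pull_hcomp s t β γ) ≫ cellLift s β ▷ pull t γ ≫ s ◁ cellLift t γ
  pull_id {i j : J} (s : i ⟶ j) : pull s (𝟙 (q.map s)) = s
  cellLift_id {i j : J} (s : i ⟶ j) : cellLift s (𝟙 (q.map s)) = eqToHom (pull_id s)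
  isOpcartesian_lift {i : J} {b : B} (u : q.obj i ⟶ b) : IsOpcartesian q (lift u)
  isCartesianCell_cellLift {i j : J} (s : i ⟶ j) {u : q.obj i ⟶ q.obj j} (β : u ⟶ q.map s) :
    IsCartesianCell q (cellLift s β)

/-- A cleavage for the `2`-functor `q : J ⟶ B`, making it into a split co-`2`-fibration. It supplies
cartesian lifts `lift u : pull u ⟶ i` of morphisms `u : a ⟶ q i` and opcartesian lifts
`cellLift s α : s ⟶ push s α` of cells `α : q s ⟶ v`. It is obtained from the notion of cleavage
for split op-`2`-fibrations by reversing the directions of both the morphisms and the cells. -/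
structure CoCleavage where
  pull {a : B} {i : J} (u : a ⟶ q.obj i) : J
  lift {a : B} {i : J} (u : a ⟶ q.obj i) : pull u ⟶ i
  obj_pull {a : B} {i : J} (u : a ⟶ q.obj i) : q.obj (pull u) = a
  map_lift {a : B} {i : J} (u : a ⟶ q.obj i) : q.map (lift u) ≍ u
  push {i j : J} (s : i ⟶ j) {v : q.obj i ⟶ q.obj j} (α : q.map s ⟶ v) : i ⟶ j
  cellLift {i j : J} (s : i ⟶ j) {v : q.obj i ⟶ q.obj j} (α : q.map s ⟶ v) : s ⟶ push s α
  map_push {i j : J} (s : i ⟶ j) {v : q.obj i ⟶ q.obj j} (α : q.map s ⟶ v) :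
    q.map (push s α) = v
  map₂_cellLift {i j : J} (s : i ⟶ j) {v : q.obj i ⟶ q.obj j} (α : q.map s ⟶ v) :
    q.map₂ (cellLift s α) = α ≫ eqToHom (map_push s α).symm
  pull_comp {a' a : B} {i : J} (v : a' ⟶ a) (u : a ⟶ q.obj i) :
    pull (v ≫ u) = pull (v.cast rfl (obj_pull u).symm)
  lift_comp {a' a : B} {i : J} (v : a' ⟶ a) (u : a ⟶ q.obj i) :
    lift (v ≫ u) ≍ lift (v.cast rfl (obj_pull u).symm) ≫ lift u
  pull_id (i : J) : pull (𝟙 (q.obj i)) = i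
  lift_id (i : J) : lift (𝟙 (q.obj i)) ≍ 𝟙 i
  push_vcomp {i j : J} (s : i ⟶ j) {v v' : q.obj i ⟶ q.obj j} (α : q.map s ⟶ v) (γ : v ⟶ v') :
    push s (α ≫ γ) = push (push s α) (eqToHom (map_push s α) ≫ γ)
  cellLift_vcomp {i j : J} (s : i ⟶ j) {v v' : q.obj i ⟶ q.obj j} (α : q.map s ⟶ v)
    (γ : v ⟶ v') : cellLift s (α ≫ γ) = cellLift s α ≫
      cellLift (push s α) (eqToHom (map_push s α) ≫ γ) ≫ eqToHom (push_vcomp s α γ).symm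
  push_hcomp {i j k : J} (s : i ⟶ j) (t : j ⟶ k) {v : q.obj i ⟶ q.obj j}
    {w : q.obj j ⟶ q.obj k} (α : q.map s ⟶ v) (γ : q.map t ⟶ w) :
    push (s ≫ t) (eqToHom (q.map_comp s t) ≫ α ▷ q.map t ≫ v ◁ γ) = push s α ≫ push t γ
  cellLift_hcomp {i j k : J} (s : i ⟶ j) (t : j ⟶ k) {v : q.obj i ⟶ q.obj j}
    {w : q.obj j ⟶ q.obj k} (α : q.map s ⟶ v) (γ : q.map t ⟶ w) :
    cellLift (s ≫ t) (eqToHom (q.map_comp s t) ≫ α ▷ q.map t ≫ v ◁ γ) =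
      (cellLift s α ▷ t ≫ push s α ◁ cellLift t γ) ≫ eqToHom (push_hcomp s t α γ).symm
  push_id {i j : J} (s : i ⟶ j) : push s (𝟙 (q.map s)) = s
  cellLift_id {i j : J} (s : i ⟶ j) : cellLift s (𝟙 (q.map s)) = eqToHom (push_id s).symm
  isCartesian_lift {a : B} {i : J} (u : a ⟶ q.obj i) : IsCartesian q (lift u)
  isOpcartesianCell_cellLift {i j : J} (s : i ⟶ j) {v : q.obj i ⟶ q.obj j} (α : q.map s ⟶ v) :
    IsOpcartesianCell q (cellLift s α)

end cleavage

section twoSided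
variable {A : Type u₁} [Bicategory.{w₁, v₁} A] {B : Type u₂} [Bicategory.{w₂, v₂} B]
  {J : Type u₃} [Bicategory.{w₃, v₃} J]
  {p : StrictPseudofunctor J A} {q : StrictPseudofunctor J B}

/-- The lifts of the cleavages for the legs `p` and `q` of a span `A ⟵ J ⟶ B` are sent to
identities by the other leg. -/
structure Vertical (l : CoCleavage p) (r : OpCleavage q) : Prop where
  obj_pull {a : A} {i : J} (u : a ⟶ p.obj i) : q.obj (l.pull u) = q.obj i
  map_lift {a : A} {i : J} (u : a ⟶ p.obj i) : q.map (l.lift u) ≍ 𝟙 (q.obj i)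
  map_push {i j : J} (s : i ⟶ j) {v : p.obj i ⟶ p.obj j} (α : p.map s ⟶ v) :
    q.map (l.push s α) = q.map s
  map₂_cellLift {i j : J} (s : i ⟶ j) {v : p.obj i ⟶ p.obj j} (α : p.map s ⟶ v) :
    q.map₂ (l.cellLift s α) = eqToHom (map_push s α).symm
  obj_push {j : J} {b : B} (v : q.obj j ⟶ b) : p.obj (r.push v) = p.obj j
  map_lift' {j : J} {b : B} (v : q.obj j ⟶ b) : p.map (r.lift v) ≍ 𝟙 (p.obj j)
  map_pull {i j : J} (t : i ⟶ j) {u : q.obj i ⟶ q.obj j} (β : u ⟶ q.map t) :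
    p.map (r.pull t β) = p.map t
  map₂_cellLift' {i j : J} (t : i ⟶ j) {u : q.obj i ⟶ q.obj j} (β : u ⟶ q.map t) :
    p.map₂ (r.cellLift t β) = eqToHom (map_pull t β)

variable {l : CoCleavage p} {r : OpCleavage q}

/-- Taking cartesian and opcartesian lifts of morphisms commutes. -/
def LiftsCommute (h : Vertical l r) : Prop :=
  ∀ {i : J} {a : A} {b : B} (u : a ⟶ p.obj i) (v : q.obj i ⟶ b),
    ∃ e : r.push (v.cast (h.obj_pull u).symm rfl) = l.pull (u.cast rfl (h.obj_push v).symm),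
      l.lift u ≫ r.lift v = (r.lift (v.cast (h.obj_pull u).symm rfl)).cast rfl e ≫
        l.lift (u.cast rfl (h.obj_push v).symm)

/-- Taking opcartesian and cartesian lifts of cells commutes. -/
def CellLiftsCommute (h : Vertical l r) : Prop :=
  ∀ {i j : J} (s : i ⟶ j) {v : p.obj i ⟶ p.obj j} {u : q.obj i ⟶ q.obj j} (α : p.map s ⟶ v)
    (β : u ⟶ q.map s),
    ∃ e : l.push (r.pull s β) (eqToHom (h.map_pull s β) ≫ α) =
        r.pull (l.push s α) (β ≫ eqToHom (h.map_push s α).symm),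
      r.cellLift s β ≫ l.cellLift s α =
        l.cellLift (r.pull s β) (eqToHom (h.map_pull s β) ≫ α) ≫ eqToHom e ≫
          r.cellLift (l.push s α) (β ≫ eqToHom (h.map_push s α).symm)

variable (p q) in
/-- The cleavages of a split two-sided `2`-fibration. -/
structure TwoSidedCleavage where
  left : CoCleavage p
  right : OpCleavage q
  vertical : Vertical left right
  liftsCommute : LiftsCommute vertical
  cellLiftsCommute : CellLiftsCommute vertical

end twoSided

section elements

theorem right_w {C : Type u} [Bicategory.{w, v} C] {a b : C} {f g : a ⟶ b} (β : f ⟶ g) :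
    ((λ_ f).hom ≫ β ≫ (ρ_ g).inv) ≫ 𝟙 g ▷ 𝟙 b = 𝟙 a ◁ β ≫ (λ_ g).hom ≫ 𝟙 g ≫ (ρ_ g).inv := by
  simp

theorem left_w {C : Type u} [Bicategory.{w, v} C] {a b : C} {f g : a ⟶ b} (α : f ⟶ g) :
    ((λ_ f).hom ≫ 𝟙 f ≫ (ρ_ f).inv) ≫ α ▷ 𝟙 b = 𝟙 a ◁ 𝟙 f ≫ (λ_ f).hom ≫ α ≫ (ρ_ g).inv := by
  simp

variable {A : Type u₁} [Bicategory.{w₁, v₁} A] [Strict A] {B : Type u₂} [Bicategory.{w₂, v₂} B]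
  [Strict B] {J : Type u₃} [Bicategory.{w₃, v₃} J] [Strict J]

section
variable (q : StrictPseudofunctor J B)

/-- The object `(i, u)` of `J ×_B B^𝟚`. -/
def rightObj {i : J} {b : B} (u : q.obj i ⟶ b) : Pullback q (LaxArrow.src B) :=
  ⟨i, ⟨q.obj i, b, u⟩, rfl⟩

/-- The morphism `(𝟙 i, (𝟙 (q i), 𝟙 u, u))` of `J ×_B B^𝟚`. -/
def rightLift {i : J} {b : B} (u : q.obj i ⟶ b) : rightObj q (𝟙 (q.obj i)) ⟶ rightObj q u :=
  Pullback.Hom.mk (𝟙 i) (LaxArrow.Hom.mk (𝟙 (q.obj i)) u (𝟙 (𝟙 (q.obj i) ≫ u)))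
    (heq_of_eq (q.map_id i))

/-- The morphism `(s, (q s, β, u))` of `J ×_B B^𝟚`. -/
def rightPull {i j : J} (s : i ⟶ j) {u : q.obj i ⟶ q.obj j} (β : u ⟶ q.map s) :
    rightObj q (𝟙 (q.obj i)) ⟶ rightObj q (𝟙 (q.obj j)) :=
  Pullback.Hom.mk s (LaxArrow.Hom.mk (q.map s) u ((λ_ u).hom ≫ β ≫ (ρ_ (q.map s)).inv)) HEq.rfl

/-- The cell `(𝟙 s, (𝟙 (q s), β))` of `J ×_B B^𝟚`. -/
def rightCell {i j : J} (s : i ⟶ j) {u : q.obj i ⟶ q.obj j} (β : u ⟶ q.map s) :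
    rightPull q s β ⟶ rightPull q s (𝟙 (q.map s)) :=
  Pullback.Hom₂.mk (𝟙 s) (LaxArrow.Hom₂.mk (𝟙 (q.map s)) β
      (right_w β)) (heq_of_eq (q.map₂_id s))

end

section
variable (p : StrictPseudofunctor J A)

/-- The object `(u, i)` of `A^𝟚 ×_A J`. -/
def leftObj {a : A} {i : J} (u : a ⟶ p.obj i) : Pullback (LaxArrow.tgt A) p :=
  ⟨⟨a, p.obj i, u⟩, i, rfl⟩

/-- The morphism `((u, 𝟙 u, 𝟙 (p i)), 𝟙 i)` of `A^𝟚 ×_A J`. -/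
def leftLift {a : A} {i : J} (u : a ⟶ p.obj i) : leftObj p u ⟶ leftObj p (𝟙 (p.obj i)) :=
  Pullback.Hom.mk (LaxArrow.Hom.mk u (𝟙 (p.obj i)) (𝟙 (u ≫ 𝟙 (p.obj i)))) (𝟙 i)
    (heq_of_eq (p.map_id i).symm)

/-- The morphism `((v, α, p s), s)` of `A^𝟚 ×_A J`. -/
def leftPush {i j : J} (s : i ⟶ j) {v : p.obj i ⟶ p.obj j} (α : p.map s ⟶ v) :
    leftObj p (𝟙 (p.obj i)) ⟶ leftObj p (𝟙 (p.obj j)) :=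
  Pullback.Hom.mk (LaxArrow.Hom.mk v (p.map s) ((λ_ (p.map s)).hom ≫ α ≫ (ρ_ v).inv)) s HEq.rfl

/-- The cell `((α, 𝟙 (p s)), 𝟙 s)` of `A^𝟚 ×_A J`. -/
def leftCell {i j : J} (s : i ⟶ j) {v : p.obj i ⟶ p.obj j} (α : p.map s ⟶ v) :
    leftPush p s (𝟙 (p.map s)) ⟶ leftPush p s α :=
  Pullback.Hom₂.mk (LaxArrow.Hom₂.mk α (𝟙 (p.map s))
      (left_w α)) (𝟙 s) (heq_of_eq (p.map₂_id s).symm)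

end

/-- The cleavage `r` is induced by the right action `R`. -/
structure RightInduces (q : StrictPseudofunctor J B)
    (R : StrictPseudofunctor (Pullback q (LaxArrow.src B)) J) (r : OpCleavage q) : Prop where
  push {i : J} {b : B} (u : q.obj i ⟶ b) : r.push u = R.obj (rightObj q u)
  lift {i : J} {b : B} (u : q.obj i ⟶ b) : r.lift u ≍ R.map (rightLift q u)
  pull {i j : J} (s : i ⟶ j) {u : q.obj i ⟶ q.obj j} (β : u ⟶ q.map s) :
    r.pull s β ≍ R.map (rightPull q s β)
  cellLift {i j : J} (s : i ⟶ j) {u : q.obj i ⟶ q.obj j} (β : u ⟶ q.map s) :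
    r.cellLift s β ≍ R.map₂ (rightCell q s β)

/-- The cleavage `l` is induced by the left action `L`. -/
structure LeftInduces (p : StrictPseudofunctor J A)
    (L : StrictPseudofunctor (Pullback (LaxArrow.tgt A) p) J) (l : CoCleavage p) : Prop where
  pull {a : A} {i : J} (u : a ⟶ p.obj i) : l.pull u = L.obj (leftObj p u)
  lift {a : A} {i : J} (u : a ⟶ p.obj i) : l.lift u ≍ L.map (leftLift p u)
  push {i j : J} (s : i ⟶ j) {v : p.obj i ⟶ p.obj j} (α : p.map s ⟶ v) :
    l.push s α ≍ L.map (leftPush p s α)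
  cellLift {i j : J} (s : i ⟶ j) {v : p.obj i ⟶ p.obj j} (α : p.map s ⟶ v) :
    l.cellLift s α ≍ L.map₂ (leftCell p s α)

end elements

/-- The cleavages `c` are induced by the actions of the internal split two-sided fibration `P`. -/
def Induces {A B J : TwoCat.{u}} {p : J ⟶ A} {q : J ⟶ B} (P : SplitTwoSidedFibration p q)
    (c : TwoSidedCleavage p q) : Prop :=
  LeftInduces p P.left c.left ∧ RightInduces q P.right c.right

end TwoDim

/-! A right action of `B^𝟚` on `q` sends an object `(i, u)` of `J ×_B B^𝟚` to an object over the
target of `u`, a square `ζ : u ⬝ t ⟶ q s ⬝ u'` to a morphism over `t`, and a cell between squares to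
a cell. Special squares yield lifts: the identity cell on `u`, as a square `(i, 1) ⟶ (i, u)`, gives
the lift of `u`, and a cell `β` into `q s`, as a square between identity arrows, gives `β^* s`.
Functoriality and associativity of the action make these lifts split.

The universal properties come from one observation. The square from `(i, u)` to `(u_! i, 1)` whose
upper side is the lift of `u` and whose cell is an identity acts as an identity
(`Action.mor_lift_self`), since by associativity its value is that of an identity square. Hence a
morphism `x` out of `u_! i` is recovered from `lift u ⬝ x`, and a factorisation of `s` through the
lift is the value at the identity-filled square from `u` to an identity arrow. The same device one
dimension up (`Action.cell_cellLift_self`) makes the lifts of cells cartesian.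

Conversely the lifts determine the action. The value at `ζ` is the only morphism `x` over `t` with
`lift u ⬝ x = ζ^* (s ⬝ lift u')` (`Action.lift_comp_mor_eq`), and the values at cells satisfy an
analogous equation (`Action.lift_hcomp_cell_eq`). For a given cleavage these equations define
`Lifting.mor` and `Lifting.cell`. Every law of an action then follows by uniqueness from the way
`cellLift` splits over horizontal and vertical pastings (`Lifting.cellLift_comp`,
`Lifting.cellLift_vert`).

The left leg needs no separate argument: it is the right leg of the dual in which morphisms and
cells are both reversed. For the compatibility of the two sides, flank a morphism `s` by the chosen
lifts at its two ends. Acting on `s` in either order and flanking the result produces `ζ^* ξ_!` or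
`ξ_! ζ^*` of the flanked morphism; these agree because lifts of cells commute, and the flanks are
cancelled by their universal properties (`Lifting.Compatible.mor_eq`, `Lifting.Compatible.cell_eq`).
In the other direction the commutation of lifts is the commutation of actions at special squares.

All of this takes place in `TotalTwoCat`, where sources and targets are functions and equations need
no transport. `hat` and `unhat` carry strict `2`-functors back and forth. `IsPullback` and
`ArrowModel` record what is used of pullbacks and of the lax arrow category, `Realizes` ties a
functor on `J ×_B B^𝟚` to an action, and `Represents` ties a cleavage to a `Lifting`. The bijection
is then assembled from `exists_cleavage_induces`, `exists_profunctor_induces`, `Induces.unique_left`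
and `Induces.unique_right`. -/

namespace TwoDim

/-! ### Strict 2-categories with total composition, lifting structures and actions -/

/-- A strict `2`-category, in terms of its types of objects, morphisms and cells. The compositions
are total, but only their values at composable pairs matter. -/
structure TotalTwoCat : Type (u + 1) where
  Obj : Type u
  Mor : Type u
  Cell : Type u
  src : Mor → Obj
  tgt : Mor → Obj
  one : Obj → Mor
  comp : Mor → Mor → Mor
  dom : Cell → Mor
  cod : Cell → Mor
  idc : Mor → Cell
  vcomp : Cell → Cell → Cell
  hcomp : Cell → Cell → Cell
  src_one (a : Obj) : src (one a) = a
  tgt_one (a : Obj) : tgt (one a) = a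
  src_comp (x y : Mor) : tgt x = src y → src (comp x y) = src x
  tgt_comp (x y : Mor) : tgt x = src y → tgt (comp x y) = tgt y
  comp_assoc (x y z : Mor) : tgt x = src y → tgt y = src z →
    comp (comp x y) z = comp x (comp y z)
  one_comp (x : Mor) (a : Obj) : a = src x → comp (one a) x = x
  comp_one (x : Mor) (a : Obj) : a = tgt x → comp x (one a) = x
  src_cod (α : Cell) : src (cod α) = src (dom α)
  tgt_cod (α : Cell) : tgt (cod α) = tgt (dom α)
  dom_idc (x : Mor) : dom (idc x) = x
  cod_idc (x : Mor) : cod (idc x) = x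
  dom_vcomp (α β : Cell) : cod α = dom β → dom (vcomp α β) = dom α
  cod_vcomp (α β : Cell) : cod α = dom β → cod (vcomp α β) = cod β
  vcomp_assoc (α β γ : Cell) : cod α = dom β → cod β = dom γ →
    vcomp (vcomp α β) γ = vcomp α (vcomp β γ)
  idc_vcomp (α : Cell) (x : Mor) : x = dom α → vcomp (idc x) α = α
  vcomp_idc (α : Cell) (x : Mor) : x = cod α → vcomp α (idc x) = α
  dom_hcomp (α β : Cell) : tgt (dom α) = src (dom β) →
    dom (hcomp α β) = comp (dom α) (dom β)
  cod_hcomp (α β : Cell) : tgt (dom α) = src (dom β) →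
    cod (hcomp α β) = comp (cod α) (cod β)
  hcomp_assoc (α β γ : Cell) : tgt (dom α) = src (dom β) → tgt (dom β) = src (dom γ) →
    hcomp (hcomp α β) γ = hcomp α (hcomp β γ)
  one_hcomp (α : Cell) (a : Obj) : a = src (dom α) → hcomp (idc (one a)) α = α
  hcomp_one (α : Cell) (a : Obj) : a = tgt (dom α) → hcomp α (idc (one a)) = α
  idc_hcomp_idc (x y : Mor) : tgt x = src y → hcomp (idc x) (idc y) = idc (comp x y)
  interchange (α α' β β' : Cell) : cod α = dom α' → cod β = dom β' →
    tgt (dom α) = src (dom β) →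
    hcomp (vcomp α α') (vcomp β β') = vcomp (hcomp α β) (hcomp α' β')

local infixl:70 " ⬝ " => TotalTwoCat.comp _
local infixl:65 " ⊙ " => TotalTwoCat.vcomp _
local infixl:75 " ∗ " => TotalTwoCat.hcomp _

namespace TotalTwoCat

-- These axioms serve `grind` as rewrite rules whose composability hypotheses it discharges itself.
-- `interchange` is left out, neither direction being a simplification; it is applied by hand,
-- mostly through its one-sided forms `hcomp_idc_vcomp`, `hcomp_vcomp_idc`, `idc_hcomp_vcomp` and
-- `vcomp_idc_hcomp`.
attribute [grind =] src_one tgt_one src_comp tgt_comp comp_assoc one_comp comp_one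
  dom_idc cod_idc dom_vcomp cod_vcomp vcomp_assoc idc_vcomp vcomp_idc dom_hcomp cod_hcomp
  hcomp_assoc one_hcomp hcomp_one idc_hcomp_idc

attribute [grind _=_] src_cod tgt_cod

/-- The dual, with both the morphisms and the cells reversed. -/
def dual (C : TotalTwoCat.{u}) : TotalTwoCat.{u} where
  Obj := C.Obj
  Mor := C.Mor
  Cell := C.Cell
  src := C.tgt
  tgt := C.src
  one := C.one
  comp x y := C.comp y x
  dom := C.cod
  cod := C.dom
  idc := C.idc
  vcomp α β := C.vcomp β α
  hcomp α β := C.hcomp β α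
  src_one := C.tgt_one
  tgt_one := C.src_one
  src_comp x y h := C.tgt_comp y x h.symm
  tgt_comp x y h := C.src_comp y x h.symm
  comp_assoc x y z h h' := (C.comp_assoc z y x h'.symm h.symm).symm
  one_comp := C.comp_one
  comp_one := C.one_comp
  src_cod α := (C.tgt_cod α).symm
  tgt_cod α := (C.src_cod α).symm
  dom_idc := C.cod_idc
  cod_idc := C.dom_idc
  dom_vcomp α β h := C.cod_vcomp β α h.symm
  cod_vcomp α β h := C.dom_vcomp β α h.symm
  vcomp_assoc α β γ h h' := (C.vcomp_assoc γ β α h'.symm h.symm).symm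
  idc_vcomp := C.vcomp_idc
  vcomp_idc := C.idc_vcomp
  dom_hcomp α β h := C.cod_hcomp β α (by grind)
  cod_hcomp α β h := C.dom_hcomp β α (by grind)
  hcomp_assoc α β γ h h' := (C.hcomp_assoc γ β α (by grind) (by grind)).symm
  one_hcomp α a h := C.hcomp_one α a (by grind)
  hcomp_one α a h := C.one_hcomp α a (by grind)
  idc_hcomp_idc x y h := C.idc_hcomp_idc y x h.symm
  interchange α α' β β' h h' h'' := C.interchange β' β α' α h'.symm h.symm (by grind)

/-- A strict functor of `2`-categories. -/
@[ext]
structure Functor (C D : TotalTwoCat.{u}) where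
  obj : C.Obj → D.Obj
  mor : C.Mor → D.Mor
  cell : C.Cell → D.Cell
  src_mor (x : C.Mor) : D.src (mor x) = obj (C.src x)
  tgt_mor (x : C.Mor) : D.tgt (mor x) = obj (C.tgt x)
  mor_one (a : C.Obj) : mor (C.one a) = D.one (obj a)
  mor_comp (x y : C.Mor) : C.tgt x = C.src y → mor (C.comp x y) = D.comp (mor x) (mor y)
  dom_cell (α : C.Cell) : D.dom (cell α) = mor (C.dom α)
  cod_cell (α : C.Cell) : D.cod (cell α) = mor (C.cod α)
  cell_idc (x : C.Mor) : cell (C.idc x) = D.idc (mor x)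
  cell_vcomp (α β : C.Cell) : C.cod α = C.dom β →
    cell (C.vcomp α β) = D.vcomp (cell α) (cell β)
  cell_hcomp (α β : C.Cell) : C.tgt (C.dom α) = C.src (C.dom β) →
    cell (C.hcomp α β) = D.hcomp (cell α) (cell β)

attribute [grind =] Functor.src_mor Functor.tgt_mor Functor.mor_one Functor.mor_comp
  Functor.dom_cell Functor.cod_cell Functor.cell_idc Functor.cell_vcomp Functor.cell_hcomp

/-- The dual of a strict functor. -/
def Functor.dual {C D : TotalTwoCat.{u}} (F : Functor C D) : Functor C.dual D.dual where
  obj := F.obj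
  mor := F.mor
  cell := F.cell
  src_mor := F.tgt_mor
  tgt_mor := F.src_mor
  mor_one := F.mor_one
  mor_comp x y h := F.mor_comp y x h.symm
  dom_cell := F.cod_cell
  cod_cell := F.dom_cell
  cell_idc := F.cell_idc
  cell_vcomp α β h := F.cell_vcomp β α h.symm
  cell_hcomp α β h := F.cell_hcomp β α (by
    -- Composability of cells in the dual is a condition on codomains; it passes to domains because
    -- the two boundaries of a cell are parallel.
    have h : C.src (C.cod α) = C.tgt (C.cod β) := h
    grind)

section
variable {J B : TotalTwoCat.{u}}

/-- The structure of a split op-`2`-fibration on `q`: opcartesian lifts of morphisms and cartesian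
lifts of cells. -/
structure Lifting (q : Functor J B) where
  lift : J.Obj → B.Mor → J.Mor
  cellLift : J.Mor → B.Cell → J.Cell
  src_lift (i : J.Obj) (u : B.Mor) : B.src u = q.obj i → J.src (lift i u) = i
  mor_lift (i : J.Obj) (u : B.Mor) : B.src u = q.obj i → q.mor (lift i u) = u
  cod_cellLift (s : J.Mor) (β : B.Cell) : B.cod β = q.mor s → J.cod (cellLift s β) = s
  cell_cellLift (s : J.Mor) (β : B.Cell) : B.cod β = q.mor s → q.cell (cellLift s β) = β
  lift_comp (i : J.Obj) (u v : B.Mor) : B.src u = q.obj i → B.tgt u = B.src v →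
    lift i (u ⬝ v) = lift i u ⬝ lift (J.tgt (lift i u)) v
  lift_one (i : J.Obj) : lift i (B.one (q.obj i)) = J.one i
  cellLift_vcomp (s : J.Mor) (γ β : B.Cell) : B.cod γ = B.dom β → B.cod β = q.mor s →
    cellLift s (γ ⊙ β) = cellLift (J.dom (cellLift s β)) γ ⊙ cellLift s β
  cellLift_hcomp (s t : J.Mor) (β γ : B.Cell) : B.cod β = q.mor s → B.cod γ = q.mor t →
    J.tgt s = J.src t → cellLift (s ⬝ t) (β ∗ γ) = cellLift s β ∗ cellLift t γ
  cellLift_idc (s : J.Mor) : cellLift s (B.idc (q.mor s)) = J.idc s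
  existsUnique_mor (i : J.Obj) (u v : B.Mor) (s : J.Mor) : B.src u = q.obj i → B.tgt u = B.src v →
    J.src s = i → q.mor s = u ⬝ v →
    ∃! x, J.src x = J.tgt (lift i u) ∧ q.mor x = v ∧ lift i u ⬝ x = s
  existsUnique_cell (i : J.Obj) (u : B.Mor) (x x' : J.Mor) (σ : J.Cell) (β : B.Cell) :
    B.src u = q.obj i → J.src x = J.tgt (lift i u) → J.src x' = J.tgt (lift i u) →
    J.tgt x = J.tgt x' → J.dom σ = lift i u ⬝ x → J.cod σ = lift i u ⬝ x' →
    B.dom β = q.mor x → B.cod β = q.mor x' → q.cell σ = B.idc u ∗ β →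
    ∃! τ, J.dom τ = x ∧ J.cod τ = x' ∧ q.cell τ = β ∧ J.idc (lift i u) ∗ τ = σ
  existsUnique_cellLift (s : J.Mor) (α β : B.Cell) (σ : J.Cell) : B.cod β = q.mor s →
    J.cod σ = s → B.cod α = B.dom β → q.cell σ = α ⊙ β →
    ∃! ω, J.cod ω = J.dom (cellLift s β) ∧ q.cell ω = α ∧ ω ⊙ cellLift s β = σ

/-- The data of an object `(i, u)`, a morphism `s` out of `i`, a morphism `t` out of the target of
`u` and a cell `ζ : u ⬝ t ⟶ q s ⬝ u'`, that is, of a morphism `(i, u) ⟶ (j, u')` of `J ×_B B^𝟚`. -/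
structure IsSquare (q : Functor J B) (s : J.Mor) (u t : B.Mor) (ζ : B.Cell) (u' : B.Mor) :
    Prop where
  src_top : B.src u = q.obj (J.src s)
  src_bot : B.src u' = q.obj (J.tgt s)
  src_right : B.src t = B.tgt u
  tgt_right : B.tgt t = B.tgt u'
  dom_cell : B.dom ζ = u ⬝ t
  cod_cell : B.cod ζ = q.mor s ⬝ u'

/-- The data of a cell of `J ×_B B^𝟚`. -/
structure IsSquareCell (q : Functor J B) (σ : J.Cell) (u : B.Mor) (τ ζ ζ' : B.Cell) (u' : B.Mor) :
    Prop where
  dom : IsSquare q (J.dom σ) u (B.dom τ) ζ u'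
  cod : IsSquare q (J.cod σ) u (B.cod τ) ζ' u'
  w : ζ ⊙ (q.cell σ ∗ B.idc u') = (B.idc u ∗ τ) ⊙ ζ'

/-- A right action of `B^𝟚` on `q`. -/
structure Action (q : Functor J B) where
  obj : J.Obj → B.Mor → J.Obj
  mor : J.Mor → B.Mor → B.Mor → B.Cell → B.Mor → J.Mor
  cell : J.Cell → B.Mor → B.Cell → B.Cell → B.Cell → B.Mor → J.Cell
  src_mor {s : J.Mor} {u t : B.Mor} {ζ : B.Cell} {u' : B.Mor} : IsSquare q s u t ζ u' →
    J.src (mor s u t ζ u') = obj (J.src s) u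
  tgt_mor {s : J.Mor} {u t : B.Mor} {ζ : B.Cell} {u' : B.Mor} : IsSquare q s u t ζ u' →
    J.tgt (mor s u t ζ u') = obj (J.tgt s) u'
  dom_cell {σ : J.Cell} {u : B.Mor} {τ ζ ζ' : B.Cell} {u' : B.Mor} :
    IsSquareCell q σ u τ ζ ζ' u' →
    J.dom (cell σ u τ ζ ζ' u') = mor (J.dom σ) u (B.dom τ) ζ u'
  cod_cell {σ : J.Cell} {u : B.Mor} {τ ζ ζ' : B.Cell} {u' : B.Mor} :
    IsSquareCell q σ u τ ζ ζ' u' →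
    J.cod (cell σ u τ ζ ζ' u') = mor (J.cod σ) u (B.cod τ) ζ' u'
  mor_one (i : J.Obj) (u : B.Mor) : B.src u = q.obj i →
    mor (J.one i) u (B.one (B.tgt u)) (B.idc u) u = J.one (obj i u)
  mor_comp {s s' : J.Mor} {u u' u'' t t' : B.Mor} {ζ ζ' : B.Cell} : IsSquare q s u t ζ u' →
    IsSquare q s' u' t' ζ' u'' → J.tgt s = J.src s' →
    mor (s ⬝ s') u (t ⬝ t') ((ζ ∗ B.idc t') ⊙ (B.idc (q.mor s) ∗ ζ')) u'' =
      mor s u t ζ u' ⬝ mor s' u' t' ζ' u''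
  cell_idc {s : J.Mor} {u t : B.Mor} {ζ : B.Cell} {u' : B.Mor} : IsSquare q s u t ζ u' →
    cell (J.idc s) u (B.idc t) ζ ζ u' = J.idc (mor s u t ζ u')
  cell_vcomp {σ σ' : J.Cell} {u : B.Mor} {τ τ' ζ ζ' ζ'' : B.Cell} {u' : B.Mor} :
    IsSquareCell q σ u τ ζ ζ' u' → IsSquareCell q σ' u τ' ζ' ζ'' u' → J.cod σ = J.dom σ' →
    B.cod τ = B.dom τ' →
    cell (σ ⊙ σ') u (τ ⊙ τ') ζ ζ'' u' = cell σ u τ ζ ζ' u' ⊙ cell σ' u τ' ζ' ζ'' u'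
  cell_hcomp {σ σ' : J.Cell} {u u' u'' : B.Mor} {τ τ' ζ ζ₁ ζ' ζ₁' : B.Cell} :
    IsSquareCell q σ u τ ζ ζ₁ u' → IsSquareCell q σ' u' τ' ζ' ζ₁' u'' →
    J.tgt (J.dom σ) = J.src (J.dom σ') →
    cell (σ ∗ σ') u (τ ∗ τ') ((ζ ∗ B.idc (B.dom τ')) ⊙ (B.idc (q.mor (J.dom σ)) ∗ ζ'))
      ((ζ₁ ∗ B.idc (B.cod τ')) ⊙ (B.idc (q.mor (J.cod σ)) ∗ ζ₁')) u'' =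
      cell σ u τ ζ ζ₁ u' ∗ cell σ' u' τ' ζ' ζ₁' u''
  map_obj (i : J.Obj) (u : B.Mor) : B.src u = q.obj i → q.obj (obj i u) = B.tgt u
  map_mor {s : J.Mor} {u t : B.Mor} {ζ : B.Cell} {u' : B.Mor} : IsSquare q s u t ζ u' →
    q.mor (mor s u t ζ u') = t
  map_cell {σ : J.Cell} {u : B.Mor} {τ ζ ζ' : B.Cell} {u' : B.Mor} :
    IsSquareCell q σ u τ ζ ζ' u' → q.cell (cell σ u τ ζ ζ' u') = τ
  obj_unit (i : J.Obj) : obj i (B.one (q.obj i)) = i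
  mor_unit (s : J.Mor) : mor s (B.one (q.obj (J.src s))) (q.mor s) (B.idc (q.mor s))
    (B.one (q.obj (J.tgt s))) = s
  cell_unit (σ : J.Cell) : cell σ (B.one (q.obj (J.src (J.dom σ)))) (q.cell σ)
    (B.idc (q.mor (J.dom σ))) (B.idc (q.mor (J.cod σ))) (B.one (q.obj (J.tgt (J.dom σ)))) = σ
  obj_assoc (i : J.Obj) (u v : B.Mor) : B.src u = q.obj i → B.tgt u = B.src v →
    obj (obj i u) v = obj i (u ⬝ v)
  mor_assoc {s : J.Mor} {u u' t v v' w : B.Mor} {ζ ξ : B.Cell} (hζ : IsSquare q s u t ζ u')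
    (hξ : IsSquare q (mor s u t ζ u') v w ξ v') :
    mor (mor s u t ζ u') v w ξ v' =
      mor s (u ⬝ v) w ((B.idc u ∗ ξ) ⊙ (ζ ∗ B.idc v')) (u' ⬝ v')
  cell_assoc {σ : J.Cell} {u u' v v' : B.Mor} {τ ω ζ ζ' ξ ξ' : B.Cell}
    (hζ : IsSquareCell q σ u τ ζ ζ' u')
    (hξ : IsSquareCell q (cell σ u τ ζ ζ' u') v ω ξ ξ' v') :
    cell (cell σ u τ ζ ζ' u') v ω ξ ξ' v' =
      cell σ (u ⬝ v) ω ((B.idc u ∗ ξ) ⊙ (ζ ∗ B.idc v')) ((B.idc u ∗ ξ') ⊙ (ζ' ∗ B.idc v'))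
        (u' ⬝ v')

end
end TotalTwoCat

/-! ### From an action to split lifts -/

namespace TotalTwoCat
variable {J B : TotalTwoCat.{u}} {q : Functor J B}

attribute [grind] IsSquare IsSquareCell

namespace IsSquare

/-- The square `(i, 1) ⟶ (i, u)` at which an action takes the lift of `u` as its value. -/
theorem liftSquare {i : J.Obj} {u : B.Mor} (h : B.src u = q.obj i) :
    IsSquare q (J.one i) (B.one (q.obj i)) u (B.idc u) u := by
  constructor <;> grind

/-- Between identity arrows a square is just a cell into `q s`; the value of an action here is `β^*
s`. -/
theorem pullSquare {s : J.Mor} {β : B.Cell} (h : B.cod β = q.mor s) :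
    IsSquare q s (B.one (q.obj (J.src s))) (B.dom β) β (B.one (q.obj (J.tgt s))) := by
  constructor <;> grind

theorem unitSquare (s : J.Mor) :
    IsSquare q s (B.one (q.obj (J.src s))) (q.mor s) (B.idc (q.mor s))
      (B.one (q.obj (J.tgt s))) := by
  constructor <;> grind

theorem comp {s s' : J.Mor} {u u' u'' t t' : B.Mor} {ζ ζ' : B.Cell} (h : IsSquare q s u t ζ u')
    (h' : IsSquare q s' u' t' ζ' u'') (e : J.tgt s = J.src s') :
    IsSquare q (s ⬝ s') u (t ⬝ t') ((ζ ∗ B.idc t') ⊙ (B.idc (q.mor s) ∗ ζ')) u'' := by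
  constructor <;> grind

end IsSquare

theorem IsSquareCell.id {s : J.Mor} {u t : B.Mor} {ζ : B.Cell} {u' : B.Mor}
    (h : IsSquare q s u t ζ u') : IsSquareCell q (J.idc s) u (B.idc t) ζ ζ u' := by
  constructor <;> grind

theorem IsSquareCell.liftCell {s : J.Mor} {β : B.Cell} (h : B.cod β = q.mor s) :
    IsSquareCell q (J.idc s) (B.one (q.obj (J.src s))) β β (B.idc (q.mor s))
      (B.one (q.obj (J.tgt s))) := by
  constructor <;> grind

attribute [grind →] IsSquare.src_top IsSquare.src_bot IsSquare.src_right IsSquare.tgt_right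
  IsSquare.dom_cell IsSquare.cod_cell

namespace Action
variable (a : Action q)

/-- The lift of a morphism that is induced by an action. -/
def lift (i : J.Obj) (u : B.Mor) : J.Mor := a.mor (J.one i) (B.one (q.obj i)) u (B.idc u) u

/-- The lift of a cell that is induced by an action. -/
def cellLift (s : J.Mor) (β : B.Cell) : J.Cell :=
  a.cell (J.idc s) (B.one (q.obj (J.src s))) β β (B.idc (q.mor s)) (B.one (q.obj (J.tgt s)))

theorem src_lift {i : J.Obj} {u : B.Mor} (h : B.src u = q.obj i) : J.src (a.lift i u) = i := by
  rw [lift, a.src_mor (.liftSquare h), J.src_one, a.obj_unit]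

theorem tgt_lift {i : J.Obj} {u : B.Mor} (h : B.src u = q.obj i) :
    J.tgt (a.lift i u) = a.obj i u := by
  rw [lift, a.tgt_mor (.liftSquare h), J.tgt_one]

theorem mor_lift {i : J.Obj} {u : B.Mor} (h : B.src u = q.obj i) : q.mor (a.lift i u) = u :=
  a.map_mor (.liftSquare h)

theorem dom_cellLift {s : J.Mor} {β : B.Cell} (h : B.cod β = q.mor s) :
    J.dom (a.cellLift s β) =
      a.mor s (B.one (q.obj (J.src s))) (B.dom β) β (B.one (q.obj (J.tgt s))) := by
  rw [cellLift, a.dom_cell (.liftCell h), J.dom_idc]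

theorem cod_cellLift {s : J.Mor} {β : B.Cell} (h : B.cod β = q.mor s) :
    J.cod (a.cellLift s β) = s := by
  rw [cellLift, a.cod_cell (.liftCell h), J.cod_idc, h, a.mor_unit]

theorem cell_cellLift {s : J.Mor} {β : B.Cell} (h : B.cod β = q.mor s) :
    q.cell (a.cellLift s β) = β :=
  a.map_cell (.liftCell h)

/-- The lift is the value at the square `(i, 1) ⟶ (i, u)`. Composed with it, the given square keeps
its cell but now starts at `(i, 1)`, so functoriality of the action applies. -/
theorem lift_comp_mor {s : J.Mor} {u t : B.Mor} {ζ : B.Cell} {u' : B.Mor}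
    (h : IsSquare q s u t ζ u') : a.lift (J.src s) u ⬝ a.mor s u t ζ u' =
      a.mor s (B.one (q.obj (J.src s))) (u ⬝ t) ζ u' := by
  have h' := a.mor_comp (.liftSquare h.src_top) h (by grind)
  grind [lift]

theorem mor_comp_lift {s : J.Mor} {t : B.Mor} {ζ : B.Cell} {u u' : B.Mor}
    (h : IsSquare q s u t ζ (B.one (q.obj (J.tgt s)))) (h' : B.src u' = q.obj (J.tgt s)) :
    a.mor s u t ζ (B.one (q.obj (J.tgt s))) ⬝ a.lift (J.tgt s) u' =
      a.mor s u (t ⬝ u') (ζ ∗ B.idc u') u' := by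
  have h'' := a.mor_comp h (.liftSquare h') (by grind)
  have := h.tgt_right
  have e : (ζ ∗ B.idc u') ⊙ (B.idc (q.mor s) ∗ B.idc u') = ζ ∗ B.idc u' := by grind
  rw [e] at h''
  grind [lift]

/-- By the unit law `s` is itself a value of the action, namely at its unit square; so composing it
with a lift is again a composition of squares. -/
theorem comp_lift {s : J.Mor} {u : B.Mor} (h : B.src u = q.obj (J.tgt s)) :
    s ⬝ a.lift (J.tgt s) u =
      a.mor s (B.one (q.obj (J.src s))) (q.mor s ⬝ u) (B.idc (q.mor s ⬝ u)) u := by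
  have h' := a.mor_comp_lift (.unitSquare s) h
  rw [a.mor_unit] at h'
  grind

theorem lift_comp {i : J.Obj} {u v : B.Mor} (h : B.src u = q.obj i) (h' : B.tgt u = B.src v) :
    a.lift i (u ⬝ v) = a.lift i u ⬝ a.lift (a.obj i u) v := by
  -- The identity of `a.obj i u` is the value at the identity square of `(i, u)`. A lift out of
  -- `a.obj i u` is therefore an iterated action, which `mor_assoc` turns into a single one.
  have e : IsSquare q (a.mor (J.one i) u (B.one (B.tgt u)) (B.idc u) u)
      (B.one (B.tgt u)) v (B.idc v) v := by
    rw [a.mor_one _ _ h]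
    constructor <;> grind [a.map_obj i u h]
  have e₁ := a.mor_assoc (by constructor <;> grind) e
  have e₂ := a.lift_comp_mor (s := J.one i) (u := u) (t := v) (ζ := B.idc (u ⬝ v)) (u' := u ⬝ v)
    (by constructor <;> grind)
  rw [a.mor_one _ _ h] at e₁
  rw [J.src_one] at e₂
  have e₃ : a.lift (a.obj i u) v = a.mor (J.one (a.obj i u)) (B.one (B.tgt u)) v (B.idc v) v := by
    rw [lift, a.map_obj i u h]
  rw [e₃, e₁, lift]
  grind

theorem lift_one (i : J.Obj) : a.lift i (B.one (q.obj i)) = J.one i := by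
  have := a.mor_one i (B.one (q.obj i)) (by grind)
  grind [lift, a.obj_unit]

theorem cellLift_idc (s : J.Mor) : a.cellLift s (B.idc (q.mor s)) = J.idc s := by
  have := a.cell_unit (J.idc s)
  grind [cellLift]

/-- The value at a square lies over its side `t`, so a second square can be stacked on the first as
soon as their boundaries in `B` fit. -/
theorem isSquare_mor {s : J.Mor} {u t : B.Mor} {ζ : B.Cell} {u' v w v' : B.Mor} {ξ : B.Cell}
    (h : IsSquare q s u t ζ u') (hu : B.src v = B.tgt u) (hu' : B.src v' = B.tgt u')
    (hv : B.src w = B.tgt v) (hv' : B.tgt w = B.tgt v') (hd : B.dom ξ = v ⬝ w)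
    (hc : B.cod ξ = t ⬝ v') : IsSquare q (a.mor s u t ζ u') v w ξ v' where
  src_top := by rw [a.src_mor h, a.map_obj _ _ h.src_top, hu]
  src_bot := by rw [a.tgt_mor h, a.map_obj _ _ h.src_bot, hu']
  src_right := hv
  tgt_right := hv'
  dom_cell := hd
  cod_cell := by rw [a.map_mor h, hc]

/-- Lifting `γ` at a value of the action is an iterated action; associativity merges the two into
the action of the pair `(𝟙 s, γ)`, seen as a cell from the square pasted with `γ` to the square `ζ`.
-/
theorem cellLift_mor {s : J.Mor} {u t : B.Mor} {ζ γ : B.Cell} {u' : B.Mor}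
    (h : IsSquare q s u t ζ u') (e : B.cod γ = t) : a.cellLift (a.mor s u t ζ u') γ =
      a.cell (J.idc s) u γ ((B.idc u ∗ γ) ⊙ ζ) ζ u' := by
  have h₁ : IsSquareCell q (a.cell (J.idc s) u (B.idc t) ζ ζ u') (B.one (B.tgt u)) γ γ
      (B.idc t) (B.one (B.tgt u')) := by
    have := a.isSquare_mor h (v := B.one (B.tgt u)) (w := B.dom γ) (ξ := γ)
      (v' := B.one (B.tgt u')) (by grind) (by grind) (by grind) (by grind) (by grind) (by grind)
    have := a.isSquare_mor h (v := B.one (B.tgt u)) (w := B.cod γ) (ξ := B.idc t)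
      (v' := B.one (B.tgt u')) (by grind) (by grind) (by grind) (by grind) (by grind) (by grind)
    have := a.map_mor h
    rw [a.cell_idc h]
    constructor <;> grind
  have h₂ := a.cell_assoc (.id h) h₁
  rw [a.cell_idc h] at h₂
  rw [cellLift, a.src_mor h, a.tgt_mor h, a.map_mor h, a.map_obj _ _ h.src_top,
    a.map_obj _ _ h.src_bot, h₂]
  grind

theorem cellLift_vcomp {s : J.Mor} {γ β : B.Cell} (h : B.cod γ = B.dom β)
    (h' : B.cod β = q.mor s) : a.cellLift s (γ ⊙ β) =
      a.cellLift (J.dom (a.cellLift s β)) γ ⊙ a.cellLift s β := by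
  rw [a.dom_cellLift h', a.cellLift_mor (.pullSquare h') h]
  have e := a.cell_vcomp (σ := J.idc s) (σ' := J.idc s) (u := B.one (q.obj (J.src s))) (τ := γ)
    (τ' := β) (ζ := γ ⊙ β) (ζ' := β) (ζ'' := B.idc (q.mor s)) (u' := B.one (q.obj (J.tgt s)))
    (by constructor <;> (try constructor) <;> grind) (.liftCell h') (by grind) h
  grind [cellLift]

theorem cellLift_hcomp {s t : J.Mor} {β γ : B.Cell} (h : B.cod β = q.mor s)
    (h' : B.cod γ = q.mor t) (e : J.tgt s = J.src t) :
    a.cellLift (s ⬝ t) (β ∗ γ) = a.cellLift s β ∗ a.cellLift t γ := by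
  have h₁ : IsSquareCell q (J.idc t) (B.one (q.obj (J.tgt s))) γ γ (B.idc (q.mor t))
      (B.one (q.obj (J.tgt t))) := by
    rw [e]; exact .liftCell h'
  have h₂ := a.cell_hcomp (.liftCell h) h₁ (by grind)
  -- Side by side, two squares between identity arrows paste to the horizontal composite of their
  -- cells; this is where interchange enters.
  have e₁ : (β ∗ B.idc (B.dom γ)) ⊙ (B.idc (q.mor (J.dom (J.idc s))) ∗ γ) = β ∗ γ := by
    rw [← B.interchange _ _ _ _ (by grind) (by grind) (by grind)]; grind
  have e₂ : (B.idc (q.mor s) ∗ B.idc (B.cod γ)) ⊙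
      (B.idc (q.mor (J.cod (J.idc s))) ∗ B.idc (q.mor t)) = B.idc (q.mor (s ⬝ t)) := by grind
  rw [e₁, e₂, J.idc_hcomp_idc _ _ e] at h₂
  simp only [cellLift]
  rw [← e, ← h₂]
  grind

/-- The heart of opcartesianness. Since `a.lift i u` is itself a value of the action, associativity
stacks the two squares; the result is the identity square of `(i, u)`. -/
theorem mor_lift_self {i : J.Obj} {u : B.Mor} (h : B.src u = q.obj i) :
    a.mor (a.lift i u) u (B.one (B.tgt u)) (B.idc u) (B.one (B.tgt u)) = J.one (a.obj i u) := by
  have e := a.mor_assoc (.liftSquare h) (a.isSquare_mor (v := u) (w := B.one (B.tgt u))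
    (ξ := B.idc u) (v' := B.one (B.tgt u)) (.liftSquare h) (by grind) (by grind) (by grind)
    (by grind) (by grind) (by grind))
  rw [lift, e, ← a.mor_one i u h]
  grind

theorem isSquare_lift {i : J.Obj} {u : B.Mor} (h : B.src u = q.obj i) :
    IsSquare q (a.lift i u) u (B.one (B.tgt u)) (B.idc u) (B.one (B.tgt u)) where
  src_top := by rw [a.src_lift h, h]
  src_bot := by rw [a.tgt_lift h, a.map_obj _ _ h, B.src_one]
  src_right := by grind
  tgt_right := by grind
  dom_cell := by grind
  cod_cell := by grind [a.mor_lift h]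

/-- The square in question is that of `mor_lift_self` followed by the unit square of `x`, so its
value is an identity followed by `x`. Thus `x` is determined by `q.mor x` and its composite with the
lift. -/
theorem mor_lift_comp {i : J.Obj} {u : B.Mor} {x : J.Mor} (h : B.src u = q.obj i)
    (hx : J.src x = a.obj i u) : a.mor (a.lift i u ⬝ x) u (q.mor x) (B.idc (u ⬝ q.mor x))
      (B.one (q.obj (J.tgt x))) = x := by
  have h₁ := a.mor_comp (a.isSquare_lift h) (s' := x) (u'' := B.one (q.obj (J.tgt x)))
    (t' := q.mor x) (ζ' := B.idc (q.mor x)) (by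
      have := IsSquare.unitSquare (q := q) x
      rwa [hx, a.map_obj _ _ h] at this) (by rw [a.tgt_lift h, hx])
  have h₂ := a.mor_unit x
  rw [hx, a.map_obj _ _ h] at h₂
  have := a.map_obj _ _ h
  rw [a.mor_lift_self h, a.mor_lift h, h₂, J.one_comp _ _ hx.symm] at h₁
  grind

theorem cell_lift_hcomp {i : J.Obj} {u : B.Mor} {τ : J.Cell} (h : B.src u = q.obj i)
    (hτ : J.src (J.dom τ) = a.obj i u) : a.cell (J.idc (a.lift i u) ∗ τ) u (q.cell τ)
      (B.idc (u ⬝ q.mor (J.dom τ))) (B.idc (u ⬝ q.mor (J.cod τ)))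
      (B.one (q.obj (J.tgt (J.dom τ)))) = τ := by
  have e := a.map_obj _ _ h
  have h₁ := a.cell_hcomp (.id (a.isSquare_lift h)) (σ' := τ)
    (u'' := B.one (q.obj (J.tgt (J.dom τ)))) (τ' := q.cell τ) (ζ' := B.idc (q.mor (J.dom τ)))
    (ζ₁' := B.idc (q.mor (J.cod τ))) (by constructor <;> (try constructor) <;> grind)
      (by grind [a.tgt_lift h])
  have h₂ := a.cell_unit τ
  rw [hτ, e] at h₂
  rw [a.cell_idc (a.isSquare_lift h), a.mor_lift_self h, h₂, J.one_hcomp _ _ hτ.symm] at h₁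
  have := a.mor_lift h
  grind

theorem lift_hcomp_cell {σ : J.Cell} {u : B.Mor} {τ ζ ζ' : B.Cell} {u' : B.Mor}
    (h : IsSquareCell q σ u τ ζ ζ' u') :
    J.idc (a.lift (J.src (J.dom σ)) u) ∗ a.cell σ u τ ζ ζ' u' =
      a.cell σ (B.one (q.obj (J.src (J.dom σ)))) (B.idc u ∗ τ) ζ ζ' u' := by
  have h₁ := a.cell_hcomp (.id (.liftSquare h.dom.src_top)) h (by grind)
  rw [a.cell_idc (.liftSquare h.dom.src_top)] at h₁
  have := h.dom
  have := h.cod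
  grind [lift]

theorem existsUnique_mor {i : J.Obj} {u v : B.Mor} {s : J.Mor} (hu : B.src u = q.obj i)
    (huv : B.tgt u = B.src v) (hs : J.src s = i) (e : q.mor s = u ⬝ v) :
    ∃! x, J.src x = J.tgt (a.lift i u) ∧ q.mor x = v ∧ a.lift i u ⬝ x = s := by
  -- The equation `q.mor s = u ⬝ v` is read as an identity-filled square from `u` to an identity
  -- arrow; the action on it is the required factorisation.
  have h : IsSquare q s u v (B.idc (u ⬝ v)) (B.one (q.obj (J.tgt s))) := by
    have := q.tgt_mor s
    constructor <;> grind
  refine ⟨a.mor s u v (B.idc (u ⬝ v)) (B.one (q.obj (J.tgt s))), ⟨?_, a.map_mor h, ?_⟩, ?_⟩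
  · rw [a.src_mor h, a.tgt_lift hu, hs]
  · subst hs
    rw [a.lift_comp_mor h, ← e, a.mor_unit]
  · rintro x ⟨h₁, rfl, rfl⟩
    rw [a.tgt_lift hu] at h₁
    rw [J.tgt_comp _ _ (by rw [a.tgt_lift hu, h₁]), a.mor_lift_comp hu h₁]

theorem existsUnique_cell {i : J.Obj} {u : B.Mor} {x x' : J.Mor} {σ : J.Cell} {β : B.Cell}
    (hu : B.src u = q.obj i) (hx : J.src x = J.tgt (a.lift i u))
    (hx' : J.src x' = J.tgt (a.lift i u)) (hxx' : J.tgt x = J.tgt x')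
    (hd : J.dom σ = a.lift i u ⬝ x) (hc : J.cod σ = a.lift i u ⬝ x') (hd' : B.dom β = q.mor x)
    (hc' : B.cod β = q.mor x') (e : q.cell σ = B.idc u ∗ β) :
    ∃! τ, J.dom τ = x ∧ J.cod τ = x' ∧ q.cell τ = β ∧ J.idc (a.lift i u) ∗ τ = σ := by
  have h₁ := a.tgt_lift hu
  have h₂ := a.map_obj _ _ hu
  have h₃ := a.src_lift hu
  have h₄ := a.mor_lift hu
  -- The hypothesis on `q.cell σ` says that `σ` and `β` form a cell between the identity-filled
  -- squares that produce `x` and `x'`.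
  have h : IsSquareCell q σ u β (B.idc (u ⬝ q.mor x)) (B.idc (u ⬝ q.mor x'))
      (B.one (q.obj (J.tgt x))) := by
    constructor <;> (try constructor) <;> grind
  refine ⟨a.cell σ u β (B.idc (u ⬝ q.mor x)) (B.idc (u ⬝ q.mor x')) (B.one (q.obj (J.tgt x))),
    ⟨?_, ?_, a.map_cell h, ?_⟩, ?_⟩
  · rw [a.dom_cell h, hd, hd', a.mor_lift_comp hu (hx.trans h₁)]
  · rw [a.cod_cell h, hc, hc', hxx', a.mor_lift_comp hu (hx'.trans h₁)]
  · have h₅ := a.lift_hcomp_cell h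
    have h₆ := a.cell_unit σ
    have : J.src (J.dom σ) = i := by grind
    rw [this] at h₅ h₆
    rw [h₅, ← h₆]
    grind
  · rintro τ ⟨rfl, rfl, rfl, rfl⟩
    exact (a.cell_lift_hcomp hu (hx.trans h₁)).symm

/-- The counterpart of `mor_lift_self` for cells: `cellLift s β` is a value of the action, and
associativity turns the iterated action into the action on the identity cell of the square `β`. -/
theorem cell_cellLift_self {s : J.Mor} {β : B.Cell} (h : B.cod β = q.mor s) :
    a.cell (a.cellLift s β) (B.one (q.obj (J.src s))) (B.idc (B.dom β)) (B.idc (B.dom β)) β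
      (B.one (q.obj (J.tgt s))) = J.idc (J.dom (a.cellLift s β)) := by
  have h₁ : IsSquareCell q (a.cellLift s β) (B.one (q.obj (J.src s))) (B.idc (B.dom β))
      (B.idc (B.dom β)) β (B.one (q.obj (J.tgt s))) := by
    have e₁ := a.isSquare_mor (.pullSquare h) (v := B.one (q.obj (J.src s))) (w := B.dom β)
      (ξ := B.idc (B.dom β)) (v' := B.one (q.obj (J.tgt s))) (by grind) (by grind) (by grind)
      (by grind) (by grind) (by grind)
    have e₂ := IsSquare.pullSquare h
    have e₃ := a.cell_cellLift h
    rw [← a.dom_cellLift h] at e₁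
    constructor
    · grind
    · grind [a.cod_cellLift h]
    · grind
  have h₂ := a.cell_assoc (.liftCell h) h₁
  rw [a.dom_cellLift h, ← a.cell_idc (.pullSquare h), cellLift, h₂]
  grind

theorem existsUnique_cellLift {s : J.Mor} {α β : B.Cell} {σ : J.Cell} (hβ : B.cod β = q.mor s)
    (hσ : J.cod σ = s) (hαβ : B.cod α = B.dom β) (e : q.cell σ = α ⊙ β) :
    ∃! ω, J.cod ω = J.dom (a.cellLift s β) ∧ q.cell ω = α ∧ ω ⊙ a.cellLift s β = σ := by
  have h : IsSquareCell q σ (B.one (q.obj (J.src s))) α (B.idc (q.mor (J.dom σ))) β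
      (B.one (q.obj (J.tgt s))) := by
    have := q.dom_cell σ
    constructor <;> (try constructor) <;> grind
  -- The factorisation is the value at the pair `(σ, α)`, viewed as a cell from the unit square of
  -- the domain of `σ` to the square `β`.
  refine ⟨a.cell σ (B.one (q.obj (J.src s))) α (B.idc (q.mor (J.dom σ))) β
      (B.one (q.obj (J.tgt s))), ⟨?_, a.map_cell h, ?_⟩, ?_⟩
  · rw [a.cod_cell h, a.dom_cellLift hβ, hσ, hαβ]
  · have h₁ := a.cell_vcomp h (.liftCell hβ) (by grind) hαβ
    have h₂ := a.cell_unit σ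
    grind [cellLift]
  · rintro ω ⟨h₁, rfl, rfl⟩
    have h₂ := a.cod_cellLift hβ
    have h₃ := a.cell_cellLift hβ
    have h₄ := a.cell_unit ω
    have h₆ : J.src (J.dom ω) = J.src s := by grind
    have h₇ : J.tgt (J.dom ω) = J.tgt s := by grind
    -- For uniqueness the value at `ω ⊙ cellLift s β` is split in two: the first factor is the unit
    -- cell of `ω`, with value `ω`, and the second has an identity as its value by
    -- `cell_cellLift_self`.
    have h₅ := a.cell_vcomp (σ := ω) (σ' := a.cellLift s β) (u := B.one (q.obj (J.src s)))
      (τ := q.cell ω) (τ' := B.idc (B.dom β)) (ζ := B.idc (q.mor (J.dom ω)))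
      (ζ' := B.idc (B.dom β)) (ζ'' := β) (u' := B.one (q.obj (J.tgt s)))
      (by constructor <;> (try constructor) <;> grind)
      (by constructor <;> (try constructor) <;> grind) h₁ (by grind)
    have h₈ : q.mor (J.cod ω) = B.dom β := by rw [← q.cod_cell, hαβ]
    rw [h₆, h₇, h₈] at h₄
    rw [a.cell_cellLift_self hβ, h₄, J.vcomp_idc _ _ h₁.symm] at h₅
    grind

/-- The lifts of morphisms and cells that are induced by an action. -/
def lifting : Lifting q where
  lift := a.lift
  cellLift := a.cellLift
  src_lift _ _ h := a.src_lift h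
  mor_lift _ _ h := a.mor_lift h
  cod_cellLift _ _ h := a.cod_cellLift h
  cell_cellLift _ _ h := a.cell_cellLift h
  lift_comp _ _ _ h h' := by rw [a.lift_comp h h', a.tgt_lift h]
  lift_one := a.lift_one
  cellLift_vcomp _ _ _ h h' := a.cellLift_vcomp h h'
  cellLift_hcomp _ _ _ _ h h' e := a.cellLift_hcomp h h' e
  cellLift_idc := a.cellLift_idc
  existsUnique_mor _ _ _ _ h h' h'' e := a.existsUnique_mor h h' h'' e
  existsUnique_cell _ _ _ _ _ _ h h₁ h₂ h₃ h₄ h₅ h₆ h₇ e :=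
    a.existsUnique_cell h h₁ h₂ h₃ h₄ h₅ h₆ h₇ e
  existsUnique_cellLift _ _ _ _ h h' h'' e := a.existsUnique_cellLift h h' h'' e

/-- This expresses every value of an action through its lifts: as the lift of `u` is opcartesian,
the equation together with `map_mor` pins down the value at the square. Both sides are the value at
the same cell `ζ`, regarded as a square out of `(i, 1)`. -/
theorem lift_comp_mor_eq {s : J.Mor} {u t : B.Mor} {ζ : B.Cell} {u' : B.Mor}
    (h : IsSquare q s u t ζ u') : a.lift (J.src s) u ⬝ a.mor s u t ζ u' =
      J.dom (a.cellLift (s ⬝ a.lift (J.tgt s) u') ζ) := by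
  have h₁ : IsSquare q s (B.one (q.obj (J.src s))) (q.mor s ⬝ u') (B.idc (q.mor s ⬝ u')) u' := by
    constructor <;> grind
  have h₂ : IsSquareCell q (J.idc s) (B.one (q.obj (J.src s))) ζ
      ((B.idc (B.one (q.obj (J.src s))) ∗ ζ) ⊙ B.idc (q.mor s ⬝ u')) (B.idc (q.mor s ⬝ u')) u' := by
    constructor <;> (try constructor) <;> grind
  rw [a.comp_lift h.src_bot, a.cellLift_mor h₁ h.cod_cell, a.dom_cell h₂, a.lift_comp_mor h]
  grind

/-- The equation that determines values at cells from the lifts. Each of the four factors is itself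
a value of the action, so that both sides become values at a vertical composite. -/
theorem lift_hcomp_cell_eq {σ : J.Cell} {u : B.Mor} {τ ζ ζ' : B.Cell} {u' : B.Mor}
    (h : IsSquareCell q σ u τ ζ ζ' u') :
    (J.idc (a.lift (J.src (J.dom σ)) u) ∗ a.cell σ u τ ζ ζ' u') ⊙
        a.cellLift (J.cod σ ⬝ a.lift (J.tgt (J.dom σ)) u') ζ' =
      a.cellLift (J.dom σ ⬝ a.lift (J.tgt (J.dom σ)) u') ζ ⊙
        (σ ∗ J.idc (a.lift (J.tgt (J.dom σ)) u')) := by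
  have hd := h.dom
  have hc := h.cod
  have hw := h.w
  have h₁ (s : J.Mor) (hs : J.src s = J.src (J.dom σ)) (hs' : J.tgt s = J.tgt (J.dom σ)) :
      IsSquare q s (B.one (q.obj (J.src (J.dom σ)))) (q.mor s ⬝ u') (B.idc (q.mor s ⬝ u')) u' := by
    constructor <;> grind
  have h₃ (ζ : B.Cell) (s : J.Mor) (hs : J.src s = J.src (J.dom σ))
      (hs' : J.tgt s = J.tgt (J.dom σ)) (hζ : B.cod ζ = q.mor s ⬝ u') :
      a.cellLift (s ⬝ a.lift (J.tgt (J.dom σ)) u') ζ =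
        a.cell (J.idc s) (B.one (q.obj (J.src (J.dom σ)))) ζ ζ (B.idc (q.mor s ⬝ u')) u' := by
    have e := a.comp_lift (s := s) (u := u') (by grind)
    rw [hs', hs] at e
    rw [e, a.cellLift_mor (h₁ s hs hs') hζ]
    grind
  have h₄ (s : J.Mor) (ζ : B.Cell) (hs : J.src s = J.src (J.dom σ))
      (hs' : J.tgt s = J.tgt (J.dom σ)) (hζ : B.cod ζ = q.mor s ⬝ u') :
      IsSquareCell q (J.idc s) (B.one (q.obj (J.src (J.dom σ)))) ζ ζ (B.idc (q.mor s ⬝ u'))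
        u' := by
    constructor <;> (try constructor) <;> grind
  have h₅ : σ ∗ J.idc (a.lift (J.tgt (J.dom σ)) u') = a.cell σ
      (B.one (q.obj (J.src (J.dom σ)))) (q.cell σ ∗ B.idc u') (B.idc (q.mor (J.dom σ) ⬝ u'))
      (B.idc (q.mor (J.cod σ) ⬝ u')) u' := by
    have e₁ := a.cell_hcomp (σ := σ) (u := B.one (q.obj (J.src (J.dom σ)))) (τ := q.cell σ)
      (ζ := B.idc (q.mor (J.dom σ))) (ζ₁ := B.idc (q.mor (J.cod σ)))
      (u' := B.one (q.obj (J.tgt (J.dom σ)))) (by constructor <;> (try constructor) <;> grind)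
      (.id (.liftSquare hd.src_bot)) (by grind)
    rw [a.cell_unit, a.cell_idc (.liftSquare hd.src_bot)] at e₁
    rw [lift, ← e₁]
    grind
  -- After the composites are merged, the components in `B` of the two sides are the two sides of
  -- the compatibility condition `hw`.
  rw [a.lift_hcomp_cell h, h₃ ζ' _ (by grind) (by grind) (by grind),
    h₃ ζ _ (by grind) (by grind) (by grind), h₅,
    ← a.cell_vcomp _ (h₄ _ _ (by grind) (by grind) (by grind)) (by grind) (by grind),
    ← a.cell_vcomp (h₄ _ _ (by grind) (by grind) (by grind)) _ (by grind) (by grind), hw]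
  · grind
  · constructor <;> (try constructor) <;> grind
  · constructor <;> (try constructor) <;> grind

end Action
end TotalTwoCat

/-! ### From lifts to an action: definition and uniqueness of the values -/

namespace TotalTwoCat
variable {J B : TotalTwoCat.{u}} {q : Functor J B}

namespace Lifting

attribute [grind =] src_lift mor_lift cod_cellLift cell_cellLift lift_one cellLift_idc

variable (r : Lifting q)

theorem map_dom_cellLift {s : J.Mor} {β : B.Cell} (h : B.cod β = q.mor s) :
    q.mor (J.dom (r.cellLift s β)) = B.dom β := by
  rw [← q.dom_cell, r.cell_cellLift s β h]

theorem src_dom_cellLift {s : J.Mor} {β : B.Cell} (h : B.cod β = q.mor s) :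
    J.src (J.dom (r.cellLift s β)) = J.src s := by
  rw [← J.src_cod, r.cod_cellLift s β h]

theorem tgt_dom_cellLift {s : J.Mor} {β : B.Cell} (h : B.cod β = q.mor s) :
    J.tgt (J.dom (r.cellLift s β)) = J.tgt s := by
  rw [← J.tgt_cod, r.cod_cellLift s β h]

theorem obj_tgt_lift {i : J.Obj} {u : B.Mor} (h : B.src u = q.obj i) :
    q.obj (J.tgt (r.lift i u)) = B.tgt u := by
  rw [← q.tgt_mor, r.mor_lift i u h]

attribute [grind =] map_dom_cellLift src_dom_cellLift tgt_dom_cellLift obj_tgt_lift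

/-- Splitness makes the lift of an identity cell an identity, so lifting commutes with whiskering.
The arrow `v` is kept apart from `q.mor t` so that the rule applies before that equality is
rewritten. -/
theorem cellLift_comp_idc {s t : J.Mor} {β : B.Cell} {v : B.Mor} (h : B.cod β = q.mor s)
    (e : J.tgt s = J.src t) (hv : q.mor t = v) :
    r.cellLift (s ⬝ t) (β ∗ B.idc v) = r.cellLift s β ∗ J.idc t := by
  subst hv
  rw [r.cellLift_hcomp s t β _ h (B.cod_idc _) e, r.cellLift_idc]

theorem cellLift_idc_comp {s t : J.Mor} {β : B.Cell} {v : B.Mor} (h : B.cod β = q.mor t)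
    (e : J.tgt s = J.src t) (hv : q.mor s = v) :
    r.cellLift (s ⬝ t) (B.idc v ∗ β) = J.idc s ∗ r.cellLift t β := by
  subst hv
  rw [r.cellLift_hcomp s t _ β (B.cod_idc _) h e, r.cellLift_idc]

theorem dom_cellLift_comp_idc {s t : J.Mor} {β : B.Cell} {v : B.Mor} (h : B.cod β = q.mor s)
    (e : J.tgt s = J.src t) (hv : q.mor t = v) :
    J.dom (r.cellLift (s ⬝ t) (β ∗ B.idc v)) = J.dom (r.cellLift s β) ⬝ t := by
  rw [r.cellLift_comp_idc h e hv, J.dom_hcomp] <;> grind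

theorem dom_cellLift_idc_comp {s t : J.Mor} {β : B.Cell} {v : B.Mor} (h : B.cod β = q.mor t)
    (e : J.tgt s = J.src t) (hv : q.mor s = v) :
    J.dom (r.cellLift (s ⬝ t) (B.idc v ∗ β)) = s ⬝ J.dom (r.cellLift t β) := by
  rw [r.cellLift_idc_comp h e hv, J.dom_hcomp] <;> grind

/-- Cancellation of an opcartesian lift. Together with `cell_ext` and `cellLift_ext` this is the
only form in which uniqueness is used below. -/
theorem mor_ext {i : J.Obj} {u : B.Mor} {x y : J.Mor} (h : B.src u = q.obj i)
    (hx : J.src x = J.tgt (r.lift i u)) (hy : J.src y = J.tgt (r.lift i u))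
    (e : q.mor x = q.mor y) (e' : r.lift i u ⬝ x = r.lift i u ⬝ y) : x = y :=
  (r.existsUnique_mor i u (q.mor y) (r.lift i u ⬝ y) h (by grind) (by grind) (by grind)).unique
    ⟨hx, e, e'⟩ ⟨hy, rfl, rfl⟩

theorem cell_ext {i : J.Obj} {u : B.Mor} {τ τ' : J.Cell} (h : B.src u = q.obj i)
    (hτ : J.src (J.dom τ) = J.tgt (r.lift i u)) (hd : J.dom τ = J.dom τ')
    (hc : J.cod τ = J.cod τ') (e : q.cell τ = q.cell τ')
    (e' : J.idc (r.lift i u) ∗ τ = J.idc (r.lift i u) ∗ τ') : τ = τ' :=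
  (r.existsUnique_cell i u (J.dom τ') (J.cod τ') (J.idc (r.lift i u) ∗ τ') (q.cell τ') h
    (by grind) (by grind) (by grind) (by grind) (by grind) (by grind) (by grind)
    (by grind)).unique ⟨hd, hc, e, e'⟩ ⟨rfl, rfl, rfl, rfl⟩

theorem cellLift_ext {s : J.Mor} {β : B.Cell} {ω ω' : J.Cell} (h : B.cod β = q.mor s)
    (hc : J.cod ω = J.dom (r.cellLift s β)) (hc' : J.cod ω' = J.dom (r.cellLift s β))
    (e : q.cell ω = q.cell ω') (e' : ω ⊙ r.cellLift s β = ω' ⊙ r.cellLift s β) : ω = ω' :=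
  (r.existsUnique_cellLift s (q.cell ω') β (ω' ⊙ r.cellLift s β) h (by grind) (by grind)
    (by grind)).unique ⟨hc, e, e'⟩ ⟨hc', rfl, rfl⟩

/-- The domain of the lift of `ζ` at `s ⬝ lift u'` lies over `u ⬝ t`, hence factors through the
opcartesian lift of `u`. -/
theorem exists_mor {s : J.Mor} {u t : B.Mor} {ζ : B.Cell} {u' : B.Mor}
    (h : IsSquare q s u t ζ u') : ∃ x, J.src x = J.tgt (r.lift (J.src s) u) ∧ q.mor x = t ∧
      r.lift (J.src s) u ⬝ x = J.dom (r.cellLift (s ⬝ r.lift (J.tgt s) u') ζ) := by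
  have hc : B.cod ζ = q.mor (s ⬝ r.lift (J.tgt s) u') := by grind
  exact (r.existsUnique_mor _ u t _ h.src_top h.src_right.symm (by grind) (by grind)).exists

open Classical in
/-- The action of a morphism of `B^𝟚` that is induced by lifts. -/
noncomputable def mor (s : J.Mor) (u t : B.Mor) (ζ : B.Cell) (u' : B.Mor) : J.Mor :=
  -- The value off squares is arbitrary, since the laws of an action only speak of squares.
  if h : IsSquare q s u t ζ u' then (r.exists_mor h).choose else s

section
variable {s : J.Mor} {u t : B.Mor} {ζ : B.Cell} {u' : B.Mor} (h : IsSquare q s u t ζ u')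
include h

theorem src_mor : J.src (r.mor s u t ζ u') = J.tgt (r.lift (J.src s) u) := by
  rw [mor, dif_pos h]; exact (r.exists_mor h).choose_spec.1

theorem map_mor : q.mor (r.mor s u t ζ u') = t := by
  rw [mor, dif_pos h]; exact (r.exists_mor h).choose_spec.2.1

theorem lift_comp_mor : r.lift (J.src s) u ⬝ r.mor s u t ζ u' =
    J.dom (r.cellLift (s ⬝ r.lift (J.tgt s) u') ζ) := by
  rw [mor, dif_pos h]; exact (r.exists_mor h).choose_spec.2.2

theorem cod_eq : B.cod ζ = q.mor (s ⬝ r.lift (J.tgt s) u') := by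
  grind

theorem tgt_mor : J.tgt (r.mor s u t ζ u') = J.tgt (r.lift (J.tgt s) u') := by
  have e := congrArg J.tgt (r.lift_comp_mor h)
  rw [J.tgt_comp _ _ (r.src_mor h).symm, r.tgt_dom_cellLift (r.cod_eq h)] at e
  grind

/-- The tool behind each law for morphisms: it suffices to check that the other side of the law
solves the defining equation. -/
theorem mor_eq {x : J.Mor} (hx : J.src x = J.tgt (r.lift (J.src s) u)) (e : q.mor x = t)
    (e' : r.lift (J.src s) u ⬝ x = J.dom (r.cellLift (s ⬝ r.lift (J.tgt s) u') ζ)) :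
    r.mor s u t ζ u' = x :=
  r.mor_ext h.src_top (r.src_mor h) hx ((r.map_mor h).trans e.symm)
    ((r.lift_comp_mor h).trans e'.symm)

end

theorem exists_cell {σ : J.Cell} {u : B.Mor} {τ ζ ζ' : B.Cell} {u' : B.Mor}
    (h : IsSquareCell q σ u τ ζ ζ' u') : ∃ κ, J.dom κ = r.mor (J.dom σ) u (B.dom τ) ζ u' ∧
      J.cod κ = r.mor (J.cod σ) u (B.cod τ) ζ' u' ∧ q.cell κ = τ ∧
      (J.idc (r.lift (J.src (J.dom σ)) u) ∗ κ) ⊙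
          r.cellLift (J.cod σ ⬝ r.lift (J.tgt (J.dom σ)) u') ζ' =
        r.cellLift (J.dom σ ⬝ r.lift (J.tgt (J.dom σ)) u') ζ ⊙
          (σ ∗ J.idc (r.lift (J.tgt (J.dom σ)) u')) := by
  have hd := h.dom
  have hc := h.cod
  have ed := r.cod_eq hd
  have ec := r.cod_eq hc
  have hw := h.w
  have ld := r.lift_comp_mor hd
  have lc := r.lift_comp_mor hc
  have sd := r.src_mor hd
  have sc := r.src_mor hc
  have td := r.tgt_mor hd
  have tc := r.tgt_mor hc
  have md := r.map_mor hd
  have mc := r.map_mor hc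
  rw [J.tgt_cod] at ec lc tc
  rw [J.src_cod] at lc sc
  -- By `h.w` the right-hand composite lies over `(u ∗ τ) ⊙ ζ'`, so it factors through the cartesian
  -- lift of `ζ'` by a cell over `u ∗ τ`.
  obtain ⟨κ, hκ, eκ, wκ⟩ := (r.existsUnique_cellLift (J.cod σ ⬝ r.lift (J.tgt (J.dom σ)) u')
    (B.idc u ∗ τ) ζ' (r.cellLift (J.dom σ ⬝ r.lift (J.tgt (J.dom σ)) u') ζ ⊙
      (σ ∗ J.idc (r.lift (J.tgt (J.dom σ)) u'))) ec (by grind) (by grind) (by grind)).exists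
  have dκ : J.dom κ = J.dom (r.cellLift (J.dom σ ⬝ r.lift (J.tgt (J.dom σ)) u') ζ) := by
    have := congrArg J.dom wκ
    rwa [J.dom_vcomp _ _ hκ, J.dom_vcomp _ _ (by grind)] at this
  -- Both ends of `κ` begin with the lift of `u`; the universal property of that lift for cells
  -- strips it off.
  obtain ⟨x, h₁, h₂, h₃, h₄⟩ := (r.existsUnique_cell (J.src (J.dom σ)) u
    (r.mor (J.dom σ) u (B.dom τ) ζ u') (r.mor (J.cod σ) u (B.cod τ) ζ' u') κ τ
    (by grind) (by grind) (by grind) (by grind) (by grind) (by grind) (by grind) (by grind)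
    (by grind)).exists
  exact ⟨x, h₁, h₂, h₃, h₄ ▸ wκ⟩

open Classical in
/-- The action of a cell of `B^𝟚` that is induced by lifts. -/
noncomputable def cell (σ : J.Cell) (u : B.Mor) (τ ζ ζ' : B.Cell) (u' : B.Mor) : J.Cell :=
  if h : IsSquareCell q σ u τ ζ ζ' u' then (r.exists_cell h).choose else σ

section
variable {σ : J.Cell} {u : B.Mor} {τ ζ ζ' : B.Cell} {u' : B.Mor}
  (h : IsSquareCell q σ u τ ζ ζ' u')
include h

theorem dom_cell : J.dom (r.cell σ u τ ζ ζ' u') = r.mor (J.dom σ) u (B.dom τ) ζ u' := by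
  rw [cell, dif_pos h]; exact (r.exists_cell h).choose_spec.1

theorem cod_cell : J.cod (r.cell σ u τ ζ ζ' u') = r.mor (J.cod σ) u (B.cod τ) ζ' u' := by
  rw [cell, dif_pos h]; exact (r.exists_cell h).choose_spec.2.1

theorem map_cell : q.cell (r.cell σ u τ ζ ζ' u') = τ := by
  rw [cell, dif_pos h]; exact (r.exists_cell h).choose_spec.2.2.1

theorem lift_hcomp_cell :
    (J.idc (r.lift (J.src (J.dom σ)) u) ∗ r.cell σ u τ ζ ζ' u') ⊙
        r.cellLift (J.cod σ ⬝ r.lift (J.tgt (J.dom σ)) u') ζ' =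
      r.cellLift (J.dom σ ⬝ r.lift (J.tgt (J.dom σ)) u') ζ ⊙
        (σ ∗ J.idc (r.lift (J.tgt (J.dom σ)) u')) := by
  rw [cell, dif_pos h]; exact (r.exists_cell h).choose_spec.2.2.2

theorem cell_eq {κ : J.Cell} (hd : J.dom κ = r.mor (J.dom σ) u (B.dom τ) ζ u')
    (hc : J.cod κ = r.mor (J.cod σ) u (B.cod τ) ζ' u') (e : q.cell κ = τ)
    (e' : (J.idc (r.lift (J.src (J.dom σ)) u) ∗ κ) ⊙
          r.cellLift (J.cod σ ⬝ r.lift (J.tgt (J.dom σ)) u') ζ' =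
        r.cellLift (J.dom σ ⬝ r.lift (J.tgt (J.dom σ)) u') ζ ⊙
          (σ ∗ J.idc (r.lift (J.tgt (J.dom σ)) u'))) :
    r.cell σ u τ ζ ζ' u' = κ := by
  have h₁ := r.dom_cell h
  have h₂ := r.cod_cell h
  have h₃ := r.map_cell h
  have h₄ := r.src_mor h.dom
  have h₅ := r.lift_comp_mor h.cod
  have h₆ := r.src_mor h.cod
  have h₇ := h.dom
  have ec := r.cod_eq h.cod
  rw [J.src_cod] at h₅ h₆
  rw [J.tgt_cod] at h₅ ec
  refine r.cell_ext (i := J.src (J.dom σ)) (u := u) h.dom.src_top (by grind) (by grind)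
    (by grind) (by grind) ?_
  -- The two universal properties that produced the value are undone in the opposite order: the
  -- opcartesian lift has been cancelled, now the cartesian lift of `ζ'` is.
  refine r.cellLift_ext ec (by grind) (by grind) (by grind) ?_
  rw [r.lift_hcomp_cell h, e']

end

end Lifting
end TotalTwoCat

/-! ### Functoriality of the action induced by lifts -/

namespace TotalTwoCat
variable {J B : TotalTwoCat.{u}} {q : Functor J B}

section
variable (C : TotalTwoCat.{u}) {α α' β β' : C.Cell} {x : C.Mor}

/-- Interchange with one identity factor; this and the three variants after it are the moves of all
pasting calculations below. -/
theorem hcomp_idc_vcomp (h : C.cod α = C.dom α') (hx : x = C.dom β)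
    (e : C.tgt (C.dom α) = C.src (C.dom β)) : (α ∗ C.idc x) ⊙ (α' ∗ β) = (α ⊙ α') ∗ β := by
  rw [← C.interchange _ _ _ _ h (by grind) (by grind), C.idc_vcomp _ _ hx]

theorem hcomp_vcomp_idc (h : C.cod α = C.dom α') (hx : x = C.cod β)
    (e : C.tgt (C.dom α) = C.src (C.dom β)) : (α ∗ β) ⊙ (α' ∗ C.idc x) = (α ⊙ α') ∗ β := by
  rw [← C.interchange _ _ _ _ h (by grind) (by grind), C.vcomp_idc _ _ hx]

theorem idc_hcomp_vcomp (h : C.cod β = C.dom β') (hx : x = C.dom α)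
    (e : C.tgt (C.dom α) = C.src (C.dom β)) : (C.idc x ∗ β) ⊙ (α ∗ β') = α ∗ (β ⊙ β') := by
  rw [← C.interchange _ _ _ _ (by grind) h (by grind), C.idc_vcomp _ _ hx]

theorem vcomp_idc_hcomp (h : C.cod β = C.dom β') (hx : x = C.cod α)
    (e : C.tgt (C.dom α) = C.src (C.dom β)) : (α ∗ β) ⊙ (C.idc x ∗ β') = α ∗ (β ⊙ β') := by
  rw [← C.interchange _ _ _ _ (by grind) h (by grind), C.vcomp_idc _ _ hx]

end

namespace IsSquareCell

theorem vcomp {σ σ' : J.Cell} {u : B.Mor} {τ τ' ζ ζ' ζ'' : B.Cell} {u' : B.Mor}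
    (h : IsSquareCell q σ u τ ζ ζ' u') (h' : IsSquareCell q σ' u τ' ζ' ζ'' u')
    (e : J.cod σ = J.dom σ') (e' : B.cod τ = B.dom τ') :
    IsSquareCell q (σ ⊙ σ') u (τ ⊙ τ') ζ ζ'' u' where
  dom := by
    rw [J.dom_vcomp _ _ e, B.dom_vcomp _ _ e']; exact h.dom
  cod := by
    rw [J.cod_vcomp _ _ e, B.cod_vcomp _ _ e']; exact h'.cod
  w := by
    have h₁ := h.dom
    have h₂ := h.cod
    have h₃ := h'.cod
    have e₁ := B.interchange (q.cell σ) (q.cell σ') (B.idc u') (B.idc u') (by grind) (by grind)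
      (by grind)
    have e₂ := B.interchange (B.idc u) (B.idc u) τ τ' (by grind) (by grind) (by grind)
    have w₁ := h.w
    have w₂ := h'.w
    rw [q.cell_vcomp _ _ e, ← B.vcomp_idc (B.idc u') u' (by grind), e₁,
      ← B.vcomp_idc (B.idc u) u (by grind), e₂, ← B.vcomp_assoc, w₁, B.vcomp_assoc, w₂,
      B.vcomp_assoc] <;> grind

/-- In the pasted diagram the cell over the second square is pushed through first, then the cell
over the first; each push is one use of the given compatibility conditions, separated by
interchange. -/
theorem hcomp {σ σ' : J.Cell} {u u' u'' : B.Mor} {τ τ' ζ ζ₁ ζ' ζ₁' : B.Cell}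
    (h : IsSquareCell q σ u τ ζ ζ₁ u') (h' : IsSquareCell q σ' u' τ' ζ' ζ₁' u'')
    (e : J.tgt (J.dom σ) = J.src (J.dom σ')) :
    IsSquareCell q (σ ∗ σ') u (τ ∗ τ')
      ((ζ ∗ B.idc (B.dom τ')) ⊙ (B.idc (q.mor (J.dom σ)) ∗ ζ'))
      ((ζ₁ ∗ B.idc (B.cod τ')) ⊙ (B.idc (q.mor (J.cod σ)) ∗ ζ₁')) u'' where
  dom := by
    have h₁ := h.dom
    have h₂ := h'.dom
    rw [J.dom_hcomp _ _ e, B.dom_hcomp _ _ (by grind)]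
    exact h₁.comp h₂ e
  cod := by
    have h₁ := h.cod
    have h₂ := h'.cod
    rw [J.cod_hcomp _ _ e, B.cod_hcomp _ _ (by grind)]
    exact h₁.comp h₂ (by grind)
  w := by
    have h₁ := h.dom
    have h₂ := h.cod
    have h₃ := h'.dom
    have h₄ := h'.cod
    have w₁ := h.w
    have w₂ := h'.w
    calc ((ζ ∗ B.idc (B.dom τ')) ⊙ (B.idc (q.mor (J.dom σ)) ∗ ζ')) ⊙
          (q.cell (σ ∗ σ') ∗ B.idc u'')
        = (ζ ∗ B.idc (B.dom τ')) ⊙ ((B.idc (q.mor (J.dom σ)) ∗ ζ') ⊙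
          (q.cell σ ∗ (q.cell σ' ∗ B.idc u''))) := by
          rw [q.cell_hcomp _ _ e, B.hcomp_assoc, B.vcomp_assoc] <;> grind
      _ = (ζ ∗ B.idc (B.dom τ')) ⊙ (q.cell σ ∗ (ζ' ⊙ (q.cell σ' ∗ B.idc u''))) := by
          rw [B.idc_hcomp_vcomp] <;> grind
      _ = (ζ ∗ B.idc (B.dom τ')) ⊙ (q.cell σ ∗ ((B.idc u' ∗ τ') ⊙ ζ₁')) := by rw [w₂]
      _ = (ζ ∗ B.idc (B.dom τ')) ⊙ ((q.cell σ ∗ (B.idc u' ∗ τ')) ⊙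
          (B.idc (q.mor (J.cod σ)) ∗ ζ₁')) := by
          rw [B.vcomp_idc_hcomp] <;> grind
      _ = ((ζ ⊙ (q.cell σ ∗ B.idc u')) ∗ τ') ⊙ (B.idc (q.mor (J.cod σ)) ∗ ζ₁') := by
          rw [← B.vcomp_assoc, ← B.hcomp_assoc, B.hcomp_idc_vcomp] <;> grind
      _ = (((B.idc u ∗ τ) ⊙ ζ₁) ∗ τ') ⊙ (B.idc (q.mor (J.cod σ)) ∗ ζ₁') := by rw [w₁]
      _ = ((B.idc u ∗ τ ∗ τ') ⊙ (ζ₁ ∗ B.idc (B.cod τ'))) ⊙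
          (B.idc (q.mor (J.cod σ)) ∗ ζ₁') := by
          rw [B.hcomp_vcomp_idc] <;> grind
      _ = _ := by
          rw [B.hcomp_assoc, B.vcomp_assoc] <;> grind

theorem unit (σ : J.Cell) : IsSquareCell q σ (B.one (q.obj (J.src (J.dom σ)))) (q.cell σ)
    (B.idc (q.mor (J.dom σ))) (B.idc (q.mor (J.cod σ))) (B.one (q.obj (J.tgt (J.dom σ)))) := by
  constructor <;> (try constructor) <;> grind

end IsSquareCell

namespace Lifting
variable (r : Lifting q)

/-- An identity solves the defining equation because the lift of an identity cell is an identity. -/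
theorem mor_one {i : J.Obj} {u : B.Mor} (h : B.src u = q.obj i) :
    r.mor (J.one i) u (B.one (B.tgt u)) (B.idc u) u = J.one (J.tgt (r.lift i u)) := by
  have e := r.cellLift_idc (r.lift i u)
  rw [r.mor_lift i u h] at e
  refine r.mor_eq (by constructor <;> grind) ?_ ?_ ?_
  · grind
  · grind
  · rw [J.src_one, J.tgt_one, J.one_comp, e] <;> grind

section
variable {s s' : J.Mor} {u u' u'' t t' : B.Mor} {ζ ζ' : B.Cell}

/-- The pasted cell is a vertical composite. Lifting its second factor replaces `s' ⬝ lift u''` by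
`lift u' ⬝ mor ζ'`, which is the morphism along which the first factor is whiskered. Functoriality
of the action on morphisms and on cells rests on this splitting. -/
theorem cellLift_comp (h : IsSquare q s u t ζ u') (h' : IsSquare q s' u' t' ζ' u'')
    (e : J.tgt s = J.src s') :
    r.cellLift (s ⬝ s' ⬝ r.lift (J.tgt s') u'')
        ((ζ ∗ B.idc t') ⊙ (B.idc (q.mor s) ∗ ζ')) =
      (r.cellLift (s ⬝ r.lift (J.tgt s) u') ζ ∗ J.idc (r.mor s' u' t' ζ' u'')) ⊙
        (J.idc s ∗ r.cellLift (s' ⬝ r.lift (J.tgt s') u'') ζ') := by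
  have h₁ := r.lift_comp_mor h'
  have h₂ := r.src_mor h'
  have h₃ := r.map_mor h'
  have h₄ := r.cod_eq h
  have h₅ := r.cod_eq h'
  have e₁ := r.cellLift_idc_comp (s := s) (t := s' ⬝ r.lift (J.tgt s') u'') (v := q.mor s) h₅
    (by grind) rfl
  have e₂ := r.dom_cellLift_idc_comp (s := s) (t := s' ⬝ r.lift (J.tgt s') u'') (v := q.mor s) h₅
    (by grind) rfl
  have e₃ := r.cellLift_comp_idc (s := s ⬝ r.lift (J.tgt s) u') (t := r.mor s' u' t' ζ' u'')
    (v := t') h₄ (by grind) h₃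
  rw [J.comp_assoc _ _ _ (by grind) (by grind), r.cellLift_vcomp _ _ _ (by grind) (by grind), e₂,
    e₁, ← h₁, ← e₃]
  grind

theorem mor_comp (h : IsSquare q s u t ζ u') (h' : IsSquare q s' u' t' ζ' u'')
    (e : J.tgt s = J.src s') :
    r.mor (s ⬝ s') u (t ⬝ t') ((ζ ∗ B.idc t') ⊙ (B.idc (q.mor s) ∗ ζ')) u'' =
      r.mor s u t ζ u' ⬝ r.mor s' u' t' ζ' u'' := by
  have h₁ := r.lift_comp_mor h'
  have h₂ := r.src_mor h'
  have h₃ := r.map_mor h'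
  have h₄ := r.lift_comp_mor h
  have h₅ := r.src_mor h
  have h₆ := r.map_mor h
  have h₇ := r.tgt_mor h
  have h₈ := r.cod_eq h
  have h₉ := r.cod_eq h'
  refine r.mor_eq (h.comp h' e) (by grind) (by grind) ?_
  rw [J.src_comp _ _ e, J.tgt_comp _ _ e, r.cellLift_comp h h' e,
    J.dom_vcomp, J.dom_hcomp, J.dom_idc, ← h₄, J.comp_assoc] <;> grind

end

theorem cell_idc {s : J.Mor} {u t : B.Mor} {ζ : B.Cell} {u' : B.Mor} (h : IsSquare q s u t ζ u') :
    r.cell (J.idc s) u (B.idc t) ζ ζ u' = J.idc (r.mor s u t ζ u') := by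
  have h₄ := r.lift_comp_mor h
  have h₅ := r.src_mor h
  have h₆ := r.map_mor h
  have h₈ := r.cod_eq h
  refine r.cell_eq (.id h) (by grind) (by grind) (by grind) ?_
  simp only [J.dom_idc, J.cod_idc]
  rw [J.idc_hcomp_idc, J.idc_hcomp_idc, J.vcomp_idc, J.idc_vcomp] <;> grind

section
variable {σ : J.Cell} {u : B.Mor} {τ ζ ζ' : B.Cell} {u' : B.Mor}
  (h : IsSquareCell q σ u τ ζ ζ' u')
include h

theorem src_dom_cell : J.src (J.dom (r.cell σ u τ ζ ζ' u')) =
    J.tgt (r.lift (J.src (J.dom σ)) u) := by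
  rw [r.dom_cell h, r.src_mor h.dom]

theorem tgt_dom_cell : J.tgt (J.dom (r.cell σ u τ ζ ζ' u')) =
    J.tgt (r.lift (J.tgt (J.dom σ)) u') := by
  rw [r.dom_cell h, r.tgt_mor h.dom]

theorem lift_comp_dom_cell : r.lift (J.src (J.dom σ)) u ⬝ J.dom (r.cell σ u τ ζ ζ' u') =
    J.dom (r.cellLift (J.dom σ ⬝ r.lift (J.tgt (J.dom σ)) u') ζ) := by
  rw [r.dom_cell h, r.lift_comp_mor h.dom]

theorem lift_comp_cod_cell : r.lift (J.src (J.dom σ)) u ⬝ J.cod (r.cell σ u τ ζ ζ' u') =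
    J.dom (r.cellLift (J.cod σ ⬝ r.lift (J.tgt (J.dom σ)) u') ζ') := by
  have := r.lift_comp_mor h.cod
  rwa [J.src_cod, J.tgt_cod, ← r.cod_cell h] at this

theorem cod_eq_dom : B.cod ζ = q.mor (J.dom σ ⬝ r.lift (J.tgt (J.dom σ)) u') :=
  r.cod_eq h.dom

theorem cod_eq_cod : B.cod ζ' = q.mor (J.cod σ ⬝ r.lift (J.tgt (J.dom σ)) u') := by
  have := r.cod_eq h.cod
  rwa [J.tgt_cod] at this

end

/-- The defining equations of the two values share the lift of `ζ'` and can be pasted along it; the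
result is the defining equation of the composite. -/
theorem cell_vcomp {σ σ' : J.Cell} {u : B.Mor} {τ τ' ζ ζ' ζ'' : B.Cell} {u' : B.Mor}
    (h : IsSquareCell q σ u τ ζ ζ' u') (h' : IsSquareCell q σ' u τ' ζ' ζ'' u')
    (e : J.cod σ = J.dom σ') (e' : B.cod τ = B.dom τ') :
    r.cell (σ ⊙ σ') u (τ ⊙ τ') ζ ζ'' u' =
      r.cell σ u τ ζ ζ' u' ⊙ r.cell σ' u τ' ζ' ζ'' u' := by
  have h₁ := r.dom_cell h
  have h₂ := r.cod_cell h
  have h₃ := r.dom_cell h'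
  have h₄ := r.cod_cell h'
  have h₅ := r.lift_hcomp_cell h
  have h₆ := r.lift_hcomp_cell h'
  have h₇ := r.src_dom_cell h
  have h₈ := r.src_dom_cell h'
  have h₉ := r.map_cell h
  have h₁₀ := r.map_cell h'
  have h₁₁ := r.cod_eq_dom h
  have h₁₂ := r.cod_eq_cod h
  have h₁₃ := r.cod_eq_cod h'
  have h₁₄ := r.lift_comp_dom_cell h
  have h₁₅ := r.lift_comp_dom_cell h'
  have h₁₆ := r.lift_comp_cod_cell h
  have h₁₇ := r.lift_comp_cod_cell h'
  have h₁₈ := h.dom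
  have h₁₉ := h.cod
  have h₂₀ := h'.cod
  have es : J.src (J.dom σ') = J.src (J.dom σ) := by grind
  have et : J.tgt (J.dom σ') = J.tgt (J.dom σ) := by grind
  rw [es, et] at h₆
  have e₀ : J.cod (r.cell σ u τ ζ ζ' u') = J.dom (r.cell σ' u τ' ζ' ζ'' u') := by grind
  refine r.cell_eq (h.vcomp h' e e') (by grind) (by grind) (by grind) ?_
  rw [J.dom_vcomp _ _ e, J.cod_vcomp _ _ e]
  set a := r.lift (J.src (J.dom σ)) u
  set b := r.lift (J.tgt (J.dom σ)) u'
  rw [← J.idc_hcomp_vcomp (x := a) e₀ (by grind) (by grind),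
    ← J.hcomp_idc_vcomp (x := b) e (by grind) (by grind), J.vcomp_assoc, h₆, ← J.vcomp_assoc, ← e,
    h₅, J.vcomp_assoc] <;> grind

/-- With the lifts of the pasted squares split by `cellLift_comp`, the defining equations of the two
factors are applied one after the other, as in `IsSquareCell.hcomp`. -/
theorem cell_hcomp {σ σ' : J.Cell} {u u' u'' : B.Mor} {τ τ' ζ ζ₁ ζ' ζ₁' : B.Cell}
    (h : IsSquareCell q σ u τ ζ ζ₁ u') (h' : IsSquareCell q σ' u' τ' ζ' ζ₁' u'')
    (e : J.tgt (J.dom σ) = J.src (J.dom σ')) :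
    r.cell (σ ∗ σ') u (τ ∗ τ') ((ζ ∗ B.idc (B.dom τ')) ⊙ (B.idc (q.mor (J.dom σ)) ∗ ζ'))
      ((ζ₁ ∗ B.idc (B.cod τ')) ⊙ (B.idc (q.mor (J.cod σ)) ∗ ζ₁')) u'' =
      r.cell σ u τ ζ ζ₁ u' ∗ r.cell σ' u' τ' ζ' ζ₁' u'' := by
  have h₁ := r.dom_cell h
  have h₂ := r.cod_cell h
  have h₃ := r.dom_cell h'
  have h₄ := r.cod_cell h'
  have h₅ := r.lift_hcomp_cell h
  have h₆ := r.lift_hcomp_cell h'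
  have h₇ := r.src_dom_cell h
  have h₈ := r.src_dom_cell h'
  have h₉ := r.map_cell h
  have h₁₀ := r.map_cell h'
  have h₁₁ := r.cod_eq_dom h
  have h₁₂ := r.cod_eq_cod h
  have h₁₃ := r.cod_eq_cod h'
  have h₂₃ := r.cod_eq_dom h'
  have h₁₄ := r.lift_comp_dom_cell h
  have h₁₅ := r.lift_comp_dom_cell h'
  have h₁₆ := r.lift_comp_cod_cell h
  have h₁₇ := r.lift_comp_cod_cell h'
  have h₁₈ := h.dom
  have h₁₉ := h.cod
  have h₂₀ := h'.cod
  have h₂₁ := h'.dom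
  have h₂₂ := r.tgt_dom_cell h
  have e₁ := r.cellLift_comp h.dom h'.dom e
  have e₂ := r.cellLift_comp h.cod h'.cod (by grind)
  have m₁ := r.mor_comp h.dom h'.dom e
  have m₂ := r.mor_comp h.cod h'.cod (by grind)
  rw [J.tgt_cod, J.tgt_cod, ← h₄] at e₂
  rw [← h₃] at e₁
  refine r.cell_eq (h.hcomp h' e) (by grind) (by grind) (by grind) ?_
  rw [J.dom_hcomp _ _ e, J.cod_hcomp _ _ e, J.tgt_comp _ _ e, J.src_comp _ _ e, e₁, e₂]
  set a := r.lift (J.src (J.dom σ)) u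
  set b := r.lift (J.tgt (J.dom σ)) u'
  have eb : r.lift (J.src (J.dom σ')) u' = b := by grind
  rw [eb] at h₆ h₈ h₁₅ h₁₇
  set c := r.lift (J.tgt (J.dom σ')) u''
  set k := r.cell σ u τ ζ ζ₁ u'
  set k' := r.cell σ' u' τ' ζ' ζ₁' u''
  set m := r.cellLift (J.cod σ ⬝ b) ζ₁
  set m' := r.cellLift (J.cod σ' ⬝ c) ζ₁'
  set l := r.cellLift (J.dom σ ⬝ b) ζ
  set l' := r.cellLift (J.dom σ' ⬝ c) ζ'
  have dm : J.cod m = J.cod σ ⬝ b := by grind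
  have dm' : J.cod m' = J.cod σ' ⬝ c := by grind
  have dl : J.cod l = J.dom σ ⬝ b := by grind
  have dl' : J.cod l' = J.dom σ' ⬝ c := by grind
  have sb : J.src b = J.tgt (J.dom σ) := by grind
  have sc : J.src c = J.tgt (J.dom σ') := by grind
  -- Only the boundaries and the two defining equations matter from here on; what remains is a
  -- formal pasting argument in `J`.
  clear_value a b c k k' m m' l l'
  calc (J.idc a ∗ (k ∗ k')) ⊙ ((m ∗ J.idc (J.cod k')) ⊙ (J.idc (J.cod σ) ∗ m'))
      = ((J.idc a ∗ k) ∗ k') ⊙ (m ∗ J.idc (J.cod k')) ⊙ (J.idc (J.cod σ) ∗ m') := by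
        rw [J.hcomp_assoc, J.vcomp_assoc] <;> grind
    _ = (((J.idc a ∗ k) ⊙ m) ∗ k') ⊙ (J.idc (J.cod σ) ∗ m') := by
        rw [J.hcomp_vcomp_idc] <;> grind
    _ = ((l ⊙ (σ ∗ J.idc b)) ∗ k') ⊙ (J.idc (J.cod σ) ∗ m') := by rw [h₅]
    _ = (l ∗ J.idc (J.dom k')) ⊙ ((σ ∗ J.idc b) ∗ k') ⊙ (J.idc (J.cod σ) ∗ m') := by
        rw [J.hcomp_idc_vcomp] <;> grind
    _ = (l ∗ J.idc (J.dom k')) ⊙ (σ ∗ ((J.idc b ∗ k') ⊙ m')) := by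
        rw [J.hcomp_assoc, J.vcomp_assoc, J.vcomp_idc_hcomp] <;> grind
    _ = (l ∗ J.idc (J.dom k')) ⊙ (σ ∗ (l' ⊙ (σ' ∗ J.idc c))) := by rw [h₆]
    _ = (l ∗ J.idc (J.dom k')) ⊙ ((J.idc (J.dom σ) ∗ l') ⊙ (σ ∗ (σ' ∗ J.idc c))) := by
        rw [J.idc_hcomp_vcomp] <;> grind
    _ = _ := by
        rw [← J.hcomp_assoc, J.vcomp_assoc] <;> grind

end Lifting
end TotalTwoCat

/-! ### Unit and associativity laws of the induced action; recovering the lifts -/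

namespace TotalTwoCat
variable {J B : TotalTwoCat.{u}} {q : Functor J B}

/-- Vertical composition of squares. -/
theorem IsSquare.vert {s m : J.Mor} {u u' t v v' w : B.Mor} {ζ ξ : B.Cell}
    (h : IsSquare q s u t ζ u') (h' : IsSquare q m v w ξ v') (e : q.mor m = t)
    (hv : B.src v = B.tgt u) (hv' : B.src v' = B.tgt u') :
    IsSquare q s (u ⬝ v) w ((B.idc u ∗ ξ) ⊙ (ζ ∗ B.idc v')) (u' ⬝ v') := by
  constructor <;> grind

/-- Vertical composition of cells between squares. -/
theorem IsSquareCell.vert {σ κ : J.Cell} {u u' v v' : B.Mor} {τ ω ζ ζ' ξ ξ' : B.Cell}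
    (h : IsSquareCell q σ u τ ζ ζ' u') (h' : IsSquareCell q κ v ω ξ ξ' v') (e : q.cell κ = τ)
    (hv : B.src v = B.tgt u) (hv' : B.src v' = B.tgt u') :
    IsSquareCell q σ (u ⬝ v) ω ((B.idc u ∗ ξ) ⊙ (ζ ∗ B.idc v')) ((B.idc u ∗ ξ') ⊙ (ζ' ∗ B.idc v'))
        (u' ⬝ v') where
  dom := h.dom.vert h'.dom (by grind) hv hv'
  cod := h.cod.vert h'.cod (by grind) hv hv'
  w := by
    have h₁ := h.dom
    have h₂ := h.cod
    have h₃ := h'.dom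
    have h₄ := h'.cod
    have w₁ := h.w
    have w₂ := h'.w
    rw [e] at w₂
    calc (B.idc u ∗ ξ) ⊙ (ζ ∗ B.idc v') ⊙ (q.cell σ ∗ B.idc (u' ⬝ v'))
        = (B.idc u ∗ ξ) ⊙ ((ζ ∗ B.idc v') ⊙ (q.cell σ ∗ B.idc u' ∗ B.idc v')) := by
          rw [B.vcomp_assoc, B.hcomp_assoc, B.idc_hcomp_idc] <;> grind
      _ = (B.idc u ∗ ξ) ⊙ (((B.idc u ∗ τ) ⊙ ζ') ∗ B.idc v') := by
          rw [B.hcomp_idc_vcomp, w₁] <;> grind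
      _ = (B.idc u ∗ ξ) ⊙ ((B.idc u ∗ (τ ∗ B.idc v')) ⊙ (ζ' ∗ B.idc v')) := by
          rw [← B.hcomp_assoc, B.hcomp_vcomp_idc (α := B.idc u ∗ τ)] <;> grind
      _ = (B.idc u ∗ (ξ ⊙ (τ ∗ B.idc v'))) ⊙ (ζ' ∗ B.idc v') := by
          rw [← B.vcomp_assoc, B.idc_hcomp_vcomp] <;> grind
      _ = (B.idc u ∗ ((B.idc v ∗ ω) ⊙ ξ')) ⊙ (ζ' ∗ B.idc v') := by rw [w₂]
      _ = (B.idc u ∗ (B.idc v ∗ ω)) ⊙ (B.idc u ∗ ξ') ⊙ (ζ' ∗ B.idc v') := by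
          rw [B.vcomp_idc_hcomp] <;> grind
      _ = _ := by
          rw [← B.hcomp_assoc, B.idc_hcomp_idc, B.vcomp_assoc] <;> grind

namespace Lifting
variable (r : Lifting q)

theorem mor_unit (s : J.Mor) : r.mor s (B.one (q.obj (J.src s))) (q.mor s) (B.idc (q.mor s))
    (B.one (q.obj (J.tgt s))) = s := by
  refine r.mor_eq (.unitSquare s) (by grind) rfl ?_
  rw [r.lift_one, r.lift_one, J.one_comp _ _ rfl, J.comp_one _ _ rfl, r.cellLift_idc, J.dom_idc]

theorem cell_unit (σ : J.Cell) : r.cell σ (B.one (q.obj (J.src (J.dom σ)))) (q.cell σ)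
    (B.idc (q.mor (J.dom σ))) (B.idc (q.mor (J.cod σ))) (B.one (q.obj (J.tgt (J.dom σ)))) = σ := by
  have h₁ := r.mor_unit (J.dom σ)
  have h₂ := r.mor_unit (J.cod σ)
  refine r.cell_eq (.unit σ) (by grind) (by grind) rfl ?_
  rw [r.lift_one, r.lift_one, J.one_hcomp _ _ rfl, J.comp_one _ _ (by grind), J.comp_one _ _ rfl,
    r.cellLift_idc, r.cellLift_idc, J.hcomp_one _ _ rfl, J.vcomp_idc _ _ rfl,
    J.idc_vcomp _ _ rfl]

section
variable {s : J.Mor} {u u' t v v' w : B.Mor} {ζ ξ : B.Cell} (hζ : IsSquare q s u t ζ u')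
  (hξ : IsSquare q (r.mor s u t ζ u') v w ξ v')
include hζ hξ

/-- That the second square is a square at the value of the first forces the arrows to be composable;
composability of `u` and `v` therefore need not be assumed. -/
theorem src_eq_tgt : B.src v = B.tgt u := by
  rw [hξ.src_top, r.src_mor hζ, r.obj_tgt_lift hζ.src_top]

theorem src_eq_tgt' : B.src v' = B.tgt u' := by
  rw [hξ.src_bot, r.tgt_mor hζ, r.obj_tgt_lift hζ.src_bot]

/-- The lift of `u' ⬝ v'` is a composite of lifts. Lifting `ζ` whiskered by `v'` then turns `s ⬝
lift u'` into `lift u ⬝ mor ζ`, at which `ξ` is lifted behind the lift of `u`. This is the source of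
associativity. -/
theorem cellLift_vert : r.cellLift (s ⬝ r.lift (J.tgt s) (u' ⬝ v'))
      ((B.idc u ∗ ξ) ⊙ (ζ ∗ B.idc v')) =
    (J.idc (r.lift (J.src s) u) ∗
        r.cellLift (r.mor s u t ζ u' ⬝ r.lift (J.tgt (r.mor s u t ζ u')) v') ξ) ⊙
      (r.cellLift (s ⬝ r.lift (J.tgt s) u') ζ ∗
        J.idc (r.lift (J.tgt (r.lift (J.tgt s) u')) v')) := by
  have h₁ := r.src_eq_tgt hζ hξ
  have h₂ := r.src_eq_tgt' hζ hξ
  have h₃ := r.lift_comp_mor hζ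
  have h₄ := r.cod_eq hζ
  have h₅ := r.cod_eq hξ
  have h₆ := r.map_mor hζ
  have h₇ := r.tgt_mor hζ
  have h₈ := r.src_mor hζ
  have e₁ := r.cellLift_comp_idc (s := s ⬝ r.lift (J.tgt s) u')
    (t := r.lift (J.tgt (r.lift (J.tgt s) u')) v') (v := v') h₄ (by grind) (by grind)
  have e₂ := r.dom_cellLift_comp_idc (s := s ⬝ r.lift (J.tgt s) u')
    (t := r.lift (J.tgt (r.lift (J.tgt s) u')) v') (v := v') h₄ (by grind) (by grind)
  rw [r.lift_comp _ _ _ hζ.src_bot h₂.symm, ← J.comp_assoc _ _ _ (by grind) (by grind),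
    r.cellLift_vcomp _ _ _ (by grind) (by grind), e₂, e₁, ← h₃, J.comp_assoc _ _ _ (by grind)
    (by grind), ← h₇, r.cellLift_idc_comp h₅ (by grind) (by grind)]

/-- The iterated value solves the equation for the stacked square: the lift of `u ⬝ v` is split, the
defining equation of the outer value is used behind the lift of `u`, and `cellLift_vert` reassembles
the result. -/
theorem mor_vert : r.mor (r.mor s u t ζ u') v w ξ v' =
    r.mor s (u ⬝ v) w ((B.idc u ∗ ξ) ⊙ (ζ ∗ B.idc v')) (u' ⬝ v') := by
  have h₁ := r.src_eq_tgt hζ hξ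
  have h₂ := r.src_eq_tgt' hζ hξ
  have h₃ := r.lift_comp_mor hζ
  have h₄ := r.cod_eq hζ
  have h₅ := r.cod_eq hξ
  have h₆ := r.map_mor hζ
  have h₇ := r.tgt_mor hζ
  have h₈ := r.src_mor hζ
  have h₉ := r.lift_comp_mor hξ
  have h₁₀ := r.src_mor hξ
  have e := r.lift_comp _ _ _ hζ.src_top h₁.symm
  refine (r.mor_eq (hζ.vert hξ h₆ h₁ h₂) ?_ (r.map_mor hξ) ?_).symm
  · grind
  · rw [r.cellLift_vert hζ hξ, e, ← h₈, J.comp_assoc _ _ _ (by grind) (by grind), h₉, J.dom_vcomp,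
      J.dom_hcomp, J.dom_idc] <;> grind

end

/-- With the lifts of both stacked squares split by `cellLift_vert`, the defining equation of the
outer cell is used behind the lift of `u`, and then that of the inner cell in front of the lift of
`v'`. -/
theorem cell_vert {σ : J.Cell} {u u' v v' : B.Mor} {τ ω ζ ζ' ξ ξ' : B.Cell}
    (h : IsSquareCell q σ u τ ζ ζ' u')
    (h' : IsSquareCell q (r.cell σ u τ ζ ζ' u') v ω ξ ξ' v') :
    r.cell (r.cell σ u τ ζ ζ' u') v ω ξ ξ' v' =
      r.cell σ (u ⬝ v) ω ((B.idc u ∗ ξ) ⊙ (ζ ∗ B.idc v')) ((B.idc u ∗ ξ') ⊙ (ζ' ∗ B.idc v'))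
        (u' ⬝ v') := by
  have hd := h'.dom
  have hc := h'.cod
  rw [r.dom_cell h] at hd
  rw [r.cod_cell h] at hc
  have h₁ := r.src_eq_tgt h.dom hd
  have h₂ := r.src_eq_tgt' h.dom hd
  have v₁ := r.cellLift_vert h.dom hd
  have v₂ := r.cellLift_vert h.cod hc
  have m₁ := r.mor_vert h.dom hd
  have m₂ := r.mor_vert h.cod hc
  have h₃ := r.dom_cell h
  have h₄ := r.cod_cell h
  have h₅ := r.dom_cell h'
  have h₆ := r.cod_cell h'
  have w₁ := r.lift_hcomp_cell h
  have w₂ := r.lift_hcomp_cell h'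
  have h₇ := r.src_dom_cell h
  have h₈ := r.tgt_dom_cell h
  have h₉ := r.src_dom_cell h'
  have h₁₀ := r.tgt_dom_cell h'
  have c₁ := r.cod_eq_dom h
  have c₂ := r.cod_eq_cod h
  have c₃ := r.cod_eq_dom h'
  have c₄ := r.cod_eq_cod h'
  have l₁ := r.lift_comp_dom_cell h
  have l₂ := r.lift_comp_cod_cell h
  have l₃ := r.lift_comp_dom_cell h'
  have l₄ := r.lift_comp_cod_cell h'
  have sd := h.dom
  have sc := h.cod
  have sd' := h'.dom
  have e := r.lift_comp _ _ _ h.dom.src_top h₁.symm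
  rw [← h₃] at v₁
  rw [← h₄, J.src_cod, J.tgt_cod, J.tgt_cod] at v₂
  have q₁ := r.map_cell h'
  refine (r.cell_eq (h.vert h' (r.map_cell h) h₁ h₂) (by grind) (by grind) q₁ ?_).symm
  rw [v₁, v₂, e, r.lift_comp _ _ _ h.dom.src_bot h₂.symm]
  rw [h₈] at w₂ h₁₀ c₃ c₄ l₃ l₄ ⊢
  rw [← h₇]
  set a := r.lift (J.src (J.dom σ)) u
  set b := r.lift (J.tgt (J.dom σ)) u'
  set k := r.cell σ u τ ζ ζ' u'
  set k' := r.cell k v ω ξ ξ' v'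
  set a' := r.lift (J.src (J.dom k)) v
  set b' := r.lift (J.tgt b) v'
  set m := r.cellLift (J.cod σ ⬝ b) ζ'
  set m' := r.cellLift (J.cod k ⬝ b') ξ'
  set l := r.cellLift (J.dom σ ⬝ b) ζ
  set l' := r.cellLift (J.dom k ⬝ b') ξ
  have dm : J.cod m = J.cod σ ⬝ b := by grind
  have dm' : J.cod m' = J.cod k ⬝ b' := by grind
  have dl : J.cod l = J.dom σ ⬝ b := by grind
  have dl' : J.cod l' = J.dom k ⬝ b' := by grind
  have sb : J.src b = J.tgt (J.dom σ) := by grind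
  have sb' : J.src b' = J.tgt b := by grind
  have sa : J.src a = J.src (J.dom σ) := by grind
  have sa' : J.src a' = J.tgt a := by grind
  clear_value a b a' b' k k' m m' l l'
  calc (J.idc (a ⬝ a') ∗ k') ⊙ ((J.idc a ∗ m') ⊙ (m ∗ J.idc b'))
      = (J.idc a ∗ (J.idc a' ∗ k')) ⊙ (J.idc a ∗ m') ⊙ (m ∗ J.idc b') := by
        rw [← J.idc_hcomp_idc, J.hcomp_assoc, J.vcomp_assoc] <;> grind
    _ = (J.idc a ∗ ((J.idc a' ∗ k') ⊙ m')) ⊙ (m ∗ J.idc b') := by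
        rw [J.idc_hcomp_vcomp] <;> grind
    _ = (J.idc a ∗ (l' ⊙ (k ∗ J.idc b'))) ⊙ (m ∗ J.idc b') := by rw [w₂]
    _ = (J.idc a ∗ l') ⊙ ((J.idc a ∗ k ∗ J.idc b') ⊙ (m ∗ J.idc b')) := by
        rw [← J.idc_hcomp_vcomp (x := a), J.vcomp_assoc, J.hcomp_assoc] <;> grind
    _ = (J.idc a ∗ l') ⊙ (((J.idc a ∗ k) ⊙ m) ∗ J.idc b') := by
        rw [J.hcomp_vcomp_idc] <;> grind
    _ = (J.idc a ∗ l') ⊙ ((l ⊙ (σ ∗ J.idc b)) ∗ J.idc b') := by rw [w₁]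
    _ = (J.idc a ∗ l') ⊙ ((l ∗ J.idc b') ⊙ (σ ∗ J.idc (b ⬝ b'))) := by
        rw [← J.idc_hcomp_idc, ← J.hcomp_assoc, J.hcomp_idc_vcomp] <;> grind
    _ = _ := by
        rw [J.vcomp_assoc] <;> grind

/-- The action that is induced by lifts. -/
noncomputable def action : Action q where
  obj i u := J.tgt (r.lift i u)
  mor := r.mor
  cell := r.cell
  src_mor := r.src_mor
  tgt_mor := r.tgt_mor
  dom_cell := r.dom_cell
  cod_cell := r.cod_cell
  mor_one _ _ h := r.mor_one h
  mor_comp := r.mor_comp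
  cell_idc := r.cell_idc
  cell_vcomp := r.cell_vcomp
  cell_hcomp := r.cell_hcomp
  map_obj _ _ h := r.obj_tgt_lift h
  map_mor := r.map_mor
  map_cell := r.map_cell
  obj_unit i := by rw [r.lift_one, J.tgt_one]
  mor_unit := r.mor_unit
  cell_unit := r.cell_unit
  obj_assoc i u v h h' := by
    have := r.obj_tgt_lift h
    rw [r.lift_comp _ _ _ h h', J.tgt_comp]
    grind
  mor_assoc := r.mor_vert
  cell_assoc := r.cell_vert

/-- At the square `(i, 1) ⟶ (i, u)` the leading lift and the lifted cell in the defining equation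
are identities, so its solution is the chosen lift. With `action_cellLift` this says that passing
from lifts to an action and back changes nothing. -/
theorem action_lift {i : J.Obj} {u : B.Mor} (h : B.src u = q.obj i) :
    r.action.lift i u = r.lift i u := by
  have e := r.cellLift_idc (r.lift i u)
  rw [r.mor_lift i u h] at e
  have e' := r.lift_one i
  refine r.mor_eq (.liftSquare h) ?_ ?_ ?_
  · rw [J.src_one, r.lift_one, J.tgt_one, r.src_lift _ _ h]
  · exact r.mor_lift _ _ h
  · rw [J.src_one, J.tgt_one, J.one_comp, e] <;> grind

/-- Between identity arrows both flanking lifts are identities, and the defining equation collapses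
to one that `r.cellLift s β` satisfies trivially. -/
theorem action_cellLift {s : J.Mor} {β : B.Cell} (h : B.cod β = q.mor s) :
    r.action.cellLift s β = r.cellLift s β := by
  have e₁ := r.lift_one (J.src s)
  have e₂ := r.lift_one (J.tgt s)
  have e₃ := r.mor_unit s
  refine r.cell_eq (.liftCell h) ?_ ?_ (r.cell_cellLift _ _ h) ?_
  · rw [J.dom_idc]
    refine (r.mor_eq (.pullSquare h) ?_ ?_ ?_).symm
    · grind
    · grind
    · rw [e₁, e₂, J.comp_one _ _ rfl, J.one_comp]
      grind
  · rw [r.cod_cellLift _ _ h, J.cod_idc, h, e₃]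
  · rw [J.dom_idc, J.cod_idc, e₁, e₂, J.comp_one _ _ rfl, r.cellLift_idc, J.idc_hcomp_idc,
      J.comp_one, J.one_hcomp] <;> grind

end Lifting

/-! ### An action is determined by its lifts -/

namespace Action
variable (a a' : Action q)

/-- Passing from an action to its lifts and back changes nothing on squares: by `lift_comp_mor_eq`
the original value solves the equation that defines the reconstructed one. -/
theorem lifting_mor {s : J.Mor} {u t : B.Mor} {ζ : B.Cell} {u' : B.Mor}
    (h : IsSquare q s u t ζ u') : a.lifting.mor s u t ζ u' = a.mor s u t ζ u' :=
  a.lifting.mor_eq h ((a.src_mor h).trans (a.tgt_lift h.src_top).symm) (a.map_mor h)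
    (a.lift_comp_mor_eq h)

theorem lifting_cell {σ : J.Cell} {u : B.Mor} {τ ζ ζ' : B.Cell} {u' : B.Mor}
    (h : IsSquareCell q σ u τ ζ ζ' u') :
    a.lifting.cell σ u τ ζ ζ' u' = a.cell σ u τ ζ ζ' u' :=
  a.lifting.cell_eq h ((a.dom_cell h).trans (a.lifting_mor h.dom).symm)
    ((a.cod_cell h).trans (a.lifting_mor h.cod).symm) (a.map_cell h) (a.lift_hcomp_cell_eq h)

variable {a a'}

/-- The defining equation of the values mentions only the lifts, and the values of both actions
satisfy it. -/
theorem mor_congr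
    (hl : ∀ {i : J.Obj} {u : B.Mor}, B.src u = q.obj i → a.lift i u = a'.lift i u)
    (hc : ∀ {s : J.Mor} {β : B.Cell}, B.cod β = q.mor s → a.cellLift s β = a'.cellLift s β)
    {s : J.Mor} {u t : B.Mor} {ζ : B.Cell} {u' : B.Mor} (h : IsSquare q s u t ζ u') :
    a.mor s u t ζ u' = a'.mor s u t ζ u' := by
  rw [← a.lifting_mor h]
  refine a.lifting.mor_eq h ?_ (a'.map_mor h) ?_
  · change _ = J.tgt (a.lift _ _)
    rw [hl h.src_top, a'.src_mor h, a'.tgt_lift h.src_top]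
  · have e := a'.lift_comp_mor_eq h
    rw [← hc, ← hl h.src_top, ← hl h.src_bot] at e
    · exact e
    · have := a'.mor_lift h.src_bot
      have := a'.src_lift h.src_bot
      grind

theorem cell_congr
    (hl : ∀ {i : J.Obj} {u : B.Mor}, B.src u = q.obj i → a.lift i u = a'.lift i u)
    (hc : ∀ {s : J.Mor} {β : B.Cell}, B.cod β = q.mor s → a.cellLift s β = a'.cellLift s β)
    {σ : J.Cell} {u : B.Mor} {τ ζ ζ' : B.Cell} {u' : B.Mor} (h : IsSquareCell q σ u τ ζ ζ' u') :
    a.cell σ u τ ζ ζ' u' = a'.cell σ u τ ζ ζ' u' := by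
  rw [← a.lifting_cell h]
  refine a.lifting.cell_eq h ?_ ?_ (a'.map_cell h) ?_
  · rw [a'.dom_cell h, a.lifting_mor h.dom, mor_congr hl hc h.dom]
  · rw [a'.cod_cell h, a.lifting_mor h.cod, mor_congr hl hc h.cod]
  · have e := a'.lift_hcomp_cell_eq h
    have hd := h.dom
    have hd' := h.cod
    have h₁ : B.src u' = q.obj (J.tgt (J.dom σ)) := h.dom.src_bot
    have h₂ := a'.mor_lift h₁
    have h₃ := a'.src_lift h₁
    rw [← hc, ← hc, ← hl h.dom.src_top, ← hl h.dom.src_bot] at e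
    · exact e
    · grind
    · grind

end Action
end TotalTwoCat

/-! ### Left actions by duality, and commutation of the two actions on morphisms -/

namespace TotalTwoCat
variable {J A B : TotalTwoCat.{u}} {p : Functor J A} {q : Functor J B}

section
variable {s : J.Mor} {u t : A.Mor} {ξ : A.Cell} {u' : A.Mor} (h : IsSquare p.dual s u t ξ u')
include h

/-- A square for `p.dual` reads as `ξ : u' ⬝ p s ⟶ t ⬝ u`, with `u` ending under the target of `s`
and `u'` under its source. These restatements undo the reversal for rewriting. -/
theorem IsSquare.dual_tgt_top : A.tgt u = p.obj (J.tgt s) := h.src_top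
theorem IsSquare.dual_tgt_bot : A.tgt u' = p.obj (J.src s) := h.src_bot
theorem IsSquare.dual_dom_cell : A.dom ξ = u' ⬝ p.mor s := h.cod_cell

end

section
variable {σ : J.Cell} {u : A.Mor} {τ ξ ξ' : A.Cell} {u' : A.Mor}
  (h : IsSquareCell p.dual σ u τ ξ' ξ u')
include h

/-- Reversal of cells swaps domain and codomain; this is why `ξ'` precedes `ξ` among the arguments
throughout. -/
theorem IsSquareCell.dual_dom : IsSquare p.dual (J.dom σ) u (A.dom τ) ξ u' := h.cod
theorem IsSquareCell.dual_cod : IsSquare p.dual (J.cod σ) u (A.cod τ) ξ' u' := h.dom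

end

namespace Lifting

section
variable (l : Lifting p.dual)

/-- The cartesian lifts of morphisms. -/
def coLift (i : J.Obj) (u : A.Mor) : J.Mor := l.lift i u

/-- The opcartesian lifts of cells. -/
def coCellLift (s : J.Mor) (α : A.Cell) : J.Cell := l.cellLift s α

/-- The action of a morphism of `A^𝟚` that is induced by lifts. -/
noncomputable def coMor (s : J.Mor) (u t : A.Mor) (ξ : A.Cell) (u' : A.Mor) : J.Mor :=
  l.mor s u t ξ u'

/-- The action of a cell of `A^𝟚` that is induced by lifts. -/
noncomputable def coCell (σ : J.Cell) (u : A.Mor) (τ ξ' ξ : A.Cell) (u' : A.Mor) : J.Cell :=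
  l.cell σ u τ ξ' ξ u'

section
variable {i : J.Obj} {u : A.Mor} (h : A.tgt u = p.obj i)
include h
theorem tgt_coLift : J.tgt (l.coLift i u) = i := l.src_lift i u h
theorem map_coLift : p.mor (l.coLift i u) = u := l.mor_lift i u h

theorem coLift_ext {x y : J.Mor} (hx : J.tgt x = J.src (l.coLift i u))
    (hy : J.tgt y = J.src (l.coLift i u)) (e : p.mor x = p.mor y)
    (e' : x ⬝ l.coLift i u = y ⬝ l.coLift i u) : x = y :=
  l.mor_ext h hx hy e e'

theorem coLift_cell_ext {τ τ' : J.Cell} (hτ : J.tgt (J.dom τ) = J.src (l.coLift i u))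
    (hd : J.dom τ = J.dom τ') (hc : J.cod τ = J.cod τ') (e : p.cell τ = p.cell τ')
    (e' : τ ∗ J.idc (l.coLift i u) = τ' ∗ J.idc (l.coLift i u)) : τ = τ' :=
  l.cell_ext h ((J.tgt_cod τ).trans hτ) hc hd e e'

end

section
variable {s : J.Mor} {α : A.Cell} (h : A.dom α = p.mor s)
include h
theorem dom_coCellLift : J.dom (l.coCellLift s α) = s := l.cod_cellLift s α h

theorem coCellLift_ext {ω ω' : J.Cell} (hc : J.dom ω = J.cod (l.coCellLift s α))
    (hc' : J.dom ω' = J.cod (l.coCellLift s α)) (e : p.cell ω = p.cell ω')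
    (e' : l.coCellLift s α ⊙ ω = l.coCellLift s α ⊙ ω') : ω = ω' :=
  l.cellLift_ext h hc hc' e e'

theorem coCellLift_comp_idc {t : J.Mor} {v : A.Mor} (e : J.tgt s = J.src t) (hv : p.mor t = v) :
    l.coCellLift (s ⬝ t) (α ∗ A.idc v) = l.coCellLift s α ∗ J.idc t :=
  l.cellLift_idc_comp (s := t) (t := s) (β := α) h e.symm hv

end

section
variable {s : J.Mor} {u t : A.Mor} {ξ : A.Cell} {u' : A.Mor} (h : IsSquare p.dual s u t ξ u')
include h
theorem tgt_coMor : J.tgt (l.coMor s u t ξ u') = J.src (l.coLift (J.tgt s) u) := l.src_mor h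
theorem src_coMor : J.src (l.coMor s u t ξ u') = J.src (l.coLift (J.src s) u') := l.tgt_mor h
theorem map_coMor : p.mor (l.coMor s u t ξ u') = t := l.map_mor h
theorem coMor_comp_coLift : l.coMor s u t ξ u' ⬝ l.coLift (J.tgt s) u =
    J.cod (l.coCellLift (l.coLift (J.src s) u' ⬝ s) ξ) := l.lift_comp_mor h
theorem dom_eq : A.dom ξ = p.mor (l.coLift (J.src s) u' ⬝ s) := l.cod_eq h
end

section
variable {σ : J.Cell} {u : A.Mor} {τ ξ ξ' : A.Cell} {u' : A.Mor}
  (h : IsSquareCell p.dual σ u τ ξ' ξ u')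
include h
theorem dom_coCell : J.dom (l.coCell σ u τ ξ' ξ u') = l.coMor (J.dom σ) u (A.dom τ) ξ u' :=
  l.cod_cell h
theorem cod_coCell : J.cod (l.coCell σ u τ ξ' ξ u') = l.coMor (J.cod σ) u (A.cod τ) ξ' u' :=
  l.dom_cell h
theorem map_coCell : p.cell (l.coCell σ u τ ξ' ξ u') = τ := l.map_cell h
theorem coCell_hcomp_coLift :
    l.coCellLift (l.coLift (J.src (J.dom σ)) u' ⬝ J.dom σ) ξ ⊙
        (l.coCell σ u τ ξ' ξ u' ∗ J.idc (l.coLift (J.tgt (J.dom σ)) u)) =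
      (J.idc (l.coLift (J.src (J.dom σ)) u') ∗ σ) ⊙
        l.coCellLift (l.coLift (J.src (J.dom σ)) u' ⬝ J.cod σ) ξ' := by
  -- In the dual, the ends of `σ` are read off its codomain; the statement uses the domain instead,
  -- as on the right side.
  have e : J.tgt (J.dom σ) = J.tgt (J.cod σ) := (J.tgt_cod σ).symm
  have e' : J.src (J.dom σ) = J.src (J.cod σ) := (J.src_cod σ).symm
  rw [e, e']
  exact l.lift_hcomp_cell h
end

end

/-- Compatibility of lifts for the legs of a span. -/
structure Compatible (l : Lifting p.dual) (r : Lifting q) : Prop where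
  mor_coLift {i : J.Obj} {u : A.Mor} : A.tgt u = p.obj i →
    q.mor (l.coLift i u) = B.one (q.obj i)
  cell_coCellLift {s : J.Mor} {α : A.Cell} : A.dom α = p.mor s →
    q.cell (l.coCellLift s α) = B.idc (q.mor s)
  mor_lift {i : J.Obj} {v : B.Mor} : B.src v = q.obj i → p.mor (r.lift i v) = A.one (p.obj i)
  cell_cellLift {s : J.Mor} {β : B.Cell} : B.cod β = q.mor s →
    p.cell (r.cellLift s β) = A.idc (p.mor s)
  obj_comm {i : J.Obj} {u : A.Mor} {v : B.Mor} : A.tgt u = p.obj i → B.src v = q.obj i →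
    J.tgt (r.lift (J.src (l.coLift i u)) v) = J.src (l.coLift (J.tgt (r.lift i v)) u)
  lift_comm {i : J.Obj} {u : A.Mor} {v : B.Mor} : A.tgt u = p.obj i → B.src v = q.obj i →
    l.coLift i u ⬝ r.lift i v =
      r.lift (J.src (l.coLift i u)) v ⬝ l.coLift (J.tgt (r.lift i v)) u
  mor_comm {s : J.Mor} {α : A.Cell} {β : B.Cell} : A.dom α = p.mor s → B.cod β = q.mor s →
    J.cod (l.coCellLift (J.dom (r.cellLift s β)) α) =
      J.dom (r.cellLift (J.cod (l.coCellLift s α)) β)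
  cell_comm {s : J.Mor} {α : A.Cell} {β : B.Cell} : A.dom α = p.mor s → B.cod β = q.mor s →
    r.cellLift s β ⊙ l.coCellLift s α =
      l.coCellLift (J.dom (r.cellLift s β)) α ⊙ r.cellLift (J.cod (l.coCellLift s α)) β

/-- Dualising exchanges the legs, and double duals reduce definitionally. Each fact about one leg
thereby yields its mirror image. -/
theorem Compatible.symm {l : Lifting p.dual} {r : Lifting q} (h : Compatible l r) :
    Compatible (J := J.dual) (A := B.dual) (B := A.dual) (p := q.dual) (q := p.dual) r l where
  mor_coLift := h.mor_lift
  cell_coCellLift := h.cell_cellLift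
  mor_lift := h.mor_coLift
  cell_cellLift := h.cell_coCellLift
  obj_comm h₁ h₂ := (h.obj_comm h₂ h₁).symm
  lift_comm h₁ h₂ := h.lift_comm h₂ h₁
  mor_comm h₁ h₂ := (h.mor_comm h₂ h₁).symm
  cell_comm h₁ h₂ := h.cell_comm h₂ h₁

namespace Compatible

variable {l : Lifting p.dual} {r : Lifting q} (c : Compatible l r)
include c

/-- Apply `p` to the defining equation: the lifts for `q` become identities and the value is all
that is left on one side, `s` on the other. -/
theorem map_mor {s : J.Mor} {v w : B.Mor} {ζ : B.Cell} {v' : B.Mor} (h : IsSquare q s v w ζ v') :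
    p.mor (r.mor s v w ζ v') = p.mor s := by
  have e := congrArg p.mor (r.lift_comp_mor h)
  have h₁ := r.src_mor h
  have h₂ := c.mor_lift h.src_top
  have h₃ := c.mor_lift h.src_bot
  have h₄ := c.cell_cellLift (r.cod_eq h)
  have h₅ := p.dom_cell (r.cellLift (s ⬝ r.lift (J.tgt s) v') ζ)
  have h₆ := p.tgt_mor (r.lift (J.src s) v)
  have h₇ := p.src_mor (r.mor s v w ζ v')
  have h₈ := h.src_top
  have h₉ := h.src_bot
  grind

theorem map_cell {σ : J.Cell} {v : B.Mor} {τ ζ ζ' : B.Cell} {v' : B.Mor}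
    (h : IsSquareCell q σ v τ ζ ζ' v') : p.cell (r.cell σ v τ ζ ζ' v') = p.cell σ := by
  have hd := h.dom
  have hc := h.cod
  have e := congrArg p.cell (r.lift_hcomp_cell h)
  have h₁ := r.src_dom_cell h
  have h₂ := c.mor_lift hd.src_top
  have h₃ := c.mor_lift hd.src_bot
  have h₄ := c.cell_cellLift (r.cod_eq_dom h)
  have h₅ := c.cell_cellLift (r.cod_eq_cod h)
  have h₆ := p.tgt_mor (r.lift (J.src (J.dom σ)) v)
  have h₇ := p.src_mor (J.dom (r.cell σ v τ ζ ζ' v'))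
  have h₈ := hd.src_top
  have h₉ := hd.src_bot
  have h₁₀ := r.lift_comp_cod_cell h
  have h₁₁ := r.cod_eq_cod h
  have h₁₂ := r.cod_eq_dom h
  have h₁₃ := c.map_mor hc
  have h₁₄ := r.cod_cell h
  rw [p.cell_vcomp _ _ (by grind), p.cell_vcomp _ _ (by grind), p.cell_hcomp _ _ (by grind),
    p.cell_hcomp _ _ (by grind), h₄, h₅, p.cell_idc, p.cell_idc, h₂, h₃, A.one_hcomp _ _ (by grind),
    A.hcomp_one _ _ (by grind), A.vcomp_idc _ _ (by grind), A.idc_vcomp _ _ (by grind)] at e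
  exact e

theorem map_coMor {s : J.Mor} {u t : A.Mor} {ξ : A.Cell} {u' : A.Mor}
    (h : IsSquare p.dual s u t ξ u') : q.mor (l.coMor s u t ξ u') = q.mor s :=
  c.symm.map_mor h

theorem map_coCell {σ : J.Cell} {u : A.Mor} {τ ξ ξ' : A.Cell} {u' : A.Mor}
    (h : IsSquareCell p.dual σ u τ ξ' ξ u') : q.cell (l.coCell σ u τ ξ' ξ u') = q.cell σ :=
  c.symm.map_cell h

theorem obj_src_coLift {i : J.Obj} {u : A.Mor} (h : A.tgt u = p.obj i) :
    q.obj (J.src (l.coLift i u)) = q.obj i := by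
  rw [← q.src_mor, c.mor_coLift h, B.src_one]

theorem obj_tgt_lift {i : J.Obj} {v : B.Mor} (h : B.src v = q.obj i) :
    p.obj (J.tgt (r.lift i v)) = p.obj i :=
  c.symm.obj_src_coLift h

section
variable {s : J.Mor} {u t : A.Mor} {ξ : A.Cell} {u' : A.Mor} {v w : B.Mor} {ζ : B.Cell}
  {v' : B.Mor} (hξ : IsSquare p.dual s u t ξ u') (hζ : IsSquare q s v w ζ v')
include hξ hζ

/-- The left action does not change images under `q`, so a square for `s` remains a square after it;
this makes iterating the two actions meaningful. -/
theorem isSquare_coMor : IsSquare q (l.coMor s u t ξ u') v w ζ v' where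
  src_top := by
    rw [hζ.src_top, l.src_coMor hξ, c.obj_src_coLift hξ.dual_tgt_bot]
  src_bot := by
    rw [hζ.src_bot, l.tgt_coMor hξ, c.obj_src_coLift hξ.dual_tgt_top]
  src_right := hζ.src_right
  tgt_right := hζ.tgt_right
  dom_cell := hζ.dom_cell
  cod_cell := by rw [hζ.cod_cell, c.map_coMor hξ]

theorem isSquare_mor : IsSquare p.dual (r.mor s v w ζ v') u t ξ u' :=
  c.symm.isSquare_coMor hζ hξ

/-- The composite of a morphism and its lifts at both ends. -/
def _root_.TwoDim.TotalTwoCat.Lifting.span (l : Lifting p.dual) (r : Lifting q) (s : J.Mor)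
    (u' : A.Mor) (v' : B.Mor) : J.Mor :=
  l.coLift (J.src s) u' ⬝ s ⬝ r.lift (J.tgt s) v'

/-- The flanking lift for `q` is invisible to `p`. Hence `ξ` can be lifted at the flanked morphism,
and by symmetry so can `ζ`, which makes the commutation of lifts of cells applicable to it. -/
theorem dom_span : A.dom ξ = p.mor (span l r s u' v') := by
  have h₁ := hξ.dual_dom_cell
  have h₂ := l.tgt_coLift hξ.dual_tgt_bot
  have h₃ := l.map_coLift hξ.dual_tgt_bot
  have h₄ := c.mor_lift hζ.src_bot
  have h₅ := r.src_lift _ _ hζ.src_bot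
  have h₆ := hξ.dual_tgt_bot
  rw [span, p.mor_comp _ _ (by grind), h₄, p.mor_comp _ _ (by grind), h₃, A.comp_one, h₁]
  grind

theorem cod_span : B.cod ζ = q.mor (span l r s u' v') := by
  have e := c.symm.dom_span hζ hξ
  rw [span, J.comp_assoc]
  · exact e
  · exact l.tgt_coLift hξ.dual_tgt_bot
  · exact (r.src_lift _ _ hζ.src_bot).symm

theorem coCellLift_span : l.coCellLift (span l r s u' v') ξ =
    l.coCellLift (l.coLift (J.src s) u' ⬝ s) ξ ∗ J.idc (r.lift (J.tgt s) v') := by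
  have h₁ := r.src_lift _ _ hζ.src_bot
  have h₂ := l.tgt_coLift hξ.dual_tgt_bot
  have h₃ := l.dom_eq hξ
  have h₄ := hξ.dual_dom_cell
  have h₅ := hξ.dual_tgt_top
  rw [← l.coCellLift_comp_idc h₃ (by grind) (c.mor_lift hζ.src_bot), A.hcomp_one _ _ (by grind),
    span]

/-- Pushing the flanked morphism along `ξ` replaces `coLift u' ⬝ s` by `coMor ⬝ coLift u`; the lift
for `q` is then moved past `coLift u` by the commutation of lifts. -/
theorem mor_coMor_comp :
    (l.coMor s u t ξ u' ⬝ r.lift (J.src (l.coLift (J.tgt s) u)) v') ⬝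
        l.coLift (J.tgt (r.lift (J.tgt s) v')) u =
      J.cod (l.coCellLift (span l r s u' v') ξ) := by
  have h₁ := c.lift_comm hξ.dual_tgt_top hζ.src_bot
  have h₂ := l.coMor_comp_coLift hξ
  have h₃ := c.coCellLift_span hξ hζ
  have h₄ := r.src_lift _ _ (c.isSquare_coMor hξ hζ).src_bot
  have h₅ := c.obj_comm hξ.dual_tgt_top hζ.src_bot
  have h₆ := r.src_lift _ _ hζ.src_bot
  have h₇ := l.tgt_coLift hξ.dual_tgt_top
  have h₈ := l.dom_coCellLift (l.dom_eq hξ)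
  have h₉ := l.tgt_coMor hξ
  have h₁₀ := l.tgt_coLift hξ.dual_tgt_bot
  rw [h₉] at h₄
  rw [J.comp_assoc _ _ _ (by grind) (by grind), ← h₁, ← J.comp_assoc _ _ _ (by grind) (by grind),
    h₂, h₃, J.cod_hcomp _ _ (by grind), J.cod_idc]

theorem cellLift_coMor :
    r.cellLift (l.coMor s u t ξ u' ⬝ r.lift (J.src (l.coLift (J.tgt s) u)) v') ζ ∗
        J.idc (l.coLift (J.tgt (r.lift (J.tgt s) v')) u) =
      r.cellLift (J.cod (l.coCellLift (span l r s u' v') ξ)) ζ := by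
  have h₁ := c.isSquare_coMor hξ hζ
  have h₂ := l.tgt_coMor hξ
  have h₃ := r.cod_eq h₁
  have h₄ := r.src_lift _ _ h₁.src_bot
  have h₅ := c.obj_comm hξ.dual_tgt_top hζ.src_bot
  have h₆ : A.tgt u = p.obj (J.tgt (r.lift (J.tgt s) v')) := by
    rw [hξ.dual_tgt_top, c.obj_tgt_lift hζ.src_bot]
  have h₇ := c.mor_coLift h₆
  have h₈ := h₁.tgt_right
  have h₉ := r.obj_tgt_lift h₁.src_bot
  have h₁₀ := q.src_mor (l.coLift (J.tgt (r.lift (J.tgt s) v')) u)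
  rw [h₂] at h₃ h₄ h₉
  rw [← r.cellLift_comp_idc h₃ (by grind) h₇, c.mor_coMor_comp hξ hζ, B.hcomp_one]
  grind

/-- Acting on the left and then on the right, and flanking the result, yields `ζ^* ξ_!` of the
flanked morphism. -/
theorem lift_comp_mor_comp_coLift :
    (r.lift (J.src (l.coLift (J.src s) u')) v ⬝ r.mor (l.coMor s u t ξ u') v w ζ v') ⬝
        l.coLift (J.tgt (r.lift (J.tgt s) v')) u =
      J.dom (r.cellLift (J.cod (l.coCellLift (span l r s u' v') ξ)) ζ) := by
  have h₁ := c.isSquare_coMor hξ hζ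
  have h₂ := l.tgt_coMor hξ
  have h₃ := l.src_coMor hξ
  have h₄ := r.lift_comp_mor h₁
  have h₅ := r.cod_eq h₁
  have h₆ := c.obj_comm hξ.dual_tgt_top hζ.src_bot
  have h₇ := r.src_lift _ _ h₁.src_bot
  rw [h₂] at h₄ h₅ h₇
  rw [h₃] at h₄
  rw [← c.cellLift_coMor hξ hζ, h₄, J.dom_hcomp, J.dom_idc]
  grind

end

section
variable {s : J.Mor} {u t : A.Mor} {ξ : A.Cell} {u' : A.Mor} {v w : B.Mor} {ζ : B.Cell}
  {v' : B.Mor} (hξ : IsSquare p.dual s u t ξ u') (hζ : IsSquare q s v w ζ v')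
include hξ hζ

/-- The dual flanked morphism differs only in its bracketing. -/
theorem span_symm :
    span (J := J.dual) (A := B.dual) (B := A.dual) (p := q.dual) (q := p.dual) r l s v' u' =
      span l r s u' v' :=
  (J.comp_assoc _ _ _ (l.tgt_coLift hξ.dual_tgt_bot)
    (r.src_lift _ _ hζ.src_bot).symm).symm

/-- The mirror image: acting in the other order yields `ξ_! ζ^*` of the same flanked morphism. -/
theorem lift_comp_coMor_comp_coLift :
    r.lift (J.src (l.coLift (J.src s) u')) v ⬝ (l.coMor (r.mor s v w ζ v') u t ξ u' ⬝
        l.coLift (J.tgt (r.lift (J.tgt s) v')) u) =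
      J.cod (l.coCellLift (J.dom (r.cellLift (span l r s u' v') ζ)) ξ) := by
  have e := c.symm.lift_comp_mor_comp_coLift hζ hξ
  rw [c.span_symm hξ hζ] at e
  exact e

end

section
variable {s : J.Mor} {u t : A.Mor} {ξ : A.Cell} {u' : A.Mor} {v w : B.Mor} {ζ : B.Cell}
  {v' : B.Mor} (hξ : IsSquare p.dual s u t ξ u') (hζ : IsSquare q s v w ζ v')
include hξ hζ

theorem obj_eq : J.tgt (r.lift (J.tgt (l.coMor s u t ξ u')) v') =
    J.src (l.coLift (J.tgt (r.mor s v w ζ v')) u) := by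
  rw [l.tgt_coMor hξ, c.obj_comm hξ.dual_tgt_top hζ.src_bot, r.tgt_mor hζ]

theorem mor_eq : r.mor (l.coMor s u t ξ u') v w ζ v' = l.coMor (r.mor s v w ζ v') u t ξ u' := by
  have hξ' := c.isSquare_mor hξ hζ
  have hζ' := c.isSquare_coMor hξ hζ
  have h₁ := c.lift_comp_mor_comp_coLift hξ hζ
  have h₂ := c.lift_comp_coMor_comp_coLift hξ hζ
  have h₃ := c.mor_comm (c.dom_span hξ hζ) (c.cod_span hξ hζ)
  have h₄ := r.src_mor hζ'
  have h₅ := r.tgt_mor hζ'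
  have h₆ := l.tgt_coMor hξ'
  have h₇ := l.src_coMor hξ'
  have h₈ := l.src_coMor hξ
  have h₉ := c.obj_eq hξ hζ
  have h₁₀ := r.tgt_mor hζ
  have h₁₁ := r.src_mor hζ
  have h₁₂ := c.obj_comm hξ.dual_tgt_bot hζ.src_top
  have h₁₃ := hξ'.dual_tgt_top
  have h₁₄ := hζ'.src_top
  have h₁₅ := c.map_mor hζ'
  have h₁₆ := l.map_coMor hξ
  have h₁₇ := l.map_coMor hξ'
  have h₁₈ := c.map_coMor hξ'
  have h₁₉ := r.map_mor hζ
  have h₂₀ := r.map_mor hζ'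
  have h₂₁ := l.tgt_coLift h₁₃
  have h₂₂ := r.src_lift _ _ h₁₄
  rw [h₈] at h₁₄ h₂₂ h₄
  rw [h₁₀] at h₉ h₁₃ h₂₁ h₆
  -- The cartesian lift at the end is cancelled, then the opcartesian lift at the start; `h₃`, the
  -- commutation of lifts of cells at the flanked morphism, is what is left.
  refine l.coLift_ext h₁₃ (by grind) (by grind) (by grind) ?_
  refine r.mor_ext h₁₄ (by grind) (by grind) (by grind) ?_
  rw [h₂, h₃, ← h₁, J.comp_assoc] <;> grind

end

end Compatible
end Lifting
end TotalTwoCat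

/-! ### Commutation of the two actions on cells -/

namespace TotalTwoCat
variable {J A B : TotalTwoCat.{u}} {p : Functor J A} {q : Functor J B}

/-- The pasting behind `coCellLift_vcomp_cell`, with the lifts replaced by free variables. The
equations `w₁` and `w₂` stand for the defining equations of the right and left actions on cells,
`w₃` and `w₄` for the commutation of lifts of cells and of morphisms, and `h₁`, `h₂`, `w₅`, `w₆` for
lifts at whiskered morphisms. -/
theorem paste_eq (C : TotalTwoCat.{u}) {a b b' d e g : C.Mor}
    {V P P' Q U U' X L L' K N N' σ : C.Cell}
    (w₁ : (C.idc a ∗ X) ⊙ L' = L ⊙ (K ∗ C.idc b')) (h₁ : L ∗ C.idc e = P) (h₂ : L' ∗ C.idc e = P')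
    (w₃ : Q ⊙ U = V ⊙ P) (w₅ : U = N ∗ C.idc b) (w₆ : U' = N' ∗ C.idc b)
    (w₂ : N ⊙ (K ∗ C.idc d) = (C.idc g ∗ σ) ⊙ N') (w₄ : d ⬝ b = b' ⬝ e)
    (aX : C.tgt a = C.src (C.dom X)) (Xe : C.tgt (C.dom X) = C.src e)
    (XL : a ⬝ C.cod X = C.dom L') (LX : C.dom L = a ⬝ C.dom X) (LK : C.cod L = C.dom K ⬝ b')
    (Kb : C.tgt (C.dom K) = C.src b') (be : C.tgt b' = C.src e) (Kd : C.tgt (C.dom K) = C.src d)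
    (db : C.tgt d = C.src b) (VL : C.cod V = C.dom L ⬝ e) (QN : C.cod Q = C.dom N ⬝ b)
    (NK : C.cod N = C.dom K ⬝ d) (Nb : C.tgt (C.dom N) = C.src b) (Ng : C.dom N = g ⬝ C.dom σ)
    (gσ : C.tgt g = C.src (C.dom σ)) (Ng' : C.dom N' = g ⬝ C.cod σ)
    (σb : C.tgt (C.dom σ) = C.src b) :
    V ⊙ ((C.idc a ∗ X) ∗ C.idc e) ⊙ P' = Q ⊙ (C.idc g ∗ σ ∗ C.idc b) ⊙ U' := by
  subst h₁ h₂ w₅ w₆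
  calc V ⊙ ((C.idc a ∗ X) ∗ C.idc e) ⊙ (L' ∗ C.idc e)
      = V ⊙ (((C.idc a ∗ X) ⊙ L') ∗ C.idc e) := by
        rw [C.vcomp_assoc, C.hcomp_idc_vcomp (α := C.idc a ∗ X)] <;> grind
    _ = V ⊙ ((L ⊙ (K ∗ C.idc b')) ∗ C.idc e) := by rw [w₁]
    _ = V ⊙ ((L ∗ C.idc e) ⊙ (K ∗ C.idc b' ∗ C.idc e)) := by
        rw [C.hcomp_idc_vcomp] <;> grind
    _ = Q ⊙ (N ∗ C.idc b) ⊙ (K ∗ C.idc (d ⬝ b)) := by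
        rw [w₃, w₄, ← C.idc_hcomp_idc, C.vcomp_assoc, C.hcomp_assoc] <;> grind
    _ = Q ⊙ ((N ⊙ (K ∗ C.idc d)) ∗ C.idc b) := by
        rw [← C.idc_hcomp_idc _ _ db, ← C.hcomp_assoc, ← C.hcomp_idc_vcomp (α' := K ∗ C.idc d),
          C.vcomp_assoc] <;> grind
    _ = Q ⊙ (((C.idc g ∗ σ) ⊙ N') ∗ C.idc b) := by rw [w₂]
    _ = _ := by
        rw [← C.hcomp_idc_vcomp (α := C.idc g ∗ σ), C.vcomp_assoc] <;> grind

namespace Lifting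
namespace Compatible

variable {l : Lifting p.dual} {r : Lifting q} (c : Compatible l r)
include c

section
variable {σ : J.Cell} {u : A.Mor} {τ ξ ξ' : A.Cell} {u' : A.Mor} {v : B.Mor} {ω ζ ζ' : B.Cell}
  {v' : B.Mor} (hξ : IsSquareCell p.dual σ u τ ξ' ξ u') (hζ : IsSquareCell q σ v ω ζ ζ' v')
include hξ hζ

theorem isSquareCell_coCell : IsSquareCell q (l.coCell σ u τ ξ' ξ u') v ω ζ ζ' v' where
  dom := by
    rw [l.dom_coCell hξ]
    exact c.isSquare_coMor hξ.dual_dom hζ.dom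
  cod := by
    rw [l.cod_coCell hξ]
    exact c.isSquare_coMor hξ.dual_cod hζ.cod
  w := by rw [c.map_coCell hξ, hζ.w]

theorem isSquareCell_cell : IsSquareCell p.dual (r.cell σ v ω ζ ζ' v') u τ ξ' ξ u' :=
  c.symm.isSquareCell_coCell hζ hξ

/-- Once flanked and composed with the lifts of `ξ` and `ζ'`, the cell obtained by acting left then
right equals an expression in `σ` and lifts in which no action occurs. The other order of acting
gives the same expression. -/
theorem coCellLift_vcomp_cell :
    l.coCellLift (J.dom (r.cellLift (span l r (J.dom σ) u' v') ζ)) ξ ⊙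
        ((J.idc (r.lift (J.src (l.coLift (J.src (J.dom σ)) u')) v) ∗
          r.cell (l.coCell σ u τ ξ' ξ u') v ω ζ ζ' v') ∗
          J.idc (l.coLift (J.tgt (r.lift (J.tgt (J.dom σ)) v')) u)) ⊙
        r.cellLift (J.cod (l.coCellLift (span l r (J.cod σ) u' v') ξ')) ζ' =
      r.cellLift (span l r (J.dom σ) u' v') ζ ⊙
        (J.idc (l.coLift (J.src (J.dom σ)) u') ∗ σ ∗ J.idc (r.lift (J.tgt (J.dom σ)) v')) ⊙
        l.coCellLift (span l r (J.cod σ) u' v') ξ' := by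
  have xd := hξ.dual_dom
  have xc := hξ.dual_cod
  have zd := hζ.dom
  have zc := hζ.cod
  have hc := c.isSquareCell_coCell hξ hζ
  have h₁ := c.cellLift_coMor xd zd
  have h₂ := c.cellLift_coMor xc zc
  have w₁ := r.lift_hcomp_cell hc
  have w₂ := l.coCell_hcomp_coLift hξ
  have w₃ := c.cell_comm (c.dom_span xd zd) (c.cod_span xd zd)
  have w₄ := c.lift_comm xd.dual_tgt_top zd.src_bot
  have w₅ := c.coCellLift_span xd zd
  have w₆ := c.coCellLift_span xc zc
  have m₁ := c.lift_comp_mor_comp_coLift xd zd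
  have m₂ := c.lift_comp_mor_comp_coLift xc zc
  have m₃ := c.mor_coMor_comp xd zd
  have m₄ := c.mor_coMor_comp xc zc
  have m₅ := c.mor_comm (c.dom_span xd zd) (c.cod_span xd zd)
  have o₁ := c.obj_comm xd.dual_tgt_top zd.src_bot
  have d₁ := l.dom_coCell hξ
  have d₂ := l.cod_coCell hξ
  have s₁ := l.src_coMor xd
  have s₂ := l.tgt_coMor xd
  have s₃ := l.src_coMor xc
  have s₄ := l.tgt_coMor xc
  have s₅ := r.src_dom_cell hc
  have s₆ := r.tgt_dom_cell hc
  have s₇ := r.lift_comp_dom_cell hc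
  have s₈ := r.lift_comp_cod_cell hc
  have s₉ := l.coMor_comp_coLift xd
  have s₁₀ := l.coMor_comp_coLift xc
  have c₁ := r.cod_eq_dom hc
  have c₂ := r.cod_eq_cod hc
  have r₁ := r.src_lift _ _ hc.dom.src_top
  have r₂ := r.src_lift _ _ hc.dom.src_bot
  have r₃ := r.src_lift _ _ zd.src_bot
  have r₄ := l.tgt_coLift xd.dual_tgt_top
  have r₅ := l.tgt_coLift xd.dual_tgt_bot
  have r₆ := l.dom_coCellLift (c.dom_span xd zd)
  have r₇ := l.dom_coCellLift (c.dom_span xc zc)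
  have r₈ := l.dom_coCellLift (l.dom_eq xd)
  have r₉ := l.dom_coCellLift (l.dom_eq xc)
  have r₁₀ := r.cod_cellLift _ _ (c.cod_span xd zd)
  have r₁₁ := r.cod_cellLift _ _ c₁
  have r₁₂ := r.cod_cellLift _ _ c₂
  have t₁ := c.obj_tgt_lift zd.src_bot
  have t₂ := l.tgt_coLift (xd.dual_tgt_top.trans t₁.symm)
  have r₁₃ : J.dom (l.coCellLift (J.dom (r.cellLift (l.span r (J.dom σ) u' v') ζ)) ξ) =
      J.dom (r.cellLift (l.span r (J.dom σ) u' v') ζ) := by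
    refine l.dom_coCellLift ?_
    rw [← p.dom_cell, c.cell_cellLift (c.cod_span xd zd), A.dom_idc, c.dom_span xd zd]
  have es := J.src_cod σ
  have et := J.tgt_cod σ
  rw [d₁] at s₅ r₁ s₆ s₇ s₈ c₁ c₂ r₁₁ r₁₂ r₂ w₁
  rw [s₁] at r₁ s₅ s₇ s₈ w₁
  rw [s₂] at s₆ s₇ s₈ c₁ c₂ r₂ r₁₁ r₁₂ w₁
  rw [d₂] at s₈ c₂ r₁₂ w₁
  rw [es] at w₆ m₂ s₁₀ r₉ s₃
  rw [et] at h₂ w₆ m₂ m₄ s₁₀ s₄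
  have sp : span l r (J.dom σ) u' v' =
    l.coLift (J.src (J.dom σ)) u' ⬝ J.dom σ ⬝ r.lift (J.tgt (J.dom σ)) v' := rfl
  have sp' : span l r (J.cod σ) u' v' =
    l.coLift (J.src (J.dom σ)) u' ⬝ J.cod σ ⬝ r.lift (J.tgt (J.dom σ)) v' := by
      rw [span, es, et]
  -- The remaining goals only concern boundaries, hence the equations between cells can be discarded
  -- for them.
  refine J.paste_eq w₁ h₁ h₂ w₃ w₅ w₆ w₂ w₄ ?_ ?_ ?_ ?_ ?_ ?_ ?_ ?_ ?_ ?_ ?_ ?_ ?_ ?_ ?_ ?_ ?_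
  all_goals clear w₁ w₂ w₃ w₅ w₆; grind

theorem coCellLift_vcomp_coCell :
    l.coCellLift (J.dom (r.cellLift (span l r (J.dom σ) u' v') ζ)) ξ ⊙
        (J.idc (r.lift (J.src (l.coLift (J.src (J.dom σ)) u')) v) ∗
          (l.coCell (r.cell σ v ω ζ ζ' v') u τ ξ' ξ u' ∗
          J.idc (l.coLift (J.tgt (r.lift (J.tgt (J.dom σ)) v')) u)) ⊙
        r.cellLift (J.cod (l.coCellLift (span l r (J.cod σ) u' v') ξ')) ζ') =
      r.cellLift (span l r (J.dom σ) u' v') ζ ⊙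
        (J.idc (l.coLift (J.src (J.dom σ)) u') ∗ (σ ∗ J.idc (r.lift (J.tgt (J.dom σ)) v')) ⊙
        l.coCellLift (span l r (J.cod σ) u' v') ξ') := by
  have e := c.symm.coCellLift_vcomp_cell hζ hξ
  have e₁ := c.span_symm hξ.dual_dom hζ.dom
  have e₂ := c.span_symm hξ.dual_cod hζ.cod
  have es := J.src_cod σ
  have et := J.tgt_cod σ
  rw [← es, ← et]
  rw [← e₁, ← e₂]
  exact e

theorem cell_eq : r.cell (l.coCell σ u τ ξ' ξ u') v ω ζ ζ' v' =
    l.coCell (r.cell σ v ω ζ ζ' v') u τ ξ' ξ u' := by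
  have xd := hξ.dual_dom
  have xc := hξ.dual_cod
  have zd := hζ.dom
  have zc := hζ.cod
  have hc := c.isSquareCell_coCell hξ hζ
  have hc' := c.isSquareCell_cell hξ hζ
  have e₁ := c.coCellLift_vcomp_cell hξ hζ
  have e₂ := c.coCellLift_vcomp_coCell hξ hζ
  have d₁ : J.dom (r.cell (l.coCell σ u τ ξ' ξ u') v ω ζ ζ' v') =
      J.dom (l.coCell (r.cell σ v ω ζ ζ' v') u τ ξ' ξ u') := by
    rw [r.dom_cell hc, l.dom_coCell hξ, l.dom_coCell hc', r.dom_cell hζ, c.mor_eq xd zd]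
  have d₂ : J.cod (r.cell (l.coCell σ u τ ξ' ξ u') v ω ζ ζ' v') =
      J.cod (l.coCell (r.cell σ v ω ζ ζ' v') u τ ξ' ξ u') := by
    rw [r.cod_cell hc, l.cod_coCell hξ, l.cod_coCell hc', r.cod_cell hζ, c.mor_eq xc zc]
  have k₁ : q.cell (r.cell (l.coCell σ u τ ξ' ξ u') v ω ζ ζ' v') =
      q.cell (l.coCell (r.cell σ v ω ζ ζ' v') u τ ξ' ξ u') := by
    rw [r.map_cell hc, c.map_coCell hc', r.map_cell hζ]
  have k₂ : p.cell (r.cell (l.coCell σ u τ ξ' ξ u') v ω ζ ζ' v') =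
      p.cell (l.coCell (r.cell σ v ω ζ ζ' v') u τ ξ' ξ u') := by
    rw [l.map_coCell hc', c.map_cell hc, l.map_coCell hξ]
  have m₁ := c.lift_comp_mor_comp_coLift xd zd
  have m₂ := c.lift_comp_mor_comp_coLift xc zc
  have m₃ := c.mor_comm (c.dom_span xd zd) (c.cod_span xd zd)
  have s₁ := r.dom_cell hc
  have s₂ := r.cod_cell hc
  have s₃ := r.src_mor hc.dom
  have s₄ := r.tgt_mor hc.dom
  have s₅ := l.src_coMor xd
  have s₆ := l.tgt_coMor xd
  have o₁ := c.obj_comm xd.dual_tgt_top zd.src_bot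
  have t₁ := c.obj_tgt_lift zd.src_bot
  have t₂ := c.obj_src_coLift xd.dual_tgt_bot
  have t₃ := l.tgt_coLift (xd.dual_tgt_top.trans t₁.symm)
  have t₄ := r.src_lift _ _ (zd.src_top.trans t₂.symm)
  have f₁ : A.dom ξ = p.mor (J.dom (r.cellLift (span l r (J.dom σ) u' v') ζ)) := by
    rw [← p.dom_cell, c.cell_cellLift (c.cod_span xd zd), A.dom_idc, c.dom_span xd zd]
  have f₂ : B.cod ζ' = q.mor (J.cod (l.coCellLift (span l r (J.cod σ) u' v') ξ')) := by
    rw [← q.cod_cell, c.cell_coCellLift (c.dom_span xc zc), B.cod_idc, c.cod_span xc zc]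
  have es := J.src_cod σ
  have et := J.tgt_cod σ
  have g₁ := l.dom_coCellLift f₁
  have g₂ := r.cod_cellLift _ _ f₂
  rw [es, et] at m₂
  rw [l.dom_coCell hξ] at s₁ s₃ s₄
  rw [l.cod_coCell hξ] at s₂
  have b₁ : J.tgt (J.dom (r.cell (l.coCell σ u τ ξ' ξ u') v ω ζ ζ' v')) =
      J.src (l.coLift (J.tgt (r.lift (J.tgt (J.dom σ)) v')) u) := by
    rw [s₁, s₄, s₆, o₁]
  have b₂ : J.src (J.dom (r.cell (l.coCell σ u τ ξ' ξ u') v ω ζ ζ' v')) =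
      J.tgt (r.lift (J.src (l.coLift (J.src (J.dom σ)) u')) v) := by
    rw [s₁, s₃, s₅]
  rw [← s₁] at m₁
  rw [← s₂] at m₂
  have g₃ : J.cod (r.cellLift (span l r (J.dom σ) u' v') ζ) =
      l.coLift (J.src (J.dom σ)) u' ⬝ J.dom σ ⬝ r.lift (J.tgt (J.dom σ)) v' :=
    r.cod_cellLift _ _ (c.cod_span xd zd)
  have g₄ : J.dom (l.coCellLift (span l r (J.cod σ) u' v') ξ') =
      l.coLift (J.src (J.dom σ)) u' ⬝ J.cod σ ⬝ r.lift (J.tgt (J.dom σ)) v' := by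
    rw [l.dom_coCellLift (c.dom_span xc zc), span, es, et]
  have g₅ := r.src_lift _ _ zd.src_bot
  have g₆ := l.tgt_coLift xd.dual_tgt_bot
  clear s₁ s₂ s₃ s₄ s₅ s₆ hc hc'
  have h₁ := xd.dual_tgt_top.trans t₁.symm
  have h₂ := zd.src_top.trans t₂.symm
  -- Only the boundaries of the two cells, their images under `p` and `q`, and the equations `e₁`
  -- and `e₂` are used from now on.
  generalize r.cell (l.coCell σ u τ ξ' ξ u') v ω ζ ζ' v' = X at *
  generalize l.coCell (r.cell σ v ω ζ ζ' v') u τ ξ' ξ u' = Y at *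
  clear hξ hζ xd xc zd zc
  -- Four cancellations: the two flanking lifts of morphisms, then the opcartesian lift of `ξ` and
  -- the cartesian lift of `ζ'`. Images under `p` and `q` supply the side conditions.
  refine l.coLift_cell_ext h₁ b₁ d₁ d₂ k₂ ?_
  refine r.cell_ext h₂ (by grind) (by grind) (by grind) (by grind) ?_
  refine l.coCellLift_ext f₁ (by grind) (by grind) (by grind) ?_
  refine r.cellLift_ext f₂ (by grind) (by grind) (by grind) ?_
  rw [← J.hcomp_assoc _ _ _ (by grind) (by grind), e₁, J.vcomp_assoc, J.vcomp_assoc, e₂,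
    J.hcomp_assoc] <;> grind

end

end Compatible
end Lifting
end TotalTwoCat

/-! ### Compatible actions correspond to compatible lifts -/

namespace TotalTwoCat
variable {J A B : TotalTwoCat.{u}} {p : Functor J A} {q : Functor J B}

namespace Action
variable (L : Action p.dual)

/-- The action of an object of `A^𝟚`. -/
def coObj (i : J.Obj) (u : A.Mor) : J.Obj := L.obj i u

/-- The action of a morphism of `A^𝟚`. -/
def coMor (s : J.Mor) (u t : A.Mor) (ξ : A.Cell) (u' : A.Mor) : J.Mor := L.mor s u t ξ u'

/-- The action of a cell of `A^𝟚`. -/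
def coCell (σ : J.Cell) (u : A.Mor) (τ ξ' ξ : A.Cell) (u' : A.Mor) : J.Cell :=
  L.cell σ u τ ξ' ξ u'

/-- The lift of a morphism that is induced by a left action. -/
def coLift (i : J.Obj) (u : A.Mor) : J.Mor := L.coMor (J.one i) (A.one (p.obj i)) u (A.idc u) u

/-- The lift of a cell that is induced by a left action. -/
def coCellLift (s : J.Mor) (α : A.Cell) : J.Cell :=
  L.coCell (J.idc s) (A.one (p.obj (J.tgt s))) α α (A.idc (p.mor s)) (A.one (p.obj (J.src s)))

section
variable {i : J.Obj} {u : A.Mor} (h : A.tgt u = p.obj i)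
include h

theorem coLiftSquare : IsSquare p.dual (J.one i) (A.one (p.obj i)) u (A.idc u) u :=
  .liftSquare (q := p.dual) h

theorem tgt_coLift : J.tgt (L.coLift i u) = i := L.src_lift h
theorem src_coLift : J.src (L.coLift i u) = L.coObj i u := L.tgt_lift h

end

section
variable {s : J.Mor} {α : A.Cell} (h : A.dom α = p.mor s)
include h

theorem coLiftCell : IsSquareCell p.dual (J.idc s) (A.one (p.obj (J.tgt s))) α α
    (A.idc (p.mor s)) (A.one (p.obj (J.src s))) := .liftCell (q := p.dual) h

theorem dom_coCellLift : J.dom (L.coCellLift s α) = s := L.cod_cellLift h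

end

end Action

/-- Compatibility of a left action of `A^𝟚` and a right action of `B^𝟚`, each of which is fibred
over the other leg. -/
structure Action.Compatible (L : Action p.dual) (R : Action q) : Prop where
  obj_left {i : J.Obj} {u : A.Mor} : A.tgt u = p.obj i → q.obj (L.coObj i u) = q.obj i
  mor_left {s : J.Mor} {u t : A.Mor} {ξ : A.Cell} {u' : A.Mor} : IsSquare p.dual s u t ξ u' →
    q.mor (L.coMor s u t ξ u') = q.mor s
  cell_left {σ : J.Cell} {u : A.Mor} {τ ξ ξ' : A.Cell} {u' : A.Mor} :
    IsSquareCell p.dual σ u τ ξ' ξ u' → q.cell (L.coCell σ u τ ξ' ξ u') = q.cell σ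
  obj_right {i : J.Obj} {v : B.Mor} : B.src v = q.obj i → p.obj (R.obj i v) = p.obj i
  mor_right {s : J.Mor} {v w : B.Mor} {ζ : B.Cell} {v' : B.Mor} : IsSquare q s v w ζ v' →
    p.mor (R.mor s v w ζ v') = p.mor s
  cell_right {σ : J.Cell} {v : B.Mor} {ω ζ ζ' : B.Cell} {v' : B.Mor} :
    IsSquareCell q σ v ω ζ ζ' v' → p.cell (R.cell σ v ω ζ ζ' v') = p.cell σ
  obj_comm {i : J.Obj} {u : A.Mor} {v : B.Mor} : A.tgt u = p.obj i → B.src v = q.obj i →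
    R.obj (L.coObj i u) v = L.coObj (R.obj i v) u
  mor_comm {s : J.Mor} {u t : A.Mor} {ξ : A.Cell} {u' : A.Mor} {v w : B.Mor} {ζ : B.Cell}
    {v' : B.Mor} : IsSquare p.dual s u t ξ u' → IsSquare q s v w ζ v' →
    R.mor (L.coMor s u t ξ u') v w ζ v' = L.coMor (R.mor s v w ζ v') u t ξ u'
  cell_comm {σ : J.Cell} {u : A.Mor} {τ ξ ξ' : A.Cell} {u' : A.Mor} {v : B.Mor}
    {ω ζ ζ' : B.Cell} {v' : B.Mor} : IsSquareCell p.dual σ u τ ξ' ξ u' →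
    IsSquareCell q σ v ω ζ ζ' v' →
    R.cell (L.coCell σ u τ ξ' ξ u') v ω ζ ζ' v' = L.coCell (R.cell σ v ω ζ ζ' v') u τ ξ' ξ u'

theorem Lifting.Compatible.action {l : Lifting p.dual} {r : Lifting q} (c : l.Compatible r) :
    l.action.Compatible r.action where
  obj_left := c.obj_src_coLift
  mor_left := c.map_coMor
  cell_left := c.map_coCell
  obj_right := c.obj_tgt_lift
  mor_right := c.map_mor
  cell_right := c.map_cell
  obj_comm := c.obj_comm
  mor_comm := c.mor_eq
  cell_comm := c.cell_eq

namespace Action.Compatible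
variable {L : Action p.dual} {R : Action q} (c : L.Compatible R)
include c

/-- Both composites are the value of the right action at one square over `coLift i u`, from an
identity arrow to `v`. For the right-hand side, commutation of actions at the identity square of
`(i, v)` exhibits the left lift at `R.obj i v` as a value of the right action. -/
theorem lift_comm {i : J.Obj} {u : A.Mor} {v : B.Mor} (hu : A.tgt u = p.obj i)
    (hv : B.src v = q.obj i) :
    L.coLift i u ⬝ R.lift i v = R.lift (L.coObj i u) v ⬝ L.coLift (R.obj i v) u := by
  have h₁ : q.mor (L.coLift i u) = B.one (q.obj i) :=
    (c.mor_left (coLiftSquare hu)).trans (q.mor_one i)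
  have h₂ := L.tgt_coLift hu
  have h₃ := L.src_coLift hu
  have h₄ : IsSquare q (L.coLift i u) v (B.one (B.tgt v)) (B.idc v) v := by
    have := c.obj_left hu
    constructor <;> grind
  have h₅ : L.coLift (R.obj i v) u = R.mor (L.coLift i u) v (B.one (B.tgt v)) (B.idc v) v := by
    have h : IsSquare q (J.one i) v (B.one (B.tgt v)) (B.idc v) v := by
      constructor <;> grind
    rw [coLift, coLift, c.mor_comm (coLiftSquare hu) h, R.mor_one i v hv, c.obj_right hv]
  have e₁ := R.comp_lift (s := L.coLift i u) (u := v) (by rw [h₂, hv])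
  have e₂ := R.lift_comp_mor h₄
  rw [h₂, h₁, B.one_comp _ _ hv.symm] at e₁
  rw [h₃, B.comp_one _ _ rfl] at e₂
  rw [h₅, e₂, e₁, h₃]

section
variable {s : J.Mor} {α : A.Cell} {β : B.Cell} (hα : A.dom α = p.mor s) (hβ : B.cod β = q.mor s)
include hα hβ

/-- The morphism `β^* s` is a value of the right action; commutation with the identity cell of the
square `β` moves the left lift inside. -/
theorem coCellLift_dom : L.coCellLift (J.dom (R.cellLift s β)) α = R.cell (L.coCellLift s α)
    (B.one (q.obj (J.src s))) (B.idc (B.dom β)) β β (B.one (q.obj (J.tgt s))) := by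
  have e := c.cell_comm (coLiftCell hα) (.id (.pullSquare hβ))
  have h₂ := R.src_mor (.pullSquare hβ)
  have h₃ := R.tgt_mor (.pullSquare hβ)
  have h₄ := c.mor_right (.pullSquare hβ)
  rw [R.obj_unit] at h₂ h₃
  rw [R.cell_idc (.pullSquare hβ)] at e
  rw [R.dom_cellLift hβ, coCellLift, coCellLift, h₂, h₃, h₄, e]

theorem mor_coCellLift : q.cell (L.coCellLift s α) = B.idc (q.mor s) :=
  (c.cell_left (coLiftCell hα)).trans (q.cell_idc s)

theorem isSquareCell_coCellLift : IsSquareCell q (L.coCellLift s α) (B.one (q.obj (J.src s)))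
    (B.idc (B.dom β)) β β (B.one (q.obj (J.tgt s))) := by
  have := IsSquare.pullSquare hβ
  have d₁ := L.dom_coCellLift hα
  have d₃ := c.mor_coCellLift hα hβ
  have d₄ := q.cod_cell (L.coCellLift s α)
  rw [d₃, B.cod_idc] at d₄
  constructor <;> (try constructor) <;> grind

theorem cellLift_cod : R.cellLift (J.cod (L.coCellLift s α)) β = R.cell
    (J.idc (J.cod (L.coCellLift s α))) (B.one (q.obj (J.src s))) β β (B.idc (q.mor s))
    (B.one (q.obj (J.tgt s))) := by
  rw [cellLift, ← q.cod_cell, c.mor_coCellLift hα hβ, B.cod_idc, J.src_cod, J.tgt_cod,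
    L.dom_coCellLift hα]

theorem mor_comm' : J.cod (L.coCellLift (J.dom (R.cellLift s β)) α) =
    J.dom (R.cellLift (J.cod (L.coCellLift s α)) β) := by
  have h : B.cod β = q.mor (J.cod (L.coCellLift s α)) := by
    rw [← q.cod_cell, c.mor_coCellLift hα hβ, B.cod_idc, hβ]
  rw [c.coCellLift_dom hα hβ, R.cod_cell (c.isSquareCell_coCellLift hα hβ), R.dom_cellLift h,
    J.src_cod, J.tgt_cod, B.cod_idc, L.dom_coCellLift hα]

/-- The pair `(L.coCellLift s α, β)` is a cell of squares that factors in two ways, with either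
component performed first. Functoriality of the right action gives the two sides. -/
theorem cell_comm' : R.cellLift s β ⊙ L.coCellLift s α =
    L.coCellLift (J.dom (R.cellLift s β)) α ⊙ R.cellLift (J.cod (L.coCellLift s α)) β := by
  have d₁ := L.dom_coCellLift hα
  have d₃ := c.mor_coCellLift hα hβ
  have d₄ : q.mor (J.cod (L.coCellLift s α)) = q.mor s := by rw [← q.cod_cell, d₃, B.cod_idc]
  have s₁ := c.isSquareCell_coCellLift hα hβ
  have s₂ : IsSquareCell q (J.idc (J.cod (L.coCellLift s α))) (B.one (q.obj (J.src s))) β β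
      (B.idc (q.mor s)) (B.one (q.obj (J.tgt s))) := by
    have := IsSquareCell.liftCell (hβ.trans d₄.symm)
    rwa [J.src_cod, J.tgt_cod, d₁, d₄] at this
  have s₃ := IsSquareCell.unit (q := q) (L.coCellLift s α)
  have u := R.cell_unit (L.coCellLift s α)
  rw [d₁, d₃, d₄] at u s₃
  -- First `β`, then the left lift, the latter entering through its unit cell; `v₂` performs them in
  -- the other order.
  have v₁ := R.cell_vcomp (.liftCell hβ) s₃ (by rw [J.cod_idc, d₁]) (by grind)
  have v₂ := R.cell_vcomp s₁ s₂ (by rw [J.dom_idc]) (by grind)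
  rw [u] at v₁
  rw [c.coCellLift_dom hα hβ, c.cellLift_cod hα hβ, ← v₂]
  refine v₁.symm.trans ?_
  rw [J.idc_vcomp _ _ d₁.symm, J.vcomp_idc _ _ rfl, B.vcomp_idc _ _ hβ.symm, B.idc_vcomp _ _ rfl]

end

theorem lifting : L.lifting.Compatible R.lifting where
  mor_coLift h := (c.mor_left (coLiftSquare h)).trans (q.mor_one _)
  cell_coCellLift h := (c.cell_left (coLiftCell h)).trans (q.cell_idc _)
  mor_lift h := (c.mor_right (.liftSquare h)).trans (p.mor_one _)
  cell_cellLift h := (c.cell_right (.liftCell h)).trans (p.cell_idc _)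
  obj_comm {i u v} hu hv := by
    change J.tgt (R.lift (J.src (L.coLift i u)) v) = J.src (L.coLift (J.tgt (R.lift i v)) u)
    rw [L.src_coLift hu, R.tgt_lift (hv.trans (c.obj_left hu).symm), R.tgt_lift hv,
      L.src_coLift (hu.trans (c.obj_right hv).symm), c.obj_comm hu hv]
  lift_comm {i u v} hu hv := by
    change L.coLift i u ⬝ R.lift i v =
      R.lift (J.src (L.coLift i u)) v ⬝ L.coLift (J.tgt (R.lift i v)) u
    rw [c.lift_comm hu hv, L.src_coLift hu, R.tgt_lift hv]
  mor_comm := c.mor_comm'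
  cell_comm := c.cell_comm'

end Action.Compatible
end TotalTwoCat

/-! ### Morphisms and cells of a bicategory with free boundary -/

section arrows
variable (C : Type u) [Bicategory.{w, v} C]

/-- The morphisms of a bicategory, with arbitrary source and target. -/
structure Arr where
  src : C
  tgt : C
  hom : src ⟶ tgt

/-- The cells of a bicategory, with arbitrary source and target. -/
structure Cel where
  src : C
  tgt : C
  dom : src ⟶ tgt
  cod : src ⟶ tgt
  hom : dom ⟶ cod

variable {C}

namespace Arr

/-- The morphism that underlies an arrow with the given source and target. -/
def homOf (x : Arr C) {a b : C} (ha : x.src = a) (hb : x.tgt = b) : a ⟶ b :=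
  x.hom.cast ha hb

theorem mk_homOf (x : Arr C) {a b : C} (ha : x.src = a) (hb : x.tgt = b) :
    Arr.mk a b (x.homOf ha hb) = x := by
  subst ha hb; rfl

theorem mk_inj {a b : C} {f g : a ⟶ b} : Arr.mk a b f = Arr.mk a b g ↔ f = g := by
  simp

theorem mk_eq {a b a' b' : C} {f : a ⟶ b} {g : a' ⟶ b'} (ha : a = a') (hb : b = b')
    (h : f ≍ g) : Arr.mk a b f = Arr.mk a' b' g := by
  subst ha hb h; rfl

theorem heq_of_eq {a b a' b' : C} {f : a ⟶ b} {g : a' ⟶ b'} (h : Arr.mk a b f = Arr.mk a' b' g) :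
    f ≍ g := by
  cases h; rfl

open Classical in
/-- The composite of two arrows. -/
noncomputable def comp (x y : Arr C) : Arr C :=
  if h : x.tgt = y.src then ⟨x.src, y.tgt, x.hom ≫ y.hom.cast h.symm rfl⟩ else x

@[simp] theorem mk_comp {a b c : C} (f : a ⟶ b) (g : b ⟶ c) :
    (Arr.mk a b f).comp (Arr.mk b c g) = ⟨a, c, f ≫ g⟩ :=
  dif_pos rfl

end Arr

namespace Cel

/-- The cell that underlies a cell with the given boundary. -/
def homOf (α : Cel C) {a b : C} {f g : a ⟶ b} (hf : Arr.mk α.src α.tgt α.dom = ⟨a, b, f⟩)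
    (hg : Arr.mk α.src α.tgt α.cod = ⟨a, b, g⟩) : f ⟶ g := by
  obtain ⟨a', b', f', g', η⟩ := α
  dsimp only at hf hg
  have ha := (Arr.mk.inj hf).1
  have hb := (Arr.mk.inj hf).2.1
  subst ha hb
  exact eqToHom (Arr.mk_inj.1 hf).symm ≫ η ≫ eqToHom (Arr.mk_inj.1 hg)

theorem mk_homOf (α : Cel C) {a b : C} {f g : a ⟶ b} (hf : Arr.mk α.src α.tgt α.dom = ⟨a, b, f⟩)
    (hg : Arr.mk α.src α.tgt α.cod = ⟨a, b, g⟩) : Cel.mk a b f g (α.homOf hf hg) = α := by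
  obtain ⟨a', b', f', g', η⟩ := α
  dsimp only at hf hg
  cases hf
  cases hg
  simp [homOf]

theorem homOf_eq {α : Cel C} {a b : C} {f g : a ⟶ b} {hf : Arr.mk α.src α.tgt α.dom = ⟨a, b, f⟩}
    {hg : Arr.mk α.src α.tgt α.cod = ⟨a, b, g⟩} {η : f ⟶ g} (h : α = Cel.mk a b f g η) :
    α.homOf hf hg = η := by
  subst h; simp [homOf]

theorem mk_inj {a b : C} {f g : a ⟶ b} {η θ : f ⟶ g} :
    Cel.mk a b f g η = Cel.mk a b f g θ ↔ η = θ := by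
  simp

theorem mk_eq {a b : C} {f g f' g' : a ⟶ b} {η : f ⟶ g} {θ : f' ⟶ g'} (hf : f = f') (hg : g = g')
    (h : η = eqToHom hf ≫ θ ≫ eqToHom hg.symm) : Cel.mk a b f g η = Cel.mk a b f' g' θ := by
  subst hf hg h; simp

theorem mk_eq_of_heq {a b a' b' : C} {f g : a ⟶ b} {f' g' : a' ⟶ b'} {η : f ⟶ g} {θ : f' ⟶ g'}
    (ha : a = a') (hb : b = b') (hf : f ≍ f') (hg : g ≍ g') (h : η ≍ θ) :
    Cel.mk a b f g η = Cel.mk a' b' f' g' θ := by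
  subst ha hb hf hg h; rfl

theorem heq_of_eq {a b a' b' : C} {f g : a ⟶ b} {f' g' : a' ⟶ b'} {η : f ⟶ g} {θ : f' ⟶ g'}
    (h : Cel.mk a b f g η = Cel.mk a' b' f' g' θ) : η ≍ θ := by
  cases h; rfl

/-- When the boundary is part of the data, composing with an `eqToHom` does nothing. This and the
next two lemmas are how transports disappear in the passage to total sets. -/
theorem eqToHom_comp {a b : C} {f f' g : a ⟶ b} (h : f = f') (η : f' ⟶ g) :
    Cel.mk a b f g (eqToHom h ≫ η) = ⟨a, b, f', g, η⟩ := by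
  subst h; simp

theorem comp_eqToHom {a b : C} {f g g' : a ⟶ b} (h : g = g') (η : f ⟶ g) :
    Cel.mk a b f g' (η ≫ eqToHom h) = ⟨a, b, f, g, η⟩ := by
  subst h; simp

theorem eqToHom_eq {a b : C} {f g : a ⟶ b} (h : f = g) :
    Cel.mk a b f g (eqToHom h) = ⟨a, b, f, f, 𝟙 f⟩ := by
  subst h; simp

open Classical in
/-- The vertical composite of two cells. -/
noncomputable def vcomp (α β : Cel C) : Cel C :=
  if h : Arr.mk α.src α.tgt α.cod = Arr.mk β.src β.tgt β.dom then
    ⟨α.src, α.tgt, α.dom, β.cod.cast (Arr.mk.inj h).1.symm (Arr.mk.inj h).2.1.symm,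
      α.hom ≫ β.homOf h.symm (Arr.mk_homOf ⟨β.src, β.tgt, β.cod⟩ _ _).symm⟩
  else α

@[simp] theorem mk_vcomp {a b : C} {f g h : a ⟶ b} (η : f ⟶ g) (θ : g ⟶ h) :
    (Cel.mk a b f g η).vcomp (Cel.mk a b g h θ) = ⟨a, b, f, h, η ≫ θ⟩ := by
  refine (dif_pos rfl).trans ?_
  congr 2
  exact homOf_eq rfl

open Classical in
/-- The horizontal composite of two cells. -/
noncomputable def hcomp (α β : Cel C) : Cel C :=
  if h : α.tgt = β.src then
    ⟨α.src, β.tgt, α.dom ≫ β.dom.cast h.symm rfl, α.cod ≫ β.cod.cast h.symm rfl,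
      α.hom ▷ _ ≫ α.cod ◁ β.homOf (Arr.mk_homOf ⟨β.src, β.tgt, β.dom⟩ _ _).symm
        (Arr.mk_homOf ⟨β.src, β.tgt, β.cod⟩ _ _).symm⟩
  else α

@[simp] theorem mk_hcomp {a b c : C} {f g : a ⟶ b} {h k : b ⟶ c} (η : f ⟶ g) (θ : h ⟶ k) :
    (Cel.mk a b f g η).hcomp (Cel.mk b c h k θ) = ⟨a, c, f ≫ h, g ≫ k, η ▷ h ≫ g ◁ θ⟩ := by
  refine (dif_pos rfl).trans ?_
  congr 3
  exact homOf_eq rfl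

end Cel

end arrows

/-! ### Strict bicategories and 2-functors in total form -/

section total
variable (C : Type u) [Bicategory.{u, u} C] [Strict C]

/-- The presentation of a strict bicategory in terms of its types of all morphisms and cells. -/
@[reducible] noncomputable def total : TotalTwoCat.{u} where
  Obj := C
  Mor := Arr C
  Cell := Cel C
  src x := x.src
  tgt x := x.tgt
  one a := ⟨a, a, 𝟙 a⟩
  comp x y := x.comp y
  dom α := ⟨α.src, α.tgt, α.dom⟩
  cod α := ⟨α.src, α.tgt, α.cod⟩
  idc x := ⟨x.src, x.tgt, x.hom, x.hom, 𝟙 x.hom⟩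
  vcomp α β := α.vcomp β
  hcomp α β := α.hcomp β
  src_one a := rfl
  tgt_one a := rfl
  src_comp := by rintro ⟨a, b, f⟩ ⟨_, c, g⟩ ⟨⟩; simp
  tgt_comp := by rintro ⟨a, b, f⟩ ⟨_, c, g⟩ ⟨⟩; simp
  comp_assoc := by rintro ⟨a, b, f⟩ ⟨_, c, g⟩ ⟨_, d, h⟩ ⟨⟩ ⟨⟩; simp
  one_comp := by rintro ⟨a, b, f⟩ _ rfl; simp
  comp_one := by rintro ⟨a, b, f⟩ _ rfl; simp
  src_cod α := rfl
  tgt_cod α := rfl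
  dom_idc x := rfl
  cod_idc x := rfl
  dom_vcomp := by rintro ⟨a, b, f, g, η⟩ ⟨_, _, _, h, θ⟩ ⟨⟩; rw [Cel.mk_vcomp]
  cod_vcomp := by rintro ⟨a, b, f, g, η⟩ ⟨_, _, _, h, θ⟩ ⟨⟩; rw [Cel.mk_vcomp]
  vcomp_assoc := by
    rintro ⟨a, b, f, g, η⟩ ⟨_, _, _, h, θ⟩ ⟨_, _, _, k, ι⟩ ⟨⟩ ⟨⟩; simp
  idc_vcomp := by rintro ⟨a, b, f, g, η⟩ _ rfl; simp
  vcomp_idc := by rintro ⟨a, b, f, g, η⟩ _ rfl; simp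
  dom_hcomp := by
    rintro ⟨a, b, f, g, η⟩ ⟨_, c, h, k, θ⟩ ⟨⟩
    rw [Cel.mk_hcomp]
    exact (Arr.mk_comp f h).symm
  cod_hcomp := by
    rintro ⟨a, b, f, g, η⟩ ⟨_, c, h, k, θ⟩ ⟨⟩
    rw [Cel.mk_hcomp]
    exact (Arr.mk_comp g k).symm
  hcomp_assoc := by
    rintro ⟨a, b, f, g, η⟩ ⟨_, c, h, k, θ⟩ ⟨_, d, m, n, ι⟩ ⟨⟩ ⟨⟩
    simp only [Cel.mk_hcomp]
    exact Cel.mk_eq (Strict.assoc _ _ _) (Strict.assoc _ _ _)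
      (by simp [Strict.associator_eqToIso])
  one_hcomp := by
    rintro ⟨a, b, f, g, η⟩ _ rfl
    simp only [Cel.mk_hcomp]
    exact Cel.mk_eq (Strict.id_comp _) (Strict.id_comp _)
      (by simp [Strict.leftUnitor_eqToIso])
  hcomp_one := by
    rintro ⟨a, b, f, g, η⟩ _ rfl
    simp only [Cel.mk_hcomp]
    exact Cel.mk_eq (Strict.comp_id _) (Strict.comp_id _)
      (by simp [Strict.rightUnitor_eqToIso])
  idc_hcomp_idc := by rintro ⟨a, b, f⟩ ⟨_, c, g⟩ ⟨⟩; rw [Arr.mk_comp, Cel.mk_hcomp]; simp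
  interchange := by
    rintro ⟨a, b, f, g, η⟩ ⟨_, _, _, h, θ⟩ ⟨_, c, k, l, ι⟩ ⟨_, _, _, m, κ⟩ ⟨⟩ ⟨⟩ ⟨⟩
    simp [whisker_exchange_assoc]

variable {C} {D : Type u} [Bicategory.{u, u} D] [Strict D] {E : Type u} [Bicategory.{u, u} E]
  [Strict E]

theorem total_comp {a b c : C} (f : a ⟶ b) (g : b ⟶ c) :
    (total C).comp (Arr.mk a b f) (Arr.mk b c g) = Arr.mk a c (f ≫ g) :=
  Arr.mk_comp f g

theorem total_vcomp {a b : C} {f g h : a ⟶ b} (η : f ⟶ g) (θ : g ⟶ h) :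
    (total C).vcomp (Cel.mk a b f g η) (Cel.mk a b g h θ) = Cel.mk a b f h (η ≫ θ) :=
  Cel.mk_vcomp η θ

/-- Whiskering is horizontal composition with an identity cell; total categories have no separate
operation for it. -/
theorem total_whiskerLeft {a b c : C} (f : a ⟶ b) {g h : b ⟶ c} (η : g ⟶ h) :
    (total C).hcomp ((total C).idc (Arr.mk a b f)) (Cel.mk b c g h η) =
      Cel.mk a c (f ≫ g) (f ≫ h) (f ◁ η) :=
  (Cel.mk_hcomp _ _).trans (by simp)

theorem total_whiskerRight {a b c : C} {f g : a ⟶ b} (η : f ⟶ g) (h : b ⟶ c) :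
    (total C).hcomp (Cel.mk a b f g η) ((total C).idc (Arr.mk b c h)) =
      Cel.mk a c (f ≫ h) (g ≫ h) (η ▷ h) :=
  (Cel.mk_hcomp _ _).trans (by simp)

theorem total_hcomp {a b c : C} {f g : a ⟶ b} {h k : b ⟶ c} (η : f ⟶ g) (θ : h ⟶ k) :
    (total C).hcomp (Cel.mk a b f g η) (Cel.mk b c h k θ) =
      Cel.mk a c (f ≫ h) (g ≫ k) (η ▷ h ≫ g ◁ θ) :=
  Cel.mk_hcomp _ _

/-- The strict functor that underlies a `2`-functor. -/
noncomputable def hat (F : StrictPseudofunctor C D) : (total C).Functor (total D) where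
  obj a := F.obj a
  mor x := ⟨F.obj x.src, F.obj x.tgt, F.map x.hom⟩
  cell α := ⟨F.obj α.src, F.obj α.tgt, F.map α.dom, F.map α.cod, F.map₂ α.hom⟩
  src_mor x := rfl
  tgt_mor x := rfl
  mor_one a := Arr.mk_inj.2 (F.map_id a)
  mor_comp := by
    rintro ⟨a, b, f⟩ ⟨_, c, g⟩ ⟨⟩
    simp only [total]
    rw [Arr.mk_comp, Arr.mk_comp, F.map_comp]
  dom_cell α := rfl
  cod_cell α := rfl
  cell_idc x := Cel.mk_inj.2 (F.map₂_id _)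
  cell_vcomp := by
    rintro ⟨a, b, f, g, η⟩ ⟨_, _, _, h, θ⟩ ⟨⟩
    simp only [total]
    rw [Cel.mk_vcomp, Cel.mk_vcomp, F.map₂_comp]
  cell_hcomp := by
    rintro ⟨a, b, f, g, η⟩ ⟨_, c, h, k, θ⟩ ⟨⟩
    simp only [total]
    rw [Cel.mk_hcomp, Cel.mk_hcomp]
    refine Cel.mk_eq (F.map_comp _ _) (F.map_comp _ _) ?_
    simp [F.mapComp_eq_eqToIso]

/-- The values on morphisms and cells record their boundaries, so equality of total functors yields
the heterogeneous equalities required by `ext_of_heq`. Equations between `2`-functors can thus be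
checked in total form. -/
theorem hat_injective {F G : StrictPseudofunctor C D} (h : hat F = hat G) : F = G := by
  have h₀ (a : C) : F.obj a = G.obj a := congrFun (congrArg (·.obj) h) a
  refine ext_of_heq h₀ (fun {a b} f => ?_) (fun {a b f g} η => ?_)
  · exact Arr.heq_of_eq (congrFun (congrArg (·.mor) h) ⟨a, b, f⟩)
  · exact Cel.heq_of_eq (congrFun (congrArg (·.cell) h) ⟨a, b, f, g, η⟩)

section unhat
variable (G : (total C).Functor (total D))

/-- The object that is the value of a strict functor at an object. -/
def unhatObj (a : C) : D := G.obj a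

/-- The morphism that is the value of a strict functor at a morphism. -/
def unhatMap {a b : C} (f : a ⟶ b) : unhatObj G a ⟶ unhatObj G b :=
  Arr.homOf (G.mor ⟨a, b, f⟩) (G.src_mor _) (G.tgt_mor _)

theorem mk_unhatMap {a b : C} (f : a ⟶ b) :
    Arr.mk (unhatObj G a) (unhatObj G b) (unhatMap G f) = G.mor ⟨a, b, f⟩ :=
  Arr.mk_homOf _ _ _

/-- The cell that is the value of a strict functor at a cell. -/
def unhatMap₂ {a b : C} {f g : a ⟶ b} (η : f ⟶ g) : unhatMap G f ⟶ unhatMap G g :=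
  Cel.homOf (G.cell ⟨a, b, f, g, η⟩) ((G.dom_cell _).trans (mk_unhatMap G f).symm)
    ((G.cod_cell _).trans (mk_unhatMap G g).symm)

theorem mk_unhatMap₂ {a b : C} {f g : a ⟶ b} (η : f ⟶ g) :
    Cel.mk (unhatObj G a) (unhatObj G b) (unhatMap G f) (unhatMap G g) (unhatMap₂ G η) =
      G.cell ⟨a, b, f, g, η⟩ :=
  Cel.mk_homOf _ _ _

theorem unhatMap_id (a : C) : unhatMap G (𝟙 a) = 𝟙 (unhatObj G a) :=
  Arr.mk_inj.1 ((mk_unhatMap G _).trans (G.mor_one a))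

theorem unhatMap_comp {a b c : C} (f : a ⟶ b) (g : b ⟶ c) :
    unhatMap G (f ≫ g) = unhatMap G f ≫ unhatMap G g := by
  refine Arr.mk_inj.1 ((mk_unhatMap G _).trans ?_)
  rw [← total_comp, ← total_comp, mk_unhatMap, mk_unhatMap]
  exact G.mor_comp _ _ rfl

theorem unhatMap₂_id {a b : C} (f : a ⟶ b) : unhatMap₂ G (𝟙 f) = 𝟙 (unhatMap G f) := by
  refine Cel.mk_inj.1 ((mk_unhatMap₂ G _).trans ((G.cell_idc ⟨a, b, f⟩).trans ?_))
  rw [← mk_unhatMap]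

theorem unhatMap₂_comp {a b : C} {f g h : a ⟶ b} (η : f ⟶ g) (θ : g ⟶ h) :
    unhatMap₂ G (η ≫ θ) = unhatMap₂ G η ≫ unhatMap₂ G θ := by
  refine Cel.mk_inj.1 ((mk_unhatMap₂ G _).trans ?_)
  rw [← total_vcomp, ← total_vcomp, mk_unhatMap₂, mk_unhatMap₂]
  exact G.cell_vcomp _ _ rfl

theorem mk_unhatMap₂_whiskerLeft {a b c : C} (f : a ⟶ b) {g h : b ⟶ c} (η : g ⟶ h) :
    Cel.mk (unhatObj G a) (unhatObj G c) _ _ (unhatMap₂ G (f ◁ η)) =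
      Cel.mk (unhatObj G a) (unhatObj G c) _ _ (unhatMap G f ◁ unhatMap₂ G η) := by
  rw [mk_unhatMap₂, ← total_whiskerLeft, ← total_whiskerLeft, mk_unhatMap₂, mk_unhatMap,
    G.cell_hcomp _ _ rfl, G.cell_idc]

theorem mk_unhatMap₂_whiskerRight {a b c : C} {f g : a ⟶ b} (η : f ⟶ g) (h : b ⟶ c) :
    Cel.mk (unhatObj G a) (unhatObj G c) _ _ (unhatMap₂ G (η ▷ h)) =
      Cel.mk (unhatObj G a) (unhatObj G c) _ _ (unhatMap₂ G η ▷ unhatMap G h) := by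
  rw [mk_unhatMap₂, ← total_whiskerRight, ← total_whiskerRight, mk_unhatMap₂, mk_unhatMap,
    G.cell_hcomp _ _ rfl, G.cell_idc]

/-- The `2`-functor that is given by a strict functor. -/
def unhat : StrictPseudofunctor C D :=
  StrictPseudofunctor.mk''
  { obj a := unhatObj G a
    map f := unhatMap G f
    map₂ η := unhatMap₂ G η
    map₂_id f := unhatMap₂_id G f
    map₂_comp η θ := unhatMap₂_comp G η θ
    map_id a := unhatMap_id G a
    map_comp f g := unhatMap_comp G f g
    map₂_whisker_left f _ _ η := by
      -- The coherence cells are `eqToHom`s; as cells with free boundary they vanish, which leaves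
      -- preservation of horizontal composites.
      rw [← Cel.mk_inj, Cel.eqToHom_comp, Cel.comp_eqToHom]
      exact mk_unhatMap₂_whiskerLeft G f η
    map₂_whisker_right η f := by
      rw [← Cel.mk_inj, Cel.eqToHom_comp, Cel.comp_eqToHom]
      exact mk_unhatMap₂_whiskerRight G η f }

/-- Every total functor comes from a `2`-functor. This is used to realise an action on total sets by
a morphism of `TwoCat`. -/
theorem hat_unhat : hat (unhat G) = G := by
  refine TotalTwoCat.Functor.ext rfl ?_ ?_
  · funext x
    exact mk_unhatMap G _
  · funext α
    exact mk_unhatMap₂ G _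

end unhat

end total

/-! ### Pullbacks and an axiomatic form of the lax arrow category -/

namespace TotalTwoCat

section functors
variable {C D E X Y Z W : TotalTwoCat.{u}}

/-- The composite of strict functors. -/
def Functor.comp (F : Functor C D) (G : Functor D E) : Functor C E where
  obj a := G.obj (F.obj a)
  mor x := G.mor (F.mor x)
  cell α := G.cell (F.cell α)
  src_mor x := by rw [G.src_mor, F.src_mor]
  tgt_mor x := by rw [G.tgt_mor, F.tgt_mor]
  mor_one a := by rw [F.mor_one, G.mor_one]
  mor_comp x y h := by rw [F.mor_comp _ _ h, G.mor_comp _ _ (by grind)]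
  dom_cell α := by rw [G.dom_cell, F.dom_cell]
  cod_cell α := by rw [G.cod_cell, F.cod_cell]
  cell_idc x := by rw [F.cell_idc, G.cell_idc]
  cell_vcomp α β h := by rw [F.cell_vcomp _ _ h, G.cell_vcomp _ _ (by grind)]
  cell_hcomp α β h := by rw [F.cell_hcomp _ _ h, G.cell_hcomp _ _ (by grind)]

/-- The identity functor. -/
def Functor.id (C : TotalTwoCat.{u}) : Functor C C where
  obj a := a
  mor x := x
  cell α := α
  src_mor x := rfl
  tgt_mor x := rfl
  mor_one a := rfl
  mor_comp x y h := rfl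
  dom_cell α := rfl
  cod_cell α := rfl
  cell_idc x := rfl
  cell_vcomp α β h := rfl
  cell_hcomp α β h := rfl

theorem Functor.obj_congr {F G : Functor C D} (h : F = G) (a : C.Obj) : F.obj a = G.obj a := by
  rw [h]

theorem Functor.mor_congr {F G : Functor C D} (h : F = G) (x : C.Mor) : F.mor x = G.mor x := by
  rw [h]

theorem Functor.cell_congr {F G : Functor C D} (h : F = G) (α : C.Cell) :
    F.cell α = G.cell α := by
  rw [h]

/-- A commutative square of functors that is a weak pullback on objects, morphisms and cells. -/
structure IsWeakPullback (F : Functor X Z) (G : Functor Y Z) (P₁ : Functor W X)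
    (P₂ : Functor W Y) : Prop where
  w : P₁.comp F = P₂.comp G
  exists_obj {x : X.Obj} {y : Y.Obj} : F.obj x = G.obj y → ∃ z, P₁.obj z = x ∧ P₂.obj z = y
  exists_mor {x : X.Mor} {y : Y.Mor} : F.mor x = G.mor y → ∃ z, P₁.mor z = x ∧ P₂.mor z = y
  exists_cell {x : X.Cell} {y : Y.Cell} : F.cell x = G.cell y →
    ∃ z, P₁.cell z = x ∧ P₂.cell z = y

/-- A commutative square of functors that is a pullback on objects, morphisms and cells. -/
structure IsPullback (F : Functor X Z) (G : Functor Y Z) (P₁ : Functor W X)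
    (P₂ : Functor W Y) : Prop extends IsWeakPullback F G P₁ P₂ where
  obj_ext {z z' : W.Obj} : P₁.obj z = P₁.obj z' → P₂.obj z = P₂.obj z' → z = z'
  mor_ext {z z' : W.Mor} : P₁.mor z = P₁.mor z' → P₂.mor z = P₂.mor z' → z = z'
  cell_ext {z z' : W.Cell} : P₁.cell z = P₁.cell z' → P₂.cell z = P₂.cell z' → z = z'

namespace IsPullback
variable {F : Functor X Z} {G : Functor Y Z} {P₁ : Functor W X} {P₂ : Functor W Y}
  (h : IsPullback F G P₁ P₂)
include h

/-- Needed with `dual` to present `A^𝟚 ×_A J`, whose factors come in the other order, as a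
right-hand pullback in the dual. -/
theorem symm : IsPullback G F P₂ P₁ where
  w := h.w.symm
  exists_obj e := (h.exists_obj e.symm).imp fun _ => And.symm
  exists_mor e := (h.exists_mor e.symm).imp fun _ => And.symm
  exists_cell e := (h.exists_cell e.symm).imp fun _ => And.symm
  obj_ext e e' := h.obj_ext e' e
  mor_ext e e' := h.mor_ext e' e
  cell_ext e e' := h.cell_ext e' e

theorem dual : IsPullback F.dual G.dual P₁.dual P₂.dual where
  w := congrArg Functor.dual h.w
  exists_obj := h.exists_obj
  exists_mor := h.exists_mor
  exists_cell := h.exists_cell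
  obj_ext := h.obj_ext
  mor_ext := h.mor_ext
  cell_ext := h.cell_ext

end IsPullback

end functors

/-- The structure of a category of lax arrows. -/
structure ArrowModel (B Y : TotalTwoCat.{u}) where
  left : Functor Y B
  right : Functor Y B
  arrow : Y.Obj → B.Mor
  square : Y.Mor → B.Cell
  src_arrow (y : Y.Obj) : B.src (arrow y) = left.obj y
  tgt_arrow (y : Y.Obj) : B.tgt (arrow y) = right.obj y
  dom_square (f : Y.Mor) : B.dom (square f) = arrow (Y.src f) ⬝ right.mor f
  cod_square (f : Y.Mor) : B.cod (square f) = left.mor f ⬝ arrow (Y.tgt f)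
  square_one (y : Y.Obj) : square (Y.one y) = B.idc (arrow y)
  square_comp (f g : Y.Mor) : Y.tgt f = Y.src g → square (f ⬝ g) =
    (square f ∗ B.idc (right.mor g)) ⊙ (B.idc (left.mor f) ∗ square g)
  square_cell (η : Y.Cell) :
    square (Y.dom η) ⊙ (left.cell η ∗ B.idc (arrow (Y.tgt (Y.dom η)))) =
      (B.idc (arrow (Y.src (Y.dom η))) ∗ right.cell η) ⊙ square (Y.cod η)
  obj_ext {y y' : Y.Obj} : arrow y = arrow y' → y = y'
  mor_ext {f f' : Y.Mor} : arrow (Y.src f) = arrow (Y.src f') →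
    arrow (Y.tgt f) = arrow (Y.tgt f') → left.mor f = left.mor f' → right.mor f = right.mor f' →
    square f = square f' → f = f'
  cell_ext {η η' : Y.Cell} : Y.dom η = Y.dom η' → Y.cod η = Y.cod η' →
    left.cell η = left.cell η' → right.cell η = right.cell η' → η = η'
  exists_obj (x : B.Mor) : ∃ y, arrow y = x
  exists_mor {y y' : Y.Obj} {s t : B.Mor} {ζ : B.Cell} : B.src s = left.obj y →
    B.tgt s = left.obj y' → B.src t = right.obj y → B.tgt t = right.obj y' →
    B.dom ζ = arrow y ⬝ t → B.cod ζ = s ⬝ arrow y' →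
    ∃ f, Y.src f = y ∧ Y.tgt f = y' ∧ left.mor f = s ∧ right.mor f = t ∧ square f = ζ
  exists_cell {f f' : Y.Mor} {σ τ : B.Cell} : Y.src f = Y.src f' → Y.tgt f = Y.tgt f' →
    B.dom σ = left.mor f → B.cod σ = left.mor f' → B.dom τ = right.mor f →
    B.cod τ = right.mor f' →
    square f ⊙ (σ ∗ B.idc (arrow (Y.tgt f))) = (B.idc (arrow (Y.src f)) ∗ τ) ⊙ square f' →
    ∃ η, Y.dom η = f ∧ Y.cod η = f' ∧ left.cell η = σ ∧ right.cell η = τ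

namespace ArrowModel
variable {B Y Y₂ X J : TotalTwoCat.{u}} (M : ArrowModel B Y)

theorem square_cell' (η : Y.Cell) :
    M.square (Y.dom η) ⊙ (M.left.cell η ∗ B.idc (M.arrow (Y.tgt (Y.cod η)))) =
      (B.idc (M.arrow (Y.src (Y.cod η))) ∗ M.right.cell η) ⊙ M.square (Y.cod η) := by
  rw [Y.src_cod, Y.tgt_cod, M.square_cell]

/-- The dual category of lax arrows. -/
def dual : ArrowModel B.dual Y.dual where
  left := M.right.dual
  right := M.left.dual
  arrow := M.arrow
  square := M.square
  src_arrow := M.tgt_arrow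
  tgt_arrow := M.src_arrow
  dom_square := M.cod_square
  cod_square := M.dom_square
  square_one := M.square_one
  square_comp f g h := M.square_comp g f h.symm
  square_cell η := (M.square_cell' η).symm
  obj_ext := M.obj_ext
  mor_ext h h' e e' := M.mor_ext h' h e' e
  cell_ext h h' e e' := M.cell_ext h' h e' e
  exists_obj := M.exists_obj
  exists_mor h₁ h₂ h₃ h₄ h₅ h₆ := by
    obtain ⟨f, e₁, e₂, e₃, e₄, e₅⟩ := M.exists_mor h₄ h₃ h₂ h₁ h₆ h₅
    exact ⟨f, e₂, e₁, e₄, e₃, e₅⟩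
  exists_cell {f f' σ τ} h h' h₁ h₂ h₃ h₄ e := by
    change Y.tgt f = Y.tgt f' at h
    change Y.src f = Y.src f' at h'
    have e' : M.square f' ⊙ (τ ∗ B.idc (M.arrow (Y.tgt f'))) =
        (B.idc (M.arrow (Y.src f')) ∗ σ) ⊙ M.square f := by
      rw [← h, ← h']
      exact e.symm
    obtain ⟨η, e₁, e₂, e₃, e₄⟩ := M.exists_cell h'.symm h.symm h₄ h₃ h₂ h₁ e'
    exact ⟨η, e₂, e₁, e₄, e₃⟩

/-- The functor `U` is the inclusion of identity arrows. -/
structure IsUnit (U : Functor B Y) : Prop where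
  left : U.comp M.left = Functor.id B
  right : U.comp M.right = Functor.id B
  arrow (b : B.Obj) : M.arrow (U.obj b) = B.one b
  square (s : B.Mor) : M.square (U.mor s) = B.idc s

/-- The functor `K` is the vertical composition of squares. -/
structure IsComp (e₁ e₂ K : Functor Y₂ Y) : Prop where
  left : K.comp M.left = e₁.comp M.left
  right : K.comp M.right = e₂.comp M.right
  arrow (y : Y₂.Obj) : M.arrow (K.obj y) = M.arrow (e₁.obj y) ⬝ M.arrow (e₂.obj y)
  square (f : Y₂.Mor) : M.square (K.mor f) =
    (B.idc (M.arrow (e₁.obj (Y₂.src f))) ∗ M.square (e₂.mor f)) ⊙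
      (M.square (e₁.mor f) ∗ B.idc (M.arrow (e₂.obj (Y₂.tgt f))))

variable {M}

theorem IsUnit.dual {U : Functor B Y} (h : M.IsUnit U) : M.dual.IsUnit U.dual where
  left := congrArg Functor.dual h.right
  right := congrArg Functor.dual h.left
  arrow := h.arrow
  square := h.square

/-- Reversal exchanges the two factors of a vertical composite of squares. -/
theorem IsComp.dual {e₁ e₂ K : Functor Y₂ Y} (h : M.IsComp e₁ e₂ K) :
    M.dual.IsComp e₂.dual e₁.dual K.dual where
  left := congrArg Functor.dual h.right
  right := congrArg Functor.dual h.left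
  arrow := h.arrow
  square := h.square

end ArrowModel
end TotalTwoCat

/-! ### Elements of the pullback of `J` and the arrow category as tuples -/

namespace TotalTwoCat

variable {J B Y X : TotalTwoCat.{u}} {q : Functor J B} {M : ArrowModel B Y} {P₁ : Functor X J}
  {P₂ : Functor X Y}

namespace ArrowModel
variable (M P₁ P₂)

/-- The object `x` of `J ×_B B^𝟚` is `(i, u)`. -/
structure RepObj (x : X.Obj) (i : J.Obj) (u : B.Mor) : Prop where
  base : P₁.obj x = i
  arrow : M.arrow (P₂.obj x) = u

/-- The morphism `x` of `J ×_B B^𝟚` is `(s, ζ, t) : (i, u) ⟶ (j, u')`. -/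
structure RepMor (x : X.Mor) (s : J.Mor) (u t : B.Mor) (ζ : B.Cell) (u' : B.Mor) : Prop where
  base : P₁.mor x = s
  src : M.arrow (P₂.obj (X.src x)) = u
  right : M.right.mor (P₂.mor x) = t
  square : M.square (P₂.mor x) = ζ
  tgt : M.arrow (P₂.obj (X.tgt x)) = u'

/-- The cell `x` of `J ×_B B^𝟚` is `(σ, τ)`. -/
structure RepCell (x : X.Cell) (σ : J.Cell) (u : B.Mor) (τ ζ ζ' : B.Cell) (u' : B.Mor) :
    Prop where
  base : P₁.cell x = σ
  right : M.right.cell (P₂.cell x) = τ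
  dom : M.square (P₂.mor (X.dom x)) = ζ
  cod : M.square (P₂.mor (X.cod x)) = ζ'
  src : M.arrow (P₂.obj (X.src (X.dom x))) = u
  tgt : M.arrow (P₂.obj (X.tgt (X.dom x))) = u'

variable {M P₁ P₂}

section
variable {x : X.Mor} {s : J.Mor} {u t : B.Mor} {ζ : B.Cell} {u' : B.Mor}
  (h : M.RepMor P₁ P₂ x s u t ζ u')
include h

theorem RepMor.repObj_src : M.RepObj P₁ P₂ (X.src x) (J.src s) u :=
  ⟨by rw [← P₁.src_mor, h.base], h.src⟩

theorem RepMor.repObj_tgt : M.RepObj P₁ P₂ (X.tgt x) (J.tgt s) u' :=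
  ⟨by rw [← P₁.tgt_mor, h.base], h.tgt⟩

end

section
variable {x : X.Cell} {σ : J.Cell} {u : B.Mor} {τ ζ ζ' : B.Cell} {u' : B.Mor}
  (h : M.RepCell P₁ P₂ x σ u τ ζ ζ' u')
include h

theorem RepCell.repMor_dom : M.RepMor P₁ P₂ (X.dom x) (J.dom σ) u (B.dom τ) ζ u' :=
  ⟨by rw [← P₁.dom_cell, h.base], h.src, by rw [← h.right, M.right.dom_cell, P₂.dom_cell], h.dom,
    h.tgt⟩

theorem RepCell.repMor_cod : M.RepMor P₁ P₂ (X.cod x) (J.cod σ) u (B.cod τ) ζ' u' :=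
  ⟨by rw [← P₁.cod_cell, h.base], by rw [X.src_cod, h.src],
    by rw [← h.right, M.right.cod_cell, P₂.cod_cell], h.cod, by rw [X.tgt_cod, h.tgt]⟩

end

theorem repObj_self (x : X.Obj) : M.RepObj P₁ P₂ x (P₁.obj x) (M.arrow (P₂.obj x)) := ⟨rfl, rfl⟩

theorem repMor_self (x : X.Mor) : M.RepMor P₁ P₂ x (P₁.mor x) (M.arrow (P₂.obj (X.src x)))
    (M.right.mor (P₂.mor x)) (M.square (P₂.mor x)) (M.arrow (P₂.obj (X.tgt x))) :=
  ⟨rfl, rfl, rfl, rfl, rfl⟩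

theorem repCell_self (x : X.Cell) : M.RepCell P₁ P₂ x (P₁.cell x)
    (M.arrow (P₂.obj (X.src (X.dom x)))) (M.right.cell (P₂.cell x))
    (M.square (P₂.mor (X.dom x))) (M.square (P₂.mor (X.cod x)))
    (M.arrow (P₂.obj (X.tgt (X.dom x)))) :=
  ⟨rfl, rfl, rfl, rfl, rfl, rfl⟩

theorem repMor_one {x : X.Obj} {i : J.Obj} {u : B.Mor} (h : M.RepObj P₁ P₂ x i u) :
    M.RepMor P₁ P₂ (X.one x) (J.one i) u (B.one (B.tgt u)) (B.idc u) u := by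
  obtain ⟨rfl, rfl⟩ := h
  constructor
  · rw [P₁.mor_one]
  · rw [X.src_one]
  · rw [P₂.mor_one, M.right.mor_one, M.tgt_arrow]
  · rw [P₂.mor_one, M.square_one]
  · rw [X.tgt_one]

theorem repCell_idc {x : X.Mor} {s : J.Mor} {u t : B.Mor} {ζ : B.Cell} {u' : B.Mor}
    (h : M.RepMor P₁ P₂ x s u t ζ u') :
    M.RepCell P₁ P₂ (X.idc x) (J.idc s) u (B.idc t) ζ ζ u' := by
  obtain ⟨rfl, rfl, rfl, rfl, rfl⟩ := h
  constructor
  · rw [P₁.cell_idc]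
  · rw [P₂.cell_idc, M.right.cell_idc]
  · rw [X.dom_idc]
  · rw [X.cod_idc]
  · rw [X.dom_idc]
  · rw [X.dom_idc]

theorem repCell_vcomp {x y : X.Cell} {σ σ' : J.Cell} {u : B.Mor} {τ τ' ζ ζ' ζ'' : B.Cell}
    {u' : B.Mor} (h : M.RepCell P₁ P₂ x σ u τ ζ ζ' u')
    (h' : M.RepCell P₁ P₂ y σ' u τ' ζ' ζ'' u') (e : X.cod x = X.dom y) :
    M.RepCell P₁ P₂ (x ⊙ y) (σ ⊙ σ') u (τ ⊙ τ') ζ ζ'' u' := by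
  constructor
  · rw [P₁.cell_vcomp _ _ e, h.base, h'.base]
  · rw [P₂.cell_vcomp _ _ e, M.right.cell_vcomp _ _ (by grind), h.right, h'.right]
  · rw [X.dom_vcomp _ _ e, h.dom]
  · rw [X.cod_vcomp _ _ e, h'.cod]
  · rw [X.dom_vcomp _ _ e, h.src]
  · rw [X.dom_vcomp _ _ e, h.tgt]

section
variable (pb : IsPullback q M.left P₁ P₂)
include pb

theorem left_obj (x : X.Obj) : M.left.obj (P₂.obj x) = q.obj (P₁.obj x) :=
  (Functor.obj_congr pb.w x).symm

theorem left_mor (x : X.Mor) : M.left.mor (P₂.mor x) = q.mor (P₁.mor x) :=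
  (Functor.mor_congr pb.w x).symm

theorem left_cell (x : X.Cell) : M.left.cell (P₂.cell x) = q.cell (P₁.cell x) :=
  (Functor.cell_congr pb.w x).symm

theorem RepObj.src {x : X.Obj} {i : J.Obj} {u : B.Mor} (h : M.RepObj P₁ P₂ x i u) :
    B.src u = q.obj i := by
  rw [← h.arrow, ← h.base, M.src_arrow, left_obj pb]

/-- An element of a pullback is determined by its projections, and an object of the arrow category
by its arrow. With `exists_repObj`, the objects of `X` are the pairs `(i, u)` with `u` starting at
`q i`. -/
theorem RepObj.unique {x y : X.Obj} {i : J.Obj} {u : B.Mor} (h : M.RepObj P₁ P₂ x i u)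
    (h' : M.RepObj P₁ P₂ y i u) : x = y :=
  pb.obj_ext (h.base.trans h'.base.symm) (M.obj_ext (h.arrow.trans h'.arrow.symm))

theorem exists_repObj {i : J.Obj} {u : B.Mor} (h : B.src u = q.obj i) :
    ∃ x, M.RepObj P₁ P₂ x i u := by
  obtain ⟨y, rfl⟩ := M.exists_obj u
  obtain ⟨x, rfl, rfl⟩ := pb.exists_obj (x := i) (y := y) (by rw [← h, M.src_arrow])
  exact ⟨x, rfl, rfl⟩

/-- With `RepMor.unique` and `exists_repMor` this identifies the morphisms of `X` with the tuples
satisfying `IsSquare`; the corresponding lemmas for cells follow. -/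
theorem RepMor.isSquare {x : X.Mor} {s : J.Mor} {u t : B.Mor} {ζ : B.Cell} {u' : B.Mor}
    (h : M.RepMor P₁ P₂ x s u t ζ u') : IsSquare q s u t ζ u' := by
  obtain ⟨rfl, rfl, rfl, rfl, rfl⟩ := h
  constructor
  · rw [M.src_arrow, left_obj pb, P₁.src_mor]
  · rw [M.src_arrow, left_obj pb, P₁.tgt_mor]
  · rw [M.tgt_arrow, M.right.src_mor, P₂.src_mor]
  · rw [M.tgt_arrow, M.right.tgt_mor, P₂.tgt_mor]
  · rw [M.dom_square, P₂.src_mor]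
  · rw [M.cod_square, P₂.tgt_mor, left_mor pb]

theorem RepMor.unique {x y : X.Mor} {s : J.Mor} {u t : B.Mor} {ζ : B.Cell} {u' : B.Mor}
    (h : M.RepMor P₁ P₂ x s u t ζ u') (h' : M.RepMor P₁ P₂ y s u t ζ u') : x = y := by
  refine pb.mor_ext (h.base.trans h'.base.symm) (M.mor_ext ?_ ?_ ?_ ?_ ?_)
  · rw [P₂.src_mor, P₂.src_mor, h.src, h'.src]
  · rw [P₂.tgt_mor, P₂.tgt_mor, h.tgt, h'.tgt]
  · rw [left_mor pb, left_mor pb, h.base, h'.base]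
  · rw [h.right, h'.right]
  · rw [h.square, h'.square]

theorem exists_repMor {s : J.Mor} {u t : B.Mor} {ζ : B.Cell} {u' : B.Mor}
    (h : IsSquare q s u t ζ u') : ∃ x, M.RepMor P₁ P₂ x s u t ζ u' := by
  obtain ⟨y, rfl⟩ := M.exists_obj u
  obtain ⟨y', rfl⟩ := M.exists_obj u'
  have h₁ := h.src_top
  have h₂ := h.src_bot
  have h₃ := h.src_right
  have h₄ := h.tgt_right
  rw [M.src_arrow] at h₁ h₂
  rw [M.tgt_arrow] at h₃ h₄
  -- The square is built in the arrow category with upper side `q.mor s`, so that it matches `s` in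
  -- the pullback.
  obtain ⟨f, rfl, rfl, e₃, rfl, rfl⟩ := M.exists_mor (s := q.mor s) (by rw [q.src_mor, h₁])
    (by rw [q.tgt_mor, h₂]) h₃ h₄ h.dom_cell h.cod_cell
  obtain ⟨x, rfl, rfl⟩ := pb.exists_mor (x := s) (y := f) e₃.symm
  exact ⟨x, rfl, by rw [P₂.src_mor], rfl, rfl, by rw [P₂.tgt_mor]⟩

theorem RepCell.isSquareCell {x : X.Cell} {σ : J.Cell} {u : B.Mor} {τ ζ ζ' : B.Cell} {u' : B.Mor}
    (h : M.RepCell P₁ P₂ x σ u τ ζ ζ' u') : IsSquareCell q σ u τ ζ ζ' u' where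
  dom := h.repMor_dom.isSquare pb
  cod := h.repMor_cod.isSquare pb
  w := by
    have e := M.square_cell (P₂.cell x)
    rw [P₂.dom_cell, P₂.cod_cell, P₂.src_mor, P₂.tgt_mor, h.src, h.tgt, h.dom, h.cod, h.right,
      left_cell pb, h.base] at e
    exact e

theorem RepCell.unique {x y : X.Cell} {σ : J.Cell} {u : B.Mor} {τ ζ ζ' : B.Cell} {u' : B.Mor}
    (h : M.RepCell P₁ P₂ x σ u τ ζ ζ' u') (h' : M.RepCell P₁ P₂ y σ u τ ζ ζ' u') : x = y := by
  refine pb.cell_ext (h.base.trans h'.base.symm) (M.cell_ext ?_ ?_ ?_ ?_)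
  · rw [P₂.dom_cell, P₂.dom_cell, h.repMor_dom.unique pb h'.repMor_dom]
  · rw [P₂.cod_cell, P₂.cod_cell, h.repMor_cod.unique pb h'.repMor_cod]
  · rw [left_cell pb, left_cell pb, h.base, h'.base]
  · rw [h.right, h'.right]

theorem exists_repCell {σ : J.Cell} {u : B.Mor} {τ ζ ζ' : B.Cell} {u' : B.Mor}
    (h : IsSquareCell q σ u τ ζ ζ' u') : ∃ x, M.RepCell P₁ P₂ x σ u τ ζ ζ' u' := by
  obtain ⟨f, hf⟩ := exists_repMor pb h.dom
  obtain ⟨f', hf'⟩ := exists_repMor pb h.cod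
  have e₁ : M.arrow (Y.src (P₂.mor f)) = u := by rw [P₂.src_mor, hf.src]
  have e₂ : M.arrow (Y.tgt (P₂.mor f)) = u' := by rw [P₂.tgt_mor, hf.tgt]
  have e₃ : M.arrow (Y.src (P₂.mor f')) = u := by rw [P₂.src_mor, hf'.src]
  have e₄ : M.arrow (Y.tgt (P₂.mor f')) = u' := by rw [P₂.tgt_mor, hf'.tgt]
  obtain ⟨η, d₁, d₂, d₃, d₄⟩ := M.exists_cell (f := P₂.mor f) (f' := P₂.mor f')
    (σ := q.cell σ) (τ := τ) (M.obj_ext (e₁.trans e₃.symm)) (M.obj_ext (e₂.trans e₄.symm))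
    (by rw [left_mor pb, hf.base, q.dom_cell]) (by rw [left_mor pb, hf'.base, q.cod_cell])
    hf.right.symm hf'.right.symm (by rw [e₁, e₂, hf.square, hf'.square, h.w])
  obtain ⟨x, rfl, rfl⟩ := pb.exists_cell (x := σ) (y := η) d₃.symm
  rw [P₂.dom_cell] at d₁
  rw [P₂.cod_cell] at d₂
  exact ⟨x, rfl, d₄, by rw [d₁, hf.square], by rw [d₂, hf'.square],
    by rw [← P₂.src_mor, d₁, e₁], by rw [← P₂.tgt_mor, d₁, e₂]⟩

/-- Composition in the pullback pastes squares side by side; this explains the cell appearing in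
`Action.mor_comp`. -/
theorem repMor_comp {x y : X.Mor} {s s' : J.Mor} {u u' u'' t t' : B.Mor} {ζ ζ' : B.Cell}
    (h : M.RepMor P₁ P₂ x s u t ζ u') (h' : M.RepMor P₁ P₂ y s' u' t' ζ' u'')
    (e : X.tgt x = X.src y) : M.RepMor P₁ P₂ (x ⬝ y) (s ⬝ s') u (t ⬝ t')
      ((ζ ∗ B.idc t') ⊙ (B.idc (q.mor s) ∗ ζ')) u'' := by
  have e' : Y.tgt (P₂.mor x) = Y.src (P₂.mor y) := by rw [P₂.src_mor, P₂.tgt_mor, e]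
  constructor
  · rw [P₁.mor_comp _ _ e, h.base, h'.base]
  · rw [X.src_comp _ _ e, h.src]
  · rw [P₂.mor_comp _ _ e, M.right.mor_comp _ _ e', h.right, h'.right]
  · rw [P₂.mor_comp _ _ e, M.square_comp _ _ e', h.square, h'.right, left_mor pb, h.base,
      h'.square]
  · rw [X.tgt_comp _ _ e, h'.tgt]

theorem repCell_hcomp {x y : X.Cell} {σ σ' : J.Cell} {u u' u'' : B.Mor}
    {τ τ' ζ ζ₁ ζ' ζ₁' : B.Cell} (h : M.RepCell P₁ P₂ x σ u τ ζ ζ₁ u')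
    (h' : M.RepCell P₁ P₂ y σ' u' τ' ζ' ζ₁' u'') (e : X.tgt (X.dom x) = X.src (X.dom y)) :
    M.RepCell P₁ P₂ (x ∗ y) (σ ∗ σ') u (τ ∗ τ')
      ((ζ ∗ B.idc (B.dom τ')) ⊙ (B.idc (q.mor (J.dom σ)) ∗ ζ'))
      ((ζ₁ ∗ B.idc (B.cod τ')) ⊙ (B.idc (q.mor (J.cod σ)) ∗ ζ₁')) u'' := by
  have e' : Y.tgt (Y.dom (P₂.cell x)) = Y.src (Y.dom (P₂.cell y)) := by
    rw [P₂.dom_cell, P₂.dom_cell, P₂.src_mor, P₂.tgt_mor, e]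
  have hd := repMor_comp pb h.repMor_dom h'.repMor_dom e
  have hc := repMor_comp pb h.repMor_cod h'.repMor_cod (by rw [X.tgt_cod, X.src_cod, e])
  rw [← X.dom_hcomp _ _ e] at hd
  rw [← X.cod_hcomp _ _ e] at hc
  constructor
  · rw [P₁.cell_hcomp _ _ e, h.base, h'.base]
  · rw [P₂.cell_hcomp _ _ e, M.right.cell_hcomp _ _ e', h.right, h'.right]
  · exact hd.square
  · exact hc.square
  · exact hd.src
  · exact hd.tgt

end

end ArrowModel
end TotalTwoCat

/-! ### Actions as functors on the pullback -/

namespace TotalTwoCat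

variable {J B Y X : TotalTwoCat.{u}} {q : Functor J B} {M : ArrowModel B Y} {P₁ : Functor X J}
  {P₂ : Functor X Y}

variable (q M P₁ P₂) in
/-- The functor `R : J ×_B B^𝟚 ⟶ J` is a right action of `B^𝟚`. -/
structure IsAction (R : Functor X J) : Prop where
  map : R.comp q = P₂.comp M.right
  obj_unit {x : X.Obj} {i : J.Obj} : M.RepObj P₁ P₂ x i (B.one (q.obj i)) → R.obj x = i
  mor_unit {x : X.Mor} {s : J.Mor} : M.RepMor P₁ P₂ x s (B.one (q.obj (J.src s))) (q.mor s)
    (B.idc (q.mor s)) (B.one (q.obj (J.tgt s))) → R.mor x = s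
  cell_unit {x : X.Cell} {σ : J.Cell} : M.RepCell P₁ P₂ x σ (B.one (q.obj (J.src (J.dom σ))))
    (q.cell σ) (B.idc (q.mor (J.dom σ))) (B.idc (q.mor (J.cod σ)))
    (B.one (q.obj (J.tgt (J.dom σ)))) → R.cell x = σ
  obj_assoc {x y z : X.Obj} {i : J.Obj} {u v : B.Mor} : M.RepObj P₁ P₂ x i u →
    M.RepObj P₁ P₂ y (R.obj x) v → M.RepObj P₁ P₂ z i (u ⬝ v) → R.obj y = R.obj z
  mor_assoc {x y z : X.Mor} {s : J.Mor} {u u' t v v' w : B.Mor} {ζ ξ : B.Cell} :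
    M.RepMor P₁ P₂ x s u t ζ u' → M.RepMor P₁ P₂ y (R.mor x) v w ξ v' →
    M.RepMor P₁ P₂ z s (u ⬝ v) w ((B.idc u ∗ ξ) ⊙ (ζ ∗ B.idc v')) (u' ⬝ v') → R.mor y = R.mor z
  cell_assoc {x y z : X.Cell} {σ : J.Cell} {u u' v v' : B.Mor} {τ ω ζ ζ' ξ ξ' : B.Cell} :
    M.RepCell P₁ P₂ x σ u τ ζ ζ' u' → M.RepCell P₁ P₂ y (R.cell x) v ω ξ ξ' v' →
    M.RepCell P₁ P₂ z σ (u ⬝ v) ω ((B.idc u ∗ ξ) ⊙ (ζ ∗ B.idc v'))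
      ((B.idc u ∗ ξ') ⊙ (ζ' ∗ B.idc v')) (u' ⬝ v') → R.cell y = R.cell z

namespace Action
variable (a : Action q) (pb : IsPullback q M.left P₁ P₂)
include pb

/-- The functor `J ×_B B^𝟚 ⟶ J` of an action. -/
def functor : Functor X J where
  obj x := a.obj (P₁.obj x) (M.arrow (P₂.obj x))
  mor x := a.mor (P₁.mor x) (M.arrow (P₂.obj (X.src x))) (M.right.mor (P₂.mor x))
    (M.square (P₂.mor x)) (M.arrow (P₂.obj (X.tgt x)))
  cell x := a.cell (P₁.cell x) (M.arrow (P₂.obj (X.src (X.dom x)))) (M.right.cell (P₂.cell x))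
    (M.square (P₂.mor (X.dom x))) (M.square (P₂.mor (X.cod x)))
    (M.arrow (P₂.obj (X.tgt (X.dom x))))
  src_mor x := by rw [a.src_mor ((ArrowModel.repMor_self x).isSquare pb), P₁.src_mor]
  tgt_mor x := by rw [a.tgt_mor ((ArrowModel.repMor_self x).isSquare pb), P₁.tgt_mor]
  mor_one x := by
    have h := ArrowModel.repMor_one (ArrowModel.repObj_self (M := M) (P₁ := P₁) (P₂ := P₂) x)
    rw [h.base, h.src, h.right, h.square, h.tgt, a.mor_one]
    exact (ArrowModel.repObj_self x).src pb
  mor_comp x y e := by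
    have h := ArrowModel.repMor_self (M := M) (P₁ := P₁) (P₂ := P₂) x
    have h' := ArrowModel.repMor_self (M := M) (P₁ := P₁) (P₂ := P₂) y
    rw [← e] at h'
    have k := ArrowModel.repMor_comp pb h h' e
    rw [k.base, k.src, k.right, k.square, k.tgt, a.mor_comp (h.isSquare pb) (h'.isSquare pb), e]
    rw [P₁.src_mor, P₁.tgt_mor, e]
  dom_cell x := by
    rw [a.dom_cell ((ArrowModel.repCell_self x).isSquareCell pb), P₁.dom_cell, M.right.dom_cell,
      P₂.dom_cell]
  cod_cell x := by
    rw [a.cod_cell ((ArrowModel.repCell_self x).isSquareCell pb), P₁.cod_cell, M.right.cod_cell,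
      P₂.cod_cell, X.src_cod, X.tgt_cod]
  cell_idc x := by
    have h := ArrowModel.repCell_idc (ArrowModel.repMor_self (M := M) (P₁ := P₁) (P₂ := P₂) x)
    rw [h.base, h.src, h.right, h.dom, h.cod, h.tgt, a.cell_idc]
    exact (ArrowModel.repMor_self x).isSquare pb
  cell_vcomp x y e := by
    have h := ArrowModel.repCell_self (M := M) (P₁ := P₁) (P₂ := P₂) x
    have h' := ArrowModel.repCell_self (M := M) (P₁ := P₁) (P₂ := P₂) y
    rw [← e, X.src_cod, X.tgt_cod] at h'
    have k := ArrowModel.repCell_vcomp h h' e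
    rw [k.base, k.src, k.right, k.dom, k.cod, k.tgt,
      a.cell_vcomp (h.isSquareCell pb) (h'.isSquareCell pb), ← e, X.src_cod, X.tgt_cod]
    · rw [P₁.dom_cell, P₁.cod_cell, e]
    · rw [M.right.dom_cell, M.right.cod_cell, P₂.dom_cell, P₂.cod_cell, e]
  cell_hcomp x y e := by
    have h := ArrowModel.repCell_self (M := M) (P₁ := P₁) (P₂ := P₂) x
    have h' := ArrowModel.repCell_self (M := M) (P₁ := P₁) (P₂ := P₂) y
    rw [← e] at h'
    have k := ArrowModel.repCell_hcomp pb h h' e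
    rw [k.base, k.src, k.right, k.dom, k.cod, k.tgt,
      a.cell_hcomp (h.isSquareCell pb) (h'.isSquareCell pb), e]
    rw [P₁.dom_cell, P₁.dom_cell, P₁.src_mor, P₁.tgt_mor, e]

theorem functor_obj {x : X.Obj} {i : J.Obj} {u : B.Mor} (h : M.RepObj P₁ P₂ x i u) :
    (a.functor pb).obj x = a.obj i u := by
  obtain ⟨rfl, rfl⟩ := h; rfl

theorem functor_mor {x : X.Mor} {s : J.Mor} {u t : B.Mor} {ζ : B.Cell} {u' : B.Mor}
    (h : M.RepMor P₁ P₂ x s u t ζ u') : (a.functor pb).mor x = a.mor s u t ζ u' := by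
  obtain ⟨rfl, rfl, rfl, rfl, rfl⟩ := h; rfl

theorem functor_cell {x : X.Cell} {σ : J.Cell} {u : B.Mor} {τ ζ ζ' : B.Cell} {u' : B.Mor}
    (h : M.RepCell P₁ P₂ x σ u τ ζ ζ' u') : (a.functor pb).cell x = a.cell σ u τ ζ ζ' u' := by
  obtain ⟨rfl, rfl, rfl, rfl, rfl, rfl⟩ := h; rfl

/-- On represented elements the functor takes the prescribed values, so each law is the
corresponding law of `a` read through the correspondence of elements with tuples. -/
theorem isAction_functor : IsAction q M P₁ P₂ (a.functor pb) where
  map := by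
    apply Functor.ext
    · funext x
      have h := ArrowModel.repObj_self (M := M) (P₁ := P₁) (P₂ := P₂) x
      exact (a.map_obj _ _ (h.src pb)).trans (M.tgt_arrow _)
    · funext x
      have h := ArrowModel.repMor_self (M := M) (P₁ := P₁) (P₂ := P₂) x
      exact a.map_mor (h.isSquare pb)
    · funext x
      have h := ArrowModel.repCell_self (M := M) (P₁ := P₁) (P₂ := P₂) x
      exact a.map_cell (h.isSquareCell pb)
  obj_unit h := by rw [a.functor_obj pb h, a.obj_unit]
  mor_unit h := by rw [a.functor_mor pb h, a.mor_unit]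
  cell_unit h := by rw [a.functor_cell pb h, a.cell_unit]
  obj_assoc h h' h'' := by
    have e := h.src pb
    have e' := h'.src pb
    rw [a.functor_obj pb h'', a.functor_obj pb h', a.functor_obj pb h, a.obj_assoc _ _ _ e]
    rw [e', a.functor_obj pb h, a.map_obj _ _ e]
  mor_assoc h h' h'' := by
    rw [a.functor_mor pb h] at h'
    rw [a.functor_mor pb h'', a.functor_mor pb h',
      a.mor_assoc (h.isSquare pb) (h'.isSquare pb)]
  cell_assoc h h' h'' := by
    rw [a.functor_cell pb h] at h'
    rw [a.functor_cell pb h'', a.functor_cell pb h',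
      a.cell_assoc (h.isSquareCell pb) (h'.isSquareCell pb)]

end Action

section values
variable (M P₁ P₂) (R : Functor X J)

open Classical in
/-- The value of `R` at `(i, u)`. -/
noncomputable def valObj (i : J.Obj) (u : B.Mor) : J.Obj :=
  if h : ∃ x, M.RepObj P₁ P₂ x i u then R.obj h.choose else i

open Classical in
/-- The value of `R` at `(s, ζ, t) : (i, u) ⟶ (j, u')`. -/
noncomputable def valMor (s : J.Mor) (u t : B.Mor) (ζ : B.Cell) (u' : B.Mor) : J.Mor :=
  if h : ∃ x, M.RepMor P₁ P₂ x s u t ζ u' then R.mor h.choose else s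

open Classical in
/-- The value of `R` at `(σ, τ)`. -/
noncomputable def valCell (σ : J.Cell) (u : B.Mor) (τ ζ ζ' : B.Cell) (u' : B.Mor) : J.Cell :=
  if h : ∃ x, M.RepCell P₁ P₂ x σ u τ ζ ζ' u' then R.cell h.choose else σ

variable {M P₁ P₂} (pb : IsPullback q M.left P₁ P₂)
include pb

theorem valObj_eq {x : X.Obj} {i : J.Obj} {u : B.Mor} (h : M.RepObj P₁ P₂ x i u) :
    valObj M P₁ P₂ R i u = R.obj x := by
  have e : ∃ x, M.RepObj P₁ P₂ x i u := ⟨x, h⟩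
  rw [valObj, dif_pos e, e.choose_spec.unique pb h]

theorem valMor_eq {x : X.Mor} {s : J.Mor} {u t : B.Mor} {ζ : B.Cell} {u' : B.Mor}
    (h : M.RepMor P₁ P₂ x s u t ζ u') : valMor M P₁ P₂ R s u t ζ u' = R.mor x := by
  have e : ∃ x, M.RepMor P₁ P₂ x s u t ζ u' := ⟨x, h⟩
  rw [valMor, dif_pos e, e.choose_spec.unique pb h]

theorem valCell_eq {x : X.Cell} {σ : J.Cell} {u : B.Mor} {τ ζ ζ' : B.Cell} {u' : B.Mor}
    (h : M.RepCell P₁ P₂ x σ u τ ζ ζ' u') : valCell M P₁ P₂ R σ u τ ζ ζ' u' = R.cell x := by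
  have e : ∃ x, M.RepCell P₁ P₂ x σ u τ ζ ζ' u' := ⟨x, h⟩
  rw [valCell, dif_pos e, e.choose_spec.unique pb h]

end values

namespace IsAction
variable {R : Functor X J} (h : IsAction q M P₁ P₂ R) (pb : IsPullback q M.left P₁ P₂)
open ArrowModel

include h in
theorem map_obj {x : X.Obj} {i : J.Obj} {u : B.Mor} (hx : M.RepObj P₁ P₂ x i u) :
    q.obj (R.obj x) = B.tgt u := by
  rw [← hx.arrow, M.tgt_arrow]
  exact Functor.obj_congr h.map x

include h in
theorem map_mor {x : X.Mor} {s : J.Mor} {u t : B.Mor} {ζ : B.Cell} {u' : B.Mor}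
    (hx : M.RepMor P₁ P₂ x s u t ζ u') : q.mor (R.mor x) = t := by
  rw [← hx.right]
  exact Functor.mor_congr h.map x

include h in
theorem map_cell {x : X.Cell} {σ : J.Cell} {u : B.Mor} {τ ζ ζ' : B.Cell} {u' : B.Mor}
    (hx : M.RepCell P₁ P₂ x σ u τ ζ ζ' u') : q.cell (R.cell x) = τ := by
  rw [← hx.right]
  exact Functor.cell_congr h.map x

/-- The action on objects, morphisms and cells that is given by a functor `J ×_B B^𝟚 ⟶ J`. -/
noncomputable def action : Action q where
  obj := valObj M P₁ P₂ R
  mor := valMor M P₁ P₂ R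
  cell := valCell M P₁ P₂ R
  src_mor hs := by
    obtain ⟨x, hx⟩ := exists_repMor pb hs
    rw [valMor_eq R pb hx, valObj_eq R pb hx.repObj_src, R.src_mor]
  tgt_mor hs := by
    obtain ⟨x, hx⟩ := exists_repMor pb hs
    rw [valMor_eq R pb hx, valObj_eq R pb hx.repObj_tgt, R.tgt_mor]
  dom_cell hs := by
    obtain ⟨x, hx⟩ := exists_repCell pb hs
    rw [valCell_eq R pb hx, valMor_eq R pb hx.repMor_dom, R.dom_cell]
  cod_cell hs := by
    obtain ⟨x, hx⟩ := exists_repCell pb hs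
    rw [valCell_eq R pb hx, valMor_eq R pb hx.repMor_cod, R.cod_cell]
  mor_one i u hu := by
    obtain ⟨x, hx⟩ := exists_repObj pb hu
    rw [valMor_eq R pb (repMor_one hx), valObj_eq R pb hx, R.mor_one]
  mor_comp hs hs' e := by
    obtain ⟨x, hx⟩ := exists_repMor pb hs
    obtain ⟨y, hy⟩ := exists_repMor pb hs'
    -- Tuples that are composable in `J` have composable representatives: both ends represent the
    -- same pair.
    have e' : X.tgt x = X.src y := hx.repObj_tgt.unique pb (by rw [e]; exact hy.repObj_src)
    rw [valMor_eq R pb (repMor_comp pb hx hy e'), valMor_eq R pb hx, valMor_eq R pb hy,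
      R.mor_comp _ _ e']
  cell_idc hs := by
    obtain ⟨x, hx⟩ := exists_repMor pb hs
    rw [valCell_eq R pb (repCell_idc hx), valMor_eq R pb hx, R.cell_idc]
  cell_vcomp hs hs' e e' := by
    obtain ⟨x, hx⟩ := exists_repCell pb hs
    obtain ⟨y, hy⟩ := exists_repCell pb hs'
    have k : X.cod x = X.dom y :=
      hx.repMor_cod.unique pb (by rw [e, e']; exact hy.repMor_dom)
    rw [valCell_eq R pb (repCell_vcomp hx hy k), valCell_eq R pb hx, valCell_eq R pb hy,
      R.cell_vcomp _ _ k]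
  cell_hcomp hs hs' e := by
    obtain ⟨x, hx⟩ := exists_repCell pb hs
    obtain ⟨y, hy⟩ := exists_repCell pb hs'
    have k : X.tgt (X.dom x) = X.src (X.dom y) :=
      hx.repMor_dom.repObj_tgt.unique pb (by rw [e]; exact hy.repMor_dom.repObj_src)
    rw [valCell_eq R pb (repCell_hcomp pb hx hy k), valCell_eq R pb hx, valCell_eq R pb hy,
      R.cell_hcomp _ _ k]
  map_obj i u hu := by
    obtain ⟨x, hx⟩ := exists_repObj pb hu
    rw [valObj_eq R pb hx, h.map_obj hx]
  map_mor hs := by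
    obtain ⟨x, hx⟩ := exists_repMor pb hs
    rw [valMor_eq R pb hx, h.map_mor hx]
  map_cell hs := by
    obtain ⟨x, hx⟩ := exists_repCell pb hs
    rw [valCell_eq R pb hx, h.map_cell hx]
  obj_unit i := by
    obtain ⟨x, hx⟩ := exists_repObj pb (B.src_one (q.obj i))
    rw [valObj_eq R pb hx, h.obj_unit hx]
  mor_unit s := by
    obtain ⟨x, hx⟩ := exists_repMor pb (IsSquare.unitSquare (q := q) s)
    rw [valMor_eq R pb hx, h.mor_unit hx]
  cell_unit σ := by
    obtain ⟨x, hx⟩ := exists_repCell pb (IsSquareCell.unit (q := q) σ)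
    rw [valCell_eq R pb hx, h.cell_unit hx]
  obj_assoc i u v hu hv := by
    obtain ⟨x, hx⟩ := exists_repObj pb hu
    obtain ⟨y, hy⟩ := exists_repObj pb (i := R.obj x) (u := v) (by rw [h.map_obj hx, hv])
    obtain ⟨z, hz⟩ := exists_repObj pb (i := i) (u := u ⬝ v) (by rw [B.src_comp _ _ hv, hu])
    rw [valObj_eq R pb hx, valObj_eq R pb hy, valObj_eq R pb hz, h.obj_assoc hx hy hz]
  mor_assoc hζ hξ := by
    obtain ⟨x, hx⟩ := exists_repMor pb hζ
    rw [valMor_eq R pb hx] at hξ ⊢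
    -- Composability of the stacked arrows follows from `R` lying over the target projection; it
    -- makes the vertical composite a square, represented by `z` below.
    have e := hξ.src_top.trans (by rw [R.src_mor, h.map_obj hx.repObj_src])
    have e' := hξ.src_bot.trans (by rw [R.tgt_mor, h.map_obj hx.repObj_tgt])
    obtain ⟨y, hy⟩ := exists_repMor pb hξ
    obtain ⟨z, hz⟩ := exists_repMor pb (IsSquare.vert hζ hξ (h.map_mor hx) e e')
    rw [valMor_eq R pb hy, valMor_eq R pb hz, h.mor_assoc hx hy hz]
  cell_assoc hζ hξ := by
    obtain ⟨x, hx⟩ := exists_repCell pb hζ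
    rw [valCell_eq R pb hx] at hξ ⊢
    have e := hξ.dom.src_top.trans
      (by rw [R.dom_cell, R.src_mor, h.map_obj hx.repMor_dom.repObj_src])
    have e' := hξ.dom.src_bot.trans
      (by rw [R.dom_cell, R.tgt_mor, h.map_obj hx.repMor_dom.repObj_tgt])
    obtain ⟨y, hy⟩ := exists_repCell pb hξ
    obtain ⟨z, hz⟩ := exists_repCell pb (IsSquareCell.vert hζ hξ (h.map_cell hx) e e')
    rw [valCell_eq R pb hy, valCell_eq R pb hz, h.cell_assoc hx hy hz]

theorem action_obj {x : X.Obj} {i : J.Obj} {u : B.Mor} (hx : M.RepObj P₁ P₂ x i u) :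
    (h.action pb).obj i u = R.obj x := valObj_eq R pb hx

theorem action_mor {x : X.Mor} {s : J.Mor} {u t : B.Mor} {ζ : B.Cell} {u' : B.Mor}
    (hx : M.RepMor P₁ P₂ x s u t ζ u') : (h.action pb).mor s u t ζ u' = R.mor x :=
  valMor_eq R pb hx

theorem action_cell {x : X.Cell} {σ : J.Cell} {u : B.Mor} {τ ζ ζ' : B.Cell} {u' : B.Mor}
    (hx : M.RepCell P₁ P₂ x σ u τ ζ ζ' u') : (h.action pb).cell σ u τ ζ ζ' u' = R.cell x :=
  valCell_eq R pb hx

end IsAction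
end TotalTwoCat

/-! ### Unit and associativity laws as equations between functors -/

namespace TotalTwoCat

variable {J B Y Y₂ X X' : TotalTwoCat.{u}} {q : Functor J B} {M : ArrowModel B Y}
  {P₁ : Functor X J} {P₂ : Functor X Y}

open ArrowModel

section unit
variable {U : Functor B Y} {Un : Functor J X} (hU : M.IsUnit U)
  (h₁ : Un.comp P₁ = Functor.id J) (h₂ : Un.comp P₂ = q.comp U)
include hU h₁ h₂

/-- The functor `Un` is the insertion of units into `J ×_B B^𝟚`, so its values are the elements with
an identity arrow to which the unit laws refer. -/
theorem repObj_unit (i : J.Obj) : M.RepObj P₁ P₂ (Un.obj i) i (B.one (q.obj i)) :=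
  ⟨Functor.obj_congr h₁ i, (congrArg M.arrow (Functor.obj_congr h₂ i)).trans (hU.arrow _)⟩

theorem repMor_unit (s : J.Mor) : M.RepMor P₁ P₂ (Un.mor s) s (B.one (q.obj (J.src s))) (q.mor s)
    (B.idc (q.mor s)) (B.one (q.obj (J.tgt s))) where
  base := Functor.mor_congr h₁ s
  src := by rw [Un.src_mor, (repObj_unit hU h₁ h₂ _).arrow]
  tgt := by rw [Un.tgt_mor, (repObj_unit hU h₁ h₂ _).arrow]
  right := (congrArg M.right.mor (Functor.mor_congr h₂ s)).trans (Functor.mor_congr hU.right _)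
  square := (congrArg M.square (Functor.mor_congr h₂ s)).trans (hU.square _)

theorem repCell_unit (σ : J.Cell) : M.RepCell P₁ P₂ (Un.cell σ) σ
    (B.one (q.obj (J.src (J.dom σ)))) (q.cell σ) (B.idc (q.mor (J.dom σ)))
    (B.idc (q.mor (J.cod σ))) (B.one (q.obj (J.tgt (J.dom σ)))) where
  base := Functor.cell_congr h₁ σ
  right := (congrArg M.right.cell (Functor.cell_congr h₂ σ)).trans (Functor.cell_congr hU.right _)
  dom := by rw [Un.dom_cell, (repMor_unit hU h₁ h₂ _).square]
  cod := by rw [Un.cod_cell, (repMor_unit hU h₁ h₂ _).square]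
  src := by rw [Un.dom_cell, Un.src_mor, (repObj_unit hU h₁ h₂ _).arrow]
  tgt := by rw [Un.dom_cell, Un.tgt_mor, (repObj_unit hU h₁ h₂ _).arrow]

end unit

variable (M P₁ P₂) in
/-- The functors from `(J ×_B B^𝟚) ×_B B^𝟚` that occur in the associativity of an action. -/
structure AssocDiagram (R : Functor X J) (D₁ D₂ : Functor X' X) where
  Y₂ : TotalTwoCat.{u}
  e₁ : Functor Y₂ Y
  e₂ : Functor Y₂ Y
  K : Functor Y₂ Y
  E : Functor X' Y₂
  z₁ : Functor X' X
  z₂ : Functor X' Y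
  isWeakPullback : IsWeakPullback (P₂.comp M.right) M.left z₁ z₂
  isComp : M.IsComp e₁ e₂ K
  E_e₁ : E.comp e₁ = z₁.comp P₂
  E_e₂ : E.comp e₂ = z₂
  D₁_P₁ : D₁.comp P₁ = z₁.comp P₁
  D₁_P₂ : D₁.comp P₂ = E.comp K
  D₂_P₁ : D₂.comp P₁ = z₁.comp R
  D₂_P₂ : D₂.comp P₂ = z₂

namespace AssocDiagram
variable {R : Functor X J} {D₁ D₂ : Functor X' X} (d : AssocDiagram M P₁ P₂ R D₁ D₂)

/-- `D₂` first acts with the first arrow and keeps the second; `D₁`, in the lemma after this one,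
composes the arrows and leaves `J` alone. Associativity compares `R` after the two. -/
theorem repObj₂ (w : X'.Obj) : M.RepObj P₁ P₂ (D₂.obj w) (R.obj (d.z₁.obj w))
    (M.arrow (d.z₂.obj w)) :=
  ⟨Functor.obj_congr d.D₂_P₁ w, congrArg M.arrow (Functor.obj_congr d.D₂_P₂ w)⟩

theorem repObj₁ (w : X'.Obj) : M.RepObj P₁ P₂ (D₁.obj w) (P₁.obj (d.z₁.obj w))
    (M.arrow (P₂.obj (d.z₁.obj w)) ⬝ M.arrow (d.z₂.obj w)) := by
  refine ⟨Functor.obj_congr d.D₁_P₁ w,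
    (congrArg M.arrow (Functor.obj_congr d.D₁_P₂ w)).trans ((d.isComp.arrow _).trans ?_)⟩
  rw [show d.e₁.obj (d.E.obj w) = _ from Functor.obj_congr d.E_e₁ w,
    show d.e₂.obj (d.E.obj w) = _ from Functor.obj_congr d.E_e₂ w]
  rfl

theorem repMor₂ (w : X'.Mor) : M.RepMor P₁ P₂ (D₂.mor w) (R.mor (d.z₁.mor w))
    (M.arrow (d.z₂.obj (X'.src w))) (M.right.mor (d.z₂.mor w)) (M.square (d.z₂.mor w))
    (M.arrow (d.z₂.obj (X'.tgt w))) where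
  base := Functor.mor_congr d.D₂_P₁ w
  src := by rw [D₂.src_mor, (d.repObj₂ _).arrow]
  tgt := by rw [D₂.tgt_mor, (d.repObj₂ _).arrow]
  right := congrArg M.right.mor (Functor.mor_congr d.D₂_P₂ w)
  square := congrArg M.square (Functor.mor_congr d.D₂_P₂ w)

theorem repMor₁ (w : X'.Mor) : M.RepMor P₁ P₂ (D₁.mor w) (P₁.mor (d.z₁.mor w))
    (M.arrow (P₂.obj (d.z₁.obj (X'.src w))) ⬝ M.arrow (d.z₂.obj (X'.src w)))
    (M.right.mor (d.z₂.mor w))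
    ((B.idc (M.arrow (P₂.obj (d.z₁.obj (X'.src w)))) ∗ M.square (d.z₂.mor w)) ⊙
      (M.square (P₂.mor (d.z₁.mor w)) ∗ B.idc (M.arrow (d.z₂.obj (X'.tgt w)))))
    (M.arrow (P₂.obj (d.z₁.obj (X'.tgt w))) ⬝ M.arrow (d.z₂.obj (X'.tgt w))) where
  base := Functor.mor_congr d.D₁_P₁ w
  src := by rw [D₁.src_mor, (d.repObj₁ _).arrow]
  tgt := by rw [D₁.tgt_mor, (d.repObj₁ _).arrow]
  right := (congrArg M.right.mor (Functor.mor_congr d.D₁_P₂ w)).trans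
    ((Functor.mor_congr d.isComp.right _).trans
      (congrArg M.right.mor (Functor.mor_congr d.E_e₂ w)))
  square := by
    refine (congrArg M.square (Functor.mor_congr d.D₁_P₂ w)).trans ((d.isComp.square _).trans ?_)
    rw [d.E.src_mor, d.E.tgt_mor, show d.e₁.obj (d.E.obj _) = _ from Functor.obj_congr d.E_e₁ _,
      show d.e₂.obj (d.E.obj _) = _ from Functor.obj_congr d.E_e₂ _,
      show d.e₁.mor (d.E.mor w) = _ from Functor.mor_congr d.E_e₁ w,
      show d.e₂.mor (d.E.mor w) = _ from Functor.mor_congr d.E_e₂ w]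
    rfl

theorem repCell₂ (w : X'.Cell) : M.RepCell P₁ P₂ (D₂.cell w) (R.cell (d.z₁.cell w))
    (M.arrow (d.z₂.obj (X'.src (X'.dom w)))) (M.right.cell (d.z₂.cell w))
    (M.square (d.z₂.mor (X'.dom w))) (M.square (d.z₂.mor (X'.cod w)))
    (M.arrow (d.z₂.obj (X'.tgt (X'.dom w)))) where
  base := Functor.cell_congr d.D₂_P₁ w
  right := congrArg M.right.cell (Functor.cell_congr d.D₂_P₂ w)
  dom := by rw [D₂.dom_cell, (d.repMor₂ _).square]
  cod := by rw [D₂.cod_cell, (d.repMor₂ _).square]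
  src := by rw [D₂.dom_cell, (d.repMor₂ _).src]
  tgt := by rw [D₂.dom_cell, (d.repMor₂ _).tgt]

theorem repCell₁ (w : X'.Cell) : M.RepCell P₁ P₂ (D₁.cell w) (P₁.cell (d.z₁.cell w))
    (M.arrow (P₂.obj (d.z₁.obj (X'.src (X'.dom w)))) ⬝ M.arrow (d.z₂.obj (X'.src (X'.dom w))))
    (M.right.cell (d.z₂.cell w))
    ((B.idc (M.arrow (P₂.obj (d.z₁.obj (X'.src (X'.dom w))))) ∗ M.square (d.z₂.mor (X'.dom w))) ⊙
      (M.square (P₂.mor (d.z₁.mor (X'.dom w))) ∗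
        B.idc (M.arrow (d.z₂.obj (X'.tgt (X'.dom w))))))
    ((B.idc (M.arrow (P₂.obj (d.z₁.obj (X'.src (X'.dom w))))) ∗ M.square (d.z₂.mor (X'.cod w))) ⊙
      (M.square (P₂.mor (d.z₁.mor (X'.cod w))) ∗
        B.idc (M.arrow (d.z₂.obj (X'.tgt (X'.dom w))))))
    (M.arrow (P₂.obj (d.z₁.obj (X'.tgt (X'.dom w)))) ⬝
      M.arrow (d.z₂.obj (X'.tgt (X'.dom w)))) where
  base := Functor.cell_congr d.D₁_P₁ w
  right := (congrArg M.right.cell (Functor.cell_congr d.D₁_P₂ w)).trans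
    ((Functor.cell_congr d.isComp.right _).trans
      (congrArg M.right.cell (Functor.cell_congr d.E_e₂ w)))
  dom := by rw [D₁.dom_cell, (d.repMor₁ _).square]
  cod := by rw [D₁.cod_cell, (d.repMor₁ _).square, X'.src_cod, X'.tgt_cod]
  src := by rw [D₁.dom_cell, (d.repMor₁ _).src]
  tgt := by rw [D₁.dom_cell, (d.repMor₁ _).tgt]

end AssocDiagram

section
variable {R : Functor X J} {D₁ D₂ : Functor X' X} {U : Functor B Y} {Un : Functor J X}
  (pb : IsPullback q M.left P₁ P₂) (hU : M.IsUnit U) (h₁ : Un.comp P₁ = Functor.id J)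
  (h₂ : Un.comp P₂ = q.comp U) (d : AssocDiagram M P₁ P₂ R D₁ D₂)

include hU h₁ h₂ in
theorem IsAction.unit_comp (h : IsAction q M P₁ P₂ R) : Un.comp R = Functor.id J :=
  Functor.ext (funext fun i => h.obj_unit (repObj_unit hU h₁ h₂ i))
    (funext fun s => h.mor_unit (repMor_unit hU h₁ h₂ s))
    (funext fun σ => h.cell_unit (repCell_unit hU h₁ h₂ σ))

-- An element of the iterated pullback supplies the three elements `x`, `y`, `z` of the elementwise
-- law.
include d in
theorem IsAction.assoc_comp (h : IsAction q M P₁ P₂ R) : D₁.comp R = D₂.comp R :=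
  Functor.ext
    (funext fun w => (h.obj_assoc (repObj_self _) (d.repObj₂ w) (d.repObj₁ w)).symm)
    (funext fun w => by
      have k := repMor_self (M := M) (P₁ := P₁) (P₂ := P₂) (d.z₁.mor w)
      rw [d.z₁.src_mor, d.z₁.tgt_mor] at k
      exact (h.mor_assoc k (d.repMor₂ w) (d.repMor₁ w)).symm)
    (funext fun w => by
      have k := repCell_self (M := M) (P₁ := P₁) (P₂ := P₂) (d.z₁.cell w)
      rw [d.z₁.dom_cell, d.z₁.cod_cell, d.z₁.src_mor, d.z₁.tgt_mor] at k
      exact (h.cell_assoc k (d.repCell₂ w) (d.repCell₁ w)).symm)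

-- Conversely, `x` and `y` as in the elementwise law come from one element of the iterated pullback;
-- only its existence is needed, hence a weak pullback suffices. Uniqueness of representatives
-- identifies `y` and `z` with its images under `D₂` and `D₁`.
include pb hU h₁ h₂ d in
theorem isAction_of_comp (h : R.comp q = P₂.comp M.right) (hu : Un.comp R = Functor.id J)
    (ha : D₁.comp R = D₂.comp R) : IsAction q M P₁ P₂ R where
  map := h
  obj_unit hx := by
    rw [hx.unique pb (repObj_unit hU h₁ h₂ _)]
    exact Functor.obj_congr hu _
  mor_unit hx := by
    rw [hx.unique pb (repMor_unit hU h₁ h₂ _)]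
    exact Functor.mor_congr hu _
  cell_unit hx := by
    rw [hx.unique pb (repCell_unit hU h₁ h₂ _)]
    exact Functor.cell_congr hu _
  obj_assoc {x y z i u v} hx hy hz := by
    obtain ⟨w, e₁, e₂⟩ := d.isWeakPullback.exists_obj (x := x) (y := P₂.obj y)
      ((Functor.obj_congr h x).symm.trans ((congrArg q.obj hy.base.symm).trans
        (Functor.obj_congr pb.w y)))
    have k₁ := d.repObj₁ w
    have k₂ := d.repObj₂ w
    rw [e₁, e₂, hx.arrow, hx.base, hy.arrow] at k₁
    rw [e₁, e₂, hy.arrow] at k₂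
    rw [hz.unique pb k₁, hy.unique pb k₂]
    exact (Functor.obj_congr ha w).symm
  mor_assoc {x y z s u u' t v v' l ζ ξ} hx hy hz := by
    obtain ⟨w, e₁, e₂⟩ := d.isWeakPullback.exists_mor (x := x) (y := P₂.mor y)
      ((Functor.mor_congr h x).symm.trans ((congrArg q.mor hy.base.symm).trans
        (Functor.mor_congr pb.w y)))
    have k₁ := d.repMor₁ w
    have k₂ := d.repMor₂ w
    -- Boundaries are expressed through the projections of `w` itself, so that `e₁` and `e₂` rewrite
    -- them.
    simp only [← d.z₁.src_mor, ← d.z₂.src_mor, ← d.z₁.tgt_mor, ← d.z₂.tgt_mor] at k₁ k₂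
    rw [e₁, e₂, P₂.src_mor, P₂.tgt_mor, hx.src, hx.tgt, hx.base, hx.square, hy.src, hy.tgt,
      hy.right, hy.square] at k₁
    rw [e₁, e₂, P₂.src_mor, P₂.tgt_mor, hy.src, hy.tgt, hy.right, hy.square] at k₂
    rw [hz.unique pb k₁, hy.unique pb k₂]
    exact (Functor.mor_congr ha w).symm
  cell_assoc {x y z s u u' t v v' τ ω ζ ζ' ξ} hx hy hz := by
    obtain ⟨w, e₁, e₂⟩ := d.isWeakPullback.exists_cell (x := x) (y := P₂.cell y)
      ((Functor.cell_congr h x).symm.trans ((congrArg q.cell hy.base.symm).trans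
        (Functor.cell_congr pb.w y)))
    have k₁ := d.repCell₁ w
    have k₂ := d.repCell₂ w
    simp only [← d.z₁.src_mor, ← d.z₂.src_mor, ← d.z₁.tgt_mor, ← d.z₂.tgt_mor,
      ← d.z₁.dom_cell, ← d.z₂.dom_cell, ← d.z₁.cod_cell, ← d.z₂.cod_cell] at k₁ k₂
    rw [e₁, e₂, P₂.dom_cell, P₂.cod_cell, P₂.src_mor, P₂.tgt_mor, hx.src, hx.tgt, hx.base, hx.dom,
      hx.cod, hy.src, hy.tgt, hy.right, hy.dom, hy.cod] at k₁
    rw [e₁, e₂, P₂.dom_cell, P₂.cod_cell, P₂.src_mor, P₂.tgt_mor, hy.src, hy.tgt, hy.right, hy.dom,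
      hy.cod] at k₂
    rw [hz.unique pb k₁, hy.unique pb k₂]
    exact (Functor.cell_congr ha w).symm

end
end TotalTwoCat

/-! ### Compatibility of the two actions as an equation between functors -/

namespace TotalTwoCat

open ArrowModel

section realizes
variable {J B Y X : TotalTwoCat.{u}} {q : Functor J B} {M : ArrowModel B Y}
  {P₁ : Functor X J} {P₂ : Functor X Y}

variable (M P₁ P₂) in
/-- The functor `R : J ×_B B^𝟚 ⟶ J` has the values that are specified by an action. -/
structure Action.Realizes (a : Action q) (R : Functor X J) : Prop where
  obj {x : X.Obj} {i : J.Obj} {u : B.Mor} : M.RepObj P₁ P₂ x i u → R.obj x = a.obj i u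
  mor {x : X.Mor} {s : J.Mor} {u t : B.Mor} {ζ : B.Cell} {u' : B.Mor} :
    M.RepMor P₁ P₂ x s u t ζ u' → R.mor x = a.mor s u t ζ u'
  cell {x : X.Cell} {σ : J.Cell} {u : B.Mor} {τ ζ ζ' : B.Cell} {u' : B.Mor} :
    M.RepCell P₁ P₂ x σ u τ ζ ζ' u' → R.cell x = a.cell σ u τ ζ ζ' u'

theorem Action.realizes_functor (a : Action q) (pb : IsPullback q M.left P₁ P₂) :
    a.Realizes M P₁ P₂ (a.functor pb) where
  obj h := a.functor_obj pb h
  mor h := a.functor_mor pb h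
  cell h := a.functor_cell pb h

theorem IsAction.realizes {R : Functor X J} (h : IsAction q M P₁ P₂ R)
    (pb : IsPullback q M.left P₁ P₂) : (h.action pb).Realizes M P₁ P₂ R where
  obj hx := (h.action_obj pb hx).symm
  mor hx := (h.action_mor pb hx).symm
  cell hx := (h.action_cell pb hx).symm

end realizes

variable {J A B YA YB XL XR W : TotalTwoCat.{u}} {p : Functor J A} {q : Functor J B}
  {MA : ArrowModel A YA} {MB : ArrowModel B YB} {Q₁ : Functor XL YA} {Q₂ : Functor XL J}
  {P₁ : Functor XR J} {P₂ : Functor XR YB} {L : Functor XL J} {R : Functor XR J}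

namespace Action.Compatible
variable {aL : Action p.dual} {aR : Action q} (c : aL.Compatible aR)
include c

theorem left_comp (hL : aL.Realizes MA.dual Q₂.dual Q₁.dual L.dual)
    (pbL : IsPullback p.dual MA.dual.left Q₂.dual Q₁.dual) :
    L.comp q = Q₂.comp q :=
  Functor.ext
    (funext fun x => (congrArg q.obj (hL.obj (repObj_self (X := XL.dual) x))).trans
      (c.obj_left ((repObj_self (M := MA.dual) (P₁ := Q₂.dual) (P₂ := Q₁.dual) x).src pbL)))
    (funext fun x => (congrArg q.mor (hL.mor (repMor_self (X := XL.dual) x))).trans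
      (c.mor_left ((repMor_self (M := MA.dual) (P₁ := Q₂.dual) (P₂ := Q₁.dual) x).isSquare pbL)))
    (funext fun x => (congrArg q.cell (hL.cell (repCell_self (X := XL.dual) x))).trans
      (c.cell_left
        ((repCell_self (M := MA.dual) (P₁ := Q₂.dual) (P₂ := Q₁.dual) x).isSquareCell pbL)))

theorem right_comp (hR : aR.Realizes MB P₁ P₂ R) (pbR : IsPullback q MB.left P₁ P₂) :
    R.comp p = P₁.comp p :=
  Functor.ext
    (funext fun x => (congrArg p.obj (hR.obj (repObj_self x))).trans
      (c.obj_right ((repObj_self (M := MB) (P₁ := P₁) (P₂ := P₂) x).src pbR)))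
    (funext fun x => (congrArg p.mor (hR.mor (repMor_self x))).trans
      (c.mor_right ((repMor_self (M := MB) (P₁ := P₁) (P₂ := P₂) x).isSquare pbR)))
    (funext fun x => (congrArg p.cell (hR.cell (repCell_self x))).trans
      (c.cell_right ((repCell_self (M := MB) (P₁ := P₁) (P₂ := P₂) x).isSquareCell pbR)))

end Action.Compatible

variable (q MB Q₁ Q₂ P₁ P₂ L R) in
/-- The functors from `(A^𝟚 ×_A J) ×_B B^𝟚` that occur in the compatibility of actions. -/
structure CommDiagram (F₁ : Functor W XR) (F₂ : Functor W XL) where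
  z₁ : Functor W XL
  z₂ : Functor W YB
  G : Functor W XR
  isWeakPullback : IsWeakPullback (Q₂.comp q) MB.left z₁ z₂
  F₁_P₁ : F₁.comp P₁ = z₁.comp L
  F₁_P₂ : F₁.comp P₂ = z₂
  G_P₁ : G.comp P₁ = z₁.comp Q₂
  G_P₂ : G.comp P₂ = z₂
  F₂_Q₁ : F₂.comp Q₁ = z₁.comp Q₁
  F₂_Q₂ : F₂.comp Q₂ = G.comp R

namespace CommDiagram
variable {F₁ : Functor W XR} {F₂ : Functor W XL} (d : CommDiagram q MB Q₁ Q₂ P₁ P₂ L R F₁ F₂)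
  {aL : Action p.dual} {aR : Action q} (hL : aL.Realizes MA.dual Q₂.dual Q₁.dual L.dual)
  (hR : aR.Realizes MB P₁ P₂ R)
include d hL hR

/-- The route through `F₁` acts on the left and then on the right; the route through `F₂`, computed
in `obj₂`, acts in the other order, with `G` discarding the arrow of `A` in between. -/
theorem obj₁ {w : W.Obj} {i : J.Obj} {u : A.Mor} {v : B.Mor}
    (h : MA.dual.RepObj Q₂.dual Q₁.dual (d.z₁.obj w) i u) (hv : MB.arrow (d.z₂.obj w) = v) :
    R.obj (F₁.obj w) = aR.obj (aL.coObj i u) v :=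
  hR.obj ⟨(Functor.obj_congr d.F₁_P₁ w).trans (hL.obj h),
    (congrArg MB.arrow (Functor.obj_congr d.F₁_P₂ w)).trans hv⟩

theorem repObj_G {w : W.Obj} {i : J.Obj} {u : A.Mor} {v : B.Mor}
    (h : MA.dual.RepObj Q₂.dual Q₁.dual (d.z₁.obj w) i u) (hv : MB.arrow (d.z₂.obj w) = v) :
    MB.RepObj P₁ P₂ (d.G.obj w) i v :=
  ⟨(Functor.obj_congr d.G_P₁ w).trans h.base,
    (congrArg MB.arrow (Functor.obj_congr d.G_P₂ w)).trans hv⟩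

theorem obj₂ {w : W.Obj} {i : J.Obj} {u : A.Mor} {v : B.Mor}
    (h : MA.dual.RepObj Q₂.dual Q₁.dual (d.z₁.obj w) i u) (hv : MB.arrow (d.z₂.obj w) = v) :
    L.obj (F₂.obj w) = aL.coObj (aR.obj i v) u :=
  hL.obj ⟨(Functor.obj_congr d.F₂_Q₂ w).trans (hR.obj (d.repObj_G hL hR h hv)),
    (congrArg MA.arrow (Functor.obj_congr d.F₂_Q₁ w)).trans h.arrow⟩

section
variable {w : W.Mor} {s : J.Mor} {u u' t : A.Mor} {ξ : A.Cell} {v v' r : B.Mor} {ζ : B.Cell}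
  (h : MA.dual.RepMor Q₂.dual Q₁.dual (d.z₁.mor w) s u t ξ u')
  (hv : MB.arrow (d.z₂.obj (W.src w)) = v) (hv' : MB.arrow (d.z₂.obj (W.tgt w)) = v')
  (hr : MB.right.mor (d.z₂.mor w) = r) (hζ : MB.square (d.z₂.mor w) = ζ)
include h hv hv' hr hζ

theorem mor₁ : R.mor (F₁.mor w) = aR.mor (aL.coMor s u t ξ u') v r ζ v' :=
  hR.mor ⟨(Functor.mor_congr d.F₁_P₁ w).trans (hL.mor h),
    (congrArg (fun x => MB.arrow (P₂.obj x)) (F₁.src_mor w)).trans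
      ((congrArg MB.arrow (Functor.obj_congr d.F₁_P₂ _)).trans hv),
    (congrArg MB.right.mor (Functor.mor_congr d.F₁_P₂ w)).trans hr,
    (congrArg MB.square (Functor.mor_congr d.F₁_P₂ w)).trans hζ,
    (congrArg (fun x => MB.arrow (P₂.obj x)) (F₁.tgt_mor w)).trans
      ((congrArg MB.arrow (Functor.obj_congr d.F₁_P₂ _)).trans hv')⟩

theorem repMor_G : MB.RepMor P₁ P₂ (d.G.mor w) s v r ζ v' :=
  ⟨(Functor.mor_congr d.G_P₁ w).trans h.base,
    (congrArg (fun x => MB.arrow (P₂.obj x)) (d.G.src_mor w)).trans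
      ((congrArg MB.arrow (Functor.obj_congr d.G_P₂ _)).trans hv),
    (congrArg MB.right.mor (Functor.mor_congr d.G_P₂ w)).trans hr,
    (congrArg MB.square (Functor.mor_congr d.G_P₂ w)).trans hζ,
    (congrArg (fun x => MB.arrow (P₂.obj x)) (d.G.tgt_mor w)).trans
      ((congrArg MB.arrow (Functor.obj_congr d.G_P₂ _)).trans hv')⟩

theorem mor₂ : L.mor (F₂.mor w) = aL.coMor (aR.mor s v r ζ v') u t ξ u' := by
  have e : Q₁.mor (F₂.mor w) = Q₁.mor (d.z₁.mor w) := Functor.mor_congr d.F₂_Q₁ w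
  refine hL.mor ⟨(Functor.mor_congr d.F₂_Q₂ w).trans
    (hR.mor (d.repMor_G hL hR h hv hv' hr hζ)), ?_, ?_, ?_, ?_⟩
  · have := h.src
    change MA.arrow (Q₁.obj (XL.tgt _)) = u at this
    change MA.arrow (Q₁.obj (XL.tgt _)) = u
    rw [← Q₁.tgt_mor, e, Q₁.tgt_mor, this]
  · exact (congrArg MA.left.mor e).trans h.right
  · exact (congrArg MA.square e).trans h.square
  · have := h.tgt
    change MA.arrow (Q₁.obj (XL.src _)) = u' at this
    change MA.arrow (Q₁.obj (XL.src _)) = u'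
    rw [← Q₁.src_mor, e, Q₁.src_mor, this]

end

section
variable {w : W.Cell} {σ : J.Cell} {u u' : A.Mor} {τ ξ ξ' : A.Cell} {v v' : B.Mor}
  {ω ζ ζ' : B.Cell}
  (h : MA.dual.RepCell Q₂.dual Q₁.dual (d.z₁.cell w) σ u τ ξ' ξ u')
  (hv : MB.arrow (d.z₂.obj (W.src (W.dom w))) = v)
  (hv' : MB.arrow (d.z₂.obj (W.tgt (W.dom w))) = v')
  (hω : MB.right.cell (d.z₂.cell w) = ω) (hζ : MB.square (d.z₂.mor (W.dom w)) = ζ)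
  (hζ' : MB.square (d.z₂.mor (W.cod w)) = ζ')
include h hv hv' hω hζ hζ'

theorem cell₁ : R.cell (F₁.cell w) = aR.cell (aL.coCell σ u τ ξ' ξ u') v ω ζ ζ' v' := by
  have e (x : W.Obj) : P₂.obj (F₁.obj x) = d.z₂.obj x := Functor.obj_congr d.F₁_P₂ x
  have e' (x : W.Mor) : P₂.mor (F₁.mor x) = d.z₂.mor x := Functor.mor_congr d.F₁_P₂ x
  refine hR.cell ⟨(Functor.cell_congr d.F₁_P₁ w).trans (hL.cell h),
    (congrArg MB.right.cell (Functor.cell_congr d.F₁_P₂ w)).trans hω, ?_, ?_, ?_, ?_⟩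
  · rw [F₁.dom_cell, e', hζ]
  · rw [F₁.cod_cell, e', hζ']
  · rw [F₁.dom_cell, F₁.src_mor, e, hv]
  · rw [F₁.dom_cell, F₁.tgt_mor, e, hv']

theorem repCell_G : MB.RepCell P₁ P₂ (d.G.cell w) σ v ω ζ ζ' v' := by
  have e (x : W.Obj) : P₂.obj (d.G.obj x) = d.z₂.obj x := Functor.obj_congr d.G_P₂ x
  have e' (x : W.Mor) : P₂.mor (d.G.mor x) = d.z₂.mor x := Functor.mor_congr d.G_P₂ x
  refine ⟨(Functor.cell_congr d.G_P₁ w).trans h.base,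
    (congrArg MB.right.cell (Functor.cell_congr d.G_P₂ w)).trans hω, ?_, ?_, ?_, ?_⟩
  · rw [d.G.dom_cell, e', hζ]
  · rw [d.G.cod_cell, e', hζ']
  · rw [d.G.dom_cell, d.G.src_mor, e, hv]
  · rw [d.G.dom_cell, d.G.tgt_mor, e, hv']

theorem cell₂ : L.cell (F₂.cell w) = aL.coCell (aR.cell σ v ω ζ ζ' v') u τ ξ' ξ u' := by
  have e : Q₁.cell (F₂.cell w) = Q₁.cell (d.z₁.cell w) := Functor.cell_congr d.F₂_Q₁ w
  refine hL.cell ⟨(Functor.cell_congr d.F₂_Q₂ w).trans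
    (hR.cell (d.repCell_G hL hR h hv hv' hω hζ hζ')), ?_, ?_, ?_, ?_, ?_⟩
  · exact (congrArg MA.left.cell e).trans h.right
  · have := h.dom
    change MA.square (Q₁.mor (XL.cod _)) = _ at this
    change MA.square (Q₁.mor (XL.cod _)) = _
    rw [← Q₁.cod_cell, e, Q₁.cod_cell, this]
  · have := h.cod
    change MA.square (Q₁.mor (XL.dom _)) = _ at this
    change MA.square (Q₁.mor (XL.dom _)) = _
    rw [← Q₁.dom_cell, e, Q₁.dom_cell, this]
  · have := h.src
    change MA.arrow (Q₁.obj (XL.tgt (XL.cod _))) = _ at this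
    change MA.arrow (Q₁.obj (XL.tgt (XL.cod _))) = _
    rw [← Q₁.tgt_mor, ← Q₁.cod_cell, e, Q₁.cod_cell, Q₁.tgt_mor, this]
  · have := h.tgt
    change MA.arrow (Q₁.obj (XL.src (XL.cod _))) = _ at this
    change MA.arrow (Q₁.obj (XL.src (XL.cod _))) = _
    rw [← Q₁.src_mor, ← Q₁.cod_cell, e, Q₁.cod_cell, Q₁.src_mor, this]

end

variable (pbL : IsPullback p.dual MA.dual.left Q₂.dual Q₁.dual)
  (pbR : IsPullback q MB.left P₁ P₂)
include pbL pbR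

/-- A square for each leg over the same morphism of `J` gives an element of the triple pullback, at
which the functor equation `hc` is evaluated. -/
theorem compatible (hq : L.comp q = Q₂.comp q) (hp : R.comp p = P₁.comp p)
    (hc : F₁.comp R = F₂.comp L) : aL.Compatible aR where
  obj_left hu := by
    obtain ⟨x, hx⟩ := exists_repObj pbL hu
    exact (congrArg q.obj (hL.obj hx)).symm.trans
      ((Functor.obj_congr hq x).trans (congrArg q.obj hx.base))
  mor_left hu := by
    obtain ⟨x, hx⟩ := exists_repMor pbL hu
    exact (congrArg q.mor (hL.mor hx)).symm.trans
      ((Functor.mor_congr hq x).trans (congrArg q.mor hx.base))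
  cell_left hu := by
    obtain ⟨x, hx⟩ := exists_repCell pbL hu
    exact (congrArg q.cell (hL.cell hx)).symm.trans
      ((Functor.cell_congr hq x).trans (congrArg q.cell hx.base))
  obj_right hv := by
    obtain ⟨x, hx⟩ := exists_repObj pbR hv
    exact (congrArg p.obj (hR.obj hx)).symm.trans
      ((Functor.obj_congr hp x).trans (congrArg p.obj hx.base))
  mor_right hv := by
    obtain ⟨x, hx⟩ := exists_repMor pbR hv
    exact (congrArg p.mor (hR.mor hx)).symm.trans
      ((Functor.mor_congr hp x).trans (congrArg p.mor hx.base))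
  cell_right hv := by
    obtain ⟨x, hx⟩ := exists_repCell pbR hv
    exact (congrArg p.cell (hR.cell hx)).symm.trans
      ((Functor.cell_congr hp x).trans (congrArg p.cell hx.base))
  obj_comm hu hv := by
    obtain ⟨x, hx⟩ := exists_repObj pbL hu
    obtain ⟨y, hy⟩ := exists_repObj pbR hv
    obtain ⟨w, rfl, e⟩ := d.isWeakPullback.exists_obj (x := x) (y := P₂.obj y)
      ((congrArg q.obj (hx.base.trans hy.base.symm)).trans (Functor.obj_congr pbR.w y))
    have hw := hy.arrow
    rw [← e] at hw
    rw [← d.obj₁ hL hR hx hw, ← d.obj₂ hL hR hx hw]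
    exact Functor.obj_congr hc w
  mor_comm {s u t ξ u' v r ζ v'} hu hv := by
    obtain ⟨x, hx⟩ := exists_repMor pbL hu
    obtain ⟨y, hy⟩ := exists_repMor pbR hv
    -- The representatives `x` and `y` have the same component in `J`, so `x` and the arrow part of
    -- `y` glue.
    obtain ⟨w, rfl, e⟩ := d.isWeakPullback.exists_mor (x := x) (y := P₂.mor y)
      ((congrArg q.mor (hx.base.trans hy.base.symm)).trans (Functor.mor_congr pbR.w y))
    have k₁ : MB.arrow (d.z₂.obj (W.src w)) = v := by
      rw [← d.z₂.src_mor, e, P₂.src_mor, hy.src]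
    have k₂ : MB.arrow (d.z₂.obj (W.tgt w)) = v' := by
      rw [← d.z₂.tgt_mor, e, P₂.tgt_mor, hy.tgt]
    have k₃ := hy.right
    have k₄ := hy.square
    rw [← e] at k₃ k₄
    rw [← d.mor₁ hL hR hx k₁ k₂ k₃ k₄, ← d.mor₂ hL hR hx k₁ k₂ k₃ k₄]
    exact Functor.mor_congr hc w
  cell_comm {σ u τ ξ ξ' u' v ω ζ ζ' v'} hu hv := by
    obtain ⟨x, hx⟩ := exists_repCell pbL hu
    obtain ⟨y, hy⟩ := exists_repCell pbR hv
    obtain ⟨w, rfl, e⟩ := d.isWeakPullback.exists_cell (x := x) (y := P₂.cell y)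
      ((congrArg q.cell (hx.base.trans hy.base.symm)).trans (Functor.cell_congr pbR.w y))
    have k₁ : MB.arrow (d.z₂.obj (W.src (W.dom w))) = v := by
      rw [← d.z₂.src_mor, ← d.z₂.dom_cell, e, P₂.dom_cell, P₂.src_mor, hy.src]
    have k₂ : MB.arrow (d.z₂.obj (W.tgt (W.dom w))) = v' := by
      rw [← d.z₂.tgt_mor, ← d.z₂.dom_cell, e, P₂.dom_cell, P₂.tgt_mor, hy.tgt]
    have k₃ := hy.right
    rw [← e] at k₃
    have k₄ : MB.square (d.z₂.mor (W.dom w)) = ζ := by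
      rw [← d.z₂.dom_cell, e, P₂.dom_cell, hy.dom]
    have k₅ : MB.square (d.z₂.mor (W.cod w)) = ζ' := by
      rw [← d.z₂.cod_cell, e, P₂.cod_cell, hy.cod]
    rw [← d.cell₁ hL hR hx k₁ k₂ k₃ k₄ k₅, ← d.cell₂ hL hR hx k₁ k₂ k₃ k₄ k₅]
    exact Functor.cell_congr hc w

/-- Here each element of the triple pullback is read as a pair of squares, to which commutation of
the actions applies. -/
theorem comp_eq_comp (c : aL.Compatible aR) : F₁.comp R = F₂.comp L :=
  Functor.ext
    (funext fun w => by
      have h := repObj_self (M := MA.dual) (P₁ := Q₂.dual) (P₂ := Q₁.dual) (d.z₁.obj w)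
      have hG := d.repObj_G hL hR h rfl
      exact (d.obj₁ hL hR h rfl).trans
        ((c.obj_comm (h.src pbL) (hG.src pbR)).trans (d.obj₂ hL hR h rfl).symm))
    (funext fun w => by
      have h := repMor_self (M := MA.dual) (P₁ := Q₂.dual) (P₂ := Q₁.dual) (d.z₁.mor w)
      have hG := d.repMor_G hL hR h rfl rfl rfl rfl
      exact (d.mor₁ hL hR h rfl rfl rfl rfl).trans
        ((c.mor_comm (h.isSquare pbL) (hG.isSquare pbR)).trans
          (d.mor₂ hL hR h rfl rfl rfl rfl).symm))
    (funext fun w => by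
      have h := repCell_self (M := MA.dual) (P₁ := Q₂.dual) (P₂ := Q₁.dual) (d.z₁.cell w)
      have hG := d.repCell_G hL hR h rfl rfl rfl rfl rfl
      exact (d.cell₁ hL hR h rfl rfl rfl rfl rfl).trans
        ((c.cell_comm (h.isSquareCell pbL) (hG.isSquareCell pbR)).trans
          (d.cell₂ hL hR h rfl rfl rfl rfl rfl).symm))

end CommDiagram
end TotalTwoCat

/-! ### The concrete pullbacks and lax arrow categories satisfy the axioms -/

section
variable {X Y Z : Type u} [Bicategory.{u, u} X] [Strict X] [Bicategory.{u, u} Y] [Strict Y]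
  [Bicategory.{u, u} Z] [Strict Z] (F : StrictPseudofunctor X Z) (G : StrictPseudofunctor Y Z)

/-- The heterogeneous equalities in the definition of `Pullback` are equalities of morphisms and
cells with free boundary, so the total sets form honest pullbacks. -/
theorem isPullback_hat : TotalTwoCat.IsPullback (hat F) (hat G) (hat (Pullback.p₁ F G))
    (hat (Pullback.p₂ F G)) where
  w := congrArg hat (Pullback.condition (F := F) (G := G))
  exists_obj {x y} h := ⟨⟨x, y, h⟩, rfl, rfl⟩
  exists_mor := by
    rintro ⟨a, b, f⟩ ⟨a', b', f'⟩ h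
    have ha : F.obj a = G.obj a' := congrArg Arr.src h
    have hb : F.obj b = G.obj b' := congrArg Arr.tgt h
    exact ⟨⟨⟨a, a', ha⟩, ⟨b, b', hb⟩, Pullback.Hom.mk f f' (Arr.heq_of_eq h)⟩, rfl, rfl⟩
  exists_cell := by
    rintro ⟨a, b, f, g, η⟩ ⟨a', b', f', g', η'⟩ h
    have ha : F.obj a = G.obj a' := congrArg Cel.src h
    have hb : F.obj b = G.obj b' := congrArg Cel.tgt h
    have hf : Arr.mk _ _ (F.map f) = Arr.mk _ _ (G.map f') := congrArg (total Z).dom h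
    have hg : Arr.mk _ _ (F.map g) = Arr.mk _ _ (G.map g') := congrArg (total Z).cod h
    exact ⟨⟨⟨a, a', ha⟩, ⟨b, b', hb⟩, Pullback.Hom.mk f f' (Arr.heq_of_eq hf),
      Pullback.Hom.mk g g' (Arr.heq_of_eq hg), Pullback.Hom₂.mk η η' (Cel.heq_of_eq h)⟩, rfl, rfl⟩
  obj_ext h h' := Pullback.obj_ext h h'
  mor_ext := by
    rintro ⟨⟨a, a', ha⟩, ⟨b, b', hb⟩, ⟨f, f', hf⟩⟩ ⟨⟨c, c', hc⟩, ⟨d, d', hd⟩, ⟨g, g', hg⟩⟩ h h'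
    cases h; cases h'; rfl
  cell_ext := by
    rintro ⟨⟨a, a', ha⟩, ⟨b, b', hb⟩, ⟨f, f', hf⟩, ⟨g, g', hg⟩, ⟨η, η', hη⟩⟩
      ⟨⟨c, c', hc⟩, ⟨d, d', hd⟩, ⟨h, h', hh⟩, ⟨k, k', hk⟩, ⟨θ, θ', hθ⟩⟩ e e'
    cases e; cases e'; rfl

end

section
variable {C : Type u} [Bicategory.{u, u} C] [Strict C]

theorem total_vcomp_eqToHom {a b : C} {f g g' h : a ⟶ b} (e : g = g') (η : f ⟶ g) (θ : g' ⟶ h) :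
    (total C).vcomp (Cel.mk a b f g η) (Cel.mk a b g' h θ) =
      Cel.mk a b f h (η ≫ eqToHom e ≫ θ) := by
  subst e; simp

/-- The pasting of two squares side by side. -/
theorem total_pasting_right {a b c x y z : C} {s : a ⟶ b} {t : b ⟶ c} {u : a ⟶ x} {v : b ⟶ y}
    {w : c ⟶ z} {s' : x ⟶ y} {t' : y ⟶ z} (η : u ≫ s' ⟶ s ≫ v) (θ : v ≫ t' ⟶ t ≫ w) :
    Cel.mk a z (u ≫ s' ≫ t') ((s ≫ t) ≫ w) ((α_ u s' t').inv ≫ η ▷ t' ≫ (α_ s v t').hom ≫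
      s ◁ θ ≫ (α_ s t w).inv) =
    (total C).vcomp ((total C).hcomp (Cel.mk a y (u ≫ s') (s ≫ v) η)
        ((total C).idc (Arr.mk y z t')))
      ((total C).hcomp ((total C).idc (Arr.mk a b s)) (Cel.mk b z (v ≫ t') (t ≫ w) θ)) := by
  rw [total_whiskerRight, total_whiskerLeft, total_vcomp_eqToHom (Strict.assoc s v t')]
  simp only [Strict.associator_eqToIso, eqToIso.hom, eqToIso.inv]
  rw [Cel.eqToHom_comp]
  simp only [← Category.assoc]
  rw [Cel.comp_eqToHom]

/-- The pasting of two squares along a horizontal side. -/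
theorem total_pasting_bottom {a b c x y z : C} {u : a ⟶ b} {v : b ⟶ c} {u' : x ⟶ y} {v' : y ⟶ z}
    {s : a ⟶ x} {t : b ⟶ y} {w : c ⟶ z} (η : u ≫ t ⟶ s ≫ u') (θ : v ≫ w ⟶ t ≫ v') :
    Cel.mk a z ((u ≫ v) ≫ w) (s ≫ u' ≫ v') ((α_ u v w).hom ≫ u ◁ θ ≫ (α_ u t v').inv ≫
      η ▷ v' ≫ (α_ s u' v').hom) =
    (total C).vcomp
      ((total C).hcomp ((total C).idc (Arr.mk a b u)) (Cel.mk b z (v ≫ w) (t ≫ v') θ))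
      ((total C).hcomp (Cel.mk a y (u ≫ t) (s ≫ u') η) ((total C).idc (Arr.mk y z v'))) := by
  rw [total_whiskerRight, total_whiskerLeft, total_vcomp_eqToHom (Strict.assoc u t v').symm]
  simp only [Strict.associator_eqToIso, eqToIso.hom, eqToIso.inv]
  rw [Cel.eqToHom_comp]
  simp only [← Category.assoc]
  rw [Cel.comp_eqToHom]

variable (C) in
/-- The lax arrow `2`-category is a model for the lax arrows. -/
noncomputable def laxArrowModel : TotalTwoCat.ArrowModel (total C) (total (LaxArrow C)) where
  left := hat (LaxArrow.src C)
  right := hat (LaxArrow.tgt C)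
  arrow x := ⟨x.left, x.right, x.hom⟩
  square f := ⟨f.src.left, f.tgt.right, f.src.hom ≫ f.hom.right, f.hom.left ≫ f.tgt.hom,
    f.hom.cell⟩
  src_arrow y := rfl
  tgt_arrow y := rfl
  dom_square f := (total_comp _ _).symm
  cod_square f := (total_comp _ _).symm
  square_one x := by
    change Cel.mk _ _ _ _ ((ρ_ x.hom).hom ≫ (λ_ x.hom).inv) = _
    simp only [Strict.rightUnitor_eqToIso, Strict.leftUnitor_eqToIso, eqToIso.hom, eqToIso.inv]
    rw [Cel.eqToHom_comp]
    exact Cel.eqToHom_eq _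
  square_comp := by
    rintro ⟨x, y, f⟩ ⟨_, z, g⟩ ⟨⟩
    rw [total_comp]
    exact total_pasting_right f.cell g.cell
  square_cell := by
    rintro ⟨x, y, f, g, η⟩
    refine (congrArg _ (total_whiskerRight _ _)).trans ((total_vcomp _ _).trans ?_)
    refine Eq.trans ?_ (congrArg (fun z => (total C).vcomp z _) (total_whiskerLeft _ _)).symm
    exact (congrArg _ η.w).trans (total_vcomp _ _).symm
  obj_ext := by
    rintro ⟨a, b, f⟩ ⟨a', b', f'⟩ h
    cases h; rfl
  mor_ext := by
    rintro ⟨⟨a, b, f⟩, ⟨c, d, g⟩, ⟨s, t, ζ⟩⟩ ⟨⟨a', b', f'⟩, ⟨c', d', g'⟩, ⟨s', t', ζ'⟩⟩ h₁ h₂ h₃ h₄ h₅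
    cases h₁; cases h₂; cases h₃; cases h₄; cases h₅; rfl
  cell_ext := by
    rintro ⟨x, y, f, g, ⟨σ, τ, h⟩⟩ ⟨x', y', f', g', ⟨σ', τ', h'⟩⟩ h₁ h₂ h₃ h₄
    cases h₁; cases h₂; cases h₃; cases h₄; rfl
  exists_obj x := ⟨⟨x.src, x.tgt, x.hom⟩, rfl⟩
  exists_mor := by
    rintro ⟨a, b, f⟩ ⟨c, d, g⟩ ⟨_, _, s⟩ ⟨_, _, t⟩ ⟨a', d', k, l, ζ⟩ ⟨⟩ ⟨⟩ ⟨⟩ ⟨⟩ h h'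
    change Arr.mk a' d' k = (total C).comp (Arr.mk _ _ f) (Arr.mk _ _ t) at h
    change Arr.mk a' d' l = (total C).comp (Arr.mk _ _ s) (Arr.mk _ _ g) at h'
    rw [total_comp] at h h'
    obtain ⟨rfl, rfl, h⟩ := Arr.mk.inj h
    obtain rfl := eq_of_heq h
    obtain rfl := Arr.mk_inj.1 h'
    exact ⟨⟨⟨_, _, f⟩, ⟨_, _, g⟩, LaxArrow.Hom.mk s t ζ⟩, rfl, rfl, rfl, rfl, rfl⟩
  exists_cell := by
    rintro ⟨x, y, f⟩ ⟨x', y', f'⟩ ⟨_, _, _, _, σ⟩ ⟨_, _, _, _, τ⟩ ⟨⟩ ⟨⟩ h₁ h₂ h₃ h₄ h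
    cases h₁; cases h₂; cases h₃; cases h₄
    refine ⟨⟨x, y, f, f', LaxArrow.Hom₂.mk σ τ ?_⟩, rfl, rfl, rfl, rfl⟩
    refine Cel.mk_inj.1 ((total_vcomp _ _).symm.trans
      ((congrArg _ (total_whiskerRight _ _).symm).trans (h.trans
        ((congrArg (fun z => (total C).vcomp z _) (total_whiskerLeft _ _)).trans
          (total_vcomp _ _)))))

end

/-! ### The internal category of arrows: units and vertical composition -/

section

section
variable {C D : TwoCat.{u}} {F G G' H : C ⟶ D}

/-- The composition of the internal category is classified by a vertical composite of this shape,
with an `eqToHom` for the equality of middle functors; this computes the arrows of its values. -/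
theorem mk_app_comp (φ : F ⟶ G) (e : G = G') (ψ : G' ⟶ H) (x : C) :
    Arr.mk (F.obj x) (H.obj x) ((φ ≫ eqToHom e ≫ ψ : F ⟶ H).app x) =
      (total D).comp (Arr.mk (F.obj x) (G.obj x) (φ.app x))
        (Arr.mk (G'.obj x) (H.obj x) (ψ.app x)) := by
  subst e
  rw [eqToHom_refl, Category.id_comp]
  exact (total_comp _ _).symm

/-- The naturality cells of a vertical composite paste one below the other, so internal composition
is vertical pasting of squares. -/
theorem mk_nat_comp (φ : F ⟶ G) (e : G = G') (ψ : G' ⟶ H) {x y : C} (f : x ⟶ y) :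
    Cel.mk (F.obj x) (H.obj y) ((φ ≫ eqToHom e ≫ ψ : F ⟶ H).app x ≫ H.map f)
        (F.map f ≫ (φ ≫ eqToHom e ≫ ψ : F ⟶ H).app y) ((φ ≫ eqToHom e ≫ ψ : F ⟶ H).nat f) =
      (total D).vcomp
        ((total D).hcomp ((total D).idc (Arr.mk (F.obj x) (G.obj x) (φ.app x)))
          (Cel.mk (G'.obj x) (H.obj y) (ψ.app x ≫ H.map f) (G'.map f ≫ ψ.app y) (ψ.nat f)))
        ((total D).hcomp
          (Cel.mk (F.obj x) (G.obj y) (φ.app x ≫ G.map f) (F.map f ≫ φ.app y) (φ.nat f))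
          ((total D).idc (Arr.mk (G'.obj y) (H.obj y) (ψ.app y)))) := by
  subst e
  rw [eqToHom_refl, Category.id_comp]
  exact total_pasting_bottom (φ.nat f) (ψ.nat f)

end

variable {A B J : TwoCat.{u}}

/-- The internal category `A^𝟚`. -/
abbrev arrowCategory (A : TwoCat.{u}) : InternalCategory A :=
  (SpecifiedLimits.cotensor A).internalCategory

/-- The lax arrow `2`-category is a model for the lax arrows. -/
noncomputable def arrowModel (A : TwoCat.{u}) :
    TotalTwoCat.ArrowModel (total A) (total (arrowCategory A).arr) :=
  laxArrowModel A

/-- The strict functor that underlies a morphism of `2`-categories. -/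
noncomputable def tot {X Y : TwoCat.{u}} (f : X ⟶ Y) : (total X).Functor (total Y) := hat f

section
variable {X Y Y' Z : TwoCat.{u}}

theorem tot_injective {f g : X ⟶ Y} (h : tot f = tot g) : f = g := hat_injective h

theorem tot_comp (f : X ⟶ Y) (g : Y ⟶ Z) : tot (f ≫ g) = (tot f).comp (tot g) := rfl

theorem tot_triangle {f : X ⟶ Y} {g : Y ⟶ Z} {k : X ⟶ Z} (h : f ≫ g = k) :
    (tot f).comp (tot g) = tot k :=
  congrArg tot h

theorem tot_square {f : X ⟶ Y} {g : Y ⟶ Z} {f' : X ⟶ Y'} {g' : Y' ⟶ Z} (h : f ≫ g = f' ≫ g') :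
    (tot f).comp (tot g) = (tot f').comp (tot g') :=
  congrArg tot h

theorem dual_tot_triangle {f : X ⟶ Y} {g : Y ⟶ Z} {k : X ⟶ Z} (h : f ≫ g = k) :
    (tot f).dual.comp (tot g).dual = (tot k).dual :=
  congrArg (fun f => (tot f).dual) h

theorem dual_tot_square {f : X ⟶ Y} {g : Y ⟶ Z} {f' : X ⟶ Y'} {g' : Y' ⟶ Z}
    (h : f ≫ g = f' ≫ g') :
    (tot f).dual.comp (tot g).dual = (tot f').dual.comp (tot g').dual :=
  congrArg (fun f => (tot f).dual) h

theorem isPullback_pb (f : X ⟶ Z) (g : Y ⟶ Z) :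
    TotalTwoCat.IsPullback (tot f) (tot g) (tot (π₁ f g)) (tot (π₂ f g)) :=
  isPullback_hat f g

end

theorem isUnit_arrowModel : (arrowModel A).IsUnit (tot (arrowCategory A).unit) where
  left := congrArg hat (arrowCategory A).unit_src
  right := congrArg hat (arrowCategory A).unit_tgt
  arrow a := rfl
  square s := by
    change Cel.mk _ _ _ _ ((λ_ s.hom).hom ≫ (ρ_ s.hom).inv) = _
    simp only [Strict.rightUnitor_eqToIso, Strict.leftUnitor_eqToIso, eqToIso.hom, eqToIso.inv]
    rw [Cel.eqToHom_comp]
    exact Cel.eqToHom_eq _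

theorem isComp_arrowModel : (arrowModel A).IsComp
    (tot (π₁ (arrowCategory A).tgt (arrowCategory A).src))
    (tot (π₂ (arrowCategory A).tgt (arrowCategory A).src))
    (tot (arrowCategory A).comp) where
  left := congrArg hat (arrowCategory A).comp_src
  right := congrArg hat (arrowCategory A).comp_tgt
  arrow y := mk_app_comp
    (Sesquicategory.preW (π₁ (arrowCategory A).tgt (arrowCategory A).src) (TwoCat.cotensor A).δ)
    (pb_condition _ _)
    (Sesquicategory.preW (π₂ (arrowCategory A).tgt (arrowCategory A).src) (TwoCat.cotensor A).δ) y
  square f := mk_nat_comp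
    (Sesquicategory.preW (π₁ (arrowCategory A).tgt (arrowCategory A).src) (TwoCat.cotensor A).δ)
    (pb_condition _ _)
    (Sesquicategory.preW (π₂ (arrowCategory A).tgt (arrowCategory A).src) (TwoCat.cotensor A).δ)
    f.hom

end

/-! ### The diagrams of the profunctor axioms -/

section

open TotalTwoCat

variable {A B J : TwoCat.{u}}

section right
variable {q : J ⟶ B} (R : pb q (arrowCategory B).src ⟶ J)
  (h : R ≫ q = π₂ q (arrowCategory B).src ≫ (arrowCategory B).tgt)

/-- The diagram for the associativity of a right action. -/
noncomputable def rightAssocDiagram : AssocDiagram (arrowModel B)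
    (tot (π₁ q (arrowCategory B).src)) (tot (π₂ q (arrowCategory B).src)) (tot R)
    (tot (pair (π₁ (π₂ q (arrowCategory B).src ≫ (arrowCategory B).tgt) (arrowCategory B).src ≫
          π₁ q (arrowCategory B).src)
        (pair (π₁ (π₂ q (arrowCategory B).src ≫ (arrowCategory B).tgt) (arrowCategory B).src ≫
            π₂ q (arrowCategory B).src)
          (π₂ (π₂ q (arrowCategory B).src ≫ (arrowCategory B).tgt) (arrowCategory B).src)
          (by rw [Category.assoc, pb_condition]) ≫ (arrowCategory B).comp)
        (by rw [Category.assoc, Category.assoc, (arrowCategory B).comp_src, pair_π₁_assoc,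
          Category.assoc, pb_condition])))
    (tot (pair (π₁ (π₂ q (arrowCategory B).src ≫ (arrowCategory B).tgt) (arrowCategory B).src ≫ R)
        (π₂ (π₂ q (arrowCategory B).src ≫ (arrowCategory B).tgt) (arrowCategory B).src)
        (by rw [Category.assoc, h, pb_condition]))) where
  Y₂ := total (pb (arrowCategory B).tgt (arrowCategory B).src : TwoCat.{u})
  e₁ := tot (π₁ (arrowCategory B).tgt (arrowCategory B).src)
  e₂ := tot (π₂ (arrowCategory B).tgt (arrowCategory B).src)
  K := tot (arrowCategory B).comp
  E := tot (pair (π₁ (π₂ q (arrowCategory B).src ≫ (arrowCategory B).tgt) (arrowCategory B).src ≫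
            π₂ q (arrowCategory B).src)
          (π₂ (π₂ q (arrowCategory B).src ≫ (arrowCategory B).tgt) (arrowCategory B).src)
          (by rw [Category.assoc, pb_condition]))
  z₁ := tot (π₁ (π₂ q (arrowCategory B).src ≫ (arrowCategory B).tgt) (arrowCategory B).src)
  z₂ := tot (π₂ (π₂ q (arrowCategory B).src ≫ (arrowCategory B).tgt) (arrowCategory B).src)
  isWeakPullback := (isPullback_pb (π₂ q (arrowCategory B).src ≫ (arrowCategory B).tgt)
    (arrowCategory B).src).toIsWeakPullback
  isComp := isComp_arrowModel
  E_e₁ := tot_square (pair_π₁ _ _ _)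
  E_e₂ := tot_triangle (pair_π₂ _ _ _)
  D₁_P₁ := tot_square (pair_π₁ _ _ _)
  D₁_P₂ := tot_square (pair_π₂ _ _ _)
  D₂_P₁ := tot_square (pair_π₁ _ _ _)
  D₂_P₂ := tot_triangle (pair_π₂ _ _ _)

end right

section left
variable {p : J ⟶ A} (L : pb (arrowCategory A).tgt p ⟶ J)
  (h : L ≫ p = π₁ (arrowCategory A).tgt p ≫ (arrowCategory A).src)

variable (p) in
theorem isPullback_left : TotalTwoCat.IsPullback (tot p).dual (arrowModel A).dual.left
    (tot (π₂ (arrowCategory A).tgt p)).dual (tot (π₁ (arrowCategory A).tgt p)).dual :=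
  (isPullback_pb (arrowCategory A).tgt p).symm.dual

-- Left associativity is stated on `(A^𝟚 ×_A A^𝟚) ×_A J`, whereas in the dual the iterated action
-- lives on pairs of an element of `A^𝟚 ×_A J` and a further arrow. Rebracketing such pairs gives
-- the weak pullback property.
variable (p) in
theorem isWeakPullback_left : IsWeakPullback
    ((tot (π₁ (arrowCategory A).tgt p)).comp (tot (arrowCategory A).src)) (tot (arrowCategory A).tgt)
    (tot (pair (π₁ (π₂ (arrowCategory A).tgt (arrowCategory A).src ≫ (arrowCategory A).tgt) p ≫
        π₂ (arrowCategory A).tgt (arrowCategory A).src)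
      (π₂ (π₂ (arrowCategory A).tgt (arrowCategory A).src ≫ (arrowCategory A).tgt) p)
      (by rw [Category.assoc, pb_condition])))
    (tot (π₁ (π₂ (arrowCategory A).tgt (arrowCategory A).src ≫ (arrowCategory A).tgt) p ≫
      π₁ (arrowCategory A).tgt (arrowCategory A).src)) := by
  have h₁ := isPullback_pb (arrowCategory A).tgt (arrowCategory A).src
  have h₂ := isPullback_pb (π₂ (arrowCategory A).tgt (arrowCategory A).src ≫ (arrowCategory A).tgt) p
  have h₃ := isPullback_pb (arrowCategory A).tgt p
  have e₁ := congrArg tot (pair_π₁ (π₁ (π₂ (arrowCategory A).tgt (arrowCategory A).src ≫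
    (arrowCategory A).tgt) p ≫ π₂ (arrowCategory A).tgt (arrowCategory A).src)
      (π₂ (π₂ (arrowCategory A).tgt (arrowCategory A).src ≫ (arrowCategory A).tgt) p)
      (by rw [Category.assoc, pb_condition]))
  have e₂ := congrArg tot (pair_π₂ (π₁ (π₂ (arrowCategory A).tgt (arrowCategory A).src ≫
    (arrowCategory A).tgt) p ≫ π₂ (arrowCategory A).tgt (arrowCategory A).src)
      (π₂ (π₂ (arrowCategory A).tgt (arrowCategory A).src ≫ (arrowCategory A).tgt) p)
      (by rw [Category.assoc, pb_condition]))
  refine ⟨?_, fun {x y} k => ?_, fun {x y} k => ?_, fun {x y} k => ?_⟩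
  · rw [← tot_comp]
    refine tot_square ?_
    rw [pair_π₁_assoc, Category.assoc, Category.assoc, pb_condition]
  -- The arrow `y` and the arrow of `x` form a composable pair `a`; adjoining the component of `x`
  -- in `J` gives `w`.
  · obtain ⟨a, rfl, ha⟩ := h₁.exists_obj k.symm
    obtain ⟨w, rfl, hw⟩ := h₂.exists_obj (x := a)
      (y := (tot (π₂ (arrowCategory A).tgt p)).obj x)
      ((congrArg (tot (arrowCategory A).tgt).obj ha).trans (TotalTwoCat.Functor.obj_congr h₃.w x))
    exact ⟨w, h₃.obj_ext ((TotalTwoCat.Functor.obj_congr e₁ w).trans ha) ((TotalTwoCat.Functor.obj_congr e₂ w).trans hw),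
      rfl⟩
  · obtain ⟨a, rfl, ha⟩ := h₁.exists_mor k.symm
    obtain ⟨w, rfl, hw⟩ := h₂.exists_mor (x := a)
      (y := (tot (π₂ (arrowCategory A).tgt p)).mor x)
      ((congrArg (tot (arrowCategory A).tgt).mor ha).trans (TotalTwoCat.Functor.mor_congr h₃.w x))
    exact ⟨w, h₃.mor_ext ((TotalTwoCat.Functor.mor_congr e₁ w).trans ha) ((TotalTwoCat.Functor.mor_congr e₂ w).trans hw),
      rfl⟩
  · obtain ⟨a, rfl, ha⟩ := h₁.exists_cell k.symm
    obtain ⟨w, rfl, hw⟩ := h₂.exists_cell (x := a)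
      (y := (tot (π₂ (arrowCategory A).tgt p)).cell x)
      ((congrArg (tot (arrowCategory A).tgt).cell ha).trans (TotalTwoCat.Functor.cell_congr h₃.w x))
    exact ⟨w, h₃.cell_ext ((TotalTwoCat.Functor.cell_congr e₁ w).trans ha)
      ((TotalTwoCat.Functor.cell_congr e₂ w).trans hw), rfl⟩

/-- The diagram for the associativity of a left action. -/
noncomputable def leftAssocDiagram : AssocDiagram (arrowModel A).dual
    (tot (π₂ (arrowCategory A).tgt p)).dual (tot (π₁ (arrowCategory A).tgt p)).dual (tot L).dual
    (tot (pair (π₁ (π₂ (arrowCategory A).tgt (arrowCategory A).src ≫ (arrowCategory A).tgt) p ≫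
          (arrowCategory A).comp)
        (π₂ (π₂ (arrowCategory A).tgt (arrowCategory A).src ≫ (arrowCategory A).tgt) p)
        (by rw [Category.assoc, (arrowCategory A).comp_tgt, pb_condition]))).dual
    (tot (pair (π₁ (π₂ (arrowCategory A).tgt (arrowCategory A).src ≫ (arrowCategory A).tgt) p ≫
          π₁ (arrowCategory A).tgt (arrowCategory A).src)
        (pair (π₁ (π₂ (arrowCategory A).tgt (arrowCategory A).src ≫ (arrowCategory A).tgt) p ≫
            π₂ (arrowCategory A).tgt (arrowCategory A).src)
          (π₂ (π₂ (arrowCategory A).tgt (arrowCategory A).src ≫ (arrowCategory A).tgt) p)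
          (by rw [Category.assoc, pb_condition]) ≫ L)
        (by rw [Category.assoc, Category.assoc, h, pair_π₁_assoc, Category.assoc,
          pb_condition]))).dual where
  Y₂ := (total (pb (arrowCategory A).tgt (arrowCategory A).src : TwoCat.{u})).dual
  e₁ := (tot (π₂ (arrowCategory A).tgt (arrowCategory A).src)).dual
  e₂ := (tot (π₁ (arrowCategory A).tgt (arrowCategory A).src)).dual
  K := (tot (arrowCategory A).comp).dual
  E := (tot (π₁ (π₂ (arrowCategory A).tgt (arrowCategory A).src ≫ (arrowCategory A).tgt) p)).dual
  z₁ := (tot (pair (π₁ (π₂ (arrowCategory A).tgt (arrowCategory A).src ≫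
        (arrowCategory A).tgt) p ≫ π₂ (arrowCategory A).tgt (arrowCategory A).src)
      (π₂ (π₂ (arrowCategory A).tgt (arrowCategory A).src ≫ (arrowCategory A).tgt) p)
      (by rw [Category.assoc, pb_condition]))).dual
  z₂ := (tot (π₁ (π₂ (arrowCategory A).tgt (arrowCategory A).src ≫ (arrowCategory A).tgt) p ≫
      π₁ (arrowCategory A).tgt (arrowCategory A).src)).dual
  isWeakPullback :=
    have h := isWeakPullback_left p
    ⟨congrArg TotalTwoCat.Functor.dual h.w, h.exists_obj, h.exists_mor, h.exists_cell⟩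
  isComp := isComp_arrowModel.dual
  E_e₁ := dual_tot_square (pair_π₁ _ _ _).symm
  E_e₂ := dual_tot_triangle rfl
  D₁_P₁ := dual_tot_square ((pair_π₂ _ _ _).trans (pair_π₂ _ _ _).symm)
  D₁_P₂ := dual_tot_square (pair_π₁ _ _ _)
  D₂_P₁ := dual_tot_square (pair_π₂ _ _ _)
  D₂_P₂ := dual_tot_triangle (pair_π₁ _ _ _)

end left

end

/-! ### Internal profunctors and pairs of compatible actions -/

section

open TotalTwoCat

variable {A B J : TwoCat.{u}} {p : J ⟶ A} {q : J ⟶ B}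

section
variable (L : pb (arrowCategory A).tgt p ⟶ J) (R : pb q (arrowCategory B).src ⟶ J)
  (hL : L ≫ q = π₂ (arrowCategory A).tgt p ≫ q) (hR : R ≫ p = π₁ q (arrowCategory B).src ≫ p)

/-- The diagram for the compatibility of a left and a right action. -/
noncomputable def commDiagram : CommDiagram (tot q) (arrowModel B)
    (tot (π₁ (arrowCategory A).tgt p)) (tot (π₂ (arrowCategory A).tgt p))
    (tot (π₁ q (arrowCategory B).src)) (tot (π₂ q (arrowCategory B).src)) (tot L) (tot R)
    (tot (pair (π₁ (π₂ (arrowCategory A).tgt p ≫ q) (arrowCategory B).src ≫ L)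
        (π₂ (π₂ (arrowCategory A).tgt p ≫ q) (arrowCategory B).src)
        (by rw [Category.assoc, hL, pb_condition])))
    (tot (pair (π₁ (π₂ (arrowCategory A).tgt p ≫ q) (arrowCategory B).src ≫
          π₁ (arrowCategory A).tgt p)
        (pair (π₁ (π₂ (arrowCategory A).tgt p ≫ q) (arrowCategory B).src ≫
            π₂ (arrowCategory A).tgt p) (π₂ (π₂ (arrowCategory A).tgt p ≫ q) (arrowCategory B).src)
          (by rw [Category.assoc, pb_condition]) ≫ R)
        (by rw [Category.assoc, Category.assoc, hR, pair_π₁_assoc, Category.assoc,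
          pb_condition]))) where
  z₁ := tot (π₁ (π₂ (arrowCategory A).tgt p ≫ q) (arrowCategory B).src)
  z₂ := tot (π₂ (π₂ (arrowCategory A).tgt p ≫ q) (arrowCategory B).src)
  G := tot (pair (π₁ (π₂ (arrowCategory A).tgt p ≫ q) (arrowCategory B).src ≫
            π₂ (arrowCategory A).tgt p) (π₂ (π₂ (arrowCategory A).tgt p ≫ q) (arrowCategory B).src)
          (by rw [Category.assoc, pb_condition]))
  isWeakPullback := (isPullback_pb (π₂ (arrowCategory A).tgt p ≫ q)
    (arrowCategory B).src).toIsWeakPullback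
  F₁_P₁ := tot_square (pair_π₁ _ _ _)
  F₁_P₂ := tot_triangle (pair_π₂ _ _ _)
  G_P₁ := tot_square (pair_π₁ _ _ _)
  G_P₂ := tot_triangle (pair_π₂ _ _ _)
  F₂_Q₁ := tot_square (pair_π₁ _ _ _)
  F₂_Q₂ := tot_square (pair_π₂ _ _ _)

end

/-- The left action of a profunctor has the values that are specified by an action. -/
abbrev LeftRealizes (a : Action (tot p).dual) (L : pb (arrowCategory A).tgt p ⟶ J) : Prop :=
  a.Realizes (arrowModel A).dual (tot (π₂ (arrowCategory A).tgt p)).dual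
    (tot (π₁ (arrowCategory A).tgt p)).dual (tot L).dual

/-- The right action of a profunctor has the values that are specified by an action. -/
abbrev RightRealizes (a : Action (tot q)) (R : pb q (arrowCategory B).src ⟶ J) : Prop :=
  a.Realizes (arrowModel B) (tot (π₁ q (arrowCategory B).src)) (tot (π₂ q (arrowCategory B).src))
    (tot R)

theorem isPullback_right (q : J ⟶ B) : TotalTwoCat.IsPullback (tot q) (arrowModel B).left
    (tot (π₁ q (arrowCategory B).src)) (tot (π₂ q (arrowCategory B).src)) :=
  isPullback_pb q (arrowCategory B).src

/-- The axioms of `P` are the functor equations that `isAction_of_comp` and `CommDiagram.compatible`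
turn into elementwise laws, the left ones after dualising. -/
theorem exists_actions (P : SplitTwoSidedFibration p q) :
    ∃ (aL : Action (tot p).dual) (aR : Action (tot q)), aL.Compatible aR ∧
      LeftRealizes aL P.left ∧ RightRealizes aR P.right := by
  have hR := isAction_of_comp (isPullback_right q) isUnit_arrowModel
    (tot_triangle (pair_π₁ _ _ _)) (tot_square (pair_π₂ _ _ _))
    (rightAssocDiagram P.right P.right_q) (tot_square P.right_q) (tot_triangle P.right_unit)
    (tot_square P.right_assoc)
  have hL := isAction_of_comp (isPullback_left p) isUnit_arrowModel.dual
    (dual_tot_triangle (pair_π₂ _ _ _)) (dual_tot_square (pair_π₁ _ _ _))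
    (leftAssocDiagram P.left P.left_p) (dual_tot_square P.left_p) (dual_tot_triangle P.left_unit)
    (dual_tot_square P.left_assoc)
  refine ⟨hL.action (isPullback_left p), hR.action (isPullback_right q), ?_, hL.realizes _,
    hR.realizes _⟩
  exact (commDiagram P.left P.right P.left_q P.right_p).compatible (hL.realizes _) (hR.realizes _)
    (isPullback_left p) (isPullback_right q) (tot_square P.left_q) (tot_square P.right_p)
    (tot_square P.left_right)

set_option maxHeartbeats 2000000 in
theorem exists_profunctor {aL : Action (tot p).dual} {aR : Action (tot q)}
    (c : aL.Compatible aR) : ∃ P : SplitTwoSidedFibration p q,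
      LeftRealizes aL P.left ∧ RightRealizes aR P.right := by
  obtain ⟨L, hL⟩ : ∃ L : pb (arrowCategory A).tgt p ⟶ J,
      (tot L).dual = aL.functor (isPullback_left p) :=
    -- The functor of the left action lives between duals; its dual is a functor between the
    -- original categories, since dualising twice is definitionally the identity.
    ⟨unhat (aL.functor (isPullback_left p)).dual, congrArg TotalTwoCat.Functor.dual (hat_unhat _)⟩
  obtain ⟨R, hR⟩ : ∃ R : pb q (arrowCategory B).src ⟶ J,
      tot R = aR.functor (isPullback_right q) :=
    ⟨unhat (aR.functor (isPullback_right q)), hat_unhat _⟩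
  have rL := aL.realizes_functor (isPullback_left p)
  have rR := aR.realizes_functor (isPullback_right q)
  have iL := aL.isAction_functor (isPullback_left p)
  have iR := aR.isAction_functor (isPullback_right q)
  rw [← hL] at rL iL
  rw [← hR] at rR iR
  have lp : L ≫ p = π₁ (arrowCategory A).tgt p ≫ (arrowCategory A).src :=
    tot_injective (congrArg TotalTwoCat.Functor.dual iL.map)
  have lq : L ≫ q = π₂ (arrowCategory A).tgt p ≫ q := tot_injective (c.left_comp rL (isPullback_left p))
  have rp : R ≫ p = π₁ q (arrowCategory B).src ≫ p :=
    tot_injective (c.right_comp rR (isPullback_right q))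
  have rq : R ≫ q = π₂ q (arrowCategory B).src ≫ (arrowCategory B).tgt := tot_injective iR.map
  exact ⟨{
    left := L
    right := R
    left_p := lp
    left_q := lq
    right_p := rp
    right_q := rq
    left_assoc := tot_injective
      (congrArg TotalTwoCat.Functor.dual (iL.assoc_comp (leftAssocDiagram L lp)))
    left_unit := tot_injective (congrArg TotalTwoCat.Functor.dual (iL.unit_comp
      isUnit_arrowModel.dual (dual_tot_triangle (pair_π₂ _ _ _)) (dual_tot_square (pair_π₁ _ _ _))))
    right_assoc := tot_injective (iR.assoc_comp (rightAssocDiagram R rq))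
    right_unit := tot_injective (iR.unit_comp isUnit_arrowModel
      (tot_triangle (pair_π₁ _ _ _)) (tot_square (pair_π₂ _ _ _)))
    left_right := tot_injective ((commDiagram L R lq rp).comp_eq_comp rL rR (isPullback_left p)
      (isPullback_right q) c) }, rL, rR⟩

end

/-! ### Universal properties in total form and in bicategories -/

section

namespace TotalTwoCat
variable {J B : TotalTwoCat.{u}} (q : Functor J B)

/-- The morphism `f` is opcartesian. -/
structure IsOpcartesian (f : J.Mor) : Prop where
  existsUnique_mor (v : B.Mor) (s : J.Mor) : B.tgt (q.mor f) = B.src v → J.src s = J.src f →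
    q.mor s = q.mor f ⬝ v → ∃! x, J.src x = J.tgt f ∧ q.mor x = v ∧ f ⬝ x = s
  existsUnique_cell (x x' : J.Mor) (σ : J.Cell) (β : B.Cell) : J.src x = J.tgt f →
    J.src x' = J.tgt f → J.tgt x = J.tgt x' → J.dom σ = f ⬝ x → J.cod σ = f ⬝ x' →
    B.dom β = q.mor x → B.cod β = q.mor x' → q.cell σ = B.idc (q.mor f) ∗ β →
    ∃! τ, J.dom τ = x ∧ J.cod τ = x' ∧ q.cell τ = β ∧ J.idc f ∗ τ = σ

/-- The cell `τ` is cartesian. -/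
def IsCartesianCell (τ : J.Cell) : Prop :=
  ∀ (α : B.Cell) (σ : J.Cell), J.cod σ = J.cod τ → B.cod α = B.dom (q.cell τ) →
    q.cell σ = α ⊙ q.cell τ → ∃! ω, J.cod ω = J.dom τ ∧ q.cell ω = α ∧ ω ⊙ τ = σ

variable {q}

/-- This phrases the universal property by the lifted morphism alone, without `i` and `u`; it is the
form that compares with the bicategorical notion. -/
theorem Lifting.isOpcartesian (l : Lifting q) {i : J.Obj} {u : B.Mor} (h : B.src u = q.obj i) :
    IsOpcartesian q (l.lift i u) where
  existsUnique_mor v s h₁ h₂ h₃ := by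
    rw [l.mor_lift i u h] at h₁ h₃
    rw [l.src_lift i u h] at h₂
    exact l.existsUnique_mor i u v s h h₁ h₂ h₃
  existsUnique_cell x x' σ β h₁ h₂ h₃ h₄ h₅ h₆ h₇ h₈ := by
    rw [l.mor_lift i u h] at h₈
    exact l.existsUnique_cell i u x x' σ β h h₁ h₂ h₃ h₄ h₅ h₆ h₇ h₈

theorem Lifting.isCartesianCell (l : Lifting q) {s : J.Mor} {β : B.Cell} (h : B.cod β = q.mor s) :
    IsCartesianCell q (l.cellLift s β) := by
  intro α σ h₁ h₂ h₃
  rw [l.cell_cellLift s β h] at h₂ h₃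
  rw [l.cod_cellLift s β h] at h₁
  exact l.existsUnique_cellLift s α β σ h h₁ h₂ h₃

end TotalTwoCat

section
variable {C : Type u} [Bicategory.{w, v} C] {a b : C} {f g f' g' : a ⟶ b} {η : f ⟶ g} {θ : f' ⟶ g'}

theorem Cel.dom_eq (h : Cel.mk a b f g η = Cel.mk a b f' g' θ) : f = f' := by
  cases h; rfl

theorem Cel.cod_eq (h : Cel.mk a b f g η = Cel.mk a b f' g' θ) : g = g' := by
  cases h; rfl

end

variable {J B : Type u} [Bicategory.{u, u} J] [Strict J] [Bicategory.{u, u} B] [Strict B]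
  {q : StrictPseudofunctor J B}

theorem mk_map_whiskerLeft {i k j : J} (f : i ⟶ k) {t t' : k ⟶ j} (β : q.map t ⟶ q.map t') :
    Cel.mk (q.obj i) (q.obj j) (q.map (f ≫ t)) (q.map (f ≫ t'))
      (eqToHom (q.map_comp f t) ≫ q.map f ◁ β ≫ eqToHom (q.map_comp f t').symm) =
    (total B).hcomp ((total B).idc (Arr.mk (q.obj i) (q.obj k) (q.map f)))
      (Cel.mk (q.obj k) (q.obj j) (q.map t) (q.map t') β) := by
  rw [Cel.eqToHom_comp, Cel.comp_eqToHom, total_whiskerLeft]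

theorem mk_map_whiskerRight {i k j : J} (f : k ⟶ i) {t t' : j ⟶ k} (β : q.map t ⟶ q.map t') :
    Cel.mk (q.obj j) (q.obj i) (q.map (t ≫ f)) (q.map (t' ≫ f))
      (eqToHom (q.map_comp t f) ≫ β ▷ q.map f ≫ eqToHom (q.map_comp t' f).symm) =
    (total B).hcomp (Cel.mk (q.obj j) (q.obj k) (q.map t) (q.map t') β)
      ((total B).idc (Arr.mk (q.obj k) (q.obj i) (q.map f))) := by
  rw [Cel.eqToHom_comp, Cel.comp_eqToHom, total_whiskerRight]

theorem isOpcartesian_hat {i k : J} {f : i ⟶ k} (h : IsOpcartesian q f) :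
    TotalTwoCat.IsOpcartesian (hat q) (Arr.mk i k f) where
  existsUnique_mor := by
    rintro ⟨_, c, v⟩ ⟨_, j, s⟩ ⟨⟩ ⟨⟩ e
    have e : Arr.mk (q.obj i) (q.obj j) (q.map s) = Arr.mk (q.obj i) c (q.map f ≫ v) :=
      e.trans (total_comp _ _)
    -- In total form the target of `v` is arbitrary; the equation `e` forces it to be the image of
    -- the target of `s`.
    obtain rfl := (Arr.mk.inj e).2.1
    obtain ⟨t, ⟨h₁, h₂⟩, ht⟩ := h.existsUnique_hom s v (Arr.mk_inj.1 e)
    refine ⟨Arr.mk k j t, ⟨rfl, Arr.mk_inj.2 h₁, (total_comp _ _).trans (Arr.mk_inj.2 h₂)⟩, ?_⟩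
    rintro ⟨_, j', t'⟩ ⟨⟨⟩, h₁', h₂'⟩
    have h₂' := (total_comp f t').symm.trans h₂'
    obtain rfl := (Arr.mk.inj h₂').2.1
    exact Arr.mk_inj.2 (ht t' ⟨Arr.mk_inj.1 h₁', Arr.mk_inj.1 h₂'⟩)
  existsUnique_cell := by
    rintro ⟨_, j, t⟩ ⟨_, _, t'⟩ ⟨a, b, s, s', σ⟩ ⟨_, _, _, _, β⟩ ⟨⟩ ⟨⟩ ⟨⟩ h₁ h₂ ⟨⟩ ⟨⟩ h₃
    have h₁ : Arr.mk a b s = Arr.mk i j (f ≫ t) := h₁.trans (total_comp _ _)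
    obtain rfl := (Arr.mk.inj h₁).1
    obtain rfl := (Arr.mk.inj h₁).2.1
    obtain rfl := Arr.mk_inj.1 h₁
    obtain rfl := Arr.mk_inj.1 (h₂.trans (total_comp _ _))
    obtain ⟨τ, ⟨e₁, e₂⟩, e⟩ := h.existsUnique_cell σ β
      (Cel.mk_inj.1 (h₃.trans (mk_map_whiskerLeft f β).symm))
    refine ⟨Cel.mk k b t t' τ, ⟨rfl, rfl, Cel.mk_inj.2 e₁,
      (total_whiskerLeft _ _).trans (Cel.mk_inj.2 e₂)⟩, ?_⟩
    rintro ⟨_, _, _, _, τ'⟩ ⟨⟨⟩, ⟨⟩, h₁', h₂'⟩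
    exact Cel.mk_inj.2 (e τ' ⟨Cel.mk_inj.1 h₁',
      Cel.mk_inj.1 ((total_whiskerLeft _ _).symm.trans h₂')⟩)

theorem isOpcartesian_of_hat {i k : J} {f : i ⟶ k}
    (h : TotalTwoCat.IsOpcartesian (hat q) (Arr.mk i k f)) : IsOpcartesian q f where
  existsUnique_hom {j} s v e := by
    obtain ⟨⟨_, j', t⟩, ⟨⟨⟩, h₁, h₂⟩, ht⟩ := h.existsUnique_mor (Arr.mk _ _ v) (Arr.mk i j s) rfl rfl
      ((Arr.mk_inj.2 e).trans (total_comp _ _).symm)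
    have h₂ := (total_comp f t).symm.trans h₂
    obtain rfl := (Arr.mk.inj h₂).2.1
    refine ⟨t, ⟨Arr.mk_inj.1 h₁, Arr.mk_inj.1 h₂⟩, fun t' ⟨h₁', h₂'⟩ => Arr.mk_inj.1
      (ht (Arr.mk k j' t') ⟨rfl, Arr.mk_inj.2 h₁', (total_comp f t').trans (Arr.mk_inj.2 h₂')⟩)⟩
  existsUnique_cell {j t t'} σ β e := by
    obtain ⟨⟨_, _, _, _, τ⟩, ⟨⟨⟩, ⟨⟩, h₁, h₂⟩, hτ⟩ := h.existsUnique_cell (Arr.mk k j t) (Arr.mk k j t')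
      (Cel.mk i j _ _ σ) (Cel.mk _ _ _ _ β) rfl rfl rfl (total_comp _ _).symm (total_comp _ _).symm
      rfl rfl ((Cel.mk_inj.2 e).trans (mk_map_whiskerLeft f β))
    exact ⟨τ, ⟨Cel.mk_inj.1 h₁, Cel.mk_inj.1 ((total_whiskerLeft _ _).symm.trans h₂)⟩,
      fun τ' ⟨h₁', h₂'⟩ => Cel.mk_inj.1 (hτ (Cel.mk _ _ _ _ τ') ⟨rfl, rfl, Cel.mk_inj.2 h₁',
        (total_whiskerLeft _ _).trans (Cel.mk_inj.2 h₂')⟩)⟩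

/-- In the dual a cell runs from `t'` to `t`, so the two morphisms appear in the opposite order. -/
theorem isCartesian_hat {i k : J} {f : k ⟶ i} (h : IsCartesian q f) :
    TotalTwoCat.IsOpcartesian (hat q).dual (Arr.mk k i f) where
  existsUnique_mor := by
    rintro ⟨c, _, v⟩ ⟨j, _, s⟩ ⟨⟩ ⟨⟩ e
    have e : Arr.mk (q.obj j) (q.obj i) (q.map s) = Arr.mk c (q.obj i) (v ≫ q.map f) :=
      e.trans (total_comp _ _)
    obtain rfl := (Arr.mk.inj e).1
    obtain ⟨t, ⟨h₁, h₂⟩, ht⟩ := h.existsUnique_hom s v (Arr.mk_inj.1 e)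
    refine ⟨Arr.mk j k t, ⟨rfl, Arr.mk_inj.2 h₁, (total_comp _ _).trans (Arr.mk_inj.2 h₂)⟩, ?_⟩
    rintro ⟨j', _, t'⟩ ⟨⟨⟩, h₁', h₂'⟩
    have h₂' := (total_comp t' f).symm.trans h₂'
    obtain rfl := (Arr.mk.inj h₂').1
    exact Arr.mk_inj.2 (ht t' ⟨Arr.mk_inj.1 h₁', Arr.mk_inj.1 h₂'⟩)
  existsUnique_cell := by
    rintro ⟨j, _, t'⟩ ⟨_, _, t⟩ ⟨a, b, s, s', σ⟩ ⟨_, _, _, _, β⟩ ⟨⟩ ⟨⟩ ⟨⟩ h₂ h₁ ⟨⟩ ⟨⟩ h₃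
    have h₁ : Arr.mk a b s = Arr.mk j i (t ≫ f) := h₁.trans (total_comp _ _)
    obtain rfl := (Arr.mk.inj h₁).1
    obtain rfl := (Arr.mk.inj h₁).2.1
    obtain rfl := Arr.mk_inj.1 h₁
    obtain rfl := Arr.mk_inj.1 (h₂.trans (total_comp _ _))
    obtain ⟨τ, ⟨e₁, e₂⟩, e⟩ := h.existsUnique_cell σ β
      (Cel.mk_inj.1 (h₃.trans (mk_map_whiskerRight f β).symm))
    refine ⟨Cel.mk a k t t' τ, ⟨rfl, rfl, Cel.mk_inj.2 e₁,
      (total_whiskerRight _ _).trans (Cel.mk_inj.2 e₂)⟩, ?_⟩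
    rintro ⟨_, _, _, _, τ'⟩ ⟨⟨⟩, ⟨⟩, h₁', h₂'⟩
    exact Cel.mk_inj.2 (e τ' ⟨Cel.mk_inj.1 h₁',
      Cel.mk_inj.1 ((total_whiskerRight _ _).symm.trans h₂')⟩)

theorem isCartesian_of_hat {i k : J} {f : k ⟶ i}
    (h : TotalTwoCat.IsOpcartesian (hat q).dual (Arr.mk k i f)) : IsCartesian q f where
  existsUnique_hom {j} s v e := by
    obtain ⟨⟨j', _, t⟩, ⟨⟨⟩, h₁, h₂⟩, ht⟩ := h.existsUnique_mor (Arr.mk _ _ v) (Arr.mk j i s) rfl rfl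
      ((Arr.mk_inj.2 e).trans (total_comp _ _).symm)
    have h₂ := (total_comp t f).symm.trans h₂
    obtain rfl := (Arr.mk.inj h₂).1
    refine ⟨t, ⟨Arr.mk_inj.1 h₁, Arr.mk_inj.1 h₂⟩, fun t' ⟨h₁', h₂'⟩ => Arr.mk_inj.1
      (ht (Arr.mk j' k t') ⟨rfl, Arr.mk_inj.2 h₁', (total_comp t' f).trans (Arr.mk_inj.2 h₂')⟩)⟩
  existsUnique_cell {j t t'} σ β e := by
    obtain ⟨⟨_, _, _, _, τ⟩, ⟨⟨⟩, ⟨⟩, h₁, h₂⟩, hτ⟩ := h.existsUnique_cell (Arr.mk j k t') (Arr.mk j k t)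
      (Cel.mk j i _ _ σ) (Cel.mk _ _ _ _ β) rfl rfl rfl (total_comp _ _).symm (total_comp _ _).symm
      rfl rfl ((Cel.mk_inj.2 e).trans (mk_map_whiskerRight f β))
    exact ⟨τ, ⟨Cel.mk_inj.1 h₁, Cel.mk_inj.1 ((total_whiskerRight _ _).symm.trans h₂)⟩,
      fun τ' ⟨h₁', h₂'⟩ => Cel.mk_inj.1 (hτ (Cel.mk _ _ _ _ τ') ⟨rfl, rfl, Cel.mk_inj.2 h₁',
        (total_whiskerRight _ _).trans (Cel.mk_inj.2 h₂')⟩)⟩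

theorem isCartesianCell_hat {i j : J} {t s : i ⟶ j} {τ : t ⟶ s} (h : IsCartesianCell q τ) :
    TotalTwoCat.IsCartesianCell (hat q) (Cel.mk i j t s τ) := by
  rintro ⟨a, b, x, y, α⟩ ⟨_, _, r, _, σ⟩ ⟨⟩ ⟨⟩ e
  have e : Cel.mk (q.obj i) (q.obj j) (q.map r) (q.map s) (q.map₂ σ) =
    Cel.mk (q.obj i) (q.obj j) x (q.map s) (α ≫ q.map₂ τ) := e.trans (total_vcomp _ _)
  obtain rfl := Cel.dom_eq e
  obtain ⟨ω, ⟨h₁, h₂⟩, hω⟩ := h σ α (Cel.mk_inj.1 e)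
  refine ⟨Cel.mk i j r t ω, ⟨rfl, Cel.mk_inj.2 h₁, (total_vcomp _ _).trans (Cel.mk_inj.2 h₂)⟩, ?_⟩
  rintro ⟨_, _, r', _, ω'⟩ ⟨⟨⟩, h₁', h₂'⟩
  have h₂' := (total_vcomp _ _).symm.trans h₂'
  obtain rfl := Cel.dom_eq h₂'
  exact Cel.mk_inj.2 (hω ω' ⟨Cel.mk_inj.1 h₁', Cel.mk_inj.1 h₂'⟩)

theorem isCartesianCell_of_hat {i j : J} {t s : i ⟶ j} {τ : t ⟶ s}
    (h : TotalTwoCat.IsCartesianCell (hat q) (Cel.mk i j t s τ)) : IsCartesianCell q τ := by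
  intro r σ α e
  obtain ⟨⟨_, _, r', _, ω⟩, ⟨⟨⟩, h₁, h₂⟩, hω⟩ := h (Cel.mk _ _ _ _ α) (Cel.mk i j r s σ) rfl rfl
    ((Cel.mk_inj.2 e).trans (total_vcomp _ _).symm)
  have h₂ := (total_vcomp _ _).symm.trans h₂
  obtain rfl := Cel.dom_eq h₂
  exact ⟨ω, ⟨Cel.mk_inj.1 h₁, Cel.mk_inj.1 h₂⟩, fun ω' ⟨h₁', h₂'⟩ => Cel.mk_inj.1
    (hω (Cel.mk i j _ t ω') ⟨rfl, Cel.mk_inj.2 h₁', (total_vcomp _ _).trans (Cel.mk_inj.2 h₂')⟩)⟩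

theorem isOpcartesianCell_hat {i j : J} {t s : i ⟶ j} {τ : s ⟶ t} (h : IsOpcartesianCell q τ) :
    TotalTwoCat.IsCartesianCell (hat q).dual (Cel.mk i j s t τ) := by
  rintro ⟨a, b, y, x, α⟩ ⟨_, _, _, r, σ⟩ ⟨⟩ ⟨⟩ e
  have e : Cel.mk (q.obj i) (q.obj j) (q.map s) (q.map r) (q.map₂ σ) =
    Cel.mk (q.obj i) (q.obj j) (q.map s) x (q.map₂ τ ≫ α) := e.trans (total_vcomp _ _)
  obtain rfl := Cel.cod_eq e
  obtain ⟨ω, ⟨h₁, h₂⟩, hω⟩ := h σ α (Cel.mk_inj.1 e)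
  refine ⟨Cel.mk i j t r ω, ⟨rfl, Cel.mk_inj.2 h₁, (total_vcomp _ _).trans (Cel.mk_inj.2 h₂)⟩, ?_⟩
  rintro ⟨_, _, _, r', ω'⟩ ⟨⟨⟩, h₁', h₂'⟩
  have h₂' := (total_vcomp _ _).symm.trans h₂'
  obtain rfl := Cel.cod_eq h₂'
  exact Cel.mk_inj.2 (hω ω' ⟨Cel.mk_inj.1 h₁', Cel.mk_inj.1 h₂'⟩)

theorem isOpcartesianCell_of_hat {i j : J} {t s : i ⟶ j} {τ : s ⟶ t}
    (h : TotalTwoCat.IsCartesianCell (hat q).dual (Cel.mk i j s t τ)) :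
    IsOpcartesianCell q τ := by
  intro r σ α e
  obtain ⟨⟨_, _, _, r', ω⟩, ⟨⟨⟩, h₁, h₂⟩, hω⟩ := h (Cel.mk _ _ _ _ α) (Cel.mk i j s r σ) rfl rfl
    ((Cel.mk_inj.2 e).trans (total_vcomp _ _).symm)
  have h₂ := (total_vcomp _ _).symm.trans h₂
  obtain rfl := Cel.cod_eq h₂
  exact ⟨ω, ⟨Cel.mk_inj.1 h₁, Cel.mk_inj.1 h₂⟩, fun ω' ⟨h₁', h₂'⟩ => Cel.mk_inj.1
    (hω (Cel.mk i j t _ ω') ⟨rfl, Cel.mk_inj.2 h₁', (total_vcomp _ _).trans (Cel.mk_inj.2 h₂')⟩)⟩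

end

/-! ### Cleavages for the right leg as lifting structures -/

section

variable {J B : Type u} [Bicategory.{u, u} J] [Strict J] [Bicategory.{u, u} B] [Strict B]
  {q : StrictPseudofunctor J B}

namespace OpCleavage
variable (r : OpCleavage q)

/-- The lifts of a cleavage are those of a lifting structure on the underlying strict functor. -/
structure Represents (l : TotalTwoCat.Lifting (hat q)) : Prop where
  lift {i : J} {b : B} (u : q.obj i ⟶ b) :
    l.lift i (Arr.mk (q.obj i) b u) = Arr.mk i (r.push u) (r.lift u)
  cellLift {i j : J} (s : i ⟶ j) {u : q.obj i ⟶ q.obj j} (β : u ⟶ q.map s) :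
    l.cellLift (Arr.mk i j s) (Cel.mk (q.obj i) (q.obj j) u (q.map s) β) =
      Cel.mk i j (r.pull s β) s (r.cellLift s β)

open Classical in
/-- The lift of a morphism. -/
noncomputable def totLift (i : J) (u : Arr B) : Arr J :=
  if h : u.src = q.obj i then ⟨i, r.push (u.hom.cast h rfl), r.lift (u.hom.cast h rfl)⟩
  else ⟨i, i, 𝟙 i⟩

open Classical in
/-- The lift of a cell. -/
noncomputable def totCellLift (s : Arr J) (β : Cel B) : Cel J :=
  if h : Arr.mk β.src β.tgt β.cod = ⟨q.obj s.src, q.obj s.tgt, q.map s.hom⟩ then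
    ⟨s.src, s.tgt, r.pull s.hom
        (β.homOf (Arr.mk_homOf ⟨β.src, β.tgt, β.dom⟩ (Arr.mk.inj h).1 (Arr.mk.inj h).2.1).symm h),
      s.hom, r.cellLift s.hom _⟩
  else ⟨s.src, s.tgt, s.hom, s.hom, 𝟙 s.hom⟩

theorem totLift_of_eq {i : J} {b c : B} (h : b = q.obj i) (v : b ⟶ c) :
    r.totLift i ⟨b, c, v⟩ = ⟨i, r.push (v.cast h rfl), r.lift (v.cast h rfl)⟩ :=
  dif_pos h

theorem totLift_mk {i : J} {b : B} (u : q.obj i ⟶ b) :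
    r.totLift i ⟨q.obj i, b, u⟩ = ⟨i, r.push u, r.lift u⟩ :=
  r.totLift_of_eq rfl u

theorem totCellLift_mk {i j : J} (s : i ⟶ j) {u : q.obj i ⟶ q.obj j} (β : u ⟶ q.map s) :
    r.totCellLift ⟨i, j, s⟩ ⟨q.obj i, q.obj j, u, q.map s, β⟩ =
      ⟨i, j, r.pull s β, s, r.cellLift s β⟩ := by
  refine (dif_pos rfl).trans ?_
  have h : (Cel.mk (q.obj i) (q.obj j) u (q.map s) β).homOf (f := u) (g := q.map s) rfl rfl = β :=
    Cel.homOf_eq rfl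
  exact congrArg (fun β => Cel.mk i j (r.pull s β) s (r.cellLift s β)) h

theorem totCellLift_of_eq {i j : J} (s : i ⟶ j) {u v : q.obj i ⟶ q.obj j} (h : v = q.map s)
    (β : u ⟶ v) : r.totCellLift ⟨i, j, s⟩ ⟨q.obj i, q.obj j, u, v, β⟩ =
      ⟨i, j, r.pull s (β ≫ eqToHom h), s, r.cellLift s (β ≫ eqToHom h)⟩ := by
  rw [← totCellLift_mk, Cel.comp_eqToHom]

theorem mk_map_lift {i : J} {b : B} (u : q.obj i ⟶ b) :
    Arr.mk (q.obj i) (q.obj (r.push u)) (q.map (r.lift u)) = ⟨q.obj i, b, u⟩ :=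
  Arr.mk_eq rfl (r.obj_push u) (r.map_lift u)

theorem mk_map₂_cellLift {i j : J} (s : i ⟶ j) {u : q.obj i ⟶ q.obj j} (β : u ⟶ q.map s) :
    Cel.mk (q.obj i) (q.obj j) (q.map (r.pull s β)) (q.map s) (q.map₂ (r.cellLift s β)) =
      ⟨q.obj i, q.obj j, u, q.map s, β⟩ := by
  rw [r.map₂_cellLift, Cel.eqToHom_comp]

/-- The lifting structure of a cleavage. -/
noncomputable def lifting : TotalTwoCat.Lifting (hat q) where
  lift := r.totLift
  cellLift := r.totCellLift
  src_lift := by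
    rintro i ⟨_, b, u⟩ ⟨⟩
    exact congrArg Arr.src (r.totLift_mk u)
  mor_lift := by
    rintro i ⟨_, b, u⟩ ⟨⟩
    exact (congrArg (hat q).mor (r.totLift_mk u)).trans (r.mk_map_lift u)
  cod_cellLift := by
    rintro ⟨i, j, s⟩ ⟨a, b, u, v, β⟩ h
    obtain ⟨rfl, rfl, h⟩ := Arr.mk.inj h
    obtain rfl := eq_of_heq h
    exact congrArg (total J).cod (r.totCellLift_mk s β)
  cell_cellLift := by
    rintro ⟨i, j, s⟩ ⟨a, b, u, v, β⟩ h
    obtain ⟨rfl, rfl, h⟩ := Arr.mk.inj h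
    obtain rfl := eq_of_heq h
    exact (congrArg (hat q).cell (r.totCellLift_mk s β)).trans (r.mk_map₂_cellLift s β)
  lift_comp := by
    rintro i ⟨_, b, u⟩ ⟨_, c, v⟩ ⟨⟩ ⟨⟩
    rw [total_comp]
    refine (r.totLift_mk (u ≫ v)).trans ?_
    rw [show r.totLift i ⟨_, _, u⟩ = _ from r.totLift_mk u]
    -- The second arrow starts at `b`, which is only propositionally `q (push u)`; this accounts for
    -- the cast in the cleavage axiom.
    refine Eq.trans ?_ (congrArg ((total J).comp _)
      (r.totLift_of_eq (r.obj_push u).symm v)).symm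
    exact (Arr.mk_eq rfl (r.push_comp u v) (r.lift_comp u v)).trans (total_comp _ _).symm
  lift_one i := (r.totLift_mk _).trans (Arr.mk_eq rfl (r.push_id i) (r.lift_id i))
  cellLift_vcomp := by
    rintro ⟨i, j, s⟩ ⟨a, b, x, y, γ⟩ ⟨_, _, _, z, β⟩ ⟨⟩ h
    obtain ⟨rfl, rfl, h⟩ := Arr.mk.inj h
    obtain rfl := eq_of_heq h
    refine (congrArg _ (total_vcomp γ β)).trans ((r.totCellLift_mk s _).trans ?_)
    rw [show r.totCellLift ⟨i, j, s⟩ ⟨_, _, _, _, β⟩ = _ from r.totCellLift_mk s β]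
    refine Eq.trans ?_ (congrArg (fun x => (total J).vcomp x _)
      (r.totCellLift_of_eq (r.pull s β) (r.map_pull s β).symm γ)).symm
    refine Eq.trans ?_ (total_vcomp _ _).symm
    exact Cel.mk_eq (r.pull_vcomp s γ β) rfl (by rw [r.cellLift_vcomp]; simp)
  cellLift_hcomp := by
    rintro ⟨i, j, s⟩ ⟨_, k, t⟩ ⟨a, b, u, x, β⟩ ⟨a', b', v, y, γ⟩ h h' ⟨⟩
    obtain ⟨rfl, rfl, h⟩ := Arr.mk.inj h
    obtain rfl := eq_of_heq h
    obtain ⟨rfl, rfl, h'⟩ := Arr.mk.inj h'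
    obtain rfl := eq_of_heq h'
    refine (congrArg₂ r.totCellLift (total_comp s t) (total_hcomp β γ)).trans ?_
    refine (r.totCellLift_of_eq (s ≫ t) (q.map_comp s t).symm _).trans ?_
    refine Eq.trans ?_ (congrArg₂ (total J).hcomp (r.totCellLift_mk s β)
      (r.totCellLift_mk t γ)).symm
    refine Eq.trans ?_ (total_hcomp _ _).symm
    exact Cel.mk_eq (r.pull_hcomp s t β γ) rfl (by rw [r.cellLift_hcomp]; simp)
  cellLift_idc := by
    rintro ⟨i, j, s⟩
    exact (r.totCellLift_mk s (𝟙 (q.map s))).trans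
      (Cel.mk_eq (r.pull_id s) rfl (by rw [r.cellLift_id]; simp))
  existsUnique_mor := by
    rintro i ⟨_, b, u⟩ v s ⟨⟩ h₁ h₂ h₃
    have h := isOpcartesian_hat (r.isOpcartesian_lift u)
    rw [← r.totLift_mk u] at h
    have e : (hat q).mor (r.totLift i ⟨_, b, u⟩) = _ :=
      (congrArg (hat q).mor (r.totLift_mk u)).trans (r.mk_map_lift u)
    exact h.existsUnique_mor v s ((congrArg Arr.tgt e).trans h₁)
      (h₂.trans (congrArg Arr.src (r.totLift_mk u)).symm)
      (h₃.trans (congrArg (fun x => (total B).comp x v) e.symm))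
  existsUnique_cell := by
    rintro i ⟨_, b, u⟩ x x' σ β ⟨⟩ h₁ h₂ h₃ h₄ h₅ h₆ h₇ h₈
    have h := isOpcartesian_hat (r.isOpcartesian_lift u)
    rw [← r.totLift_mk u] at h
    have e : (hat q).mor (r.totLift i ⟨_, b, u⟩) = _ :=
      (congrArg (hat q).mor (r.totLift_mk u)).trans (r.mk_map_lift u)
    exact h.existsUnique_cell x x' σ β h₁ h₂ h₃ h₄ h₅ h₆ h₇
      (h₈.trans (congrArg (fun x => (total B).hcomp ((total B).idc x) β) e.symm))
  existsUnique_cellLift := by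
    rintro ⟨i, j, s⟩ α ⟨a, b, u, v, β⟩ σ h h₁ h₂ h₃
    obtain ⟨rfl, rfl, h⟩ := Arr.mk.inj h
    obtain rfl := eq_of_heq h
    have h := isCartesianCell_hat (r.isCartesianCell_cellLift s β)
    rw [← r.totCellLift_mk s β] at h
    have e : (hat q).cell (r.totCellLift ⟨i, j, s⟩ ⟨_, _, _, _, β⟩) = _ :=
      (congrArg (hat q).cell (r.totCellLift_mk s β)).trans (r.mk_map₂_cellLift s β)
    exact h α σ (h₁.trans (congrArg (total J).cod (r.totCellLift_mk s β)).symm)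
      (h₂.trans (congrArg (total B).dom e.symm))
      (h₃.trans (congrArg ((total B).vcomp α) e.symm))

theorem represents_lifting : r.Represents r.lifting where
  lift u := r.totLift_mk u
  cellLift s _ β := r.totCellLift_mk s β

end OpCleavage

/-- The typed data are extracted from the lifts by means of their known boundaries. Each axiom is
first stated for elements with free boundary, where it is an axiom of `l`, and then read back. -/
theorem exists_opCleavage (l : TotalTwoCat.Lifting (hat q)) : ∃ r : OpCleavage q, r.Represents l := by
  let push {i : J} {b : B} (u : q.obj i ⟶ b) : J := (l.lift i (Arr.mk (q.obj i) b u)).tgt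
  let lift {i : J} {b : B} (u : q.obj i ⟶ b) : i ⟶ push u :=
    (l.lift i (Arr.mk (q.obj i) b u)).homOf (l.src_lift i _ rfl) rfl
  have mk_lift {i : J} {b : B} (u : q.obj i ⟶ b) :
      l.lift i (Arr.mk (q.obj i) b u) = Arr.mk i (push u) (lift u) := (Arr.mk_homOf _ _ _).symm
  have hcod {i j : J} (s : i ⟶ j) {u : q.obj i ⟶ q.obj j} (β : u ⟶ q.map s) :=
    l.cod_cellLift (Arr.mk i j s) (Cel.mk (q.obj i) (q.obj j) u (q.map s) β) rfl
  let pull {i j : J} (s : i ⟶ j) {u : q.obj i ⟶ q.obj j} (β : u ⟶ q.map s) : i ⟶ j :=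
    ((total J).dom (l.cellLift (Arr.mk i j s) (Cel.mk (q.obj i) (q.obj j) u (q.map s) β))).homOf
      (congrArg Arr.src (hcod s β)) (congrArg Arr.tgt (hcod s β))
  let cellLift {i j : J} (s : i ⟶ j) {u : q.obj i ⟶ q.obj j} (β : u ⟶ q.map s) : pull s β ⟶ s :=
    (l.cellLift (Arr.mk i j s) (Cel.mk (q.obj i) (q.obj j) u (q.map s) β)).homOf
      (Arr.mk_homOf _ _ _).symm (hcod s β)
  have mk_cellLift {i j : J} (s : i ⟶ j) {u : q.obj i ⟶ q.obj j} (β : u ⟶ q.map s) :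
      l.cellLift (Arr.mk i j s) (Cel.mk (q.obj i) (q.obj j) u (q.map s) β) =
        Cel.mk i j (pull s β) s (cellLift s β) := (Cel.mk_homOf _ _ _).symm
  have mk_map_lift {i : J} {b : B} (u : q.obj i ⟶ b) :
      Arr.mk (q.obj i) (q.obj (push u)) (q.map (lift u)) = ⟨q.obj i, b, u⟩ :=
    (congrArg (hat q).mor (mk_lift u).symm).trans (l.mor_lift i ⟨_, b, u⟩ rfl)
  have mk_map₂_cellLift {i j : J} (s : i ⟶ j) {u : q.obj i ⟶ q.obj j} (β : u ⟶ q.map s) :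
      Cel.mk (q.obj i) (q.obj j) (q.map (pull s β)) (q.map s) (q.map₂ (cellLift s β)) =
        ⟨q.obj i, q.obj j, u, q.map s, β⟩ :=
    (congrArg (hat q).cell (mk_cellLift s β).symm).trans (l.cell_cellLift _ _ rfl)
  have obj_push {i : J} {b : B} (u : q.obj i ⟶ b) : q.obj (push u) = b :=
    congrArg Arr.tgt (mk_map_lift u)
  have map_pull {i j : J} (s : i ⟶ j) {u : q.obj i ⟶ q.obj j} (β : u ⟶ q.map s) :
      q.map (pull s β) = u := Cel.dom_eq (mk_map₂_cellLift s β)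
  have mk_lift_comp {i : J} {b b' : B} (u : q.obj i ⟶ b) (v : b ⟶ b') :
      Arr.mk i (push (u ≫ v)) (lift (u ≫ v)) =
        ⟨i, _, lift u ≫ lift (v.cast (obj_push u).symm rfl)⟩ := by
    rw [← mk_lift, ← total_comp, ← total_comp, ← mk_lift, ← mk_lift]
    refine (l.lift_comp i _ _ rfl rfl).trans (congrArg ((total J).comp _) ?_)
    exact congrArg (l.lift (push u)) (Arr.mk_homOf ⟨b, b', v⟩ _ _).symm
  have mk_cellLift_vcomp {i j : J} (s : i ⟶ j) {u u' : q.obj i ⟶ q.obj j} (γ : u' ⟶ u)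
      (β : u ⟶ q.map s) : Cel.mk i j (pull s (γ ≫ β)) s (cellLift s (γ ≫ β)) =
        ⟨i, j, _, s, cellLift (pull s β) (γ ≫ eqToHom (map_pull s β).symm) ≫ cellLift s β⟩ := by
    rw [← mk_cellLift, ← total_vcomp, ← total_vcomp, ← mk_cellLift, ← mk_cellLift,
      Cel.comp_eqToHom]
    refine (l.cellLift_vcomp _ _ _ rfl rfl).trans (congrArg (fun x => (total J).vcomp x _) ?_)
    exact congrArg (fun x => l.cellLift x _) (Arr.mk_homOf _ _ _).symm
  have mk_cellLift_hcomp {i j k : J} (s : i ⟶ j) (t : j ⟶ k) {u : q.obj i ⟶ q.obj j}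
      {v : q.obj j ⟶ q.obj k} (β : u ⟶ q.map s) (γ : v ⟶ q.map t) :
      Cel.mk i k (pull (s ≫ t) ((β ▷ v ≫ q.map s ◁ γ) ≫ eqToHom (q.map_comp s t).symm)) (s ≫ t)
          (cellLift (s ≫ t) ((β ▷ v ≫ q.map s ◁ γ) ≫ eqToHom (q.map_comp s t).symm)) =
        ⟨i, k, pull s β ≫ pull t γ, s ≫ t, cellLift s β ▷ pull t γ ≫ s ◁ cellLift t γ⟩ := by
    rw [← mk_cellLift, ← total_hcomp, ← mk_cellLift, ← mk_cellLift, Cel.comp_eqToHom,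
      ← total_hcomp, ← total_comp]
    exact l.cellLift_hcomp _ _ _ _ rfl rfl rfl
  have mk_lift_id (i : J) : Arr.mk i (push (𝟙 (q.obj i))) (lift (𝟙 (q.obj i))) = ⟨i, i, 𝟙 i⟩ :=
    (mk_lift _).symm.trans (l.lift_one i)
  have mk_cellLift_id {i j : J} (s : i ⟶ j) :
      Cel.mk i j (pull s (𝟙 (q.map s))) s (cellLift s (𝟙 (q.map s))) = ⟨i, j, s, s, 𝟙 s⟩ :=
    (mk_cellLift _ _).symm.trans (l.cellLift_idc ⟨i, j, s⟩)
  exact ⟨{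
    push := push
    lift := lift
    obj_push := obj_push
    map_lift u := Arr.heq_of_eq (mk_map_lift u)
    pull := pull
    cellLift := cellLift
    map_pull := map_pull
    map₂_cellLift s _ β := by
      rw [← Cel.mk_inj, mk_map₂_cellLift, Cel.eqToHom_comp]
    push_comp u v := (Arr.mk.inj (mk_lift_comp u v)).2.1
    lift_comp u v := Arr.heq_of_eq (mk_lift_comp u v)
    push_id i := (Arr.mk.inj (mk_lift_id i)).2.1
    lift_id i := Arr.heq_of_eq (mk_lift_id i)
    pull_vcomp s _ _ γ β := Cel.dom_eq (mk_cellLift_vcomp s γ β)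
    cellLift_vcomp s _ _ γ β := by
      rw [← Cel.mk_inj, mk_cellLift_vcomp, Cel.eqToHom_comp]
    pull_hcomp s t _ _ β γ := Cel.dom_eq (mk_cellLift_hcomp s t β γ)
    cellLift_hcomp s t _ _ β γ := by
      rw [← Cel.mk_inj, mk_cellLift_hcomp, Cel.eqToHom_comp]
    pull_id s := Cel.dom_eq (mk_cellLift_id s)
    cellLift_id s := by
      rw [← Cel.mk_inj, mk_cellLift_id, Cel.eqToHom_eq, Cel.dom_eq (mk_cellLift_id s)]
    isOpcartesian_lift u := isOpcartesian_of_hat (by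
      rw [← mk_lift]; exact l.isOpcartesian rfl)
    isCartesianCell_cellLift s _ β := isCartesianCell_of_hat (by
      rw [← mk_cellLift]; exact l.isCartesianCell rfl) }, mk_lift, mk_cellLift⟩

end

/-! ### Cleavages for the left leg as lifting structures of the dual -/

section coCleavage
variable {J A : Type u} [Bicategory.{u, u} J] [Strict J] [Bicategory.{u, u} A] [Strict A]
  {p : StrictPseudofunctor J A}

namespace CoCleavage
variable (c : CoCleavage p)

/-- The lifts of a cleavage are those of a lifting structure on the dual of the underlying strict
functor. -/
structure Represents (l : TotalTwoCat.Lifting (hat p).dual) : Prop where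
  lift {a : A} {i : J} (u : a ⟶ p.obj i) :
    l.lift i (Arr.mk a (p.obj i) u) = Arr.mk (c.pull u) i (c.lift u)
  cellLift {i j : J} (s : i ⟶ j) {v : p.obj i ⟶ p.obj j} (α : p.map s ⟶ v) :
    l.cellLift (Arr.mk i j s) (Cel.mk (p.obj i) (p.obj j) (p.map s) v α) =
      Cel.mk i j s (c.push s α) (c.cellLift s α)

open Classical in
/-- The lift of a morphism. -/
noncomputable def totLift (i : J) (u : Arr A) : Arr J :=
  if h : u.tgt = p.obj i then ⟨c.pull (u.hom.cast rfl h), i, c.lift (u.hom.cast rfl h)⟩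
  else ⟨i, i, 𝟙 i⟩

open Classical in
/-- The lift of a cell. -/
noncomputable def totCellLift (s : Arr J) (α : Cel A) : Cel J :=
  if h : Arr.mk α.src α.tgt α.dom = ⟨p.obj s.src, p.obj s.tgt, p.map s.hom⟩ then
    ⟨s.src, s.tgt, s.hom, c.push s.hom
        (α.homOf h (Arr.mk_homOf ⟨α.src, α.tgt, α.cod⟩ (Arr.mk.inj h).1 (Arr.mk.inj h).2.1).symm),
      c.cellLift s.hom _⟩
  else ⟨s.src, s.tgt, s.hom, s.hom, 𝟙 s.hom⟩

theorem totLift_of_eq {i : J} {a b : A} (h : b = p.obj i) (v : a ⟶ b) :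
    c.totLift i ⟨a, b, v⟩ = ⟨c.pull (v.cast rfl h), i, c.lift (v.cast rfl h)⟩ :=
  dif_pos h

theorem totLift_mk {i : J} {a : A} (u : a ⟶ p.obj i) :
    c.totLift i ⟨a, p.obj i, u⟩ = ⟨c.pull u, i, c.lift u⟩ :=
  c.totLift_of_eq rfl u

theorem totCellLift_mk {i j : J} (s : i ⟶ j) {v : p.obj i ⟶ p.obj j} (α : p.map s ⟶ v) :
    c.totCellLift ⟨i, j, s⟩ ⟨p.obj i, p.obj j, p.map s, v, α⟩ =
      ⟨i, j, s, c.push s α, c.cellLift s α⟩ := by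
  refine (dif_pos rfl).trans ?_
  have h : (Cel.mk (p.obj i) (p.obj j) (p.map s) v α).homOf (f := p.map s) (g := v) rfl rfl = α :=
    Cel.homOf_eq rfl
  exact congrArg (fun α => Cel.mk i j s (c.push s α) (c.cellLift s α)) h

theorem totCellLift_of_eq {i j : J} (s : i ⟶ j) {u v : p.obj i ⟶ p.obj j} (h : p.map s = u)
    (α : u ⟶ v) : c.totCellLift ⟨i, j, s⟩ ⟨p.obj i, p.obj j, u, v, α⟩ =
      ⟨i, j, s, c.push s (eqToHom h ≫ α), c.cellLift s (eqToHom h ≫ α)⟩ := by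
  rw [← totCellLift_mk, Cel.eqToHom_comp]

theorem mk_map_lift {i : J} {a : A} (u : a ⟶ p.obj i) :
    Arr.mk (p.obj (c.pull u)) (p.obj i) (p.map (c.lift u)) = ⟨a, p.obj i, u⟩ :=
  Arr.mk_eq (c.obj_pull u) rfl (c.map_lift u)

theorem mk_map₂_cellLift {i j : J} (s : i ⟶ j) {v : p.obj i ⟶ p.obj j} (α : p.map s ⟶ v) :
    Cel.mk (p.obj i) (p.obj j) (p.map s) (p.map (c.push s α)) (p.map₂ (c.cellLift s α)) =
      ⟨p.obj i, p.obj j, p.map s, v, α⟩ := by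
  rw [c.map₂_cellLift, Cel.comp_eqToHom]

/-- The lifting structure of a cleavage. -/
noncomputable def lifting : TotalTwoCat.Lifting (hat p).dual where
  lift := c.totLift
  cellLift := c.totCellLift
  src_lift := by
    rintro i ⟨a, _, u⟩ ⟨⟩
    exact congrArg Arr.tgt (c.totLift_mk u)
  mor_lift := by
    rintro i ⟨a, _, u⟩ ⟨⟩
    exact (congrArg (hat p).mor (c.totLift_mk u)).trans (c.mk_map_lift u)
  cod_cellLift := by
    rintro ⟨i, j, s⟩ ⟨a, b, u, v, α⟩ h
    obtain ⟨rfl, rfl, h⟩ := Arr.mk.inj h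
    obtain rfl := eq_of_heq h
    exact congrArg (total J).dom (c.totCellLift_mk s α)
  cell_cellLift := by
    rintro ⟨i, j, s⟩ ⟨a, b, u, v, α⟩ h
    obtain ⟨rfl, rfl, h⟩ := Arr.mk.inj h
    obtain rfl := eq_of_heq h
    exact (congrArg (hat p).cell (c.totCellLift_mk s α)).trans (c.mk_map₂_cellLift s α)
  lift_comp := by
    rintro i ⟨b, _, u⟩ ⟨a, _, v⟩ ⟨⟩ ⟨⟩
    change c.totLift i ((total A).comp ⟨_, _, v⟩ ⟨_, _, u⟩) = (total J).comp _ _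
    rw [total_comp]
    refine (c.totLift_mk (v ≫ u)).trans ?_
    rw [show c.totLift i ⟨_, _, u⟩ = _ from c.totLift_mk u]
    refine Eq.trans ?_ (congrArg (fun x => (total J).comp x _)
      (c.totLift_of_eq (c.obj_pull u).symm v)).symm
    exact (Arr.mk_eq (c.pull_comp v u) rfl (c.lift_comp v u)).trans (total_comp _ _).symm
  lift_one i := (c.totLift_mk _).trans (Arr.mk_eq (c.pull_id i) rfl (c.lift_id i))
  cellLift_vcomp := by
    rintro ⟨i, j, s⟩ ⟨_, _, y, z, γ⟩ ⟨a, b, x, _, α⟩ ⟨⟩ h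
    obtain ⟨rfl, rfl, h⟩ := Arr.mk.inj h
    obtain rfl := eq_of_heq h
    refine (congrArg _ (total_vcomp α γ)).trans ((c.totCellLift_mk s _).trans ?_)
    change _ = (total J).vcomp _ _
    rw [show c.totCellLift ⟨i, j, s⟩ ⟨_, _, _, _, α⟩ = _ from c.totCellLift_mk s α]
    refine Eq.trans ?_ (congrArg ((total J).vcomp _)
      (c.totCellLift_of_eq (c.push s α) (c.map_push s α) γ)).symm
    refine Eq.trans ?_ (total_vcomp _ _).symm
    exact Cel.mk_eq rfl (c.push_vcomp s α γ) (by rw [c.cellLift_vcomp]; simp)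
  cellLift_hcomp := by
    rintro ⟨j, k, t⟩ ⟨i, _, s⟩ ⟨a', b', y, w, γ⟩ ⟨a, b, x, v, α⟩ h' h ⟨⟩
    obtain ⟨rfl, rfl, h⟩ := Arr.mk.inj h
    obtain rfl := eq_of_heq h
    obtain ⟨rfl, rfl, h'⟩ := Arr.mk.inj h'
    obtain rfl := eq_of_heq h'
    refine (congrArg₂ c.totCellLift (total_comp s t) (total_hcomp α γ)).trans ?_
    refine (c.totCellLift_of_eq (s ≫ t) (p.map_comp s t) _).trans ?_
    refine Eq.trans ?_ (congrArg₂ (total J).hcomp (c.totCellLift_mk s α)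
      (c.totCellLift_mk t γ)).symm
    refine Eq.trans ?_ (total_hcomp _ _).symm
    exact Cel.mk_eq rfl (c.push_hcomp s t α γ) (by rw [c.cellLift_hcomp]; simp)
  cellLift_idc := by
    rintro ⟨i, j, s⟩
    exact (c.totCellLift_mk s (𝟙 (p.map s))).trans
      (Cel.mk_eq rfl (c.push_id s) (by rw [c.cellLift_id]; simp))
  existsUnique_mor := by
    rintro i ⟨a, _, u⟩ v s ⟨⟩ h₁ h₂ h₃
    have h := isCartesian_hat (c.isCartesian_lift u)
    rw [← c.totLift_mk u] at h
    have e : (hat p).mor (c.totLift i ⟨a, _, u⟩) = _ :=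
      (congrArg (hat p).mor (c.totLift_mk u)).trans (c.mk_map_lift u)
    exact h.existsUnique_mor v s ((congrArg Arr.src e).trans h₁)
      (h₂.trans (congrArg Arr.tgt (c.totLift_mk u)).symm)
      (h₃.trans (congrArg (fun x => (total A).comp v x) e.symm))
  existsUnique_cell := by
    rintro i ⟨a, _, u⟩ x x' σ α ⟨⟩ h₁ h₂ h₃ h₄ h₅ h₆ h₇ h₈
    have h := isCartesian_hat (c.isCartesian_lift u)
    rw [← c.totLift_mk u] at h
    have e : (hat p).mor (c.totLift i ⟨a, _, u⟩) = _ :=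
      (congrArg (hat p).mor (c.totLift_mk u)).trans (c.mk_map_lift u)
    exact h.existsUnique_cell x x' σ α h₁ h₂ h₃ h₄ h₅ h₆ h₇
      (h₈.trans (congrArg (fun x => (total A).hcomp α ((total A).idc x)) e.symm))
  existsUnique_cellLift := by
    rintro ⟨i, j, s⟩ β ⟨a, b, u, v, α⟩ σ h h₁ h₂ h₃
    obtain ⟨rfl, rfl, h⟩ := Arr.mk.inj h
    obtain rfl := eq_of_heq h
    have h := isOpcartesianCell_hat (c.isOpcartesianCell_cellLift s α)
    rw [← c.totCellLift_mk s α] at h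
    have e : (hat p).cell (c.totCellLift ⟨i, j, s⟩ ⟨_, _, _, _, α⟩) = _ :=
      (congrArg (hat p).cell (c.totCellLift_mk s α)).trans (c.mk_map₂_cellLift s α)
    exact h β σ (h₁.trans (congrArg (total J).dom (c.totCellLift_mk s α)).symm)
      (h₂.trans (congrArg (total A).cod e.symm))
      (h₃.trans (congrArg (fun x => (total A).vcomp x β) e.symm))

theorem represents_lifting : c.Represents c.lifting where
  lift u := c.totLift_mk u
  cellLift s _ α := c.totCellLift_mk s α

end CoCleavage

/-- The construction of `exists_opCleavage` with both directions reversed: what `l` calls the source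
of a lift and the codomain of a cell are here its target and its domain. -/
theorem exists_coCleavage (l : TotalTwoCat.Lifting (hat p).dual) :
    ∃ c : CoCleavage p, c.Represents l := by
  let pull {i : J} {a : A} (u : a ⟶ p.obj i) : J := (l.lift i (Arr.mk a (p.obj i) u)).src
  let lift {i : J} {a : A} (u : a ⟶ p.obj i) : pull u ⟶ i :=
    (l.lift i (Arr.mk a (p.obj i) u)).homOf rfl (l.src_lift i (Arr.mk a (p.obj i) u) rfl)
  have mk_lift {i : J} {a : A} (u : a ⟶ p.obj i) :
      l.lift i (Arr.mk a (p.obj i) u) = Arr.mk (pull u) i (lift u) := (Arr.mk_homOf _ _ _).symm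
  have hdom {i j : J} (s : i ⟶ j) {v : p.obj i ⟶ p.obj j} (α : p.map s ⟶ v) :
      (total J).dom (l.cellLift (Arr.mk i j s) (Cel.mk (p.obj i) (p.obj j) (p.map s) v α)) =
        Arr.mk i j s :=
    l.cod_cellLift (Arr.mk i j s) (Cel.mk (p.obj i) (p.obj j) (p.map s) v α) rfl
  let push {i j : J} (s : i ⟶ j) {v : p.obj i ⟶ p.obj j} (α : p.map s ⟶ v) : i ⟶ j :=
    ((total J).cod (l.cellLift (Arr.mk i j s) (Cel.mk (p.obj i) (p.obj j) (p.map s) v α))).homOf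
      (congrArg Arr.src (hdom s α)) (congrArg Arr.tgt (hdom s α))
  let cellLift {i j : J} (s : i ⟶ j) {v : p.obj i ⟶ p.obj j} (α : p.map s ⟶ v) : s ⟶ push s α :=
    (l.cellLift (Arr.mk i j s) (Cel.mk (p.obj i) (p.obj j) (p.map s) v α)).homOf
      (hdom s α) (Arr.mk_homOf _ _ _).symm
  have mk_cellLift {i j : J} (s : i ⟶ j) {v : p.obj i ⟶ p.obj j} (α : p.map s ⟶ v) :
      l.cellLift (Arr.mk i j s) (Cel.mk (p.obj i) (p.obj j) (p.map s) v α) =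
        Cel.mk i j s (push s α) (cellLift s α) := (Cel.mk_homOf _ _ _).symm
  have mk_map_lift {i : J} {a : A} (u : a ⟶ p.obj i) :
      Arr.mk (p.obj (pull u)) (p.obj i) (p.map (lift u)) = ⟨a, p.obj i, u⟩ :=
    (congrArg (hat p).mor (mk_lift u).symm).trans (l.mor_lift i ⟨a, _, u⟩ rfl)
  have mk_map₂_cellLift {i j : J} (s : i ⟶ j) {v : p.obj i ⟶ p.obj j} (α : p.map s ⟶ v) :
      Cel.mk (p.obj i) (p.obj j) (p.map s) (p.map (push s α)) (p.map₂ (cellLift s α)) =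
        ⟨p.obj i, p.obj j, p.map s, v, α⟩ :=
    (congrArg (hat p).cell (mk_cellLift s α).symm).trans
      (l.cell_cellLift (Arr.mk i j s) (Cel.mk (p.obj i) (p.obj j) (p.map s) v α) rfl)
  have obj_pull {i : J} {a : A} (u : a ⟶ p.obj i) : p.obj (pull u) = a :=
    congrArg Arr.src (mk_map_lift u)
  have map_push {i j : J} (s : i ⟶ j) {v : p.obj i ⟶ p.obj j} (α : p.map s ⟶ v) :
      p.map (push s α) = v := Cel.cod_eq (mk_map₂_cellLift s α)
  have mk_lift_comp {i : J} {a' a : A} (v : a' ⟶ a) (u : a ⟶ p.obj i) :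
      Arr.mk (pull (v ≫ u)) i (lift (v ≫ u)) =
        ⟨_, i, lift (v.cast rfl (obj_pull u).symm) ≫ lift u⟩ := by
    rw [← mk_lift, ← total_comp, ← total_comp, ← mk_lift, ← mk_lift]
    refine (l.lift_comp i (Arr.mk _ _ u) (Arr.mk _ _ v) rfl rfl).trans
      (congrArg (fun x => (total J).comp x _) ?_)
    exact congrArg (l.lift (pull u)) (Arr.mk_homOf ⟨a', a, v⟩ _ _).symm
  have mk_cellLift_vcomp {i j : J} (s : i ⟶ j) {v v' : p.obj i ⟶ p.obj j} (α : p.map s ⟶ v)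
      (γ : v ⟶ v') : Cel.mk i j s (push s (α ≫ γ)) (cellLift s (α ≫ γ)) =
        ⟨i, j, s, _, cellLift s α ≫ cellLift (push s α) (eqToHom (map_push s α) ≫ γ)⟩ := by
    rw [← mk_cellLift, ← total_vcomp, ← total_vcomp, ← mk_cellLift, ← mk_cellLift,
      Cel.eqToHom_comp]
    refine (l.cellLift_vcomp (Arr.mk i j s) (Cel.mk _ _ _ _ γ) (Cel.mk _ _ _ _ α) rfl rfl).trans
      (congrArg ((total J).vcomp _) ?_)
    exact congrArg (fun x => l.cellLift x _) (Arr.mk_homOf _ _ _).symm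
  have mk_cellLift_hcomp {i j k : J} (s : i ⟶ j) (t : j ⟶ k) {v : p.obj i ⟶ p.obj j}
      {w : p.obj j ⟶ p.obj k} (α : p.map s ⟶ v) (γ : p.map t ⟶ w) :
      Cel.mk i k (s ≫ t) (push (s ≫ t) (eqToHom (p.map_comp s t) ≫ α ▷ p.map t ≫ v ◁ γ))
          (cellLift (s ≫ t) (eqToHom (p.map_comp s t) ≫ α ▷ p.map t ≫ v ◁ γ)) =
        ⟨i, k, s ≫ t, push s α ≫ push t γ, cellLift s α ▷ t ≫ push s α ◁ cellLift t γ⟩ := by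
    rw [← mk_cellLift, ← total_hcomp, ← mk_cellLift, ← mk_cellLift, Cel.eqToHom_comp,
      ← total_hcomp, ← total_comp]
    exact l.cellLift_hcomp (Arr.mk j k t) (Arr.mk i j s) (Cel.mk _ _ _ _ γ) (Cel.mk _ _ _ _ α)
      rfl rfl rfl
  have mk_lift_id (i : J) : Arr.mk (pull (𝟙 (p.obj i))) i (lift (𝟙 (p.obj i))) = ⟨i, i, 𝟙 i⟩ :=
    (mk_lift _).symm.trans (l.lift_one i)
  have mk_cellLift_id {i j : J} (s : i ⟶ j) :
      Cel.mk i j s (push s (𝟙 (p.map s))) (cellLift s (𝟙 (p.map s))) = ⟨i, j, s, s, 𝟙 s⟩ :=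
    (mk_cellLift _ _).symm.trans (l.cellLift_idc ⟨i, j, s⟩)
  exact ⟨{
    pull := pull
    lift := lift
    obj_pull := obj_pull
    map_lift u := Arr.heq_of_eq (mk_map_lift u)
    push := push
    cellLift := cellLift
    map_push := map_push
    map₂_cellLift s _ α := by
      rw [← Cel.mk_inj, mk_map₂_cellLift, Cel.comp_eqToHom]
    pull_comp v u := (Arr.mk.inj (mk_lift_comp v u)).1
    lift_comp v u := Arr.heq_of_eq (mk_lift_comp v u)
    pull_id i := (Arr.mk.inj (mk_lift_id i)).1
    lift_id i := Arr.heq_of_eq (mk_lift_id i)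
    push_vcomp s _ _ α γ := Cel.cod_eq (mk_cellLift_vcomp s α γ)
    cellLift_vcomp s _ _ α γ := by
      rw [← Cel.mk_inj, mk_cellLift_vcomp, ← Category.assoc, Cel.comp_eqToHom]
    push_hcomp s t _ _ α γ := Cel.cod_eq (mk_cellLift_hcomp s t α γ)
    cellLift_hcomp s t _ _ α γ := by
      rw [← Cel.mk_inj, mk_cellLift_hcomp, Cel.comp_eqToHom]
    push_id s := Cel.cod_eq (mk_cellLift_id s)
    cellLift_id s := by
      rw [← Cel.mk_inj, mk_cellLift_id, Cel.eqToHom_eq]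
    isCartesian_lift u := isCartesian_of_hat (by
      rw [← mk_lift]; exact l.isOpcartesian rfl)
    isOpcartesianCell_cellLift s _ α := isOpcartesianCell_of_hat (by
      rw [← mk_cellLift]; exact l.isCartesianCell rfl) }, mk_lift, mk_cellLift⟩

end coCleavage

/-! ### Verticality and commutation of lifts in total form -/

section compatibility
variable {J A B : Type u} [Bicategory.{u, u} J] [Strict J] [Bicategory.{u, u} A] [Strict A]
  [Bicategory.{u, u} B] [Strict B] {p : StrictPseudofunctor J A} {q : StrictPseudofunctor J B}

theorem total_comp_of_eq {a b b' c : J} (f : a ⟶ b) (e : b = b') (g : b' ⟶ c) :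
    (total J).comp (Arr.mk a b f) (Arr.mk b' c g) = ⟨a, c, f.cast rfl e ≫ g⟩ := by
  subst e
  exact total_comp _ _

theorem total_vcomp_of_eq {a b : J} {f g g' h : a ⟶ b} (η : f ⟶ g) (e : g = g') (θ : g' ⟶ h) :
    (total J).vcomp (Cel.mk a b f g η) (Cel.mk a b g' h θ) = ⟨a, b, f, h, η ≫ eqToHom e ≫ θ⟩ := by
  subst e
  simp

namespace OpCleavage.Represents
variable {r : OpCleavage q} {m : TotalTwoCat.Lifting (hat q)} (hr : r.Represents m)
include hr

theorem lift_of_eq {i : J} {b c : B} (h : b = q.obj i) (v : b ⟶ c) :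
    m.lift i (Arr.mk b c v) = Arr.mk i (r.push (v.cast h rfl)) (r.lift (v.cast h rfl)) := by
  subst h
  exact hr.lift v

theorem cellLift_of_eq {i j : J} (s : i ⟶ j) {u v : q.obj i ⟶ q.obj j} (h : v = q.map s)
    (β : u ⟶ v) : m.cellLift (Arr.mk i j s) (Cel.mk (q.obj i) (q.obj j) u v β) =
      Cel.mk i j (r.pull s (β ≫ eqToHom h)) s (r.cellLift s (β ≫ eqToHom h)) := by
  rw [← hr.cellLift, Cel.comp_eqToHom]

end OpCleavage.Represents

namespace CoCleavage.Represents
variable {c : CoCleavage p} {l : TotalTwoCat.Lifting (hat p).dual} (hc : c.Represents l)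
include hc

theorem lift_of_eq {i : J} {a b : A} (h : b = p.obj i) (v : a ⟶ b) :
    l.lift i (Arr.mk a b v) = Arr.mk (c.pull (v.cast rfl h)) i (c.lift (v.cast rfl h)) := by
  subst h
  exact hc.lift v

theorem cellLift_of_eq {i j : J} (s : i ⟶ j) {u v : p.obj i ⟶ p.obj j} (h : p.map s = u)
    (α : u ⟶ v) : l.cellLift (Arr.mk i j s) (Cel.mk (p.obj i) (p.obj j) u v α) =
      Cel.mk i j s (c.push s (eqToHom h ≫ α)) (c.cellLift s (eqToHom h ≫ α)) := by
  rw [← hc.cellLift, Cel.eqToHom_comp]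

end CoCleavage.Represents

variable {c : CoCleavage p} {r : OpCleavage q} {l : TotalTwoCat.Lifting (hat p).dual}
  {m : TotalTwoCat.Lifting (hat q)} (hc : c.Represents l) (hr : r.Represents m)
include hc hr

/-- Verticality is what makes the second lift defined; it enters as the cast of `v` along
`h.obj_pull`. -/
theorem Vertical.lift_lift (h : Vertical c r) {i : J} {a : A} {b : B} (u : a ⟶ p.obj i)
    (v : q.obj i ⟶ b) : m.lift (l.lift i (Arr.mk a _ u)).src (Arr.mk _ b v) =
      Arr.mk (c.pull u) (r.push (v.cast (h.obj_pull u).symm rfl))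
        (r.lift (v.cast (h.obj_pull u).symm rfl)) := by
  rw [hc.lift, hr.lift_of_eq (h.obj_pull u).symm]

theorem Vertical.coLift_lift (h : Vertical c r) {i : J} {a : A} {b : B} (u : a ⟶ p.obj i)
    (v : q.obj i ⟶ b) : l.lift (m.lift i (Arr.mk _ b v)).tgt (Arr.mk a _ u) =
      Arr.mk (c.pull (u.cast rfl (h.obj_push v).symm)) (r.push v)
        (c.lift (u.cast rfl (h.obj_push v).symm)) := by
  rw [hr.lift, hc.lift_of_eq (h.obj_push v).symm]

theorem Vertical.cellLift_cellLift (h : Vertical c r) {i j : J} (s : i ⟶ j)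
    {v : p.obj i ⟶ p.obj j} {u : q.obj i ⟶ q.obj j} (α : p.map s ⟶ v) (β : u ⟶ q.map s) :
    m.cellLift ((total J).cod (l.cellLift (Arr.mk i j s) (Cel.mk _ _ _ v α))) (Cel.mk _ _ u _ β) =
      Cel.mk i j (r.pull (c.push s α) (β ≫ eqToHom (h.map_push s α).symm)) (c.push s α)
        (r.cellLift (c.push s α) (β ≫ eqToHom (h.map_push s α).symm)) := by
  rw [hc.cellLift]
  exact hr.cellLift_of_eq (c.push s α) (h.map_push s α).symm β

theorem Vertical.coCellLift_cellLift (h : Vertical c r) {i j : J} (s : i ⟶ j)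
    {v : p.obj i ⟶ p.obj j} {u : q.obj i ⟶ q.obj j} (α : p.map s ⟶ v) (β : u ⟶ q.map s) :
    l.cellLift ((total J).dom (m.cellLift (Arr.mk i j s) (Cel.mk _ _ u _ β))) (Cel.mk _ _ _ v α) =
      Cel.mk i j (r.pull s β) (c.push (r.pull s β) (eqToHom (h.map_pull s β) ≫ α))
        (c.cellLift (r.pull s β) (eqToHom (h.map_pull s β) ≫ α)) := by
  rw [hr.cellLift]
  exact hc.cellLift_of_eq (r.pull s β) (h.map_pull s β) α

/-- The first four fields come from verticality. The others are the commutation conditions, whose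
casts and `eqToHom`s are absorbed by the free boundaries. -/
theorem Vertical.compatible (h : Vertical c r) (h₁ : LiftsCommute h) (h₂ : CellLiftsCommute h) :
    l.Compatible m where
  mor_coLift := by
    rintro i ⟨a, _, u⟩ ⟨⟩
    exact (congrArg (hat q).mor (hc.lift u)).trans (Arr.mk_eq (h.obj_pull u) rfl (h.map_lift u))
  cell_coCellLift := by
    rintro ⟨i, j, s⟩ ⟨a, b, u, v, α⟩ e
    obtain ⟨rfl, rfl, e⟩ := Arr.mk.inj e
    obtain rfl := eq_of_heq e
    refine (congrArg (hat q).cell (hc.cellLift s α)).trans ?_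
    change Cel.mk _ _ _ _ (q.map₂ _) = _
    rw [h.map₂_cellLift, Cel.eqToHom_eq]
    rfl
  mor_lift := by
    rintro i ⟨_, b, u⟩ ⟨⟩
    exact (congrArg (hat p).mor (hr.lift u)).trans (Arr.mk_eq rfl (h.obj_push u) (h.map_lift' u))
  cell_cellLift := by
    rintro ⟨i, j, s⟩ ⟨a, b, u, v, β⟩ e
    obtain ⟨rfl, rfl, e⟩ := Arr.mk.inj e
    obtain rfl := eq_of_heq e
    refine (congrArg (hat p).cell (hr.cellLift s β)).trans ?_
    change Cel.mk _ _ _ _ (p.map₂ _) = _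
    rw [h.map₂_cellLift', Cel.eqToHom_eq, h.map_pull]
    rfl
  obj_comm := by
    rintro i ⟨a, _, u⟩ ⟨_, b, v⟩ ⟨⟩ ⟨⟩
    obtain ⟨e, -⟩ := h₁ u v
    exact (congrArg Arr.tgt (h.lift_lift hc hr u v)).trans
      (e.trans (congrArg Arr.src (h.coLift_lift hc hr u v)).symm)
  lift_comm := by
    rintro i ⟨a, _, u⟩ ⟨_, b, v⟩ ⟨⟩ ⟨⟩
    obtain ⟨e, e'⟩ := h₁ u v
    refine (congrArg₂ (total J).comp (hc.lift u) (hr.lift v)).trans ?_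
    refine Eq.trans ?_ (congrArg₂ (total J).comp (h.lift_lift hc hr u v)
      (h.coLift_lift hc hr u v)).symm
    rw [total_comp, total_comp_of_eq _ e, e']
  mor_comm := by
    rintro ⟨i, j, s⟩ ⟨a, b, x, v, α⟩ ⟨a', b', u, y, β⟩ e e'
    obtain ⟨rfl, rfl, e⟩ := Arr.mk.inj e
    obtain rfl := eq_of_heq e
    obtain ⟨rfl, rfl, e'⟩ := Arr.mk.inj e'
    obtain rfl := eq_of_heq e'
    obtain ⟨e, -⟩ := h₂ s α β
    exact (congrArg (total J).cod (h.coCellLift_cellLift hc hr s α β)).trans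
      ((Arr.mk_inj.2 e).trans (congrArg (total J).dom (h.cellLift_cellLift hc hr s α β)).symm)
  cell_comm := by
    rintro ⟨i, j, s⟩ ⟨a, b, x, v, α⟩ ⟨a', b', u, y, β⟩ e e'
    obtain ⟨rfl, rfl, e⟩ := Arr.mk.inj e
    obtain rfl := eq_of_heq e
    obtain ⟨rfl, rfl, e'⟩ := Arr.mk.inj e'
    obtain rfl := eq_of_heq e'
    obtain ⟨e, e'⟩ := h₂ s α β
    refine (congrArg₂ (total J).vcomp (hr.cellLift s β) (hc.cellLift s α)).trans ?_
    refine Eq.trans ?_ (congrArg₂ (total J).vcomp (h.coCellLift_cellLift hc hr s α β)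
      (h.cellLift_cellLift hc hr s α β)).symm
    rw [total_vcomp, total_vcomp_of_eq _ e, e']

/-- Equations between morphisms and cells with free boundary contain those of their boundaries, so
each total equation yields two fields. -/
theorem vertical_of_compatible (h : l.Compatible m) : Vertical c r := by
  have h₁ {a : A} {i : J} (u : a ⟶ p.obj i) :
      Arr.mk (q.obj (c.pull u)) (q.obj i) (q.map (c.lift u)) = ⟨q.obj i, q.obj i, 𝟙 _⟩ :=
    (congrArg (hat q).mor (hc.lift u).symm).trans (h.mor_coLift (u := Arr.mk a _ u) rfl)
  have h₂ {i j : J} (s : i ⟶ j) {v : p.obj i ⟶ p.obj j} (α : p.map s ⟶ v) :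
      Cel.mk (q.obj i) (q.obj j) (q.map s) (q.map (c.push s α)) (q.map₂ (c.cellLift s α)) =
        ⟨q.obj i, q.obj j, q.map s, q.map s, 𝟙 _⟩ :=
    (congrArg (hat q).cell (hc.cellLift s α).symm).trans
      (h.cell_coCellLift (s := Arr.mk i j s) (α := Cel.mk _ _ _ v α) rfl)
  have h₃ {i : J} {b : B} (v : q.obj i ⟶ b) :
      Arr.mk (p.obj i) (p.obj (r.push v)) (p.map (r.lift v)) = ⟨p.obj i, p.obj i, 𝟙 _⟩ :=
    (congrArg (hat p).mor (hr.lift v).symm).trans (h.mor_lift (v := Arr.mk _ b v) rfl)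
  have h₄ {i j : J} (s : i ⟶ j) {u : q.obj i ⟶ q.obj j} (β : u ⟶ q.map s) :
      Cel.mk (p.obj i) (p.obj j) (p.map (r.pull s β)) (p.map s) (p.map₂ (r.cellLift s β)) =
        ⟨p.obj i, p.obj j, p.map s, p.map s, 𝟙 _⟩ :=
    (congrArg (hat p).cell (hr.cellLift s β).symm).trans
      (h.cell_cellLift (s := Arr.mk i j s) (β := Cel.mk _ _ u _ β) rfl)
  exact {
    obj_pull := fun u => congrArg Arr.src (h₁ u)
    map_lift := fun u => Arr.heq_of_eq (h₁ u)
    map_push := fun s _ α => Cel.cod_eq (h₂ s α)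
    map₂_cellLift := fun s _ α => by rw [← Cel.mk_inj, h₂, Cel.eqToHom_eq]
    obj_push := fun v => congrArg Arr.tgt (h₃ v)
    map_lift' := fun v => Arr.heq_of_eq (h₃ v)
    map_pull := fun s _ β => Cel.dom_eq (h₄ s β)
    map₂_cellLift' := fun s _ β => by
      rw [← Cel.mk_inj, h₄, Cel.eqToHom_eq, Cel.dom_eq (h₄ s β)] }

theorem liftsCommute_of_compatible (h : l.Compatible m) (hv : Vertical c r) :
    LiftsCommute hv := by
  intro i a b u v
  have e : r.push _ = c.pull _ := (congrArg Arr.tgt (hv.lift_lift hc hr u v)).symm.trans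
    ((h.obj_comm (i := i) (u := Arr.mk a _ u) (v := Arr.mk _ b v) rfl rfl).trans
      (congrArg Arr.src (hv.coLift_lift hc hr u v)))
  refine ⟨e, Arr.mk_inj.1 ?_⟩
  rw [← total_comp, ← total_comp_of_eq]
  exact (congrArg₂ (total J).comp (hc.lift u) (hr.lift v)).symm.trans
    ((h.lift_comm (i := i) (u := Arr.mk a _ u) (v := Arr.mk _ b v) rfl rfl).trans
      (congrArg₂ (total J).comp (hv.lift_lift hc hr u v) (hv.coLift_lift hc hr u v)))

theorem cellLiftsCommute_of_compatible (h : l.Compatible m) (hv : Vertical c r) :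
    CellLiftsCommute hv := by
  intro i j s v u α β
  have e : c.push (r.pull s β) (eqToHom (hv.map_pull s β) ≫ α) =
      r.pull (c.push s α) (β ≫ eqToHom (hv.map_push s α).symm) := by
    rw [← Arr.mk_inj]
    exact (congrArg (total J).cod (hv.coCellLift_cellLift hc hr s α β)).symm.trans ((h.mor_comm
      (s := Arr.mk i j s) (α := Cel.mk _ _ _ v α) (β := Cel.mk _ _ u _ β) rfl rfl).trans
        (congrArg (total J).dom (hv.cellLift_cellLift hc hr s α β)))
  refine ⟨e, Cel.mk_inj.1 ?_⟩
  rw [← total_vcomp, ← total_vcomp_of_eq]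
  exact (congrArg₂ (total J).vcomp (hr.cellLift s β) (hc.cellLift s α)).symm.trans
    ((h.cell_comm (s := Arr.mk i j s) (α := Cel.mk _ _ _ v α) (β := Cel.mk _ _ u _ β) rfl rfl).trans
      (congrArg₂ (total J).vcomp (hv.coCellLift_cellLift hc hr s α β)
        (hv.cellLift_cellLift hc hr s α β)))

end compatibility

/-! ### The cleavage induced by an action, and the bijection -/

namespace TotalTwoCat
variable {J B X Y : TotalTwoCat.{u}} {q : Functor J B} {M : ArrowModel B Y} {P₁ : Functor X J}
  {P₂ : Functor X Y}

/-- The functors that realize two actions with the same lifts agree. -/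
theorem Action.Realizes.functor_eq {a a' : Action q} {R R' : Functor X J}
    (h : a.Realizes M P₁ P₂ R) (h' : a'.Realizes M P₁ P₂ R') (pb : IsPullback q M.left P₁ P₂)
    (hl : ∀ {i : J.Obj} {u : B.Mor}, B.src u = q.obj i → a.lift i u = a'.lift i u)
    (hc : ∀ {s : J.Mor} {β : B.Cell}, B.cod β = q.mor s → a.cellLift s β = a'.cellLift s β) :
    R = R' := by
  refine Functor.ext (funext fun x => ?_) (funext fun x => ?_) (funext fun x => ?_)
  · have e := ArrowModel.repObj_self (M := M) (P₁ := P₁) (P₂ := P₂) x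
    rw [h.obj e, h'.obj e, ← a.tgt_lift (e.src pb), hl (e.src pb), a'.tgt_lift (e.src pb)]
  · have e := ArrowModel.repMor_self (M := M) (P₁ := P₁) (P₂ := P₂) x
    rw [h.mor e, h'.mor e, Action.mor_congr hl hc (e.isSquare pb)]
  · have e := ArrowModel.repCell_self (M := M) (P₁ := P₁) (P₂ := P₂) x
    rw [h.cell e, h'.cell e, Action.cell_congr hl hc (e.isSquareCell pb)]

end TotalTwoCat

section
variable {J A B : Type u} [Bicategory.{u, u} J] [Strict J] [Bicategory.{u, u} A] [Strict A]
  [Bicategory.{u, u} B] [Strict B] {p : StrictPseudofunctor J A} {q : StrictPseudofunctor J B}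

/-- A cleavage survives the round trip through the action that it defines, by `Lifting.action_lift`
and `Lifting.action_cellLift`. -/
theorem OpCleavage.Represents.action {r : OpCleavage q} {m : TotalTwoCat.Lifting (hat q)}
    (h : r.Represents m) : r.Represents m.action.lifting where
  lift u := (m.action_lift rfl).trans (h.lift u)
  cellLift s _ β := (m.action_cellLift rfl).trans (h.cellLift s β)

theorem CoCleavage.Represents.action {c : CoCleavage p} {l : TotalTwoCat.Lifting (hat p).dual}
    (h : c.Represents l) : c.Represents l.action.lifting where
  lift u := (l.action_lift rfl).trans (h.lift u)
  cellLift s _ α := (l.action_cellLift rfl).trans (h.cellLift s α)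

theorem OpCleavage.Represents.lift_eq {r : OpCleavage q} {m m' : TotalTwoCat.Lifting (hat q)}
    (h : r.Represents m) (h' : r.Represents m') {i : J} {u : Arr B} (e : u.src = q.obj i) :
    m.lift i u = m'.lift i u := by
  obtain ⟨_, b, u⟩ := u
  obtain rfl := e
  exact (h.lift u).trans (h'.lift u).symm

theorem OpCleavage.Represents.cellLift_eq {r : OpCleavage q} {m m' : TotalTwoCat.Lifting (hat q)}
    (h : r.Represents m) (h' : r.Represents m') {s : Arr J} {β : Cel B}
    (e : (total B).cod β = (hat q).mor s) : m.cellLift s β = m'.cellLift s β := by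
  obtain ⟨i, j, s⟩ := s
  obtain ⟨a, b, u, v, β⟩ := β
  obtain ⟨rfl, rfl, e⟩ := Arr.mk.inj e
  obtain rfl := eq_of_heq e
  exact (h.cellLift s β).trans (h'.cellLift s β).symm

theorem CoCleavage.Represents.lift_eq {c : CoCleavage p}
    {l l' : TotalTwoCat.Lifting (hat p).dual} (h : c.Represents l) (h' : c.Represents l') {i : J}
    {u : Arr A} (e : u.tgt = p.obj i) : l.lift i u = l'.lift i u := by
  obtain ⟨a, _, u⟩ := u
  obtain rfl := e
  exact (h.lift u).trans (h'.lift u).symm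

theorem CoCleavage.Represents.cellLift_eq {c : CoCleavage p}
    {l l' : TotalTwoCat.Lifting (hat p).dual} (h : c.Represents l) (h' : c.Represents l')
    {s : Arr J} {α : Cel A} (e : (total A).dom α = (hat p).mor s) :
    l.cellLift s α = l'.cellLift s α := by
  obtain ⟨i, j, s⟩ := s
  obtain ⟨a, b, u, v, α⟩ := α
  obtain ⟨rfl, rfl, e⟩ := Arr.mk.inj e
  obtain rfl := eq_of_heq e
  exact (h.cellLift s α).trans (h'.cellLift s α).symm

/-- The induced values fix the four data fields; all other fields are propositions. Objects and
morphisms are identified before the lifts, whose types depend on them. -/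
theorem RightInduces.unique {R : StrictPseudofunctor (Pullback q (LaxArrow.src B)) J}
    {r r' : OpCleavage q} (h : RightInduces q R r) (h' : RightInduces q R r') : r = r' := by
  have e₁ {i : J} {b : B} (u : q.obj i ⟶ b) := (h.push u).trans (h'.push u).symm
  have e₂ {i : J} {b : B} (u : q.obj i ⟶ b) := (h.lift u).trans (h'.lift u).symm
  have e₃ {i j : J} (s : i ⟶ j) {u : q.obj i ⟶ q.obj j} (β : u ⟶ q.map s) :=
    (h.pull s β).trans (h'.pull s β).symm
  have e₄ {i j : J} (s : i ⟶ j) {u : q.obj i ⟶ q.obj j} (β : u ⟶ q.map s) :=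
    (h.cellLift s β).trans (h'.cellLift s β).symm
  clear h h'
  obtain ⟨push, lift, _, _, pull, cellLift⟩ := r
  obtain ⟨push', lift', _, _, pull', cellLift'⟩ := r'
  obtain rfl : @push = @push' := by
    funext i b u; exact e₁ u
  obtain rfl : @lift = @lift' := by
    funext i b u; exact eq_of_heq (e₂ u)
  obtain rfl : @pull = @pull' := by
    funext i j s u β; exact eq_of_heq (e₃ s β)
  obtain rfl : @cellLift = @cellLift' := by
    funext i j s u β; exact eq_of_heq (e₄ s β)
  rfl

theorem LeftInduces.unique {L : StrictPseudofunctor (Pullback (LaxArrow.tgt A) p) J}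
    {c c' : CoCleavage p} (h : LeftInduces p L c) (h' : LeftInduces p L c') : c = c' := by
  have e₁ {a : A} {i : J} (u : a ⟶ p.obj i) := (h.pull u).trans (h'.pull u).symm
  have e₂ {a : A} {i : J} (u : a ⟶ p.obj i) := (h.lift u).trans (h'.lift u).symm
  have e₃ {i j : J} (s : i ⟶ j) {v : p.obj i ⟶ p.obj j} (α : p.map s ⟶ v) :=
    (h.push s α).trans (h'.push s α).symm
  have e₄ {i j : J} (s : i ⟶ j) {v : p.obj i ⟶ p.obj j} (α : p.map s ⟶ v) :=
    (h.cellLift s α).trans (h'.cellLift s α).symm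
  clear h h'
  obtain ⟨pull, lift, _, _, push, cellLift⟩ := c
  obtain ⟨pull', lift', _, _, push', cellLift'⟩ := c'
  obtain rfl : @pull = @pull' := by
    funext a i u; exact e₁ u
  obtain rfl : @lift = @lift' := by
    funext a i u; exact eq_of_heq (e₂ u)
  obtain rfl : @push = @push' := by
    funext i j s v α; exact eq_of_heq (e₃ s α)
  obtain rfl : @cellLift = @cellLift' := by
    funext i j s v α; exact eq_of_heq (e₄ s α)
  rfl

/-- Shows that the cells of `rightPull` and `leftPush`, which carry unitors, are the given cells
once boundaries are free. -/
theorem mk_unitors {a b : J} {f g : a ⟶ b} (η : f ⟶ g) :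
    Cel.mk a b (𝟙 a ≫ f) (g ≫ 𝟙 b) ((λ_ f).hom ≫ η ≫ (ρ_ g).inv) = ⟨a, b, f, g, η⟩ := by
  simp only [Strict.rightUnitor_eqToIso, Strict.leftUnitor_eqToIso, eqToIso.hom, eqToIso.inv]
  rw [Cel.eqToHom_comp, Cel.comp_eqToHom]

end

section
variable {A B J : TwoCat.{u}} {p : J ⟶ A} {q : J ⟶ B}

section
variable {a : TotalTwoCat.Action (tot q)} {R : pb q (arrowCategory B).src ⟶ J}
  (h : RightRealizes a R)
include h

/-- The concrete morphism `rightLift` represents the tuple at which the abstract lift is defined;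
strictness identifies `𝟙 ≫ u` with `u` in its cell. -/
theorem RightRealizes.lift {i : J} {b : B} (u : q.obj i ⟶ b) :
    a.lift i (Arr.mk (q.obj i) b u) = Arr.mk (R.obj (rightObj q (𝟙 (q.obj i))))
      (R.obj (rightObj q u)) (R.map (rightLift q u)) :=
  (h.mor (x := Arr.mk (C := (pb q (arrowCategory B).src : TwoCat.{u})) _ _ (rightLift q u))
    ⟨rfl, rfl, rfl, congrArg (fun f => Cel.mk _ _ f f (𝟙 f)) (Strict.id_comp u), rfl⟩).symm

theorem RightRealizes.cellLift {i j : J} (s : i ⟶ j) {u : q.obj i ⟶ q.obj j} (β : u ⟶ q.map s) :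
    a.cellLift (Arr.mk i j s) (Cel.mk (q.obj i) (q.obj j) u (q.map s) β) =
      Cel.mk (R.obj (rightObj q (𝟙 (q.obj i)))) (R.obj (rightObj q (𝟙 (q.obj j))))
        (R.map (rightPull q s β)) (R.map (rightPull q s (𝟙 (q.map s))))
        (R.map₂ (rightCell q s β)) :=
  (h.cell (x := Cel.mk (C := (pb q (arrowCategory B).src : TwoCat.{u})) _ _ _ _ (rightCell q s β))
    ⟨rfl, rfl, mk_unitors β, mk_unitors _, rfl, rfl⟩).symm

/-- A cleavage is induced by a right action if and only if it consists of the lifts of the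
corresponding action. -/
theorem RightRealizes.rightInduces_iff {r : OpCleavage q} :
    RightInduces q R r ↔ r.Represents a.lifting := by
  -- The source of the image of `rightLift` is only propositionally `i`; the unit law, here in the
  -- guise of `src_lift`, identifies the two.
  have hu (i : J) : R.obj (rightObj q (𝟙 (q.obj i))) = i :=
    (congrArg Arr.src (RightRealizes.lift h (𝟙 (q.obj i)))).symm.trans
      (a.lifting.src_lift i (Arr.mk _ _ (𝟙 (q.obj i))) rfl)
  have hs {i j : J} (s : i ⟶ j) : R.map (rightPull q s (𝟙 (q.map s))) ≍ s :=
    Arr.heq_of_eq ((congrArg (total J).cod (RightRealizes.cellLift h s (𝟙 _))).symm.trans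
      (a.lifting.cod_cellLift (Arr.mk i j s) (Cel.mk _ _ _ _ (𝟙 (q.map s))) rfl))
  constructor
  · intro e
    exact ⟨fun u => (RightRealizes.lift h u).trans
        (Arr.mk_eq (hu _) (e.push u).symm (e.lift u).symm),
      fun s _ β => (RightRealizes.cellLift h s β).trans (Cel.mk_eq_of_heq (hu _) (hu _)
        (e.pull s β).symm (hs s) (e.cellLift s β).symm)⟩
  · intro e
    have e₁ {i : J} {b : B} (u : q.obj i ⟶ b) := (e.lift u).symm.trans (RightRealizes.lift h u)
    have e₂ {i j : J} (s : i ⟶ j) {u : q.obj i ⟶ q.obj j} (β : u ⟶ q.map s) :=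
      (e.cellLift s β).symm.trans (RightRealizes.cellLift h s β)
    exact ⟨fun u => (Arr.mk.inj (e₁ u)).2.1, fun u => Arr.heq_of_eq (e₁ u),
      fun s _ β => (Cel.mk.inj (e₂ s β)).2.2.1, fun s _ β => (Cel.mk.inj (e₂ s β)).2.2.2.2⟩

end

section
variable {a : TotalTwoCat.Action (tot p).dual} {L : pb (arrowCategory A).tgt p ⟶ J}
  (h : LeftRealizes a L)
include h

theorem LeftRealizes.lift {i : J} {x : A} (u : x ⟶ p.obj i) :
    a.lift i (Arr.mk x (p.obj i) u) = Arr.mk (L.obj (leftObj p u))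
      (L.obj (leftObj p (𝟙 (p.obj i)))) (L.map (leftLift p u)) :=
  (h.mor (x := Arr.mk (C := (pb (arrowCategory A).tgt p : TwoCat.{u})) _ _ (leftLift p u))
    ⟨rfl, rfl, rfl, congrArg (fun f => Cel.mk _ _ f f (𝟙 f)) (Strict.comp_id u), rfl⟩).symm

theorem LeftRealizes.cellLift {i j : J} (s : i ⟶ j) {v : p.obj i ⟶ p.obj j} (α : p.map s ⟶ v) :
    a.cellLift (Arr.mk i j s) (Cel.mk (p.obj i) (p.obj j) (p.map s) v α) =
      Cel.mk (L.obj (leftObj p (𝟙 (p.obj i)))) (L.obj (leftObj p (𝟙 (p.obj j))))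
        (L.map (leftPush p s (𝟙 (p.map s)))) (L.map (leftPush p s α))
        (L.map₂ (leftCell p s α)) :=
  (h.cell (x := Cel.mk (C := (pb (arrowCategory A).tgt p : TwoCat.{u})) _ _ _ _ (leftCell p s α))
    ⟨rfl, rfl, mk_unitors α, mk_unitors _, rfl, rfl⟩).symm

/-- A cleavage is induced by a left action if and only if it consists of the lifts of the
corresponding action. -/
theorem LeftRealizes.leftInduces_iff {c : CoCleavage p} :
    LeftInduces p L c ↔ c.Represents a.lifting := by
  have hu (i : J) : L.obj (leftObj p (𝟙 (p.obj i))) = i :=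
    (congrArg Arr.tgt (LeftRealizes.lift h (𝟙 (p.obj i)))).symm.trans
      (a.lifting.src_lift i (Arr.mk _ _ (𝟙 (p.obj i))) rfl)
  have hs {i j : J} (s : i ⟶ j) : L.map (leftPush p s (𝟙 (p.map s))) ≍ s :=
    Arr.heq_of_eq ((congrArg (total J).dom (LeftRealizes.cellLift h s (𝟙 _))).symm.trans
      (a.lifting.cod_cellLift (Arr.mk i j s) (Cel.mk _ _ _ _ (𝟙 (p.map s))) rfl))
  constructor
  · intro e
    exact ⟨fun u => (LeftRealizes.lift h u).trans
        (Arr.mk_eq (e.pull u).symm (hu _) (e.lift u).symm),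
      fun s _ α => (LeftRealizes.cellLift h s α).trans (Cel.mk_eq_of_heq (hu _) (hu _) (hs s)
        (e.push s α).symm (e.cellLift s α).symm)⟩
  · intro e
    have e₁ {x : A} {i : J} (u : x ⟶ p.obj i) := (e.lift u).symm.trans (LeftRealizes.lift h u)
    have e₂ {i j : J} (s : i ⟶ j) {v : p.obj i ⟶ p.obj j} (α : p.map s ⟶ v) :=
      (e.cellLift s α).symm.trans (LeftRealizes.cellLift h s α)
    exact ⟨fun u => (Arr.mk.inj (e₁ u)).1, fun u => Arr.heq_of_eq (e₁ u),
      fun s _ α => (Cel.mk.inj (e₂ s α)).2.2.2.1, fun s _ α => (Cel.mk.inj (e₂ s α)).2.2.2.2⟩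

end

/-- The actions of `P` are replaced by their lifts, which are compatible and come from cleavages on
the two legs. -/
theorem exists_cleavage_induces (P : SplitTwoSidedFibration p q) :
    ∃ c : TwoSidedCleavage p q, Induces P c := by
  obtain ⟨aL, aR, h, hL, hR⟩ := exists_actions P
  obtain ⟨l, hl⟩ := exists_coCleavage aL.lifting
  obtain ⟨r, hr⟩ := exists_opCleavage aR.lifting
  have hc := h.lifting
  have hv := vertical_of_compatible hl hr hc
  exact ⟨⟨l, r, hv, liftsCommute_of_compatible hl hr hc hv,
    cellLiftsCommute_of_compatible hl hr hc hv⟩, (LeftRealizes.leftInduces_iff hL).2 hl,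
    (RightRealizes.rightInduces_iff hR).2 hr⟩

/-- The profunctor is built from the actions defined by the lifts of `c`; it induces `c` because
those actions have the same lifts. -/
theorem exists_profunctor_induces (c : TwoSidedCleavage p q) :
    ∃ P : SplitTwoSidedFibration p q, Induces P c := by
  have hl := c.left.represents_lifting
  have hr := c.right.represents_lifting
  obtain ⟨P, hL, hR⟩ := exists_profunctor (p := p) (q := q)
    (c.vertical.compatible hl hr c.liftsCommute c.cellLiftsCommute).action
  exact ⟨P, (LeftRealizes.leftInduces_iff hL).2 hl.action,
    (RightRealizes.rightInduces_iff hR).2 hr.action⟩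

theorem Induces.unique_right {P : SplitTwoSidedFibration p q} {c c' : TwoSidedCleavage p q}
    (h : Induces P c) (h' : Induces P c') : c = c' := by
  have e₁ := h.1.unique h'.1
  have e₂ := h.2.unique h'.2
  obtain ⟨l, r⟩ := c
  obtain ⟨l', r'⟩ := c'
  obtain rfl : l = l' := e₁
  obtain rfl : r = r' := e₂
  rfl

/-- The actions of both profunctors have the lifts of `c`, and an action is determined by its lifts,
hence so are the functors that realise it. -/
theorem Induces.unique_left {P P' : SplitTwoSidedFibration p q} {c : TwoSidedCleavage p q}
    (h : Induces P c) (h' : Induces P' c) : P = P' := by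
  obtain ⟨aL, aR, -, hL, hR⟩ := exists_actions P
  obtain ⟨aL', aR', -, hL', hR'⟩ := exists_actions P'
  have eL := (LeftRealizes.leftInduces_iff hL).1 h.1
  have eR := (RightRealizes.rightInduces_iff hR).1 h.2
  have eL' := (LeftRealizes.leftInduces_iff hL').1 h'.1
  have eR' := (RightRealizes.rightInduces_iff hR').1 h'.2
  have e₁ : (tot P.left).dual = (tot P'.left).dual :=
    TotalTwoCat.Action.Realizes.functor_eq hL hL' (isPullback_left p)
      (fun e => eL.lift_eq eL' e) (fun e => eL.cellLift_eq eL' e)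
  have e₂ : tot P.right = tot P'.right :=
    TotalTwoCat.Action.Realizes.functor_eq hR hR' (isPullback_right q)
      (fun e => eR.lift_eq eR' e) (fun e => eR.cellLift_eq eR' e)
  exact Profunctor.ext (tot_injective (congrArg TotalTwoCat.Functor.dual e₁)) (tot_injective e₂)

end

end TwoDim

/-! ### The main theorem -/

open TwoDim

theorem mainTheorem6 (A B J : TwoCat.{u}) (p : J ⟶ A) (q : J ⟶ B) :
    (Nonempty (SplitTwoSidedFibration p q) ↔
      ∃ (l : CoCleavage p) (r : OpCleavage q) (h : Vertical l r),
        LiftsCommute h ∧ CellLiftsCommute h) ∧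
    ∃ e : SplitTwoSidedFibration p q ≃ TwoSidedCleavage p q, ∀ P, Induces P (e P) := by
  -- A cleavage is chosen for each structure; it is in fact unique. Injectivity is
  -- `Induces.unique_left`, while surjectivity combines `exists_profunctor_induces` with
  -- `Induces.unique_right`.
  choose f hf using fun P : SplitTwoSidedFibration p q => exists_cleavage_induces P
  refine ⟨⟨fun ⟨P⟩ => ⟨(f P).left, (f P).right, (f P).vertical, (f P).liftsCommute,
    (f P).cellLiftsCommute⟩, fun ⟨l, r, h, h₁, h₂⟩ => ?_⟩, Equiv.ofBijective f ⟨?_, ?_⟩, hf⟩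
  · obtain ⟨P, -⟩ := exists_profunctor_induces (p := p) (q := q) ⟨l, r, h, h₁, h₂⟩
    exact ⟨P⟩
  · intro P P' e
    exact (hf P).unique_left (e ▸ hf P')
  · intro c
    obtain ⟨P, hP⟩ := exists_profunctor_induces c
    exact ⟨P, (hf P).unique_right hP⟩
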